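/- Let $e_*,s_*\ge 0$, $p=e_*+2s_*$, and let the indices $e,s$ run over $1\le e\le e_*$, $e_*<s\le e_*+s_*$. Put $e^*=e$, $s^*=s+s_*$, $(s+s_*)^*=s$. Let $0<\gamma_e<\tfrac12$, $\operatorname{Re}\gamma_s>\tfrac12$, $\operatorname{Im}\gamma_s>0$, $\gamma_{s+s_*}=1-\overline{\gamma_s}$, and let $L_j(z',w')=z_j+2\gamma_jw_{j^*}$ for $1\le j\le p$. Thus $z_{p+j}=L_j(z',\bar z')^2$ $(1\le j\le p)$ is a product quadric in $\mathbb C^{2p}$ without hyperbolic components. Let $\lambda_e>1$ with $\gamma_e=(\lambda_e+\lambda_e^{-1})^{-1}$, let $|\lambda_s|>1$, $0<\arg\lambda_s<\pi/2$ with $\gamma_s=(1+\lambda_s^{-2})^{-1}$, and $\lambda_{s+s_*}=\overline{\lambda_s}^{-1}$. Let $M\subset\mathbb C^{2p}$ be the germ at $0$ of the real analytic submanifold $z_{p+j}=E_j(z',\bar z')$, $1\le j\le p$, where $E_j(z',w')=L_j(z',w')^2+O(|(z',w')|^3)$ are convergent power series. A deck transformation is a germ of biholomorphism $F$ of $(\mathbb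 C^{2p},0)$ with $\pi_1\circ F=\pi_1$, where $\pi_1(z',w')=(z',E(z',w'))$. Assume that there are exactly $2^p$ deck transformations. They are then generated by unique $\tau_{11},\dots,\tau_{1p}$, each fixing a hypersurface pointwise, numbered so that the linear part of $\tau_{1j}$ at $0$ maps $L_j$ to $-L_j$. Let $\rho_0(z',w')=(\bar w',\bar z')$, $\tau_{2j}=\rho_0\tau_{1j}\rho_0$, $\sigma_j=\tau_{1j}\tau_{2j^*}$, and $\sigma=\tau_{11}\cdots\tau_{1p}\,\tau_{21}\cdots\tau_{2p}$. Assume that $M$ has an abelian CR singularity at $0$, i.e. $\sigma_i\sigma_j=\sigma_j\sigma_i$ for all $i,j$, and that (the linear part at $0$ of) $\sigma$ has $2p$ distinct eigenvalues. Let $\rho$ be the involution $(\xi,\eta)\mapsto(\xi',\eta')$ of $\mathbb C^p\times\mathbb C^p$ with $\xi'_e=\bar\eta_e$, $\eta_e'=\bar\xi_e$ and $\xi_j'=\bar\xi_{j^*}$, $\eta'_j=\bar\eta_{j^*}$ for $j=s,s+s_*$. Let $\rho_z(\zeta)_j=\bar\zeta_{j^*}$ and $\xi\eta=(\xi_1\eta_1,\dots,\xi_p\eta_p)$.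 Then there are germs of holomorphic functions $\Lambda_{11},\dots,\Lambda_{1p}$ at $0\in\mathbb C^p$ with $\Lambda_{1j}(0)=\lambda_j$ and $$\Lambda_{1e}=\overline{\Lambda_{1e}\circ\rho_z},\qquad \Lambda_{1s}=\overline{\Lambda_{1(s+s_*)}^{-1}\circ\rho_z},$$ for which the following hold. (1) There is a germ of biholomorphism $\psi$ at $0$, $\psi(0)=0$, with $\rho_0\psi=\psi\rho$, such that for every $j$, with $\Lambda_{2j}=\Lambda_{1j}^{-1}$ and $M_j=\Lambda_{1j}^2$, the maps $\psi^{-1}\tau_{1j}\psi$ and $\psi^{-1}\tau_{2j^*}\psi$ are $\xi_j'=\Lambda_{kj}(\xi\eta)\eta_j$, $\eta_j'=\Lambda_{kj}^{-1}(\xi\eta)\xi_j$ with $k=1$ and $k=2$ respectively, the map $\psi^{-1}\sigma_j\psi$ is $\xi_j'=M_j(\xi\eta)\xi_j$, $\eta_j'=M_j^{-1}(\xi\eta)\eta_j$, and each of the three maps fixes all coordinates $\xi_i,\eta_i$ with $i\ne j$. (2) The equations $$\zeta_e=A_e(\zeta)z_e\bar z_e-B_e(\zeta)(z_e^2+\bar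 z_e^2),\qquad \zeta_j=A_j(\zeta)z_j\bar z_{j^*}-B_j(\zeta)\bigl(z_j^2+\Lambda_{1j}^2(\zeta)\bar z_{j^*}^2\bigr)\quad(j=s,\,s+s_*),$$ where $$A_e=\frac{1+\Lambda_{1e}^2}{(1-\Lambda_{1e}^2)^2},\qquad A_j=\Lambda_{1j}\frac{1+\Lambda_{1j}^2}{(1-\Lambda_{1j}^2)^2}\ (j=s,s+s_*),\qquad B_j=\frac{\Lambda_{1j}}{(1-\Lambda_{1j}^2)^2}\ (1\le j\le p),$$ have a unique germ of real analytic solution $\zeta=\zeta(z')$ at $0$ with $\zeta(0)=0$, and $M$ is equivalent, by a germ of biholomorphism of $(\mathbb C^{2p},0)$, to $$\widehat M:\quad z_{p+j}=\Lambda_{1j}(\zeta)\zeta_j,\qquad 1\le j\le p.$$ In particular $M$ can be holomorphically flattened: in suitable local holomorphic coordinates fixing $0$, $M$ is contained in the linear subspace $z_{p+e}=\bar z_{p+e}$, $z_{p+s}=\bar z_{p+s+s_*}$. -/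

import Mathlib

open Filter Topology
open scoped ComplexConjugate

namespace AbelianCR

noncomputable section

/-- The index set `{1, …, p}`, `p = a + 2 b`, of a complex tangent with `a = e_*` elliptic components,
no hyperbolic component and `b = s_*` complex components: the indices `e` are `Sum.inl e`, the indices
`s` are `Sum.inr (Sum.inl s)` and the indices `s + s_*` are `Sum.inr (Sum.inr s)`. -/
abbrev Idx (a b : ℕ) : Type := Fin a ⊕ (Fin b ⊕ Fin b)

/-- The space `ℂ^p`; the ambient space `ℂ^{2p}` is `V a b × V a b`, with points `(z', z'')`, and the
coordinates of the complexification are `(z', w')` or `(ξ, η)`, again in `V a b × V a b`. -/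
abbrev V (a b : ℕ) : Type := Idx a b → ℂ

variable {a b : ℕ}

/-- The involution `e ↦ e`, `s ↔ s + s_*` of the index set. -/
def swapIdx : Idx a b → Idx a b
  | Sum.inl e => Sum.inl e
  | Sum.inr (Sum.inl s) => Sum.inr (Sum.inr s)
  | Sum.inr (Sum.inr s) => Sum.inr (Sum.inl s)

/-- The indices in their order `1, …, p`. -/
def idxList (a b : ℕ) : List (Idx a b) :=
  (List.finRange a).map Sum.inl ++
    ((List.finRange b).map (fun s => Sum.inr (Sum.inl s)) ++
      (List.finRange b).map (fun s => Sum.inr (Sum.inr s)))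

/-- Coordinatewise complex conjugation. -/
def conjV (z : V a b) : V a b := fun j => conj (z j)

/-! ### The product quadric and its perturbations -/

/-- The Bishop invariants: `γ_e`, `γ_s` and `γ_{s+s_*} = 1 - conj γ_s`. -/
def gam (γe : Fin a → ℝ) (γs : Fin b → ℂ) : Idx a b → ℂ
  | Sum.inl e => (γe e : ℂ)
  | Sum.inr (Sum.inl s) => γs s
  | Sum.inr (Sum.inr s) => 1 - conj (γs s)

/-- The numbers `λ_j`:  `λ_e > 1` is the solution of `γ_e = 1 / (λ_e + λ_e⁻¹)`, `λ_s` is the solution of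
`γ_s = 1 / (1 + λ_s⁻²)` with `0 < arg λ_s < π / 2` (it has `|λ_s| > 1`), and
`λ_{s+s_*} = (conj λ_s)⁻¹`. -/
def lam (γe : Fin a → ℝ) (γs : Fin b → ℂ) : Idx a b → ℂ
  | Sum.inl e => (((1 + Real.sqrt (1 - 4 * γe e ^ 2)) / (2 * γe e) : ℝ) : ℂ)
  | Sum.inr (Sum.inl s) => (γs s / (1 - γs s)) ^ (1 / 2 : ℂ)
  | Sum.inr (Sum.inr s) => (conj ((γs s / (1 - γs s)) ^ (1 / 2 : ℂ)))⁻¹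

/-- The linear forms of the product quadric `z_{p+j} = L_j(z', conj z')^2`, complexified:
`L_e = z_e + 2 γ_e w_e`, `L_s = z_s + 2 γ_s w_{s+s_*}`,
`L_{s+s_*} = z_{s+s_*} + 2 (1 - conj γ_s) w_s`. -/
def quadForm (γe : Fin a → ℝ) (γs : Fin b → ℂ) (j : Idx a b) (x : V a b × V a b) : ℂ :=
  x.1 j + 2 * gam γe γs j * x.2 (swapIdx j)

/-- `E(z', w')` is a convergent power series whose real form `z'' = E(z', conj z')` is a higher order
(that is, third order) perturbation of the product quadric. -/
def IsPerturbation (γe : Fin a → ℝ) (γs : Fin b → ℂ) (E : V a b × V a b → V a b) : Prop :=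
  AnalyticAt ℂ E 0 ∧
    (fun x => E x - fun j => quadForm γe γs j x ^ 2) =O[𝓝 0] fun x => ‖x‖ ^ 3

/-- The real submanifold `M : z'' = E(z', conj z')` of `ℂ^{2p}` (only its germ at `0` matters). -/
def realM (E : V a b × V a b → V a b) : Set (V a b × V a b) :=
  {x | x.2 = E (x.1, conjV x.1)}

/-! ### Germs of biholomorphisms and deck transformations -/

/-- `F` is a germ of biholomorphism at `0` with `F 0 = 0`. -/
def IsBiholGerm (F : V a b × V a b → V a b × V a b) : Prop :=
  AnalyticAt ℂ F 0 ∧ F 0 = 0 ∧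
    ∃ G : V a b × V a b → V a b × V a b, AnalyticAt ℂ G 0 ∧ G 0 = 0 ∧
      (∀ᶠ x in 𝓝 0, G (F x) = x) ∧ ∀ᶠ x in 𝓝 0, F (G x) = x

/-- Two germs at `0` of subsets of `ℂ^{2p}` are holomorphically equivalent. -/
def HolEquivalent (M N : Set (V a b × V a b)) : Prop :=
  ∃ Φ : V a b × V a b → V a b × V a b, IsBiholGerm Φ ∧ ∀ᶠ x in 𝓝 0, (x ∈ M ↔ Φ x ∈ N)

/-- The projection `π₁(z, w) = z` of the complexification of `M`, in its coordinates `(z', w')`. -/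
def proj1 (E : V a b × V a b → V a b) (x : V a b × V a b) : V a b × V a b := (x.1, E x)

/-- `F` is (a representative of) a deck transformation of `π₁`. -/
def IsDeck (E : V a b × V a b → V a b) (F : V a b × V a b → V a b × V a b) : Prop :=
  IsBiholGerm F ∧ ∀ᶠ x in 𝓝 0, proj1 E (F x) = proj1 E x

/-- `π₁` has the maximum number `2^p` of deck transformations (counted as germs at `0`). -/
def HasMaxDeck (E : V a b × V a b → V a b) : Prop :=
  {f : Germ (𝓝 (0 : V a b × V a b)) (V a b × V a b) | ∃ F, IsDeck E F ∧ f = ↑F}.ncard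
    = 2 ^ (a + 2 * b)

/-- `F` is the generator `τ_{1j}` of the group of deck transformations: it fixes a (smooth) complex
hypersurface `h = 0` pointwise, and it is numbered by the product quadric, that is, its linear part maps
`L_j` to `-L_j`. -/
def IsGenerator (γe : Fin a → ℝ) (γs : Fin b → ℂ) (E : V a b × V a b → V a b) (j : Idx a b)
    (F : V a b × V a b → V a b × V a b) : Prop :=
  IsDeck E F ∧
    (∃ h : V a b × V a b → ℂ, AnalyticAt ℂ h 0 ∧ h 0 = 0 ∧ fderiv ℂ h 0 ≠ 0 ∧
      ∀ᶠ x in 𝓝 0, h x = 0 → F x = x) ∧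
    ∀ v, quadForm γe γs j (fderiv ℂ F 0 v) = - quadForm γe γs j v

/-- The anti-holomorphic involution `ρ₀(z', w') = (conj w', conj z')` of the complexification. -/
def rho0 (x : V a b × V a b) : V a b × V a b := (conjV x.2, conjV x.1)

/-- `τ_{2j} = ρ₀ τ_{1j} ρ₀`. -/
def tau2 (τ : Idx a b → V a b × V a b → V a b × V a b) (j : Idx a b) :
    V a b × V a b → V a b × V a b :=
  rho0 ∘ τ j ∘ rho0

/-- `σ_e = τ_{1e} τ_{2e}`, `σ_s = τ_{1s} τ_{2(s+s_*)}`, `σ_{s+s_*} = τ_{1(s+s_*)} τ_{2s}`. -/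
def sigmaJ (τ : Idx a b → V a b × V a b → V a b × V a b) (j : Idx a b) :
    V a b × V a b → V a b × V a b :=
  τ j ∘ tau2 τ (swapIdx j)

/-- The composition `T_1 ∘ ⋯ ∘ T_p`. -/
def compAll (T : Idx a b → V a b × V a b → V a b × V a b) : V a b × V a b → V a b × V a b :=
  ((idxList a b).map T).foldr (fun f g => f ∘ g) id

/-- `σ = τ₁ τ₂` with `τ_i = τ_{i1} ⋯ τ_{ip}`. -/
def sigmaTot (τ : Idx a b → V a b × V a b → V a b × V a b) : V a b × V a b → V a b × V a b :=
  compAll τ ∘ compAll (tau2 τ)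

/-- `σ` has `2p` distinct eigenvalues (those of its linear part at `0`). -/
def HasDistinctEigenvalues (τ : Idx a b → V a b × V a b → V a b × V a b) : Prop :=
  {μ : ℂ | Module.End.HasEigenvalue
    ((fderiv ℂ (sigmaTot τ) 0 : V a b × V a b →L[ℂ] V a b × V a b) :
      V a b × V a b →ₗ[ℂ] V a b × V a b) μ}.ncard = 2 * (a + 2 * b)

/-- `M` has an abelian CR singularity at `0`: it has the maximum number of deck transformations and
`σ_1, …, σ_p` commute pairwise (as germs at `0`). -/
def IsAbelianCR (E : V a b × V a b → V a b) (τ : Idx a b → V a b × V a b → V a b × V a b) : Prop :=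
  HasMaxDeck E ∧
    ∀ i j, ∀ᶠ x in 𝓝 0, sigmaJ τ i (sigmaJ τ j x) = sigmaJ τ j (sigmaJ τ i x)

/-! ### The normal forms -/

/-- The anti-holomorphic involution `ρ` in the coordinates `(ξ, η)`: `ξ_e' = conj η_e`,
`η_e' = conj ξ_e`, and `(ξ_j', η_j') = (conj ξ_{j^*}, conj η_{j^*})` for `j = s, s + s_*`, where `^*`
exchanges `s` and `s + s_*`. -/
def rho (x : V a b × V a b) : V a b × V a b :=
  (fun j => match j with
    | Sum.inl e => conj (x.2 (Sum.inl e))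
    | Sum.inr i => conj (x.1 (swapIdx (Sum.inr i))),
   fun j => match j with
    | Sum.inl e => conj (x.1 (Sum.inl e))
    | Sum.inr i => conj (x.2 (swapIdx (Sum.inr i))))

/-- `ρ_z : ζ_e ↦ conj ζ_e, ζ_s ↦ conj ζ_{s+s_*}, ζ_{s+s_*} ↦ conj ζ_s`. -/
def rhoZ (ζ : V a b) : V a b := fun j => conj (ζ (swapIdx j))

/-- The map `ξ_j' = Λ(ξη) η_j`, `η_j' = Λ(ξη)⁻¹ ξ_j`, the other coordinates being fixed. -/
def nfTau (L : V a b → ℂ) (j : Idx a b) (x : V a b × V a b) : V a b × V a b :=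
  (Function.update x.1 j (L (x.1 * x.2) * x.2 j),
   Function.update x.2 j ((L (x.1 * x.2))⁻¹ * x.1 j))

/-- The map `ξ_j' = m(ξη) ξ_j`, `η_j' = m(ξη)⁻¹ η_j`, the other coordinates being fixed. -/
def nfSigma (m : V a b → ℂ) (j : Idx a b) (x : V a b × V a b) : V a b × V a b :=
  (Function.update x.1 j (m (x.1 * x.2) * x.1 j),
   Function.update x.2 j ((m (x.1 * x.2))⁻¹ * x.2 j))

/-- The reality conditions `Λ_{1e} = conj (Λ_{1e} ∘ ρ_z)` and
`Λ_{1s} = conj (Λ_{1(s+s_*)}⁻¹ ∘ ρ_z)` (as germs at `0`). -/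
def RealityCondition (Λ : Idx a b → V a b → ℂ) : Prop :=
  (∀ e : Fin a, ∀ᶠ ζ in 𝓝 0, Λ (Sum.inl e) ζ = conj (Λ (Sum.inl e) (rhoZ ζ))) ∧
  (∀ s : Fin b, ∀ᶠ ζ in 𝓝 0,
    Λ (Sum.inr (Sum.inl s)) ζ = conj (Λ (Sum.inr (Sum.inr s)) (rhoZ ζ))⁻¹)

/-- The simultaneous normalization: `ψ` is a germ of biholomorphism which transforms `ρ₀` into `ρ`,
and, for each `j`,
`ψ⁻¹ τ_{1j} ψ` into `(ξ_j, η_j) ↦ (Λ_{1j}(ξη) η_j, Λ_{1j}(ξη)⁻¹ ξ_j)`,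
the `τ_{2k}` paired with `τ_{1j}` in `σ_j` into the same form with `Λ_{2j} = Λ_{1j}⁻¹`,
and `σ_j` into `(ξ_j, η_j) ↦ (M_j(ξη) ξ_j, M_j(ξη)⁻¹ η_j)` with `M_j = Λ_{1j}²`. -/
def Normalizes (τ : Idx a b → V a b × V a b → V a b × V a b) (Λ : Idx a b → V a b → ℂ)
    (ψ : V a b × V a b → V a b × V a b) : Prop :=
  IsBiholGerm ψ ∧
    (∀ᶠ x in 𝓝 0, rho0 (ψ x) = ψ (rho x)) ∧
    ∀ j,
      (∀ᶠ x in 𝓝 0, τ j (ψ x) = ψ (nfTau (Λ j) j x)) ∧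
      (∀ᶠ x in 𝓝 0, tau2 τ (swapIdx j) (ψ x) = ψ (nfTau (fun ζ => (Λ j ζ)⁻¹) j x)) ∧
      (∀ᶠ x in 𝓝 0, sigmaJ τ j (ψ x) = ψ (nfSigma (fun ζ => Λ j ζ ^ 2) j x))

/-- `A_e = (1 + Λ²) / (1 - Λ²)²`, and `A_j = Λ (1 + Λ²) / (1 - Λ²)²` for `j = s, s + s_*`, where
`Λ = Λ_{1j}`. -/
def coefA (Λ : Idx a b → V a b → ℂ) (j : Idx a b) (ζ : V a b) : ℂ :=
  match j with
  | Sum.inl e => (1 + Λ (Sum.inl e) ζ ^ 2) / (1 - Λ (Sum.inl e) ζ ^ 2) ^ 2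
  | Sum.inr i =>
      Λ (Sum.inr i) ζ * ((1 + Λ (Sum.inr i) ζ ^ 2) / (1 - Λ (Sum.inr i) ζ ^ 2) ^ 2)

/-- `B_j = Λ_{1j} / (1 - Λ_{1j}²)²`. -/
def coefB (Λ : Idx a b → V a b → ℂ) (j : Idx a b) (ζ : V a b) : ℂ :=
  Λ j ζ / (1 - Λ j ζ ^ 2) ^ 2

/-- `ζ = ζ(z')` is a convergent (real analytic) solution with `ζ(0) = 0` of
`ζ_e = A_e(ζ) z_e conj z_e - B_e(ζ) (z_e² + conj z_e²)` and, for `j = s, s + s_*`,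
`ζ_j = A_j(ζ) z_j conj z_{j^*} - B_j(ζ) (z_j² + Λ_{1j}(ζ)² conj z_{j^*}²)`. -/
def IsZetaSolution (Λ : Idx a b → V a b → ℂ) (ζ : V a b → V a b) : Prop :=
  AnalyticAt ℝ ζ 0 ∧ ζ 0 = 0 ∧ ∀ᶠ z in 𝓝 0,
    (∀ e : Fin a, ζ z (Sum.inl e) =
      coefA Λ (Sum.inl e) (ζ z) * (z (Sum.inl e) * conj (z (Sum.inl e)))
        - coefB Λ (Sum.inl e) (ζ z) * (z (Sum.inl e) ^ 2 + conj (z (Sum.inl e)) ^ 2)) ∧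
    (∀ i : Fin b ⊕ Fin b, ζ z (Sum.inr i) =
      coefA Λ (Sum.inr i) (ζ z) * (z (Sum.inr i) * conj (z (swapIdx (Sum.inr i))))
        - coefB Λ (Sum.inr i) (ζ z) *
          (z (Sum.inr i) ^ 2 + Λ (Sum.inr i) (ζ z) ^ 2 * conj (z (swapIdx (Sum.inr i))) ^ 2))

/-- The normal form `z_{p+j} = Λ_{1j}(ζ) ζ_j`, `ζ = ζ(z')`. -/
def normalFormM (Λ : Idx a b → V a b → ℂ) (ζ : V a b → V a b) : Set (V a b × V a b) :=
  {x | ∀ j, x.2 j = Λ j (ζ x.1) * ζ x.1 j}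

/-- The linear subspace `z_{p+e} = conj z_{p+e}`, `z_{p+s} = conj z_{p+s+s_*}`. -/
def flatSpace (a b : ℕ) : Set (V a b × V a b) :=
  {x | (∀ e : Fin a, x.2 (Sum.inl e) = conj (x.2 (Sum.inl e))) ∧
    ∀ s : Fin b, x.2 (Sum.inr (Sum.inl s)) = conj (x.2 (Sum.inr (Sum.inr s)))}

end

end AbelianCR

open AbelianCR

open Filter Topology
open scoped ComplexConjugate

namespace AbelianCR

noncomputable section

set_option linter.unusedSectionVars false

section

/-! ### Germs of biholomorphisms between normed spaces -/

section Germs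

variable {E F G : Type*} [NormedAddCommGroup E] [NormedSpace ℂ E] [NormedAddCommGroup F]
  [NormedSpace ℂ F] [NormedAddCommGroup G] [NormedSpace ℂ G]

/-- `f` and `g` are mutually inverse germs at `0` of biholomorphisms. -/
structure IsGermInv (f : E → F) (g : F → E) : Prop where
  an : AnalyticAt ℂ f 0
  map0 : f 0 = 0
  an' : AnalyticAt ℂ g 0
  map0' : g 0 = 0
  left : ∀ᶠ x in 𝓝 0, g (f x) = x
  right : ∀ᶠ x in 𝓝 0, f (g x) = x

theorem AnalyticAt.tendsto_zero {f : E → F} (hf : AnalyticAt ℂ f 0) (h0 : f 0 = 0) :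
    Tendsto f (𝓝 0) (𝓝 0) := by
  have := hf.continuousAt.tendsto
  rwa [h0] at this

theorem AnalyticAt.comp_zero {g : F → G} {f : E → F} (hg : AnalyticAt ℂ g 0)
    (hf : AnalyticAt ℂ f 0) (h0 : f 0 = 0) : AnalyticAt ℂ (fun x => g (f x)) 0 := by
  have hg' : AnalyticAt ℂ g (f 0) := by rwa [h0]
  exact hg'.comp hf

theorem fderiv_comp_zero {g : F → G} {f : E → F} (hg : AnalyticAt ℂ g 0)
    (hf : AnalyticAt ℂ f 0) (h0 : f 0 = 0) (v : E) :
    fderiv ℂ (fun x => g (f x)) 0 v = fderiv ℂ g 0 (fderiv ℂ f 0 v) := by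
  have hg' : DifferentiableAt ℂ g (f 0) := by rw [h0]; exact hg.differentiableAt
  have := fderiv_comp (x := (0 : E)) (g := g) (f := f) hg' hf.differentiableAt
  rw [h0] at this
  change fderiv ℂ (g ∘ f) 0 v = _
  rw [this]; rfl

namespace IsGermInv

theorem symm {f : E → F} {g : F → E} (h : IsGermInv f g) : IsGermInv g f :=
  ⟨h.an', h.map0', h.an, h.map0, h.right, h.left⟩

theorem tendsto {f : E → F} {g : F → E} (h : IsGermInv f g) : Tendsto f (𝓝 0) (𝓝 0) :=
  AnalyticAt.tendsto_zero h.an h.map0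

theorem tendsto' {f : E → F} {g : F → E} (h : IsGermInv f g) : Tendsto g (𝓝 0) (𝓝 0) :=
  h.symm.tendsto

theorem comp {f : E → F} {g : F → E} {f' : F → G} {g' : G → F} (h' : IsGermInv f' g')
    (h : IsGermInv f g) : IsGermInv (fun x => f' (f x)) (fun x => g (g' x)) where
  an := AnalyticAt.comp_zero h'.an h.an h.map0
  map0 := by simp [h.map0, h'.map0]
  an' := AnalyticAt.comp_zero h.an' h'.an' h'.map0'
  map0' := by simp [h.map0', h'.map0']
  left := by
    filter_upwards [h.tendsto.eventually h'.left, h.left] with x h1 h2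
    rw [h1, h2]
  right := by
    filter_upwards [h'.tendsto'.eventually h.right, h'.right] with x h1 h2
    rw [h1, h2]

theorem of_equiv (L : E ≃L[ℂ] F) : IsGermInv (fun x => L x) (fun x => L.symm x) where
  an := L.toContinuousLinearMap.analyticAt 0
  map0 := map_zero L
  an' := L.symm.toContinuousLinearMap.analyticAt 0
  map0' := map_zero L.symm
  left := Eventually.of_forall fun x => by simp
  right := Eventually.of_forall fun x => by simp

theorem fderiv_left {f : E → F} {g : F → E} (h : IsGermInv f g) (v : E) :
    fderiv ℂ g 0 (fderiv ℂ f 0 v) = v := by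
  rw [← fderiv_comp_zero h.an' h.an h.map0]
  have : (fun x => g (f x)) =ᶠ[𝓝 0] id := h.left
  rw [this.fderiv_eq]; simp

theorem fderiv_right {f : E → F} {g : F → E} (h : IsGermInv f g) (v : F) :
    fderiv ℂ f 0 (fderiv ℂ g 0 v) = v := h.symm.fderiv_left v

theorem of_involutive {f : E → E} (hf : AnalyticAt ℂ f 0) (h0 : f 0 = 0)
    (h : ∀ᶠ x in 𝓝 0, f (f x) = x) : IsGermInv f f := ⟨hf, h0, hf, h0, h, h⟩

/-- The inverse function theorem. -/
theorem exists_of_fderiv [CompleteSpace E] [CompleteSpace F] {f : E → F} (hf : AnalyticAt ℂ f 0)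
    (h0 : f 0 = 0) (i : E ≃L[ℂ] F) (hi : fderiv ℂ f 0 = i) : ∃ g, IsGermInv f g := by
  have hs : HasStrictFDerivAt f (i : E →L[ℂ] F) 0 := by
    rw [← hi]; exact hf.hasStrictFDerivAt
  let e := hs.toOpenPartialHomeomorph f
  have hmem : (0 : E) ∈ e.source := hs.mem_toOpenPartialHomeomorph_source
  have hcoe : ∀ x, e x = f x := fun x => by rw [hs.toOpenPartialHomeomorph_coe]
  have han : AnalyticAt ℂ e.symm (e 0) := by
    refine e.analyticAt_symm' (i := i) hmem ?_ ?_
    · exact hf.congr (Eventually.of_forall fun x => (hcoe x).symm)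
    · have : (e : E → F) = f := funext hcoe
      rw [this, hi]
  have h00 : e 0 = 0 := by rw [hcoe, h0]
  refine ⟨e.symm, hf, h0, by rwa [h00] at han, ?_, ?_, ?_⟩
  · have := e.left_inv hmem
    rwa [h00] at this
  · filter_upwards [e.open_source.mem_nhds hmem] with x hx
    rw [← hcoe, e.left_inv hx]
  · have : (0 : F) ∈ e.target := by rw [← h00]; exact e.map_source hmem
    filter_upwards [e.open_target.mem_nhds this] with x hx
    rw [← hcoe, e.right_inv hx]

theorem exists_of_fderiv_injective [FiniteDimensional ℂ E] {f : E → E} (hf : AnalyticAt ℂ f 0)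
    (h0 : f 0 = 0) (hi : ∀ v, fderiv ℂ f 0 v = 0 → v = 0) : ∃ g, IsGermInv f g := by
  have : CompleteSpace E := FiniteDimensional.complete ℂ E
  have hinj : Function.Injective (fderiv ℂ f 0 : E →ₗ[ℂ] E) :=
    (injective_iff_map_eq_zero _).2 hi
  let L := (LinearEquiv.ofInjectiveEndo (fderiv ℂ f 0 : E →ₗ[ℂ] E) hinj).toContinuousLinearEquiv
  refine exists_of_fderiv hf h0 L ?_
  ext v
  rfl

end IsGermInv

/-- An analytic germ vanishing along curves with a dense set of leading coefficients is zero. -/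
theorem eventually_eq_zero_of_curves {g : E → F} (hg : AnalyticAt ℂ g 0) (D : Set E)
    (hD : Dense D)
    (h : ∀ w ∈ D, ∃ (m : ℕ) (c : ℂ → E), 1 ≤ m ∧
      Tendsto (fun t : ℂ => (t ^ m)⁻¹ • c t) (𝓝[≠] 0) (𝓝 w) ∧ ∀ᶠ t in 𝓝[≠] 0, g (c t) = 0) :
    ∀ᶠ x in 𝓝 0, g x = 0 := by
  obtain ⟨p, hp⟩ := hg
  have key : ∀ n, ∀ w : E, p n (fun _ => w) = 0 := by
    intro n
    induction n using Nat.strong_induction_on with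
    | _ n ih =>
    have hcont : Continuous fun w : E => p n (fun _ => w) :=
      (p n).cont.comp (continuous_pi fun _ => continuous_id)
    have : Set.EqOn (fun w : E => p n (fun _ => w)) (fun _ => 0) D := by
      intro w hw
      obtain ⟨m, c, hm, hc, hz⟩ := h w hw
      have hO := hp.isBigO_sub_partialSum_pow (n + 1)
      simp only [zero_add] at hO
      have hps : ∀ y, p.partialSum (n + 1) y = p n (fun _ => y) := by
        intro y
        rw [FormalMultilinearSeries.partialSum, Finset.sum_range_succ]
        rw [Finset.sum_eq_zero, zero_add]
        intro k hk
        exact ih k (Finset.mem_range.1 hk) y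
      simp only [hps] at hO
      obtain ⟨C, hC⟩ := hO.bound
      have ht : Tendsto (fun t : ℂ => t) (𝓝[≠] 0) (𝓝 0) := tendsto_id.mono_left nhdsWithin_le_nhds
      have htm : Tendsto (fun t : ℂ => t ^ m) (𝓝[≠] 0) (𝓝 0) := by
        have := ht.pow m
        rwa [zero_pow (by omega)] at this
      have hne : ∀ᶠ t : ℂ in 𝓝[≠] 0, t ≠ 0 := eventually_mem_nhdsWithin
      have hceq : ∀ᶠ t : ℂ in 𝓝[≠] 0, c t = t ^ m • ((t ^ m)⁻¹ • c t) := by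
        filter_upwards [hne] with t h0
        rw [smul_smul, mul_inv_cancel₀ (pow_ne_zero _ h0), one_smul]
      have hc0 : Tendsto c (𝓝[≠] 0) (𝓝 0) := by
        have := htm.smul hc
        rw [zero_smul] at this
        exact this.congr' (hceq.mono fun t h => h.symm)
      have hb : ∀ᶠ t : ℂ in 𝓝[≠] 0, ‖p n (fun _ => (t ^ m)⁻¹ • c t)‖ ≤
          C * (‖t ^ m‖ * ‖(t ^ m)⁻¹ • c t‖ ^ (n + 1)) := by
        filter_upwards [hc0.eventually hC, hz, hne, hceq] with t h1 h2 h3 h4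
        rw [h2, zero_sub, norm_neg] at h1
        have h5 : p n (fun _ => c t) = (t ^ m) ^ n • p n (fun _ => (t ^ m)⁻¹ • c t) := by
          conv_lhs => rw [h4]
          rw [(p n).map_smul_univ (fun _ => t ^ m) (fun _ => (t ^ m)⁻¹ • c t)]
          simp
        rw [h5, norm_smul, norm_pow, norm_pow] at h1
        have h6 : ‖c t‖ = ‖t ^ m‖ * ‖(t ^ m)⁻¹ • c t‖ := by
          rw [← norm_smul, ← h4]
        rw [h6, Real.norm_of_nonneg (by positivity), mul_pow, pow_succ, norm_pow] at h1
        rw [norm_pow]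
        have hpos : 0 < (‖t‖ ^ m) ^ n := by positivity
        refine le_of_mul_le_mul_left ?_ hpos
        linarith
      have hl : Tendsto (fun t : ℂ => p n (fun _ => (t ^ m)⁻¹ • c t)) (𝓝[≠] 0)
          (𝓝 (p n fun _ => w)) := (hcont.tendsto w).comp hc
      have hr : Tendsto (fun t : ℂ => C * (‖t ^ m‖ * ‖(t ^ m)⁻¹ • c t‖ ^ (n + 1))) (𝓝[≠] 0)
          (𝓝 (C * (0 * ‖w‖ ^ (n + 1)))) := by
        refine Tendsto.const_mul _ (Tendsto.mul ?_ (hc.norm.pow _))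
        have := htm.norm
        rwa [norm_zero] at this
      have := le_of_tendsto_of_tendsto hl.norm hr hb
      simpa using this
    have := Continuous.ext_on hD hcont continuous_const this
    exact fun w => congrFun this w
  filter_upwards [hp.eventually_hasSum] with x hx
  simp only [key, zero_add] at hx
  exact hx.unique hasSum_zero

theorem eventually_forall_ball_of_eventually {f g : E → F} {r : ℝ}
    [CompleteSpace F] (hf : AnalyticOnNhd ℂ f (Metric.ball 0 r)) (hg : AnalyticOnNhd ℂ g (Metric.ball 0 r))
    (hr : 0 < r) (h : ∀ᶠ x in 𝓝 0, f x = g x) : ∀ x ∈ Metric.ball (0 : E) r, f x = g x :=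
  fun _ hx => hf.eqOn_of_preconnected_of_eventuallyEq hg
    (convex_ball (0 : E) r).isPreconnected (Metric.mem_ball_self hr) h hx

end Germs

/-! ### Composition operators on spaces of continuous functions -/

section Nemytskii

variable {E F : Type*} [NormedAddCommGroup E] [NormedSpace ℂ E] [NormedAddCommGroup F]
  [NormedSpace ℂ F] {K : Type*} [TopologicalSpace K] [CompactSpace K]

/-- The multilinear map acting pointwise on continuous functions. -/
def pointwiseMultilinear {n : ℕ} (m : E [×n]→L[ℂ] F) : C(K, E) [×n]→L[ℂ] C(K, F) :=
  MultilinearMap.mkContinuous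
    { toFun := fun u => ⟨fun t => m fun i => u i t,
        m.cont.comp (continuous_pi fun i => (u i).continuous)⟩
      map_update_add' := by
        intro _ u i x y
        ext t
        have key : ∀ z : C(K, E), (fun j => (Function.update u i z j) t) =
            Function.update (fun j => u j t) i (z t) := by
          intro z; ext j
          by_cases hj : j = i
          · subst hj; simp
          · simp [hj]
        change m _ = m _ + m _
        simp only [key]
        exact m.map_update_add _ _ _ _
      map_update_smul' := by
        intro _ u i c x
        ext t
        have key : ∀ z : C(K, E), (fun j => (Function.update u i z j) t) =
            Function.update (fun j => u j t) i (z t) := by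
          intro z; ext j
          by_cases hj : j = i
          · subst hj; simp
          · simp [hj]
        change m _ = c • m _
        simp only [key]
        exact m.map_update_smul _ _ _ _ }
    ‖m‖ (by
      intro u
      refine (ContinuousMap.norm_le _ (by positivity)).2 fun t => ?_
      refine (m.le_opNorm _).trans ?_
      gcongr with i
      exact (u i).norm_coe_le_norm t)

theorem norm_pointwiseMultilinear_le {n : ℕ} (m : E [×n]→L[ℂ] F) :
    ‖(pointwiseMultilinear m : C(K, E) [×n]→L[ℂ] C(K, F))‖ ≤ ‖m‖ :=
  MultilinearMap.mkContinuous_norm_le _ (norm_nonneg _) _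

open Classical in
/-- The composition operator `u ↦ g ∘ u`. -/
def nemytskii (g : E → F) (u : C(K, E)) : C(K, F) :=
  if h : Continuous fun t => g (u t) then ⟨_, h⟩ else 0

theorem hasFPowerSeriesOnBall_nemytskii [CompleteSpace F] {g : E → F} {p : FormalMultilinearSeries ℂ E F}
    {r : ENNReal} (hg : HasFPowerSeriesOnBall g p 0 r) :
    HasFPowerSeriesOnBall (nemytskii g : C(K, E) → C(K, F))
      (fun n => pointwiseMultilinear (p n)) 0 r where
  r_le := by
    refine hg.r_le.trans (ENNReal.le_of_forall_nnreal_lt fun s hs => ?_)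
    obtain ⟨C, -, hC⟩ := p.norm_mul_pow_le_of_lt_radius hs
    refine FormalMultilinearSeries.le_radius_of_bound _ C fun n => ?_
    refine le_trans ?_ (hC n)
    gcongr
    exact norm_pointwiseMultilinear_le _
  r_pos := hg.r_pos
  hasSum := by
    intro u hu
    have hu' : ∀ t, u t ∈ Metric.eball (0 : E) r := by
      intro t
      rw [Metric.mem_eball, edist_zero_right] at hu ⊢
      refine lt_of_le_of_lt ?_ hu
      exact enorm_le_iff_norm_le.2 (u.norm_coe_le_norm t)
    have hcont : Continuous fun t => g (u t) := by
      refine continuous_iff_continuousAt.2 fun t => ?_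
      have : ContinuousAt g (u t) :=
        (hg.continuousOn.continuousAt (Metric.isOpen_eball.mem_nhds (hu' t)))
      exact ContinuousAt.comp (f := u) this u.continuous.continuousAt
    have hrad : ‖u‖₊ < p.radius := by
      refine lt_of_lt_of_le ?_ hg.r_le
      rw [Metric.mem_eball, edist_zero_right] at hu
      exact hu
    have hsum : Summable fun n : ℕ => (pointwiseMultilinear (p n) fun _ => u : C(K, F)) := by
      refine Summable.of_norm_bounded (p.summable_norm_mul_pow hrad) fun n => ?_
      refine (ContinuousMultilinearMap.le_opNorm _ _).trans ?_
      simp only [Finset.prod_const, Finset.card_univ, Fintype.card_fin]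
      exact mul_le_mul_of_nonneg_right (norm_pointwiseMultilinear_le _) (by positivity)
    have heq : nemytskii g ((0 : C(K, E)) + u) = ∑' n : ℕ, (pointwiseMultilinear (p n) fun _ => u : C(K, F)) := by
      ext t
      have h1 := ((ContinuousMap.evalCLM ℂ t : C(K, F) →L[ℂ] F).hasSum hsum.hasSum)
      have h2 := hg.hasSum (hu' t)
      rw [zero_add] at h2 ⊢
      rw [nemytskii, dif_pos hcont]
      exact h2.unique h1
    rw [heq]
    exact hsum.hasSum

end Nemytskii

end

section

/-! ### Rotations and averages -/

section Rot

variable {κ : Type*} [Fintype κ] [DecidableEq κ]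

/-- The space `ℂ^κ × ℂ^κ` with coordinates `(ξ, η)`. -/
abbrev Dbl (κ : Type*) : Type _ := (κ → ℂ) × (κ → ℂ)

/-- The linear map `ξ_j' = c ξ_j`, `η_j' = c⁻¹ η_j`. -/
def rot (j : κ) (c : ℂ) : Dbl κ →L[ℂ] Dbl κ :=
  LinearMap.toContinuousLinearMap
    { toFun := fun y => (Function.update y.1 j (c * y.1 j), Function.update y.2 j (c⁻¹ * y.2 j))
      map_add' := by
        intro x y
        ext i <;> by_cases h : i = j <;> [subst h; skip; subst h; skip] <;> simp [*] <;> ring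
      map_smul' := by
        intro a y
        ext i <;> by_cases h : i = j <;> [subst h; skip; subst h; skip] <;> simp [*] <;> ring }

/-- The linear map `ξ_j' = α η_j`, `η_j' = α⁻¹ ξ_j`. -/
def flip (j : κ) (α : ℂ) : Dbl κ →L[ℂ] Dbl κ :=
  LinearMap.toContinuousLinearMap
    { toFun := fun y => (Function.update y.1 j (α * y.2 j), Function.update y.2 j (α⁻¹ * y.1 j))
      map_add' := by
        intro x y
        ext i <;> by_cases h : i = j <;> [subst h; skip; subst h; skip] <;> simp [*] <;> ring
      map_smul' := by
        intro a y
        ext i <;> by_cases h : i = j <;> [subst h; skip; subst h; skip] <;> simp [*] <;> ring }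

theorem rot_apply (j : κ) (c : ℂ) (y : Dbl κ) :
    rot j c y = (Function.update y.1 j (c * y.1 j), Function.update y.2 j (c⁻¹ * y.2 j)) := rfl

theorem flip_apply (j : κ) (α : ℂ) (y : Dbl κ) :
    flip j α y = (Function.update y.1 j (α * y.2 j), Function.update y.2 j (α⁻¹ * y.1 j)) := rfl

@[simp] theorem rot_fst_self (j : κ) (c : ℂ) (y : Dbl κ) : (rot j c y).1 j = c * y.1 j := by
  simp [rot_apply]

@[simp] theorem rot_snd_self (j : κ) (c : ℂ) (y : Dbl κ) : (rot j c y).2 j = c⁻¹ * y.2 j := by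
  simp [rot_apply]

theorem rot_fst_ne {i j : κ} (h : i ≠ j) (c : ℂ) (y : Dbl κ) : (rot j c y).1 i = y.1 i := by
  simp [rot_apply, h]

theorem rot_snd_ne {i j : κ} (h : i ≠ j) (c : ℂ) (y : Dbl κ) : (rot j c y).2 i = y.2 i := by
  simp [rot_apply, h]

@[simp] theorem flip_fst_self (j : κ) (c : ℂ) (y : Dbl κ) : (flip j c y).1 j = c * y.2 j := by
  simp [flip_apply]

@[simp] theorem flip_snd_self (j : κ) (c : ℂ) (y : Dbl κ) : (flip j c y).2 j = c⁻¹ * y.1 j := by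
  simp [flip_apply]

theorem flip_fst_ne {i j : κ} (h : i ≠ j) (c : ℂ) (y : Dbl κ) : (flip j c y).1 i = y.1 i := by
  simp [flip_apply, h]

theorem flip_snd_ne {i j : κ} (h : i ≠ j) (c : ℂ) (y : Dbl κ) : (flip j c y).2 i = y.2 i := by
  simp [flip_apply, h]

theorem Dbl.ext' {x y : Dbl κ} (j : κ) (h1 : x.1 j = y.1 j) (h2 : x.2 j = y.2 j)
    (h : ∀ i, i ≠ j → x.1 i = y.1 i ∧ x.2 i = y.2 i) : x = y := by
  ext i <;> by_cases hi : i = j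
  · subst hi; exact h1
  · exact (h i hi).1
  · subst hi; exact h2
  · exact (h i hi).2

@[simp] theorem rot_one (j : κ) (y : Dbl κ) : rot j 1 y = y := by
  simp [rot_apply]

theorem rot_rot (j : κ) (c d : ℂ) (y : Dbl κ) : rot j c (rot j d y) = rot j (c * d) y := by
  refine Dbl.ext' j ?_ ?_ fun i hi => ?_
  · simp [mul_assoc]
  · simp; ring
  · simp [rot_fst_ne hi, rot_snd_ne hi]

theorem rot_inv_rot (j : κ) {c : ℂ} (hc : c ≠ 0) (y : Dbl κ) : rot j c⁻¹ (rot j c y) = y := by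
  rw [rot_rot, inv_mul_cancel₀ hc, rot_one]

theorem rot_rot_inv (j : κ) {c : ℂ} (hc : c ≠ 0) (y : Dbl κ) : rot j c (rot j c⁻¹ y) = y := by
  rw [rot_rot, mul_inv_cancel₀ hc, rot_one]

theorem rot_comm (i j : κ) (c d : ℂ) (y : Dbl κ) : rot i c (rot j d y) = rot j d (rot i c y) := by
  by_cases h : i = j
  · subst h; rw [rot_rot, rot_rot, mul_comm]
  · refine Dbl.ext' j ?_ ?_ fun k hk => ?_
    · simp [rot_fst_ne (Ne.symm h)]
    · simp [rot_snd_ne (Ne.symm h)]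
    · by_cases hki : k = i
      · subst hki; simp [rot_fst_ne h, rot_snd_ne h]
      · simp [rot_fst_ne hk, rot_snd_ne hk, rot_fst_ne hki, rot_snd_ne hki]

theorem flip_flip (j : κ) {α : ℂ} (hα : α ≠ 0) (y : Dbl κ) : flip j α (flip j α y) = y := by
  refine Dbl.ext' j ?_ ?_ fun i hi => ?_
  · simp [hα]
  · simp [hα]
  · simp [flip_fst_ne hi, flip_snd_ne hi]

theorem flip_flip' (j : κ) {α β : ℂ} (y : Dbl κ) :
    flip j α (flip j β y) = rot j (α / β) y := by
  refine Dbl.ext' j ?_ ?_ fun i hi => ?_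
  · simp; ring
  · simp; ring
  · simp [flip_fst_ne hi, flip_snd_ne hi, rot_fst_ne hi, rot_snd_ne hi]

theorem flip_rot (j : κ) (α c : ℂ) (y : Dbl κ) :
    flip j α (rot j c y) = rot j c⁻¹ (flip j α y) := by
  refine Dbl.ext' j ?_ ?_ fun i hi => ?_
  · simp; ring
  · simp; ring
  · simp [flip_fst_ne hi, flip_snd_ne hi, rot_fst_ne hi, rot_snd_ne hi]

theorem flip_rot_of_ne {i j : κ} (hij : i ≠ j) (α c : ℂ) (y : Dbl κ) :
    flip i α (rot j c y) = rot j c (flip i α y) := by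
  refine Dbl.ext' i ?_ ?_ fun k hk => ?_
  · simp [rot_fst_ne hij, rot_snd_ne hij]
  · simp [rot_fst_ne hij, rot_snd_ne hij]
  · by_cases hkj : k = j
    · subst hkj; simp [flip_fst_ne hk, flip_snd_ne hk]
    · simp [flip_fst_ne hk, flip_snd_ne hk, rot_fst_ne hkj, rot_snd_ne hkj]

theorem norm_coord_fst_le (y : Dbl κ) (i : κ) : ‖y.1 i‖ ≤ ‖y‖ :=
  (norm_le_pi_norm y.1 i).trans (norm_fst_le y)

theorem norm_coord_snd_le (y : Dbl κ) (i : κ) : ‖y.2 i‖ ≤ ‖y‖ :=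
  (norm_le_pi_norm y.2 i).trans (norm_snd_le y)

theorem Dbl.norm_le {y : Dbl κ} {r : ℝ} (hr : 0 ≤ r) (h : ∀ i, ‖y.1 i‖ ≤ r ∧ ‖y.2 i‖ ≤ r) :
    ‖y‖ ≤ r :=
  norm_prod_le_iff.2 ⟨(pi_norm_le_iff_of_nonneg hr).2 fun i => (h i).1,
    (pi_norm_le_iff_of_nonneg hr).2 fun i => (h i).2⟩

theorem norm_rot_le' (j : κ) {c : ℂ} {C : ℝ} (hC : 1 ≤ C) (h1 : ‖c‖ ≤ C) (h2 : ‖c⁻¹‖ ≤ C)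
    (y : Dbl κ) : ‖rot j c y‖ ≤ C * ‖y‖ := by
  refine Dbl.norm_le (by positivity) fun i => ?_
  by_cases h : i = j
  · subst h
    simp only [rot_fst_self, rot_snd_self, norm_mul]
    constructor <;> gcongr
    · exact norm_coord_fst_le y i
    · exact norm_coord_snd_le y i
  · rw [rot_fst_ne h, rot_snd_ne h]
    constructor
    · exact (norm_coord_fst_le y i).trans (le_mul_of_one_le_left (norm_nonneg _) hC)
    · exact (norm_coord_snd_le y i).trans (le_mul_of_one_le_left (norm_nonneg _) hC)

theorem norm_rot_le (j : κ) {c : ℂ} (hc : ‖c‖ = 1) (y : Dbl κ) : ‖rot j c y‖ ≤ ‖y‖ := by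
  simpa using norm_rot_le' j (C := 1) le_rfl hc.le (by simp [hc]) y

theorem ne_zero_of_norm_one {c : ℂ} (hc : ‖c‖ = 1) : c ≠ 0 := by
  rintro rfl; simp at hc

theorem norm_rot (j : κ) {c : ℂ} (hc : ‖c‖ = 1) (y : Dbl κ) : ‖rot j c y‖ = ‖y‖ := by
  refine le_antisymm (norm_rot_le j hc y) ?_
  conv_lhs => rw [← rot_inv_rot j (ne_zero_of_norm_one hc) y]
  exact norm_rot_le j (by simp [hc]) _

theorem continuous_rot {X : Type*} [TopologicalSpace X] (j : κ) {c : X → ℂ} {y : X → Dbl κ}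
    (hc : Continuous c) (h0 : ∀ x, c x ≠ 0) (hy : Continuous y) :
    Continuous fun x => rot j (c x) (y x) := by
  have h1 : Continuous fun x => (y x).1 := continuous_fst.comp hy
  have h2 : Continuous fun x => (y x).2 := continuous_snd.comp hy
  refine Continuous.prodMk (h1.update j ?_) (h2.update j ?_)
  · exact hc.mul ((continuous_apply j).comp h1)
  · exact (hc.inv₀ h0).mul ((continuous_apply j).comp h2)

theorem rot_germInv (j : κ) {c : ℂ} (hc : c ≠ 0) :
    IsGermInv (fun y : Dbl κ => rot j c y) (fun y => rot j c⁻¹ y) where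
  an := (rot j c).analyticAt 0
  map0 := map_zero _
  an' := (rot j c⁻¹).analyticAt 0
  map0' := map_zero _
  left := Eventually.of_forall fun y => rot_inv_rot j hc y
  right := Eventually.of_forall fun y => rot_rot_inv j hc y

/-- The point `e^{it}` of the unit circle. -/
def expi (t : ℝ) : ℂ := Complex.exp (t * Complex.I)

theorem norm_expi (t : ℝ) : ‖expi t‖ = 1 := Complex.norm_exp_ofReal_mul_I t

theorem expi_ne_zero (t : ℝ) : expi t ≠ 0 := Complex.exp_ne_zero _

theorem continuous_expi : Continuous expi := by unfold expi; fun_prop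

theorem expi_add (s t : ℝ) : expi (s + t) = expi s * expi t := by
  simp [expi, add_mul, Complex.exp_add]

theorem expi_periodic : Function.Periodic expi (2 * Real.pi) := by
  intro t
  rw [expi_add]
  have : expi (2 * Real.pi) = 1 := by
    unfold expi; push_cast; exact Complex.exp_two_pi_mul_I
  rw [this, mul_one]

theorem exists_expi {c : ℂ} (hc : ‖c‖ = 1) : ∃ s, c = expi s := by
  refine ⟨c.arg, ?_⟩
  conv_lhs => rw [← Complex.norm_mul_exp_arg_mul_I c, hc]
  simp [expi]

/-- The average of the conjugates of a map `B` by the rotations of the coordinates `ξ_j, η_j`. -/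
def avg (j : κ) (B : Dbl κ → Dbl κ) (w : Dbl κ) : Dbl κ :=
  (2 * Real.pi)⁻¹ • ∫ t in (0 : ℝ)..2 * Real.pi, rot j (expi t)⁻¹ (B (rot j (expi t) w))

theorem avg_zero (j : κ) {B : Dbl κ → Dbl κ} (hB : B 0 = 0) : avg j B 0 = 0 := by
  simp [avg, hB]

theorem avg_rot (j : κ) (B : Dbl κ → Dbl κ) {c : ℂ} (hc : ‖c‖ = 1) (w : Dbl κ) :
    avg j B (rot j c w) = rot j c (avg j B w) := by
  obtain ⟨s, rfl⟩ := exists_expi hc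
  unfold avg
  let L : Dbl κ ≃L[ℂ] Dbl κ := ContinuousLinearEquiv.equivOfInverse (rot j (expi s))
    (rot j (expi s)⁻¹) (fun y => rot_inv_rot j (expi_ne_zero s) y)
    (fun y => rot_rot_inv j (expi_ne_zero s) y)
  rw [ContinuousLinearMap.map_smul_of_tower]
  congr 1
  have h1 : rot j (expi s) (∫ t in (0 : ℝ)..2 * Real.pi, rot j (expi t)⁻¹ (B (rot j (expi t) w)))
      = ∫ t in (0 : ℝ)..2 * Real.pi, rot j (expi s) (rot j (expi t)⁻¹ (B (rot j (expi t) w))) := by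
    rw [intervalIntegral.integral_of_le Real.two_pi_pos.le,
      intervalIntegral.integral_of_le Real.two_pi_pos.le]
    exact (ContinuousLinearEquiv.integral_comp_comm L _).symm
  rw [h1]
  have hper : Function.Periodic (fun t : ℝ => rot j (expi s) (rot j (expi t)⁻¹ (B (rot j (expi t) w))))
      (2 * Real.pi) := by
    intro t
    simp only [expi_periodic t]
  have h2 := hper.intervalIntegral_add_eq 0 s
  rw [zero_add] at h2
  have h3 := intervalIntegral.integral_comp_add_right (a := 0) (b := 2 * Real.pi)
    (fun t => rot j (expi s) (rot j (expi t)⁻¹ (B (rot j (expi t) w)))) s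
  rw [zero_add, add_comm (2 * Real.pi)] at h3
  rw [h2, ← h3]
  congr 1
  ext1 t
  rw [rot_rot, rot_rot, expi_add, mul_inv]
  congr 2
  have := expi_ne_zero s
  have := expi_ne_zero t
  field_simp

theorem norm_avg_sub_le (j : κ) {B : Dbl κ → Dbl κ} {w v : Dbl κ} {C : ℝ}
    (hB : Continuous fun t : ℝ => B (rot j (expi t) w))
    (h : ∀ t : ℝ, ‖rot j (expi t)⁻¹ (B (rot j (expi t) w)) - v‖ ≤ C) : ‖avg j B w - v‖ ≤ C := by
  have hpi := Real.two_pi_pos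
  have hc : Continuous fun t : ℝ => rot j (expi t)⁻¹ (B (rot j (expi t) w)) :=
    continuous_rot j (continuous_expi.inv₀ expi_ne_zero) (fun t => inv_ne_zero (expi_ne_zero t)) hB
  have hv : v = (2 * Real.pi)⁻¹ • ∫ _t in (0 : ℝ)..2 * Real.pi, v := by
    rw [intervalIntegral.integral_const, smul_smul, sub_zero, inv_mul_cancel₀ hpi.ne', one_smul]
  rw [hv, avg, ← smul_sub, ← intervalIntegral.integral_sub
    (hc.intervalIntegrable _ _) (continuous_const.intervalIntegrable _ _), norm_smul,
    Real.norm_of_nonneg (by positivity)]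
  have := intervalIntegral.norm_integral_le_of_norm_le_const (a := 0) (b := 2 * Real.pi)
    (f := fun t => rot j (expi t)⁻¹ (B (rot j (expi t) w)) - v) (C := C) fun t _ => h t
  rw [sub_zero, abs_of_pos hpi] at this
  calc (2 * Real.pi)⁻¹ * _ ≤ (2 * Real.pi)⁻¹ * (C * (2 * Real.pi)) := by gcongr
    _ = C := by field_simp

theorem eventually_forall_rot (j : κ) {P : Dbl κ → Prop} (h : ∀ᶠ y in 𝓝 0, P y) :
    ∀ᶠ y in 𝓝 0, ∀ c : ℂ, ‖c‖ = 1 → P (rot j c y) := by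
  obtain ⟨r, hr, hP⟩ := Metric.eventually_nhds_iff_ball.1 h
  filter_upwards [Metric.ball_mem_nhds 0 hr] with y hy c hc
  refine hP _ ?_
  rw [mem_ball_zero_iff] at hy ⊢
  rwa [norm_rot j hc]

theorem hasFDerivAt_avg (j : κ) {B : Dbl κ → Dbl κ} (hB : AnalyticAt ℂ B 0) (h0 : B 0 = 0)
    (hc : ∀ c : ℂ, ‖c‖ = 1 → ∀ v, fderiv ℂ B 0 (rot j c v) = rot j c (fderiv ℂ B 0 v)) :
    HasFDerivAt (avg j B) (fderiv ℂ B 0) 0 := by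
  have hd := hB.differentiableAt.hasFDerivAt
  rw [hasFDerivAt_iff_isLittleO_nhds_zero] at hd ⊢
  simp only [zero_add, h0, sub_zero, avg_zero j h0] at hd ⊢
  refine Asymptotics.isLittleO_iff.2 fun ε hε => ?_
  have h1 := eventually_forall_rot j (Asymptotics.isLittleO_iff.1 hd hε)
  have h2 := eventually_forall_rot j hB.eventually_analyticAt
  filter_upwards [h1, h2] with w hw hw2
  refine norm_avg_sub_le j ?_ fun t => ?_
  · refine continuous_iff_continuousAt.2 fun t => ?_
    have := (hw2 _ (norm_expi t)).continuousAt
    exact ContinuousAt.comp (f := fun t : ℝ => rot j (expi t) w) this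
      (continuous_rot j continuous_expi expi_ne_zero continuous_const).continuousAt
  · have h3 := hw _ (norm_expi t)
    rw [norm_rot j (norm_expi t), hc _ (norm_expi t)] at h3
    have h4 : fderiv ℂ B 0 w = rot j (expi t)⁻¹ (rot j (expi t) (fderiv ℂ B 0 w)) :=
      (rot_inv_rot j (expi_ne_zero t) _).symm
    rw [h4, ← map_sub]
    exact (norm_rot_le j (by simp [norm_expi]) _).trans h3

/-- The orbit of a point under the rotations of the coordinates `ξ_j, η_j`. -/
def orbitMap (j : κ) : Dbl κ →L[ℂ] C(Set.Icc (0 : ℝ) (2 * Real.pi), Dbl κ) :=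
  LinearMap.mkContinuous
    { toFun := fun w => ⟨fun t => rot j (expi t) w, continuous_rot j
        (continuous_expi.comp continuous_subtype_val) (fun t => expi_ne_zero _) continuous_const⟩
      map_add' := fun x y => by ext1 t; exact (rot j (expi t)).map_add x y
      map_smul' := fun c y => by ext1 t; exact (rot j (expi t)).map_smul c y } 1 (fun w => by
      rw [one_mul]
      refine (ContinuousMap.norm_le _ (norm_nonneg _)).2 fun t => ?_
      exact norm_rot_le j (norm_expi _) w)

theorem continuous_projIcc_comp (j : κ) (u : C(Set.Icc (0 : ℝ) (2 * Real.pi), Dbl κ)) :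
    Continuous fun t : ℝ =>
      rot j (expi t)⁻¹ (u (Set.projIcc 0 (2 * Real.pi) Real.two_pi_pos.le t)) :=
  continuous_rot j (continuous_expi.inv₀ expi_ne_zero) (fun t => inv_ne_zero (expi_ne_zero t))
    (u.continuous.comp continuous_projIcc)

/-- The mean of the values of a continuous function, rotated back. -/
def meanMap (j : κ) : C(Set.Icc (0 : ℝ) (2 * Real.pi), Dbl κ) →L[ℂ] Dbl κ :=
  LinearMap.mkContinuous
    { toFun := fun u => (2 * Real.pi)⁻¹ • ∫ t in (0 : ℝ)..2 * Real.pi,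
        rot j (expi t)⁻¹ (u (Set.projIcc 0 (2 * Real.pi) Real.two_pi_pos.le t))
      map_add' := fun x y => by
        rw [← smul_add, ← intervalIntegral.integral_add
          ((continuous_projIcc_comp j x).intervalIntegrable _ _)
          ((continuous_projIcc_comp j y).intervalIntegrable _ _)]
        simp only [ContinuousMap.add_apply, map_add]
      map_smul' := fun c y => by
        simp only [ContinuousMap.smul_apply, map_smul, intervalIntegral.integral_smul,
          RingHom.id_apply]
        rw [smul_comm] } 1 (fun u => by
      have hpi := Real.two_pi_pos
      simp only [LinearMap.coe_mk, AddHom.coe_mk]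
      rw [norm_smul, Real.norm_of_nonneg (by positivity), one_mul]
      have := intervalIntegral.norm_integral_le_of_norm_le_const (a := 0) (b := 2 * Real.pi)
        (f := fun t => rot j (expi t)⁻¹ (u (Set.projIcc 0 (2 * Real.pi) Real.two_pi_pos.le t)))
        (C := ‖u‖) fun t _ => (norm_rot_le j (by simp [norm_expi]) _).trans (u.norm_coe_le_norm _)
      rw [sub_zero, abs_of_pos hpi] at this
      calc (2 * Real.pi)⁻¹ * _ ≤ (2 * Real.pi)⁻¹ * (‖u‖ * (2 * Real.pi)) := by gcongr
        _ = ‖u‖ := by field_simp)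

theorem meanMap_apply (j : κ) (u : C(Set.Icc (0 : ℝ) (2 * Real.pi), Dbl κ)) :
    meanMap j u = (2 * Real.pi)⁻¹ • ∫ t in (0 : ℝ)..2 * Real.pi,
      rot j (expi t)⁻¹ (u (Set.projIcc 0 (2 * Real.pi) Real.two_pi_pos.le t)) := rfl

theorem analyticAt_avg (j : κ) {B : Dbl κ → Dbl κ} (hB : AnalyticAt ℂ B 0) :
    AnalyticAt ℂ (avg j B) 0 := by
  have hB' := hB.eventually_analyticAt
  obtain ⟨p, r, hp⟩ := hB
  have h1 : AnalyticAt ℂ (nemytskii B : C(Set.Icc (0 : ℝ) (2 * Real.pi), Dbl κ) → _)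
      (orbitMap j 0) := by
    rw [map_zero]
    exact (hasFPowerSeriesOnBall_nemytskii hp).analyticAt
  have h2 : AnalyticAt ℂ (fun w => meanMap j (nemytskii B (orbitMap j w))) 0 :=
    ((meanMap j).analyticAt _).comp (h1.comp ((orbitMap j).analyticAt 0))
  refine h2.congr ?_
  filter_upwards [eventually_forall_rot j hB'] with w hw
  have hcont : Continuous fun t : Set.Icc (0 : ℝ) (2 * Real.pi) => B (orbitMap j w t) := by
    refine continuous_iff_continuousAt.2 fun t => ?_
    have := (hw _ (norm_expi t)).continuousAt
    exact ContinuousAt.comp (f := orbitMap j w) this (orbitMap j w).continuous.continuousAt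
  rw [avg, meanMap_apply]
  congr 1
  refine intervalIntegral.integral_congr fun t ht => ?_
  rw [Set.uIcc_of_le Real.two_pi_pos.le] at ht
  simp only [nemytskii, dif_pos hcont, ContinuousMap.coe_mk, Set.projIcc_of_mem _ ht]
  rfl

end Rot

end

section

/-! ### The Banach algebra of absolutely convergent power series on the unit polydisc -/

section PowerSeries

variable {ι : Type*} [Fintype ι] [DecidableEq ι]

theorem cauchyProduct {A : Type*} [AddCommMonoid A] [Finset.HasAntidiagonal A] {u v : A → ℂ}
    (hu : Summable fun a => ‖u a‖) (hv : Summable fun a => ‖v a‖) :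
    (Summable fun n => ‖∑ x ∈ Finset.HasAntidiagonal.antidiagonal n, u x.1 * v x.2‖) ∧
    ∑' n, ‖∑ x ∈ Finset.HasAntidiagonal.antidiagonal n, u x.1 * v x.2‖ ≤
      (∑' a, ‖u a‖) * ∑' a, ‖v a‖ ∧
    (∑' a, u a) * ∑' a, v a =
      ∑' n, ∑ x ∈ Finset.HasAntidiagonal.antidiagonal n, u x.1 * v x.2 := by
  have h1 : Summable fun x : A × A => ‖u x.1‖ * ‖v x.2‖ := by
    have := Summable.mul_norm hu hv
    simpa only [norm_mul] using this
  have h2 := summable_sum_mul_antidiagonal_of_summable_mul (f := fun a => ‖u a‖)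
    (g := fun a => ‖v a‖) h1
  have h3 : ∀ n, ‖∑ x ∈ Finset.HasAntidiagonal.antidiagonal n, u x.1 * v x.2‖ ≤
      ∑ x ∈ Finset.HasAntidiagonal.antidiagonal n, ‖u x.1‖ * ‖v x.2‖ := fun n =>
    (norm_sum_le _ _).trans (Finset.sum_le_sum fun x _ => (norm_mul _ _).le)
  have h4 := Summable.of_nonneg_of_le (fun _ => norm_nonneg _) h3 h2
  refine ⟨h4, ?_, ?_⟩
  · rw [Summable.tsum_mul_tsum_eq_tsum_sum_antidiagonal hu hv h1]
    exact h4.tsum_le_tsum h3 h2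
  · exact Summable.tsum_mul_tsum_eq_tsum_sum_antidiagonal hu.of_norm hv.of_norm
      (summable_mul_of_summable_norm hu hv)

theorem summable_norm_coeff_mul {f g : MvPowerSeries ι ℂ}
    (hf : Summable fun α => ‖MvPowerSeries.coeff α f‖)
    (hg : Summable fun α => ‖MvPowerSeries.coeff α g‖) :
    (Summable fun α => ‖MvPowerSeries.coeff α (f * g)‖) ∧
    ∑' α, ‖MvPowerSeries.coeff α (f * g)‖ ≤
      (∑' α, ‖MvPowerSeries.coeff α f‖) * ∑' α, ‖MvPowerSeries.coeff α g‖ := by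
  have h := cauchyProduct hf hg
  simp only [← MvPowerSeries.coeff_mul] at h
  exact ⟨h.1, h.2.1⟩

variable (ι) in
/-- The algebra of power series with absolutely summable coefficients. -/
def absAlg : Subalgebra ℂ (MvPowerSeries ι ℂ) where
  carrier := {f | Summable fun α => ‖MvPowerSeries.coeff α f‖}
  mul_mem' := fun hf hg => (summable_norm_coeff_mul hf hg).1
  add_mem' := fun {f g} hf hg =>
    Summable.of_nonneg_of_le (fun _ => norm_nonneg _) (fun α => by
      rw [map_add]; exact norm_add_le _ _) (Summable.add hf hg)
  algebraMap_mem' := fun c => by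
    refine summable_of_ne_finset_zero (s := {0}) fun α hα => ?_
    rw [MvPowerSeries.algebraMap_apply, Algebra.algebraMap_self_apply, MvPowerSeries.coeff_C,
      if_neg (by simpa using hα), norm_zero]

variable (ι) in
/-- Power series with absolutely summable coefficients. -/
abbrev AbsSer : Type _ := absAlg ι

namespace AbsSer

/-- The coefficients of an absolutely summable power series. -/
def co (f : AbsSer ι) (α : ι →₀ ℕ) : ℂ := MvPowerSeries.coeff α (f : MvPowerSeries ι ℂ)

theorem summable (f : AbsSer ι) : Summable fun α => ‖f.co α‖ := f.2

@[ext] theorem ext' {f g : AbsSer ι} (h : ∀ α, f.co α = g.co α) : f = g :=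
  Subtype.ext (MvPowerSeries.ext h)

@[simp] theorem co_add (f g : AbsSer ι) (α) : (f + g).co α = f.co α + g.co α := rfl
@[simp] theorem co_neg (f : AbsSer ι) (α) : (-f).co α = -f.co α := rfl
@[simp] theorem co_sub (f g : AbsSer ι) (α) : (f - g).co α = f.co α - g.co α := rfl
@[simp] theorem co_zero (α) : (0 : AbsSer ι).co α = 0 := rfl
@[simp] theorem co_smul (c : ℂ) (f : AbsSer ι) (α) : (c • f).co α = c * f.co α := rfl

theorem co_mul (f g : AbsSer ι) (α) :
    (f * g).co α = ∑ x ∈ Finset.HasAntidiagonal.antidiagonal α, f.co x.1 * g.co x.2 :=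
  MvPowerSeries.coeff_mul _ _ _

theorem co_one (α : ι →₀ ℕ) : (1 : AbsSer ι).co α = if α = 0 then 1 else 0 :=
  MvPowerSeries.coeff_one α

/-- The power series with given coefficients. -/
def mk (c : (ι →₀ ℕ) → ℂ) (hc : Summable fun α => ‖c α‖) : AbsSer ι := ⟨c, hc⟩

@[simp] theorem co_mk (c : (ι →₀ ℕ) → ℂ) (hc) (α) : (mk c hc).co α = c α := rfl

instance : Norm (AbsSer ι) := ⟨fun f => ∑' α, ‖f.co α‖⟩

theorem norm_def (f : AbsSer ι) : ‖f‖ = ∑' α, ‖f.co α‖ := rfl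

theorem norm_co_le (f : AbsSer ι) (α) : ‖f.co α‖ ≤ ‖f‖ :=
  f.summable.le_tsum α fun _ _ => norm_nonneg _

instance : NormedCommRing (AbsSer ι) where
  toCommRing := inferInstance
  norm := norm
  dist f g := ‖f - g‖
  dist_self f := by simp [norm_def]
  dist_comm f g := by
    simp only [norm_def, co_sub]
    exact tsum_congr fun α => norm_sub_rev _ _
  dist_triangle f g h := by
    rw [norm_def, norm_def, norm_def, ← (f - g).summable.tsum_add (g - h).summable]
    refine (f - h).summable.tsum_le_tsum (fun α => ?_) ((f - g).summable.add (g - h).summable)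
    simp only [co_sub]
    exact norm_sub_le_norm_sub_add_norm_sub _ _ _
  eq_of_dist_eq_zero := by
    intro f g h
    ext α
    have h1 := norm_co_le (f - g) α
    have h2 : ‖f - g‖ = 0 := h
    rw [h2, co_sub] at h1
    exact sub_eq_zero.1 (norm_le_zero_iff.1 h1)
  dist_eq f g := by
    change ‖f - g‖ = ‖-f + g‖
    simp only [norm_def, co_sub, co_add, co_neg]
    exact tsum_congr fun α => by rw [← norm_neg]; congr 1; ring
  norm_mul_le f g := (summable_norm_coeff_mul f.2 g.2).2

instance : NormedAlgebra ℂ (AbsSer ι) where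
  norm_smul_le c f := by
    simp only [norm_def, co_smul, norm_mul]
    rw [tsum_mul_left]

theorem norm_one_le : ‖(1 : AbsSer ι)‖ ≤ 1 := by
  rw [norm_def, tsum_eq_single 0]
  · simp [co_one]
  · intro α hα
    simp [co_one, hα]

instance : NormOneClass (AbsSer ι) where
  norm_one := by
    refine le_antisymm norm_one_le ?_
    have := norm_co_le (1 : AbsSer ι) 0
    simpa [co_one] using this

instance : CompleteSpace (AbsSer ι) := by
  have key : ∀ c : (ι →₀ ℕ) → ℂ, Memℓp c 1 ↔ Summable fun α => ‖c α‖ := fun c => by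
    rw [memℓp_gen_iff (by simp)]; simp
  let e : AbsSer ι ≃ lp (fun _ : ι →₀ ℕ => ℂ) 1 :=
    { toFun := fun f => ⟨fun α => f.co α, (key _).2 f.summable⟩
      invFun := fun g => mk (fun α => g α) ((key _).1 g.2)
      left_inv := fun f => by ext α; rfl
      right_inv := fun g => by ext α; rfl }
  have he : Isometry e := Isometry.of_dist_eq fun f g => by
    rw [dist_eq_norm, dist_eq_norm, lp.norm_eq_tsum_rpow (by simp), norm_def]
    simp [e]
    rfl
  exact (IsometryEquiv.mk e he).completeSpace

/-- The monomial `y^α`. -/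
def mon (α : ι →₀ ℕ) (y : ι → ℂ) : ℂ := ∏ i, y i ^ α i

theorem mon_zero (y : ι → ℂ) : mon 0 y = 1 := by simp [mon]

theorem mon_add (α β : ι →₀ ℕ) (y : ι → ℂ) : mon (α + β) y = mon α y * mon β y := by
  simp [mon, pow_add, Finset.prod_mul_distrib]

theorem mon_single (i : ι) (y : ι → ℂ) : mon (Finsupp.single i 1) y = y i := by
  rw [mon, Finset.prod_eq_single i]
  · simp
  · intro j _ hj; simp [Ne.symm hj]
  · simp

theorem norm_mon_le {y : ι → ℂ} (hy : ‖y‖ ≤ 1) (α : ι →₀ ℕ) : ‖mon α y‖ ≤ 1 := by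
  rw [mon, norm_prod]
  refine Finset.prod_le_one (fun _ _ => norm_nonneg _) fun i _ => ?_
  rw [norm_pow]
  exact pow_le_one₀ (norm_nonneg _) ((norm_le_pi_norm y i).trans hy)

/-- The value of a power series. -/
def ev (y : ι → ℂ) (f : AbsSer ι) : ℂ := ∑' α, f.co α * mon α y

theorem norm_term_le {y : ι → ℂ} (hy : ‖y‖ ≤ 1) (f : AbsSer ι) (α) :
    ‖f.co α * mon α y‖ ≤ ‖f.co α‖ := by
  rw [norm_mul]
  exact mul_le_of_le_one_right (norm_nonneg _) (norm_mon_le hy α)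

theorem summable_norm_term {y : ι → ℂ} (hy : ‖y‖ ≤ 1) (f : AbsSer ι) :
    Summable fun α => ‖f.co α * mon α y‖ :=
  Summable.of_nonneg_of_le (fun _ => norm_nonneg _) (norm_term_le hy f) f.summable

theorem summable_term {y : ι → ℂ} (hy : ‖y‖ ≤ 1) (f : AbsSer ι) :
    Summable fun α => f.co α * mon α y := (summable_norm_term hy f).of_norm

theorem norm_ev_le {y : ι → ℂ} (hy : ‖y‖ ≤ 1) (f : AbsSer ι) : ‖ev y f‖ ≤ ‖f‖ :=
  (norm_tsum_le_tsum_norm (summable_norm_term hy f)).trans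
    ((summable_norm_term hy f).tsum_le_tsum (norm_term_le hy f) f.summable)

theorem ev_add {y : ι → ℂ} (hy : ‖y‖ ≤ 1) (f g : AbsSer ι) : ev y (f + g) = ev y f + ev y g := by
  rw [ev, ev, ev, ← (summable_term hy f).tsum_add (summable_term hy g)]
  exact tsum_congr fun α => by rw [co_add, add_mul]

theorem ev_smul (y : ι → ℂ) (c : ℂ) (f : AbsSer ι) : ev y (c • f) = c * ev y f := by
  rw [ev, ev, ← tsum_mul_left]
  exact tsum_congr fun α => by rw [co_smul, mul_assoc]

theorem ev_one (y : ι → ℂ) : ev y 1 = 1 := by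
  rw [ev, tsum_eq_single 0]
  · simp [co_one, mon_zero]
  · intro α hα; simp [co_one, hα]

theorem ev_mul {y : ι → ℂ} (hy : ‖y‖ ≤ 1) (f g : AbsSer ι) : ev y (f * g) = ev y f * ev y g := by
  have h := (cauchyProduct (summable_norm_term hy f) (summable_norm_term hy g)).2.2
  refine Eq.trans ?_ h.symm
  refine tsum_congr fun α => ?_
  rw [co_mul, Finset.sum_mul]
  refine Finset.sum_congr rfl fun x hx => ?_
  rw [← Finset.HasAntidiagonal.mem_antidiagonal.1 hx, mon_add]
  ring

/-- Evaluation as a homomorphism of algebras. -/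
def evHom (y : ι → ℂ) (hy : ‖y‖ ≤ 1) : AbsSer ι →ₐ[ℂ] ℂ where
  toFun := ev y
  map_one' := ev_one y
  map_mul' := ev_mul hy
  map_zero' := by simp [ev]
  map_add' := ev_add hy
  commutes' c := by
    rw [Algebra.algebraMap_eq_smul_one, ev_smul, ev_one, mul_one, Algebra.algebraMap_self_apply]

theorem evHom_apply (y : ι → ℂ) (hy : ‖y‖ ≤ 1) (f : AbsSer ι) : evHom y hy f = ev y f := rfl

/-- Evaluation as a continuous linear map. -/
def evL (y : ι → ℂ) (hy : ‖y‖ ≤ 1) : AbsSer ι →L[ℂ] ℂ :=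
  LinearMap.mkContinuous { toFun := ev y, map_add' := ev_add hy, map_smul' := ev_smul y } 1
    fun f => by rw [one_mul]; exact norm_ev_le hy f

theorem evL_apply (y : ι → ℂ) (hy : ‖y‖ ≤ 1) (f : AbsSer ι) : evL y hy f = ev y f := rfl

/-- The coordinate functions. -/
def X (i : ι) : AbsSer ι :=
  mk (fun α => if α = Finsupp.single i 1 then 1 else 0)
    (summable_of_ne_finset_zero (s := {Finsupp.single i 1}) fun α hα => by
      rw [if_neg (by simpa using hα), norm_zero])

theorem ev_X (i : ι) (y : ι → ℂ) : ev y (X i) = y i := by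
  rw [ev, tsum_eq_single (Finsupp.single i 1)]
  · simp [X, mon_single]
  · intro α hα; simp [X, hα]

theorem norm_X (i : ι) : ‖(X i : AbsSer ι)‖ = 1 := by
  rw [norm_def, tsum_eq_single (Finsupp.single i 1)]
  · simp [X]
  · intro α hα; simp [X, hα]

open Classical in
/-- The power series with coefficients `f_{e(α)}` for `α ∈ S`. -/
def reindex (e : (ι →₀ ℕ) → (ι →₀ ℕ)) (he : Function.Injective e) (S : Set (ι →₀ ℕ))
    (f : AbsSer ι) : AbsSer ι :=
  mk (fun α => if α ∈ S then f.co (e α) else 0)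
    (Summable.of_nonneg_of_le (fun _ => norm_nonneg _) (fun α => by
      split_ifs
      · exact le_rfl
      · rw [norm_zero]; exact norm_nonneg _) (f.summable.comp_injective he))

theorem norm_reindex_le (e : (ι →₀ ℕ) → (ι →₀ ℕ)) (he : Function.Injective e)
    (S : Set (ι →₀ ℕ)) (f : AbsSer ι) : ‖reindex e he S f‖ ≤ ‖f‖ := by
  rw [norm_def, norm_def]
  refine le_trans ((reindex e he S f).summable.tsum_le_tsum (fun α => ?_)
    (f.summable.comp_injective he)) (tsum_comp_le_tsum_of_inj f.summable
      (fun _ => norm_nonneg _) he)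
  simp only [reindex, co_mk, Function.comp]
  split_ifs
  · exact le_rfl
  · rw [norm_zero]; exact norm_nonneg _

/-- The reindexing operators are linear. -/
def reindexL (e : (ι →₀ ℕ) → (ι →₀ ℕ)) (he : Function.Injective e) (S : Set (ι →₀ ℕ)) :
    AbsSer ι →L[ℂ] AbsSer ι :=
  LinearMap.mkContinuous
    { toFun := reindex e he S
      map_add' := fun f g => by
        ext α; simp only [reindex, co_mk, co_add]; split_ifs <;> simp
      map_smul' := fun c f => by
        ext α; simp only [reindex, co_mk, co_smul, RingHom.id_apply]; split_ifs <;> simp } 1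
    fun f => by rw [one_mul]; exact norm_reindex_le e he S f

theorem norm_reindexL_le (e : (ι →₀ ℕ) → (ι →₀ ℕ)) (he : Function.Injective e)
    (S : Set (ι →₀ ℕ)) (f : AbsSer ι) : ‖reindexL e he S f‖ ≤ ‖f‖ := norm_reindex_le e he S f

open Classical in
theorem co_reindexL (e : (ι →₀ ℕ) → (ι →₀ ℕ)) (he : Function.Injective e)
    (S : Set (ι →₀ ℕ)) (f : AbsSer ι) (α) :
    (reindexL e he S f).co α = if α ∈ S then f.co (e α) else 0 := rfl

section Weights

variable (p q : ι)

/-- The weight of a monomial under the rotations of the coordinates `y_p, y_q`. -/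
def wt (α : ι →₀ ℕ) : ℤ := α p - α q

/-- The part of weight `k`. -/
def proj (k : ℤ) : AbsSer ι →L[ℂ] AbsSer ι :=
  reindexL id Function.injective_id {α | wt p q α = k}

theorem co_proj (k : ℤ) (f : AbsSer ι) (α) :
    (proj p q k f).co α = if wt p q α = k then f.co α else 0 := by
  rw [proj, co_reindexL]; simp

/-- The part of weight `-1`, divided by `y_q`. -/
def divq : AbsSer ι →L[ℂ] AbsSer ι :=
  reindexL (fun α => α + Finsupp.single q 1) (add_left_injective _) {α | wt p q α = 0}

theorem equivMapDomain_injective (e : ι ≃ ι) :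
    Function.Injective fun α : ι →₀ ℕ => Finsupp.equivMapDomain e α := fun _ _ h =>
  (Finsupp.domCongr e : (ι →₀ ℕ) ≃+ (ι →₀ ℕ)).injective h

/-- The exchange of the coordinates `y_p` and `y_q`. -/
def exch : AbsSer ι →L[ℂ] AbsSer ι :=
  reindexL (fun α => Finsupp.equivMapDomain (Equiv.swap p q) α)
    (equivMapDomain_injective _) Set.univ

variable {p q}

theorem norm_divq_le (f : AbsSer ι) : ‖divq p q f‖ ≤ ‖f‖ := norm_reindexL_le _ _ _ _
theorem norm_exch_le (f : AbsSer ι) : ‖exch p q f‖ ≤ ‖f‖ := norm_reindexL_le _ _ _ _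

theorem ev_exch (f : AbsSer ι) (y : ι → ℂ) :
    ev y (exch p q f) = ev (fun i => y (Equiv.swap p q i)) f := by
  let e : (ι →₀ ℕ) ≃ (ι →₀ ℕ) := (Finsupp.domCongr (Equiv.swap p q) : (ι →₀ ℕ) ≃+ (ι →₀ ℕ)).toEquiv
  rw [ev, ev, ← e.tsum_eq]
  refine tsum_congr fun α => ?_
  rw [exch, co_reindexL, if_pos (Set.mem_univ _)]
  have h1 : Finsupp.equivMapDomain (Equiv.swap p q) (e α) = α := by
    ext i
    change (Finsupp.equivMapDomain (Equiv.swap p q) (Finsupp.equivMapDomain (Equiv.swap p q) α)) i = _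
    simp [Finsupp.equivMapDomain_apply]
  rw [h1]
  congr 1
  unfold mon
  rw [← Equiv.prod_comp (Equiv.swap p q)]
  refine Finset.prod_congr rfl fun i _ => ?_
  congr 1
  change (Finsupp.equivMapDomain (Equiv.swap p q) α) (Equiv.swap p q i) = _
  rw [Finsupp.equivMapDomain_apply]
  simp

theorem ev_divq (hpq : p ≠ q) (f : AbsSer ι) (y : ι → ℂ) :
    y q * ev y (divq p q f) = ev y (proj p q (-1) f) := by
  rw [ev, ev, ← tsum_mul_left]
  have hinj : Function.Injective fun α : ι →₀ ℕ => α + Finsupp.single q 1 := add_left_injective _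
  rw [← hinj.tsum_eq (f := fun α => (proj p q (-1) f).co α * mon α y)]
  · refine tsum_congr fun α => ?_
    rw [co_proj, divq, co_reindexL, mon_add, mon_single]
    have : wt p q (α + Finsupp.single q 1) = -1 ↔ α ∈ {α | wt p q α = 0} := by
      simp only [wt, Set.mem_ofPred_eq, Finsupp.add_apply, Finsupp.single_eq_same]
      rw [Finsupp.single_eq_of_ne hpq]
      push_cast
      omega
    by_cases h : α ∈ {α | wt p q α = 0}
    · rw [if_pos (this.2 h), if_pos h]; ring
    · rw [if_neg (fun h' => h (this.1 h')), if_neg h]; ring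
  · intro α hα
    have h1 : wt p q α = -1 := by
      by_contra h
      rw [Function.mem_support, co_proj, if_neg h, zero_mul] at hα
      exact hα rfl
    refine ⟨α - Finsupp.single q 1, ?_⟩
    ext i
    simp only [wt] at h1
    by_cases hi : i = q
    · subst hi; simp; omega
    · simp [Ne.symm hi]

theorem hasSum_norm_proj (f : AbsSer ι) : HasSum (fun k => ‖proj p q k f‖) ‖f‖ := by
  have h := f.summable.hasSum.tsum_fiberwise (wt p q)
  refine (congrArg (HasSum · _) (funext fun k => ?_)).mpr h
  rw [norm_def, tsum_subtype (wt p q ⁻¹' {k}) fun α => ‖f.co α‖]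
  refine tsum_congr fun α => ?_
  rw [co_proj]
  by_cases hk : wt p q α = k
  · rw [if_pos hk, Set.indicator_of_mem (by simpa using hk)]
  · rw [if_neg hk, Set.indicator_of_notMem (by simpa using hk), norm_zero]

theorem hasSum_ev_proj (f : AbsSer ι) {y : ι → ℂ} (hy : ‖y‖ ≤ 1) :
    HasSum (fun k => ev y (proj p q k f)) (ev y f) := by
  have h := (summable_term hy f).hasSum.tsum_fiberwise (wt p q)
  refine (congrArg (HasSum · _) (funext fun k => ?_)).mpr h
  rw [ev, tsum_subtype (wt p q ⁻¹' {k}) fun α => f.co α * mon α y]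
  refine tsum_congr fun α => ?_
  rw [co_proj]
  by_cases hk : wt p q α = k
  · rw [if_pos hk, Set.indicator_of_mem (by simpa using hk)]
  · rw [if_neg hk, Set.indicator_of_notMem (by simpa using hk), zero_mul]

/-- The rotation of the coordinates `y_p`, `y_q`. -/
def rotp (p q : ι) (c : ℂ) (y : ι → ℂ) : ι → ℂ :=
  fun i => if i = p then c * y i else if i = q then c⁻¹ * y i else y i

theorem mon_rotp (hpq : p ≠ q) {c : ℂ} (hc : c ≠ 0) (α : ι →₀ ℕ) (y : ι → ℂ) :
    mon α (rotp p q c y) = c ^ wt p q α * mon α y := by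
  have key : ∀ i, rotp p q c y i ^ α i =
      ((if i = p then c ^ α p else 1) * (if i = q then (c⁻¹) ^ α q else 1)) * y i ^ α i := by
    intro i
    unfold rotp
    by_cases h1 : i = p
    · subst h1; simp [hpq, mul_pow]
    · by_cases h2 : i = q
      · subst h2; simp [h1, mul_pow]
      · simp [h1, h2]
  rw [mon, Finset.prod_congr rfl fun i _ => key i, Finset.prod_mul_distrib,
    Finset.prod_mul_distrib]
  simp only [Finset.prod_ite_eq', Finset.mem_univ, if_true]
  rw [mon, wt, zpow_sub₀ hc]
  simp [div_eq_mul_inv]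

theorem ev_rotp_proj (hpq : p ≠ q) {c : ℂ} (hc : c ≠ 0) (k : ℤ) (f : AbsSer ι) (y : ι → ℂ) :
    ev (rotp p q c y) (proj p q k f) = c ^ k * ev y (proj p q k f) := by
  rw [ev, ev, ← tsum_mul_left]
  refine tsum_congr fun α => ?_
  rw [co_proj]
  split_ifs with h
  · rw [mon_rotp hpq hc, h]; ring
  · simp

theorem ev_rotp_divq (hpq : p ≠ q) {c : ℂ} (hc : c ≠ 0) (f : AbsSer ι) (y : ι → ℂ) :
    ev (rotp p q c y) (divq p q f) = ev y (divq p q f) := by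
  rw [ev, ev]
  refine tsum_congr fun α => ?_
  rw [divq, co_reindexL]
  split_ifs with h
  · rw [mon_rotp hpq hc, show wt p q α = 0 from h]; simp
  · simp

theorem mon_swap_of_wt_zero {α : ι →₀ ℕ} (h : wt p q α = 0) (y : ι → ℂ) :
    mon α (fun i => y (Equiv.swap p q i)) = mon α y := by
  rw [mon, mon, ← Equiv.prod_comp (Equiv.swap p q)]
  refine Finset.prod_congr rfl fun i _ => ?_
  rw [Equiv.swap_apply_self]
  congr 1
  unfold wt at h
  by_cases h1 : i = p
  · subst h1; rw [Equiv.swap_apply_left]; omega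
  · by_cases h2 : i = q
    · subst h2; rw [Equiv.swap_apply_right]; omega
    · rw [Equiv.swap_apply_of_ne_of_ne h1 h2]

theorem ev_swap_divq (f : AbsSer ι) (y : ι → ℂ) :
    ev (fun i => y (Equiv.swap p q i)) (divq p q f) = ev y (divq p q f) := by
  rw [ev, ev]
  refine tsum_congr fun α => ?_
  rw [divq, co_reindexL]
  split_ifs with h
  · rw [mon_swap_of_wt_zero h]
  · simp

theorem ev_swap_proj_zero (f : AbsSer ι) (y : ι → ℂ) :
    ev (fun i => y (Equiv.swap p q i)) (proj p q 0 f) = ev y (proj p q 0 f) := by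
  rw [ev, ev]
  refine tsum_congr fun α => ?_
  rw [co_proj]
  split_ifs with h
  · rw [mon_swap_of_wt_zero h]
  · simp

end Weights

theorem mon_multilinear (α : ι →₀ ℕ) : ∃ m : (ι → ℂ) [×(∑ i, α i)]→L[ℂ] ℂ,
    ‖m‖ ≤ 1 ∧ ∀ y, m (fun _ => y) = mon α y := by
  have hlen : α.toMultiset.toList.length = ∑ i, α i := by
    rw [Multiset.length_toList, Finsupp.card_toMultiset, Finsupp.sum_fintype _ _ (by simp)]
    rfl
  let v : Fin (∑ i, α i) → ι := fun l => α.toMultiset.toList.get (Fin.cast hlen.symm l)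
  refine ⟨(ContinuousMultilinearMap.mkPiAlgebra ℂ (Fin (∑ i, α i)) ℂ).compContinuousLinearMap
    fun l => ContinuousLinearMap.proj (v l), ?_, fun y => ?_⟩
  · refine ContinuousMultilinearMap.opNorm_le_bound zero_le_one fun u => ?_
    simp only [ContinuousMultilinearMap.compContinuousLinearMap_apply,
      ContinuousMultilinearMap.mkPiAlgebra_apply, ContinuousLinearMap.proj_apply, one_mul, norm_prod]
    exact Finset.prod_le_prod (fun _ _ => norm_nonneg _) fun l _ => norm_le_pi_norm (u l) (v l)
  · simp only [ContinuousMultilinearMap.compContinuousLinearMap_apply,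
      ContinuousMultilinearMap.mkPiAlgebra_apply, ContinuousLinearMap.proj_apply]
    have h1 : ∏ l : Fin (∑ i, α i), y (v l) = (α.toMultiset.toList.map y).prod := by
      rw [← List.ofFn_getElem_eq_map, List.prod_ofFn]
      exact Fintype.prod_equiv (finCongr hlen.symm) _ _ fun l => rfl
    rw [h1, ← Multiset.prod_coe, ← Multiset.map_coe, Multiset.coe_toList, Finset.prod_multiset_map_count, mon]
    refine Finset.prod_subset_one_on_sdiff (Finset.subset_univ _) ?_ fun i _ => ?_
    · intro i hi
      have : α i = 0 := by simpa using hi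
      rw [this, pow_zero]
    · rw [Finsupp.count_toMultiset]

end AbsSer

end PowerSeries

end

section

section PowerSeries

variable {ι : Type*} [Fintype ι] [DecidableEq ι]

namespace AbsSer

theorem exists_mon_multilinear (α : ι →₀ ℕ) (n : ℕ) : ∃ m : (ι → ℂ) [×n]→L[ℂ] ℂ,
    ‖m‖ ≤ 1 ∧ (∑ i, α i = n → ∀ y, m (fun _ => y) = mon α y) := by
  by_cases h : ∑ i, α i = n
  · subst h
    obtain ⟨m, h1, h2⟩ := mon_multilinear α
    exact ⟨m, h1, fun _ => h2⟩
  · exact ⟨0, by simp, fun h' => absurd h' h⟩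

theorem analyticAt_ev (f : AbsSer ι) : AnalyticOnNhd ℂ (fun y => ev y f) (Metric.ball 0 1) := by
  choose m hm1 hm2 using exists_mon_multilinear (ι := ι)
  let S : ℕ → Finset (ι →₀ ℕ) := fun n => Finset.finsuppAntidiag Finset.univ n
  have hS : ∀ n α, α ∈ S n ↔ ∑ i, α i = n := by
    intro n α; simp [S, Finset.mem_finsuppAntidiag]
  let P : FormalMultilinearSeries ℂ (ι → ℂ) ℂ := fun n => ∑ α ∈ S n, f.co α • m α n
  have hP : HasFPowerSeriesOnBall (fun y => ev y f) P 0 1 := by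
    refine ⟨?_, zero_lt_one, ?_⟩
    · refine FormalMultilinearSeries.le_radius_of_bound (r := 1) _ ‖f‖ fun n => ?_
      simp only [NNReal.coe_one, one_pow, mul_one]
      refine (norm_sum_le _ _).trans ?_
      refine le_trans (Finset.sum_le_sum fun α _ => ?_) (f.summable.sum_le_tsum (S n) fun _ _ => norm_nonneg _)
      rw [norm_smul]
      exact mul_le_of_le_one_right (norm_nonneg _) (hm1 _ _)
    · intro y hy
      have hy' : ‖y‖ ≤ 1 := by
        rw [Metric.mem_eball, edist_zero_right] at hy
        have := hy.le
        rwa [← ofReal_norm, ENNReal.ofReal_le_one] at this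
      rw [zero_add]
      have h := (summable_term hy' f).hasSum.tsum_fiberwise fun α => ∑ i, α i
      refine (congrArg (HasSum · _) (funext fun n => ?_)).mpr h
      rw [tsum_subtype ((fun α : ι →₀ ℕ => ∑ i, α i) ⁻¹' {n}) fun α => f.co α * mon α y]
      rw [tsum_eq_sum (s := S n)]
      · simp only [P, sum_apply, smul_apply,
          smul_eq_mul]
        refine Finset.sum_congr rfl fun α hα => ?_
        rw [Set.indicator_of_mem (by simpa using (hS n α).1 hα), hm2 _ _ ((hS n α).1 hα)]
      · intro α hα
        rw [Set.indicator_of_notMem]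
        simpa using fun h => hα ((hS n α).2 h)
  intro y hy
  refine hP.analyticAt_of_mem ?_
  rw [mem_ball_zero_iff] at hy
  rw [Metric.mem_eball, edist_zero_right, ← ofReal_norm, ENNReal.ofReal_lt_one]
  exact hy

end AbsSer

end PowerSeries

/-! ### Analytic maps acting on commutative Banach algebras -/

section Calculus

variable {ι : Type*} [Fintype ι] [DecidableEq ι]
  {A : Type*} [NormedCommRing A] [NormedAlgebra ℂ A] [NormOneClass A] [CompleteSpace A]

/-- The value of a homogeneous polynomial map on elements of an algebra. -/
def fcTerm (p : FormalMultilinearSeries ℂ (ι → ℂ) (ι → ℂ)) (n : ℕ) (ψ : ι → A) (i : ι) : A :=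
  ∑ v : Fin n → ι, (p n fun l => Pi.single (v l) 1) i • ∏ l, ψ (v l)

/-- The value of a power series map on elements of an algebra. -/
def fc (p : FormalMultilinearSeries ℂ (ι → ℂ) (ι → ℂ)) (ψ : ι → A) (i : ι) : A :=
  ∑' n, fcTerm p n ψ i

theorem norm_wordCoeff_le (p : FormalMultilinearSeries ℂ (ι → ℂ) (ι → ℂ)) (n : ℕ)
    (v : Fin n → ι) (i : ι) : ‖(p n fun l => Pi.single (v l) 1) i‖ ≤ ‖p n‖ := by
  refine (norm_le_pi_norm _ i).trans (((p n).le_opNorm _).trans ?_)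
  refine mul_le_of_le_one_right (norm_nonneg _) (Finset.prod_le_one (fun _ _ => norm_nonneg _) ?_)
  intro l _
  refine (pi_norm_le_iff_of_nonneg zero_le_one).2 fun k => ?_
  by_cases h : k = v l
  · subst h; simp
  · simp [h]

theorem norm_prod_sub_prod_le {n : ℕ} {x y : Fin n → A} {ρ d : ℝ} (hρ : 0 ≤ ρ)
    (hx : ∀ l, ‖x l‖ ≤ ρ) (hy : ∀ l, ‖y l‖ ≤ ρ) (hd : ∀ l, ‖x l - y l‖ ≤ d) :
    ‖∏ l, x l - ∏ l, y l‖ ≤ n * ρ ^ (n - 1) * d := by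
  induction n with
  | zero => simp
  | succ n ih =>
    rw [Fin.prod_univ_succ, Fin.prod_univ_succ]
    have h1 := ih (x := fun l => x l.succ) (y := fun l => y l.succ) (fun l => hx _) (fun l => hy _)
      (fun l => hd _)
    have hd0 : 0 ≤ d := (norm_nonneg _).trans (hd 0)
    have h2 : ‖∏ l : Fin n, x l.succ‖ ≤ ρ ^ n := by
      refine (Finset.norm_prod_le _ _).trans ?_
      refine (Finset.prod_le_prod (fun _ _ => norm_nonneg _) fun l _ => hx l.succ).trans ?_
      simp
    have h3 : x 0 * ∏ l : Fin n, x l.succ - y 0 * ∏ l : Fin n, y l.succ =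
        (x 0 - y 0) * ∏ l : Fin n, x l.succ +
          y 0 * (∏ l : Fin n, x l.succ - ∏ l : Fin n, y l.succ) := by ring
    rw [h3]
    calc _ ≤ ‖x 0 - y 0‖ * ‖∏ l : Fin n, x l.succ‖ +
          ‖y 0‖ * ‖∏ l : Fin n, x l.succ - ∏ l : Fin n, y l.succ‖ :=
          (norm_add_le _ _).trans (add_le_add (norm_mul_le _ _) (norm_mul_le _ _))
      _ ≤ d * ρ ^ n + ρ * (n * ρ ^ (n - 1) * d) := by
          gcongr
          · exact hd 0
          · exact hy 0
      _ ≤ (n + 1 : ℕ) * ρ ^ (n + 1 - 1) * d := by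
          rcases Nat.eq_zero_or_pos n with h | h
          · subst h; simp
          · obtain ⟨m, rfl⟩ := Nat.exists_eq_add_of_lt h
            apply le_of_eq
            simp only [zero_add, Nat.add_sub_cancel]
            push_cast
            ring

theorem norm_fcTerm_sub_le (p : FormalMultilinearSeries ℂ (ι → ℂ) (ι → ℂ)) (n : ℕ)
    {ψ ψ' : ι → A} {ρ : ℝ} (hρ : 0 ≤ ρ) (h : ‖ψ‖ ≤ ρ) (h' : ‖ψ'‖ ≤ ρ) (i : ι) :
    ‖fcTerm p n ψ i - fcTerm p n ψ' i‖ ≤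
      (Fintype.card ι : ℝ) ^ n * (‖p n‖ * (n * ρ ^ (n - 1) * ‖ψ - ψ'‖)) := by
  rw [fcTerm, fcTerm, ← Finset.sum_sub_distrib]
  refine (norm_sum_le _ _).trans ?_
  refine (Finset.sum_le_card_nsmul _ _ (‖p n‖ * (n * ρ ^ (n - 1) * ‖ψ - ψ'‖)) fun v _ => ?_).trans ?_
  · rw [← smul_sub, norm_smul]
    refine mul_le_mul (norm_wordCoeff_le p n v i) ?_ (norm_nonneg _) (norm_nonneg _)
    exact norm_prod_sub_prod_le hρ (fun l => (norm_le_pi_norm ψ _).trans h)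
      (fun l => (norm_le_pi_norm ψ' _).trans h') (fun l => norm_le_pi_norm (ψ - ψ') (v l))
  · simp

/-- The bounds on the coefficients of a map of order two needed for the functional calculus. -/
structure CoeffBound (p : FormalMultilinearSeries ℂ (ι → ℂ) (ι → ℂ)) (C b : ℝ) : Prop where
  b_pos : 0 < b
  C_nonneg : 0 ≤ C
  zero : p 0 = 0
  one : p 1 = 0
  bound : ∀ n, (Fintype.card ι : ℝ) ^ n * ‖p n‖ ≤ C * b ^ n

variable {p : FormalMultilinearSeries ℂ (ι → ℂ) (ι → ℂ)} {C b : ℝ}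

theorem norm_fcTerm_sub_le' (hp : CoeffBound p C b) (n : ℕ) {ψ ψ' : ι → A} {ρ : ℝ} (hρ : 0 ≤ ρ)
    (hρb : 4 * b * ρ ≤ 1) (h : ‖ψ‖ ≤ ρ) (h' : ‖ψ'‖ ≤ ρ) (i : ι) :
    ‖fcTerm p n ψ i - fcTerm p n ψ' i‖ ≤ (16 * C * b ^ 2 * ρ * ‖ψ - ψ'‖) * (1 / 2) ^ n := by
  have hb := hp.b_pos
  have hC := hp.C_nonneg
  rcases n with _ | _ | n
  · rw [show fcTerm p 0 ψ i = 0 by simp [fcTerm, hp.zero],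
      show fcTerm p 0 ψ' i = 0 by simp [fcTerm, hp.zero], sub_zero, norm_zero]
    positivity
  · rw [show fcTerm p 1 ψ i = 0 by simp [fcTerm, hp.one],
      show fcTerm p 1 ψ' i = 0 by simp [fcTerm, hp.one]]
    simp only [zero_add, sub_zero, norm_zero]
    positivity
  · refine (norm_fcTerm_sub_le p (n + 2) hρ h h' i).trans ?_
    rw [← mul_assoc]
    have h1 : (n + 2 : ℕ) * ρ ^ (n + 2 - 1) * ‖ψ - ψ'‖ = ((n + 2 : ℕ) * ρ ^ n) * (ρ * ‖ψ - ψ'‖) := by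
      rw [show n + 2 - 1 = n + 1 by omega]; ring
    calc _ ≤ C * b ^ (n + 2) * ((n + 2 : ℕ) * ρ ^ (n + 2 - 1) * ‖ψ - ψ'‖) := by
          exact mul_le_mul_of_nonneg_right (hp.bound (n + 2)) (by positivity)
      _ = (C * b ^ 2 * ρ * ‖ψ - ψ'‖) * ((n + 2 : ℕ) * (b * ρ) ^ n) := by rw [h1]; ring
      _ ≤ (C * b ^ 2 * ρ * ‖ψ - ψ'‖) * (2 ^ (n + 2) * (1 / 4) ^ n) := by
          gcongr
          · exact_mod_cast (Nat.lt_two_pow_self (n := n + 2)).le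
          · linarith
      _ = _ := by
          rw [show (1 / 4 : ℝ) = (1 / 2) * (1 / 2) by norm_num, mul_pow, pow_add, pow_add]
          rw [show (2 : ℝ) ^ n * 2 ^ 2 * ((1 / 2) ^ n * (1 / 2) ^ n) =
            (2 * (1 / 2)) ^ n * (4 * (1 / 2) ^ n) by rw [mul_pow]; ring]
          norm_num
          ring

theorem fcTerm_zero (hp : CoeffBound p C b) (n : ℕ) (i : ι) : fcTerm p n (0 : ι → A) i = 0 := by
  rcases n with _ | n
  · simp [fcTerm, hp.zero]
  · simp [fcTerm]

theorem fc_zero (hp : CoeffBound p C b) (i : ι) : fc p (0 : ι → A) i = 0 := by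
  simp [fc, fcTerm_zero hp]

theorem summable_fcTerm (hp : CoeffBound p C b) {ψ : ι → A} {ρ : ℝ} (hρ : 0 ≤ ρ)
    (hρb : 4 * b * ρ ≤ 1) (h : ‖ψ‖ ≤ ρ) (i : ι) : Summable fun n => fcTerm p n ψ i := by
  refine Summable.of_norm_bounded (g := fun n => (16 * C * b ^ 2 * ρ * ‖ψ‖) * (1 / 2) ^ n)
    (Summable.mul_left _ (summable_geometric_of_lt_one (by norm_num) (by norm_num))) fun n => ?_
  have := norm_fcTerm_sub_le' hp n hρ hρb h (ψ' := 0) (by simpa using hρ) i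
  rwa [fcTerm_zero hp, sub_zero, sub_zero] at this

theorem norm_fc_sub_le (hp : CoeffBound p C b) {ψ ψ' : ι → A} {ρ : ℝ} (hρ : 0 ≤ ρ)
    (hρb : 4 * b * ρ ≤ 1) (h : ‖ψ‖ ≤ ρ) (h' : ‖ψ'‖ ≤ ρ) (i : ι) :
    ‖fc p ψ i - fc p ψ' i‖ ≤ 32 * C * b ^ 2 * ρ * ‖ψ - ψ'‖ := by
  rw [fc, fc, ← (summable_fcTerm hp hρ hρb h i).tsum_sub (summable_fcTerm hp hρ hρb h' i)]
  have hg : HasSum (fun n : ℕ => (16 * C * b ^ 2 * ρ * ‖ψ - ψ'‖) * (1 / 2) ^ n)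
      (32 * C * b ^ 2 * ρ * ‖ψ - ψ'‖) := by
    have := (hasSum_geometric_of_lt_one (r := (1 / 2 : ℝ)) (by norm_num) (by norm_num)).mul_left
      (16 * C * b ^ 2 * ρ * ‖ψ - ψ'‖)
    rwa [show 16 * C * b ^ 2 * ρ * ‖ψ - ψ'‖ * (1 - 1 / 2)⁻¹ = 32 * C * b ^ 2 * ρ * ‖ψ - ψ'‖ by
      rw [show (1 - 1 / 2 : ℝ)⁻¹ = 2 by norm_num]; ring] at this
  exact tsum_of_norm_bounded hg fun n => norm_fcTerm_sub_le' hp n hρ hρb h h' i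

theorem norm_fc_le (hp : CoeffBound p C b) {ψ : ι → A} {ρ : ℝ} (hρ : 0 ≤ ρ)
    (hρb : 4 * b * ρ ≤ 1) (h : ‖ψ‖ ≤ ρ) (i : ι) : ‖fc p ψ i‖ ≤ 32 * C * b ^ 2 * ρ ^ 2 := by
  have hb := hp.b_pos
  have hC := hp.C_nonneg
  have := norm_fc_sub_le hp hρ hρb h (ψ' := 0) (by simpa using hρ) i
  rw [fc_zero hp, sub_zero, sub_zero] at this
  calc _ ≤ _ := this
    _ ≤ 32 * C * b ^ 2 * ρ * ρ := by gcongr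
    _ = _ := by ring

theorem apply_diag_eq (n : ℕ) (y : ι → ℂ) (i : ι) :
    (p n fun _ => y) i = ∑ v : Fin n → ι, (p n fun l => Pi.single (v l) 1) i * ∏ l, y (v l) := by
  have h1 : y = ∑ k, y k • (Pi.single k (1 : ℂ) : ι → ℂ) := by
    ext j
    simp [Finset.sum_apply, Pi.single_apply]
  conv_lhs => rw [h1]
  have := (p n).toMultilinearMap.map_sum (fun (_ : Fin n) (k : ι) => y k • (Pi.single k (1 : ℂ) : ι → ℂ))
  simp only [ContinuousMultilinearMap.coe_coe] at this
  rw [this, Finset.sum_apply]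
  refine Finset.sum_congr rfl fun v _ => ?_
  have := (p n).map_smul_univ (fun l => y (v l)) fun l => (Pi.single (v l) (1 : ℂ) : ι → ℂ)
  rw [this, Pi.smul_apply, smul_eq_mul, mul_comm]

theorem map_fc (hp : CoeffBound p C b) (e : A →ₐ[ℂ] ℂ) (he : ∀ x, ‖e x‖ ≤ ‖x‖)
    {g : (ι → ℂ) → (ι → ℂ)} {r : ENNReal} (hg : HasFPowerSeriesOnBall g p 0 r)
    {ψ : ι → A} {ρ : ℝ} (hρ : 0 ≤ ρ) (hρb : 4 * b * ρ ≤ 1) (hρr : ENNReal.ofReal ρ < r)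
    (h : ‖ψ‖ ≤ ρ) (i : ι) : e (fc p ψ i) = g (fun k => e (ψ k)) i := by
  have hcont : Continuous e :=
    AddMonoidHomClass.continuous_of_bound e 1 fun x => by rw [one_mul]; exact he x
  have h1 := (summable_fcTerm hp hρ hρb h i).hasSum.map e hcont
  have hmem : (fun k => e (ψ k)) ∈ Metric.eball (0 : ι → ℂ) r := by
    rw [Metric.mem_eball, edist_zero_right, ← ofReal_norm]
    refine lt_of_le_of_lt (ENNReal.ofReal_le_ofReal ?_) hρr
    exact (pi_norm_le_iff_of_nonneg hρ).2 fun k => (he _).trans ((norm_le_pi_norm ψ k).trans h)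
  have h2 := hg.hasSum hmem
  rw [zero_add] at h2
  have h3 := Pi.hasSum.1 h2 i
  refine h1.unique ?_
  refine (congrArg (HasSum · _) (funext fun n => ?_)).mpr h3
  rw [apply_diag_eq, Function.comp, fcTerm, map_sum]
  refine Finset.sum_congr rfl fun v _ => ?_
  rw [map_smul, map_prod, smul_eq_mul]

theorem exists_coeffBound {g : (ι → ℂ) → (ι → ℂ)} (hg : AnalyticAt ℂ g 0) (h0 : g 0 = 0)
    (h1 : fderiv ℂ g 0 = 0) : ∃ p C b r, CoeffBound p C b ∧ 0 < r ∧ HasFPowerSeriesOnBall g p 0 r := by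
  obtain ⟨p, r, hp⟩ := hg
  refine ⟨p, ?_⟩
  obtain ⟨s, hs0, hsr⟩ := ENNReal.lt_iff_exists_nnreal_btwn.1 (lt_of_lt_of_le hp.r_pos hp.r_le)
  obtain ⟨C, hC, hCb⟩ := p.norm_mul_pow_le_of_lt_radius hsr
  have hs : 0 < (s : ℝ) := by exact_mod_cast hs0
  refine ⟨C, (Fintype.card ι + 1) / s, r, ⟨by positivity, hC.le, ?_, ?_, fun n => ?_⟩, hp.r_pos, hp⟩
  · ext v i
    have := hp.coeff_zero v
    rw [this, h0]; rfl
  · have h2 : (continuousMultilinearCurryFin1 ℂ (ι → ℂ) (ι → ℂ)) (p 1) = 0 := by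
      rw [← hp.hasFPowerSeriesAt.fderiv_eq, h1]
    simpa using h2
  · have h3 : ‖p n‖ ≤ C / s ^ n := by
      rw [le_div_iff₀ (by positivity)]; exact hCb n
    rw [div_pow, mul_div_assoc', mul_comm C, mul_div_assoc]
    gcongr
    linarith

end Calculus

end

section

/-! ### Geometric series in Banach algebras -/

section Geo

variable {A : Type*} [NormedCommRing A] [NormedAlgebra ℂ A] [NormOneClass A] [CompleteSpace A]

/-- The geometric series. -/
def geo (a : A) : A := ∑' n : ℕ, a ^ n

theorem one_sub_mul_geo {a : A} (ha : ‖a‖ < 1) : (1 - a) * geo a = 1 :=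
  mul_neg_geom_series a ha

theorem norm_geo_le {a : A} {θ : ℝ} (hθ : θ < 1) (ha : ‖a‖ ≤ θ) : ‖geo a‖ ≤ (1 - θ)⁻¹ := by
  have h := tsum_geometric_le_of_norm_lt_one a (ha.trans_lt hθ)
  rw [norm_one, sub_self, zero_add] at h
  refine h.trans ?_
  apply inv_anti₀ <;> linarith

theorem norm_geo_sub_le {a b : A} {θ : ℝ} (hθ : θ < 1) (ha : ‖a‖ ≤ θ) (hb : ‖b‖ ≤ θ) :
    ‖geo a - geo b‖ ≤ (1 - θ)⁻¹ ^ 2 * ‖a - b‖ := by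
  have h1 := one_sub_mul_geo (ha.trans_lt hθ)
  have h2 := one_sub_mul_geo (hb.trans_lt hθ)
  have h3 : geo a - geo b = geo a * (a - b) * geo b := by
    have h4 : geo a * ((1 - b) * geo b) - geo b * ((1 - a) * geo a) = geo a * (a - b) * geo b := by
      ring
    rw [← h4, h1, h2]; ring
  have hp : 0 < 1 - θ := by linarith
  rw [h3]
  calc _ ≤ ‖geo a‖ * ‖a - b‖ * ‖geo b‖ :=
        (norm_mul_le _ _).trans (by gcongr; exact norm_mul_le _ _)
    _ ≤ (1 - θ)⁻¹ * ‖a - b‖ * (1 - θ)⁻¹ := by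
        gcongr
        · exact norm_geo_le hθ ha
        · exact norm_geo_le hθ hb
    _ = _ := by ring

theorem norm_pow_sub_pow_le {a b : A} {ρ : ℝ} (hρ0 : 0 ≤ ρ) (hρ : ρ < 1) (ha : ‖a‖ ≤ ρ)
    (hb : ‖b‖ ≤ ρ) (k : ℕ) : ‖a ^ k - b ^ k‖ ≤ (1 - ρ)⁻¹ * ‖a - b‖ := by
  have h := norm_prod_sub_prod_le (n := k) (x := fun _ => a) (y := fun _ => b) hρ0 (fun _ => ha)
    (fun _ => hb) (fun _ => le_rfl)
  simp only [Finset.prod_const, Finset.card_univ, Fintype.card_fin] at h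
  refine h.trans ?_
  gcongr
  have h1 : (k : ℝ) * ρ ^ (k - 1) ≤ ∑ j ∈ Finset.range k, ρ ^ j := by
    have : ∑ j ∈ Finset.range k, ρ ^ (k - 1) ≤ ∑ j ∈ Finset.range k, ρ ^ j :=
      Finset.sum_le_sum fun j hj =>
        pow_le_pow_of_le_one hρ0 hρ.le (by have := Finset.mem_range.1 hj; omega)
    simpa using this
  refine h1.trans ?_
  have h2 := (summable_geometric_of_lt_one hρ0 hρ).sum_le_tsum (Finset.range k)
    fun _ _ => pow_nonneg hρ0 _
  rwa [tsum_geometric_of_lt_one hρ0 hρ] at h2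

theorem norm_pow_le_of_le {a : A} {ρ : ℝ} (ha : ‖a‖ ≤ ρ) (k : ℕ) : ‖a ^ k‖ ≤ ρ ^ k :=
  (norm_pow_le a k).trans (pow_le_pow_left₀ (norm_nonneg _) ha k)

theorem map_geo (e : A →ₐ[ℂ] ℂ) {a : A} (ha : ‖a‖ < 1) : e (geo a) = (1 - e a)⁻¹ := by
  have h := congrArg e (one_sub_mul_geo ha)
  rw [map_mul, map_sub, map_one] at h
  exact eq_inv_of_mul_eq_one_right h

end Geo

section Operators

variable {ι : Type*} [Fintype ι] [DecidableEq ι] {p q : ι}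

namespace AbsSer

variable (p q) in
/-- Multiplication of the parts of weight `k` by `c k`. -/
def multOp (c : ℤ → AbsSer ι) (f : AbsSer ι) : AbsSer ι := ∑' k, c k * proj p q k f

theorem norm_multTerm_le {c : ℤ → AbsSer ι} {C : ℝ} (hc : ∀ k, ‖c k‖ ≤ C) (f : AbsSer ι) (k : ℤ) :
    ‖c k * proj p q k f‖ ≤ C * ‖proj p q k f‖ :=
  (norm_mul_le _ _).trans (mul_le_mul_of_nonneg_right (hc k) (norm_nonneg _))

theorem summable_multOp {c : ℤ → AbsSer ι} {C : ℝ} (hc : ∀ k, ‖c k‖ ≤ C) (f : AbsSer ι) :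
    Summable fun k => c k * proj p q k f :=
  Summable.of_norm_bounded ((hasSum_norm_proj f).summable.mul_left C) (norm_multTerm_le hc f)

theorem norm_multOp_le {c : ℤ → AbsSer ι} {C : ℝ} (hc : ∀ k, ‖c k‖ ≤ C) (f : AbsSer ι) :
    ‖multOp p q c f‖ ≤ C * ‖f‖ :=
  tsum_of_norm_bounded ((hasSum_norm_proj f).mul_left C) (norm_multTerm_le hc f)

theorem norm_multOp_sub_le {c c' : ℤ → AbsSer ι} {C d : ℝ} (hc : ∀ k, ‖c k‖ ≤ C)
    (hc' : ∀ k, ‖c' k‖ ≤ C) (hd : ∀ k, ‖c k - c' k‖ ≤ d) (f f' : AbsSer ι) :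
    ‖multOp p q c f - multOp p q c' f'‖ ≤ C * ‖f - f'‖ + d * ‖f'‖ := by
  have h : multOp p q c f - multOp p q c' f' =
      multOp p q c (f - f') + multOp p q (fun k => c k - c' k) f' := by
    rw [multOp, multOp, multOp, multOp,
      ← (summable_multOp hc f).tsum_sub (summable_multOp hc' f'),
      ← (summable_multOp hc (f - f')).tsum_add (summable_multOp hd f')]
    refine tsum_congr fun k => ?_
    rw [map_sub]
    ring
  rw [h]
  exact (norm_add_le _ _).trans (add_le_add (norm_multOp_le hc _) (norm_multOp_le hd _))

theorem hasSum_ev_multOp {c : ℤ → AbsSer ι} {C : ℝ} (hc : ∀ k, ‖c k‖ ≤ C) (f : AbsSer ι)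
    {y : ι → ℂ} (hy : ‖y‖ ≤ 1) :
    HasSum (fun k => ev y (c k) * ev y (proj p q k f)) (ev y (multOp p q c f)) := by
  have h := (evL y hy).hasSum (summable_multOp (p := p) (q := q) hc f).hasSum
  simp only [evL_apply, ev_mul hy] at h
  exact h

theorem ev_zero_proj {f : AbsSer ι} (hf : ev 0 f = 0) (k : ℤ) : ev 0 (proj p q k f) = 0 := by
  have key : ∀ g : AbsSer ι, ev 0 g = g.co 0 := by
    intro g
    rw [ev, tsum_eq_single 0]
    · simp [mon_zero]
    · intro α hα
      obtain ⟨i, hi⟩ := Finsupp.ne_iff.1 hα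
      rw [mon, Finset.prod_eq_zero (Finset.mem_univ i), mul_zero]
      simpa using hi
  rw [key] at hf ⊢
  rw [co_proj, hf, ite_self]

theorem ev_zero_multOp {c : ℤ → AbsSer ι} {C : ℝ} (hc : ∀ k, ‖c k‖ ≤ C) {f : AbsSer ι}
    (hf : ev 0 f = 0) : ev 0 (multOp p q c f) = 0 := by
  have h := hasSum_ev_multOp (p := p) (q := q) hc f (y := 0) (by simp)
  simp only [ev_zero_proj hf, mul_zero] at h
  exact h.unique hasSum_zero

/-- The inverses of `N^{-k} - ν`, for `k ≠ -1`. -/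
def coefV (ν : ℂ) (N : AbsSer ι) (k : ℤ) : AbsSer ι :=
  if 0 ≤ k then N ^ k.toNat * geo (ν • N ^ k.toNat)
  else if k = -1 then 0 else -(ν⁻¹ • geo (ν⁻¹ • N ^ (-k).toNat))

/-- The inverses of `N^{-k} - 1`, for `k > 0`. -/
def coefX (N : AbsSer ι) (k : ℤ) : AbsSer ι :=
  if 0 < k then N ^ k.toNat * geo (N ^ k.toNat) else 0

/-- A radius `ρ` and a ratio `θ` adapted to the eigenvalue `ν`. -/
structure Adapted (ν : ℂ) (ρ θ : ℝ) : Prop where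
  ne : ν ≠ 0
  lt : ‖ν‖ < ρ
  lt_one : ρ < 1
  le : ρ ≤ θ
  sq_le : ‖ν‖⁻¹ * ρ ^ 2 ≤ θ
  theta : θ < 1

theorem exists_adapted {ν : ℂ} (h0 : ν ≠ 0) (h1 : ‖ν‖ < 1) : ∃ ρ θ, Adapted ν ρ θ := by
  have hpos : 0 < ‖ν‖ := norm_pos_iff.2 h0
  obtain ⟨ρ, hρ1, hρ2⟩ := exists_between (Real.lt_sqrt_of_sq_lt (x := ‖ν‖) (y := ‖ν‖) (by nlinarith))
  have hρ0 : 0 < ρ := hpos.trans hρ1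
  have h2 : ρ ^ 2 < ‖ν‖ := (Real.lt_sqrt hρ0.le).1 hρ2
  refine ⟨ρ, max ρ (‖ν‖⁻¹ * ρ ^ 2), h0, hρ1, by nlinarith, le_max_left _ _, le_max_right _ _, ?_⟩
  refine max_lt (by nlinarith) ?_
  rw [inv_mul_lt_iff₀ hpos, mul_one]
  exact h2

namespace Adapted

variable {ν : ℂ} {ρ θ : ℝ} (H : Adapted ν ρ θ) {N N' : AbsSer ι}
include H

theorem pos : 0 < ‖ν‖ := norm_pos_iff.2 H.ne
theorem rho_pos : 0 < ρ := H.pos.trans H.lt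

theorem norm_a_le (hN : ‖N‖ ≤ ρ) (k : ℕ) : ‖ν • N ^ k‖ ≤ θ := by
  rw [norm_smul]
  have h1 := norm_pow_le_of_le hN k
  have h2 : ρ ^ k ≤ 1 := pow_le_one₀ H.rho_pos.le H.lt_one.le
  calc _ ≤ ‖ν‖ * 1 := by gcongr; exact h1.trans h2
    _ ≤ θ := by linarith [H.lt, H.le]

theorem norm_b_le (hN : ‖N‖ ≤ ρ) {k : ℕ} (hk : 2 ≤ k) : ‖ν⁻¹ • N ^ k‖ ≤ θ := by
  rw [norm_smul, norm_inv]
  refine le_trans ?_ H.sq_le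
  have := H.pos
  gcongr
  exact (norm_pow_le_of_le hN k).trans (pow_le_pow_of_le_one H.rho_pos.le H.lt_one.le hk)

theorem norm_c_le (hN : ‖N‖ ≤ ρ) {k : ℕ} (hk : 1 ≤ k) : ‖N ^ k‖ ≤ θ :=
  (norm_pow_le_of_le hN k).trans ((pow_le_of_le_one H.rho_pos.le H.lt_one.le (by omega)).trans H.le)

theorem norm_pow_le_one (hN : ‖N‖ ≤ ρ) (k : ℕ) : ‖N ^ k‖ ≤ 1 :=
  (norm_pow_le_of_le hN k).trans (pow_le_one₀ H.rho_pos.le H.lt_one.le)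

/-- Bounds for the coefficients and their dependence on `N`. -/
theorem exists_bounds : ∃ C L : ℝ, 0 < C ∧ 0 < L ∧
    (∀ N : AbsSer ι, ‖N‖ ≤ ρ → ∀ k, ‖coefV ν N k‖ ≤ C ∧ ‖coefX N k‖ ≤ C) ∧
    ∀ N N' : AbsSer ι, ‖N‖ ≤ ρ → ‖N'‖ ≤ ρ → ∀ k,
      ‖coefV ν N k - coefV ν N' k‖ ≤ L * ‖N - N'‖ ∧ ‖coefX N k - coefX N' k‖ ≤ L * ‖N - N'‖ := by
  have hν := H.pos
  have hν1 : ‖ν‖ < 1 := H.lt.trans H.lt_one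
  have hG : 0 < (1 - θ)⁻¹ := inv_pos.2 (by linarith [H.theta])
  have hR : 0 < (1 - ρ)⁻¹ := inv_pos.2 (by linarith [H.lt_one])
  set G := (1 - θ)⁻¹ with hGdef
  set R := (1 - ρ)⁻¹ with hRdef
  have hi : 1 ≤ ‖ν‖⁻¹ := (one_le_inv₀ hν).2 hν1.le
  have hprod : ∀ x y x' y' : AbsSer ι, ∀ d : ℝ, ‖x'‖ ≤ 1 → ‖y‖ ≤ θ → ‖y'‖ ≤ θ → ‖x - x'‖ ≤ d →
      ‖y - y'‖ ≤ d → ‖x * geo y - x' * geo y'‖ ≤ (G + G ^ 2) * d := by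
    intro x y x' y' d hx' hy hy' hdx hdy
    have h : x * geo y - x' * geo y' = (x - x') * geo y + x' * (geo y - geo y') := by ring
    have hd : 0 ≤ d := (norm_nonneg _).trans hdx
    rw [h]
    calc _ ≤ ‖x - x'‖ * ‖geo y‖ + ‖x'‖ * ‖geo y - geo y'‖ :=
          (norm_add_le _ _).trans (add_le_add (norm_mul_le _ _) (norm_mul_le _ _))
      _ ≤ d * G + 1 * (G ^ 2 * d) := by
          gcongr
          · exact norm_geo_le H.theta hy
          · exact (norm_geo_sub_le H.theta hy hy').trans (by gcongr)
      _ = _ := by ring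
  refine ⟨‖ν‖⁻¹ * G, (G + G ^ 2) * R + ‖ν‖⁻¹ * (G ^ 2 * (‖ν‖⁻¹ * R)), by positivity, by positivity, ?_, ?_⟩
  · intro N hN k
    have hx : ∀ (m : ℕ) (y : AbsSer ι), ‖y‖ ≤ θ → ‖N ^ m * geo y‖ ≤ ‖ν‖⁻¹ * G := by
      intro m y hy
      calc _ ≤ ‖N ^ m‖ * ‖geo y‖ := norm_mul_le _ _
        _ ≤ ‖ν‖⁻¹ * G := by
          gcongr
          · exact (H.norm_pow_le_one hN m).trans hi
          · exact norm_geo_le H.theta hy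
    constructor
    · unfold coefV
      split_ifs with h1 h2
      · exact hx _ _ (H.norm_a_le hN _)
      · rw [norm_zero]; positivity
      · rw [norm_neg, norm_smul, norm_inv]
        gcongr
        exact norm_geo_le H.theta (H.norm_b_le hN (by omega))
    · unfold coefX
      split_ifs with h1
      · exact hx _ _ (H.norm_c_le hN (by omega))
      · rw [norm_zero]; positivity
  · intro N N' hN hN' k
    have hpow : ∀ m, ‖N ^ m - N' ^ m‖ ≤ R * ‖N - N'‖ := fun m =>
      norm_pow_sub_pow_le H.rho_pos.le H.lt_one hN hN' m
    have hA : (G + G ^ 2) * (R * ‖N - N'‖) ≤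
        ((G + G ^ 2) * R + ‖ν‖⁻¹ * (G ^ 2 * (‖ν‖⁻¹ * R))) * ‖N - N'‖ := by
      rw [← mul_assoc]
      gcongr
      have : 0 ≤ ‖ν‖⁻¹ * (G ^ 2 * (‖ν‖⁻¹ * R)) := by positivity
      linarith
    have h0 : 0 ≤ ((G + G ^ 2) * R + ‖ν‖⁻¹ * (G ^ 2 * (‖ν‖⁻¹ * R))) * ‖N - N'‖ := by positivity
    constructor
    · unfold coefV
      split_ifs with h1 h2
      · refine (hprod _ _ _ _ (R * ‖N - N'‖) (H.norm_pow_le_one hN' _) (H.norm_a_le hN _)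
          (H.norm_a_le hN' _) (hpow _) ?_).trans hA
        rw [← smul_sub, norm_smul]
        exact (mul_le_of_le_one_left (norm_nonneg _) hν1.le).trans (hpow _)
      · rw [sub_zero, norm_zero]; exact h0
      · rw [neg_sub_neg, ← smul_sub, norm_smul, norm_inv, norm_sub_rev]
        have h3 := norm_geo_sub_le H.theta (H.norm_b_le hN (k := (-k).toNat) (by omega))
          (H.norm_b_le hN' (k := (-k).toNat) (by omega))
        rw [← smul_sub, norm_smul, norm_inv] at h3
        calc _ ≤ ‖ν‖⁻¹ * (G ^ 2 * (‖ν‖⁻¹ * (R * ‖N - N'‖))) := by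
              gcongr
              exact h3.trans (by gcongr; exact hpow _)
          _ = ‖ν‖⁻¹ * (G ^ 2 * (‖ν‖⁻¹ * R)) * ‖N - N'‖ := by ring
          _ ≤ _ := by
              gcongr
              have : 0 ≤ (G + G ^ 2) * R := by positivity
              linarith
    · unfold coefX
      split_ifs with h1
      · exact (hprod _ _ _ _ (R * ‖N - N'‖) (H.norm_pow_le_one hN' _) (H.norm_c_le hN (by omega))
          (H.norm_c_le hN' (by omega)) (hpow _) (hpow _)).trans hA
      · rw [sub_zero, norm_zero]; exact h0

/-- The values of the coefficients `coefV`. -/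
theorem ev_coefV (hN : ‖N‖ ≤ ρ) {y : ι → ℂ} (hy : ‖y‖ ≤ 1) (h0 : ev y N ≠ 0) (k : ℤ) :
    ev y (coefV ν N k) * ((ev y N)⁻¹ ^ k - ν) = if k = -1 then 0 else 1 := by
  have hgeo : ∀ a : AbsSer ι, ‖a‖ ≤ θ → ev y (geo a) = (1 - ev y a)⁻¹ ∧ 1 - ev y a ≠ 0 := by
    intro a ha
    refine ⟨map_geo (evHom y hy) (ha.trans_lt H.theta), fun h => ?_⟩
    have h1 := (norm_ev_le hy a).trans ha
    rw [← sub_eq_zero.1 h, norm_one] at h1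
    linarith [H.theta]
  have hpow : ∀ m : ℕ, ev y (N ^ m) = ev y N ^ m := fun m => map_pow (evHom y hy) N m
  have hneg : ∀ f : AbsSer ι, ev y (-f) = -ev y f := fun f => map_neg (evHom y hy) f
  unfold coefV
  by_cases h1 : 0 ≤ k
  · rw [if_pos h1, if_neg (by omega)]
    obtain ⟨h2, h3⟩ := hgeo _ (H.norm_a_le hN k.toNat)
    rw [ev_mul hy, h2]
    rw [ev_smul, hpow] at h3 ⊢
    obtain ⟨m, rfl⟩ := Int.eq_ofNat_of_zero_le h1
    simp only [Int.toNat_natCast, zpow_natCast, inv_pow] at h3 ⊢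
    have h4 := pow_ne_zero m h0
    rw [show ((ev y N ^ m)⁻¹ - ν) = (ev y N ^ m)⁻¹ * (1 - ν * ev y N ^ m) by field_simp]
    calc _ = ev y N ^ m * (ev y N ^ m)⁻¹ * ((1 - ν * ev y N ^ m)⁻¹ * (1 - ν * ev y N ^ m)) := by ring
      _ = 1 := by rw [mul_inv_cancel₀ h4, inv_mul_cancel₀ h3, one_mul]
  · by_cases h2 : k = -1
    · rw [if_neg h1, if_pos h2, if_pos h2]
      simp [ev]
    · rw [if_neg h1, if_neg h2, if_neg h2]
      obtain ⟨m, hm⟩ := Int.eq_ofNat_of_zero_le (show 0 ≤ -k by omega)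
      obtain ⟨h3, h4⟩ := hgeo _ (H.norm_b_le hN (k := (-k).toNat) (by omega))
      rw [hneg, ev_smul, h3]
      rw [ev_smul, hpow] at h4 ⊢
      rw [hm, Int.toNat_natCast] at h4 ⊢
      rw [inv_zpow', hm, zpow_natCast]
      have := H.ne
      have h5 : ev y N ^ m - ν = -(ν * (1 - ν⁻¹ * ev y N ^ m)) := by
        rw [mul_sub, mul_inv_cancel_left₀ this]; ring
      rw [h5]
      calc _ = ν⁻¹ * ν * ((1 - ν⁻¹ * ev y N ^ m)⁻¹ * (1 - ν⁻¹ * ev y N ^ m)) := by ring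
        _ = 1 := by rw [inv_mul_cancel₀ h4, inv_mul_cancel₀ this, one_mul]

theorem ev_coefX (hN : ‖N‖ ≤ ρ) {y : ι → ℂ} (hy : ‖y‖ ≤ 1) (h0 : ev y N ≠ 0) (k : ℤ) :
    ev y (coefX N k) * ((ev y N)⁻¹ ^ k - 1) = if 0 < k then 1 else 0 := by
  have hpow : ∀ m : ℕ, ev y (N ^ m) = ev y N ^ m := fun m => map_pow (evHom y hy) N m
  unfold coefX
  by_cases h1 : 0 < k
  · rw [if_pos h1, if_pos h1]
    have ha := H.norm_c_le hN (k := k.toNat) (by omega)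
    have h2 : ev y (geo (N ^ k.toNat)) = (1 - ev y (N ^ k.toNat))⁻¹ :=
      map_geo (evHom y hy) (ha.trans_lt H.theta)
    have h3 : 1 - ev y (N ^ k.toNat) ≠ 0 := fun h => by
      have h1 := (norm_ev_le hy (N ^ k.toNat)).trans ha
      rw [← sub_eq_zero.1 h, norm_one] at h1
      linarith [H.theta]
    rw [ev_mul hy, h2]
    rw [hpow] at h3 ⊢
    obtain ⟨m, rfl⟩ := Int.eq_ofNat_of_zero_le h1.le
    simp only [Int.toNat_natCast, zpow_natCast, inv_pow] at h3 ⊢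
    have h4 := pow_ne_zero m h0
    field_simp
  · rw [if_neg h1, if_neg h1]
    simp [ev]

end Adapted

end AbsSer

end Operators

end

section

namespace AbsSer

variable {ι : Type*} [Fintype ι] [DecidableEq ι] {p q : ι}

/-! ### The equation for the normalizing map of a pair of involutions -/

/-- The map `r • id + u`. -/
def pert (r : ℝ) (u : ι → AbsSer ι) (i : ι) : AbsSer ι := (r : ℂ) • X i + u i

variable (p q) in
/-- The series `N` with `r (N - ν) y_q` the part of weight `-1` of `h`. -/
def mult (ν : ℂ) (r : ℝ) (h : AbsSer ι) : AbsSer ι := ν • 1 + (r : ℂ)⁻¹ • divq p q h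

variable (p q) in
/-- The right-hand side of the fixed point equation. -/
def step (P : FormalMultilinearSeries ℂ (ι → ℂ) (ι → ℂ)) (ν : ℂ) (r : ℝ) (u : ι → AbsSer ι) (i : ι) :
    AbsSer ι :=
  let h := fc P (pert r u)
  let N := mult p q ν r (h p)
  if i = q then multOp p q (coefV ν N) (h p)
  else if i = p then exch p q (multOp p q (coefV ν N) (h p))
  else multOp p q (coefX N) (h i) + exch p q (multOp p q (coefX N) (h i))

theorem norm_pert_le {r : ℝ} (hr : 0 ≤ r) {u : ι → AbsSer ι} (hu : ‖u‖ ≤ r) : ‖pert r u‖ ≤ 2 * r := by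
  refine (pi_norm_le_iff_of_nonneg (by positivity)).2 fun i => ?_
  refine (norm_add_le _ _).trans ?_
  rw [norm_smul, norm_X, Complex.norm_real, Real.norm_of_nonneg hr]
  linarith [(norm_le_pi_norm u i).trans hu]

theorem norm_pert_sub (r : ℝ) (u u' : ι → AbsSer ι) : ‖pert r u - pert r u'‖ = ‖u - u'‖ := by
  congr 1
  ext1 i
  simp [pert]

theorem norm_mult_sub_le {ν : ℂ} {r : ℝ} (hr : 0 < r) {h : AbsSer ι} {d : ℝ} (hd : ‖h‖ ≤ d) :
    ‖mult p q ν r h - ν • 1‖ ≤ r⁻¹ * d := by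
  rw [mult, add_sub_cancel_left, norm_smul, norm_inv, Complex.norm_real, Real.norm_of_nonneg hr.le]
  gcongr
  exact (norm_divq_le h).trans hd

theorem norm_mult_sub_mult_le {ν : ℂ} {r : ℝ} (hr : 0 < r) (h h' : AbsSer ι) :
    ‖mult p q ν r h - mult p q ν r h'‖ ≤ r⁻¹ * ‖h - h'‖ := by
  rw [mult, mult, add_sub_add_left_eq_sub, ← smul_sub, ← map_sub, norm_smul, norm_inv,
    Complex.norm_real, Real.norm_of_nonneg hr.le]
  gcongr
  exact norm_divq_le _

theorem ev_zero_exch {f : AbsSer ι} (hf : ev 0 f = 0) : ev 0 (exch p q f) = 0 := by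
  have h := ev_exch (p := p) (q := q) f 0
  rw [h]
  exact hf

theorem ev_zero_add {f g : AbsSer ι} (hf : ev 0 f = 0) (hg : ev 0 g = 0) : ev 0 (f + g) = 0 := by
  rw [ev_add (by simp), hf, hg, add_zero]

variable {P : FormalMultilinearSeries ℂ (ι → ℂ) (ι → ℂ)} {C b : ℝ}

/-- A fixed point of `step`, for a small radius `r`. -/
structure IsSol (P : FormalMultilinearSeries ℂ (ι → ℂ) (ι → ℂ)) (p q : ι) (ν : ℂ) (r : ℝ)
    (u : ι → AbsSer ι) : Prop where
  norm_le : ‖u‖ ≤ r / 2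
  zero : ∀ i, ev 0 (u i) = 0
  eq : u = step p q P ν r u

theorem exists_isSol (hp : CoeffBound P C b) {ν : ℂ} {ρ θ : ℝ} (H : Adapted ν ρ θ)
    {g : (ι → ℂ) → (ι → ℂ)} (g0 : g 0 = 0) {s : ENNReal} (hs : 0 < s) (hg : HasFPowerSeriesOnBall g P 0 s) :
    ∀ᶠ r : ℝ in 𝓝[>] 0, ∃ u, IsSol P p q ν r u := by
  obtain ⟨C₀, L, hC₀, hL, hbd, hlip⟩ := H.exists_bounds (ι := ι)
  have hb := hp.b_pos
  have hC := hp.C_nonneg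
  set K : ℝ := 32 * C * b ^ 2 with hK
  have hK0 : 0 ≤ K := by positivity
  have ev1 : ∀ c d : ℝ, 0 < d → ∀ᶠ r : ℝ in 𝓝[>] 0, c * r < d := by
    intro c d hd
    have : Tendsto (fun r : ℝ => c * r) (𝓝[>] 0) (𝓝 (c * 0)) :=
      (tendsto_id.mono_left nhdsWithin_le_nhds).const_mul c
    rw [mul_zero] at this
    exact this.eventually_lt_const hd
  have ev2 : ∀ᶠ r : ℝ in 𝓝[>] 0, ENNReal.ofReal (2 * r) < s := by
    have : Tendsto (fun r : ℝ => ENNReal.ofReal (2 * r)) (𝓝[>] 0) (𝓝 (ENNReal.ofReal (2 * 0))) :=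
      ENNReal.tendsto_ofReal ((tendsto_id.mono_left nhdsWithin_le_nhds).const_mul 2)
    rw [mul_zero, ENNReal.ofReal_zero] at this
    exact this.eventually_lt_const hs
  filter_upwards [ev1 1 1 one_pos, ev1 (8 * b) 1 one_pos, ev1 (4 * K) (ρ - ‖ν‖) (by linarith [H.lt]),
    ev1 (8 * C₀ * K) (1 / 2) (by norm_num), ev1 (4 * C₀ * K + 16 * L * K ^ 2) (1 / 2) (by norm_num), ev2,
    self_mem_nhdsWithin] with r h1 h2 h3 h4 h5 h6 hr
  replace hr : 0 < r := hr
  have hρb : 4 * b * (2 * r) ≤ 1 := by linarith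
  have hr2 : 0 ≤ 2 * r := by positivity
  have f1 : ∀ u : ι → AbsSer ι, ‖u‖ ≤ r → ∀ i, ‖fc P (pert r u) i‖ ≤ 4 * K * r ^ 2 := by
    intro u hu i
    refine (norm_fc_le hp hr2 hρb (norm_pert_le hr.le hu) i).trans (le_of_eq ?_)
    rw [hK]; ring
  have f2 : ∀ u u' : ι → AbsSer ι, ‖u‖ ≤ r → ‖u'‖ ≤ r → ∀ i,
      ‖fc P (pert r u) i - fc P (pert r u') i‖ ≤ 2 * K * r * ‖u - u'‖ := by
    intro u u' hu hu' i
    refine (norm_fc_sub_le hp hr2 hρb (norm_pert_le hr.le hu) (norm_pert_le hr.le hu') i).trans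
      (le_of_eq ?_)
    rw [norm_pert_sub, hK]; ring
  have f3 : ∀ u : ι → AbsSer ι, ‖u‖ ≤ r → ‖mult p q ν r (fc P (pert r u) p)‖ ≤ ρ := by
    intro u hu
    have h := norm_mult_sub_le (p := p) (q := q) (ν := ν) hr (f1 u hu p)
    have h' := norm_le_norm_add_norm_sub' (mult p q ν r (fc P (pert r u) p)) (ν • 1)
    rw [norm_smul, norm_one, mul_one] at h'
    have h'' : r⁻¹ * (4 * K * r ^ 2) = 4 * K * r := by field_simp
    linarith
  have f4 : ∀ u u' : ι → AbsSer ι, ‖u‖ ≤ r → ‖u'‖ ≤ r →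
      ‖mult p q ν r (fc P (pert r u) p) - mult p q ν r (fc P (pert r u') p)‖ ≤ 2 * K * ‖u - u'‖ := by
    intro u u' hu hu'
    refine (norm_mult_sub_mult_le hr _ _).trans ?_
    calc _ ≤ r⁻¹ * (2 * K * r * ‖u - u'‖) := by gcongr; exact f2 u u' hu hu' p
      _ = _ := by field_simp
  have f5 : ∀ u : ι → AbsSer ι, ‖u‖ ≤ r → ‖step p q P ν r u‖ ≤ r / 2 := by
    intro u hu
    have hv : C₀ * (4 * K * r ^ 2) ≤ r / 4 := by nlinarith
    have hV : ∀ i, ‖multOp p q (coefV ν (mult p q ν r (fc P (pert r u) p))) (fc P (pert r u) i)‖ ≤ r / 4 :=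
      fun i => ((norm_multOp_le (fun k => (hbd _ (f3 u hu) k).1) _).trans
        (mul_le_mul_of_nonneg_left (f1 u hu i) hC₀.le)).trans hv
    have hX : ∀ i, ‖multOp p q (coefX (mult p q ν r (fc P (pert r u) p))) (fc P (pert r u) i)‖ ≤ r / 4 :=
      fun i => ((norm_multOp_le (fun k => (hbd _ (f3 u hu) k).2) _).trans
        (mul_le_mul_of_nonneg_left (f1 u hu i) hC₀.le)).trans hv
    refine (pi_norm_le_iff_of_nonneg (by positivity)).2 fun i => ?_
    simp only [step]
    split_ifs
    · exact (hV p).trans (by linarith)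
    · exact ((norm_exch_le _).trans (hV p)).trans (by linarith)
    · refine (norm_add_le _ _).trans ?_
      linarith [hX i, (norm_exch_le (p := p) (q := q)
        (multOp p q (coefX (mult p q ν r (fc P (pert r u) p))) (fc P (pert r u) i))).trans (hX i)]
  have f6 : ∀ u u' : ι → AbsSer ι, ‖u‖ ≤ r → ‖u'‖ ≤ r →
      ‖step p q P ν r u - step p q P ν r u'‖ ≤ 1 / 2 * ‖u - u'‖ := by
    intro u u' hu hu'
    set N := mult p q ν r (fc P (pert r u) p) with hN
    set N' := mult p q ν r (fc P (pert r u') p) with hN'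
    have hd : L * ‖N - N'‖ ≤ L * (2 * K * ‖u - u'‖) := by
      gcongr; exact f4 u u' hu hu'
    have hfin : C₀ * (2 * K * r * ‖u - u'‖) + L * (2 * K * ‖u - u'‖) * (4 * K * r ^ 2) ≤
        1 / 4 * ‖u - u'‖ := by
      have h7 : r ^ 2 ≤ r := by nlinarith
      have h8 : 2 * C₀ * K * r + 8 * L * K ^ 2 * r ^ 2 ≤ 1 / 4 := by
        have : 8 * L * K ^ 2 * r ^ 2 ≤ 8 * L * K ^ 2 * r := by gcongr
        linarith
      calc _ = (2 * C₀ * K * r + 8 * L * K ^ 2 * r ^ 2) * ‖u - u'‖ := by ring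
        _ ≤ _ := by gcongr
    have hV : ∀ i, ‖multOp p q (coefV ν N) (fc P (pert r u) i) -
        multOp p q (coefV ν N') (fc P (pert r u') i)‖ ≤ 1 / 4 * ‖u - u'‖ := fun i => by
      refine (norm_multOp_sub_le (fun k => (hbd _ (f3 u hu) k).1) (fun k => (hbd _ (f3 u' hu') k).1)
        (fun k => ((hlip N N' (f3 u hu) (f3 u' hu') k).1.trans hd)) _ _).trans (le_trans ?_ hfin)
      gcongr
      · exact f2 u u' hu hu' i
      · exact f1 u' hu' i
    have hX : ∀ i, ‖multOp p q (coefX N) (fc P (pert r u) i) -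
        multOp p q (coefX N') (fc P (pert r u') i)‖ ≤ 1 / 4 * ‖u - u'‖ := fun i => by
      refine (norm_multOp_sub_le (fun k => (hbd _ (f3 u hu) k).2) (fun k => (hbd _ (f3 u' hu') k).2)
        (fun k => ((hlip N N' (f3 u hu) (f3 u' hu') k).2.trans hd)) _ _).trans (le_trans ?_ hfin)
      gcongr
      · exact f2 u u' hu hu' i
      · exact f1 u' hu' i
    have hn := norm_nonneg (u - u')
    refine (pi_norm_le_iff_of_nonneg (by positivity)).2 fun i => ?_
    rw [Pi.sub_apply]
    simp only [step]
    split_ifs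
    · exact (hV p).trans (by linarith)
    · rw [← map_sub]
      exact ((norm_exch_le _).trans (hV p)).trans (by linarith)
    · rw [add_sub_add_comm, ← map_sub]
      refine (norm_add_le _ _).trans ?_
      have := (norm_exch_le (p := p) (q := q) _).trans (hX i)
      linarith [hX i]
  have f7 : ∀ u : ι → AbsSer ι, ‖u‖ ≤ r → (∀ i, ev 0 (u i) = 0) → ∀ i, ev 0 (step p q P ν r u i) = 0 := by
    intro u hu hu0 i
    have hh : ∀ i, ev 0 (fc P (pert r u) i) = 0 := by
      intro i
      have h0 : ‖(0 : ι → ℂ)‖ ≤ 1 := by simp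
      have := map_fc hp (evHom 0 h0) (fun x => norm_ev_le h0 x) hg hr2 hρb h6 (norm_pert_le hr.le hu) i
      rw [evHom_apply] at this
      rw [this]
      have h1 : (fun k => evHom 0 h0 (pert r u k)) = 0 := by
        ext k
        rw [evHom_apply, pert, ev_add h0, ev_smul, ev_X, hu0]
        simp
      rw [h1, g0]
      rfl
    have hV := ev_zero_multOp (p := p) (q := q) (fun k => (hbd _ (f3 u hu) k).1) (hh p)
    have hX := ev_zero_multOp (p := p) (q := q) (fun k => (hbd _ (f3 u hu) k).2) (hh i)
    simp only [step]
    split_ifs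
    · exact hV
    · exact ev_zero_exch hV
    · exact ev_zero_add hX (ev_zero_exch hX)
  set S : Set (ι → AbsSer ι) := {u | ‖u‖ ≤ r ∧ ∀ i, ev 0 (u i) = 0} with hS
  have hSc : IsClosed S := by
    rw [hS, Set.ofPred_and]
    refine (isClosed_le continuous_norm continuous_const).inter ?_
    rw [Set.ofPred_forall]
    refine isClosed_iInter fun i => isClosed_eq ?_ continuous_const
    have h0 : ‖(0 : ι → ℂ)‖ ≤ 1 := by simp
    exact (evL 0 h0).continuous.comp (continuous_apply i)
  have hmaps : Set.MapsTo (step p q P ν r) S S := fun u hu =>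
    ⟨(f5 u hu.1).trans (by linarith), f7 u hu.1 hu.2⟩
  have hcontr : ContractingWith (1 / 2) (hmaps.restrict (step p q P ν r) S S) := by
    refine ⟨by norm_num, LipschitzWith.of_dist_le_mul fun x y => ?_⟩
    have := f6 x y x.2.1 y.2.1
    rw [Subtype.dist_eq, Subtype.dist_eq, dist_eq_norm, dist_eq_norm]
    simpa using this
  have h0S : (0 : ι → AbsSer ι) ∈ S := ⟨by simpa using hr.le, fun i => by simp [ev]⟩
  obtain ⟨u, hu, hfix, -⟩ := hcontr.exists_fixedPoint' hSc.isComplete hmaps h0S (edist_ne_top _ _)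
  have hfix' : step p q P ν r u = u := hfix
  exact ⟨u, by rw [← hfix']; exact f5 u hu.1, hu.2, hfix'.symm⟩

end AbsSer

end

section

namespace AbsSer

variable {ι : Type*} [Fintype ι] [DecidableEq ι] {p q : ι}

theorem Adapted.ev_coefV_congr {ν : ℂ} {ρ θ : ℝ} (H : Adapted ν ρ θ) {N : AbsSer ι} (hN : ‖N‖ ≤ ρ)
    {y y' : ι → ℂ} (hy : ‖y‖ ≤ 1) (hy' : ‖y'‖ ≤ 1) (h : ev y N = ev y' N) (k : ℤ) :
    ev y (coefV ν N k) = ev y' (coefV ν N k) := by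
  have key : ∀ a : AbsSer ι, ‖a‖ ≤ θ → ev y a = ev y' a → ev y (geo a) = ev y' (geo a) := by
    intro a ha h
    have h1 := map_geo (evHom y hy) (ha.trans_lt H.theta)
    have h2 := map_geo (evHom y' hy') (ha.trans_lt H.theta)
    rw [evHom_apply, evHom_apply] at h1 h2
    rw [h1, h2, h]
  have hpow : ∀ m : ℕ, ev y (N ^ m) = ev y' (N ^ m) := fun m => by
    have h1 := map_pow (evHom y hy) N m
    have h2 := map_pow (evHom y' hy') N m
    rw [evHom_apply, evHom_apply] at h1 h2
    rw [h1, h2, h]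
  unfold coefV
  split_ifs with h1 h2
  · rw [ev_mul hy, ev_mul hy', hpow, key _ (H.norm_a_le hN _) (by rw [ev_smul, ev_smul, hpow])]
  · simp [ev]
  · rw [← neg_one_smul ℂ, ev_smul, ev_smul, ev_smul, ev_smul,
      key _ (H.norm_b_le hN (by omega)) (by rw [ev_smul, ev_smul, hpow])]

theorem Adapted.ev_coefX_congr {ν : ℂ} {ρ θ : ℝ} (H : Adapted ν ρ θ) {N : AbsSer ι} (hN : ‖N‖ ≤ ρ)
    {y y' : ι → ℂ} (hy : ‖y‖ ≤ 1) (hy' : ‖y'‖ ≤ 1) (h : ev y N = ev y' N) (k : ℤ) :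
    ev y (coefX N k) = ev y' (coefX N k) := by
  have hpow : ∀ m : ℕ, ev y (N ^ m) = ev y' (N ^ m) := fun m => by
    have h1 := map_pow (evHom y hy) N m
    have h2 := map_pow (evHom y' hy') N m
    rw [evHom_apply, evHom_apply] at h1 h2
    rw [h1, h2, h]
  unfold coefX
  split_ifs with h1
  · have ha := (H.norm_c_le hN (k := k.toNat) (by omega)).trans_lt H.theta
    have h1 := map_geo (evHom y hy) ha
    have h2 := map_geo (evHom y' hy') ha
    rw [evHom_apply, evHom_apply] at h1 h2
    rw [ev_mul hy, ev_mul hy', hpow, h1, h2, hpow]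
  · simp [ev]

variable (p q) in
/-- The transposition of two coordinates. -/
def sw (y : ι → ℂ) : ι → ℂ := fun i => y (Equiv.swap p q i)

variable (p q) in
/-- The map `y_p ↦ n y_q`, `y_q ↦ n⁻¹ y_p`. -/
def tw (n : ℂ) (y : ι → ℂ) : ι → ℂ := rotp p q n (sw p q y)

theorem norm_sw_le (y : ι → ℂ) : ‖sw p q y‖ ≤ ‖y‖ :=
  (pi_norm_le_iff_of_nonneg (norm_nonneg _)).2 fun _ => norm_le_pi_norm y _

theorem sw_sw (y : ι → ℂ) : sw p q (sw p q y) = y := by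
  ext i; simp [sw]

theorem rotp_fst (c : ℂ) (y : ι → ℂ) : rotp p q c y p = c * y p := by simp [rotp]

theorem rotp_snd (hpq : p ≠ q) (c : ℂ) (y : ι → ℂ) : rotp p q c y q = c⁻¹ * y q := by
  simp [rotp, hpq.symm]

theorem rotp_ne {i : ι} (hip : i ≠ p) (hiq : i ≠ q) (c : ℂ) (y : ι → ℂ) : rotp p q c y i = y i := by
  simp [rotp, hip, hiq]

theorem ext_pair {x y : ι → ℂ} (h1 : x p = y p) (h2 : x q = y q)
    (h : ∀ i, i ≠ p → i ≠ q → x i = y i) : x = y := by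
  ext i
  by_cases hp : i = p
  · rw [hp, h1]
  · by_cases hq : i = q
    · rw [hq, h2]
    · exact h i hp hq

theorem sw_fst (y : ι → ℂ) : sw p q y p = y q := by simp [sw]
theorem sw_snd (y : ι → ℂ) : sw p q y q = y p := by simp [sw]
theorem sw_ne {i : ι} (hip : i ≠ p) (hiq : i ≠ q) (y : ι → ℂ) : sw p q y i = y i := by
  simp [sw, Equiv.swap_apply_of_ne_of_ne hip hiq]

theorem rotp_rotp (hpq : p ≠ q) (c d : ℂ) (y : ι → ℂ) :
    rotp p q c (rotp p q d y) = rotp p q (c * d) y := by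
  refine ext_pair (p := p) (q := q) ?_ ?_ fun i hp hq => ?_
  · rw [rotp_fst, rotp_fst, rotp_fst]; ring
  · rw [rotp_snd hpq, rotp_snd hpq, rotp_snd hpq, mul_inv]; ring
  · rw [rotp_ne hp hq, rotp_ne hp hq, rotp_ne hp hq]

theorem rotp_one (y : ι → ℂ) : rotp p q 1 y = y := by
  ext i; simp [rotp]

theorem sw_rotp (hpq : p ≠ q) (c : ℂ) (y : ι → ℂ) :
    sw p q (rotp p q c y) = rotp p q c⁻¹ (sw p q y) := by
  refine ext_pair (p := p) (q := q) ?_ ?_ fun i hp hq => ?_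
  · rw [rotp_fst, sw_fst, sw_fst, rotp_snd hpq]
  · rw [rotp_snd hpq, sw_snd, sw_snd, rotp_fst, inv_inv]
  · rw [rotp_ne hp hq, sw_ne hp hq, sw_ne hp hq, rotp_ne hp hq]

theorem sw_tw (hpq : p ≠ q) (n : ℂ) (y : ι → ℂ) : sw p q (tw p q n y) = rotp p q n⁻¹ y := by
  rw [tw, sw_rotp hpq, sw_sw]

theorem tw_tw (hpq : p ≠ q) {n : ℂ} (hn : n ≠ 0) (y : ι → ℂ) : tw p q n (tw p q n y) = y := by
  conv_lhs => rw [tw, sw_tw hpq, rotp_rotp hpq, mul_inv_cancel₀ hn, rotp_one]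

theorem tw_rotp (hpq : p ≠ q) (n c : ℂ) (y : ι → ℂ) :
    tw p q n (rotp p q c y) = rotp p q c⁻¹ (tw p q n y) := by
  rw [tw, tw, sw_rotp hpq, rotp_rotp hpq, rotp_rotp hpq, mul_comm]

/-- The data of the normalization of a pair of involutions. -/
structure PairData (p q : ι) (ν : ℂ) (g : (ι → ℂ) → ι → ℂ)
    (P : FormalMultilinearSeries ℂ (ι → ℂ) (ι → ℂ)) (C b ρ θ : ℝ) (s : ENNReal) (r : ℝ)
    (u : ι → AbsSer ι) : Prop where
  ne : p ≠ q
  cb : CoeffBound P C b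
  ad : Adapted ν ρ θ
  ps : HasFPowerSeriesOnBall g P 0 s
  r_pos : 0 < r
  r_le : 4 * b * (2 * r) ≤ 1
  r_lt : ENNReal.ofReal (2 * r) < s
  sol : IsSol P p q ν r u
  small : 4 * (32 * C * b ^ 2) * r ≤ ρ - ‖ν‖
  small' : 4 * (32 * C * b ^ 2) * r ≤ ‖ν‖ / 2

namespace PairData

variable {ν : ℂ} {g : (ι → ℂ) → ι → ℂ} {P : FormalMultilinearSeries ℂ (ι → ℂ) (ι → ℂ)} {C b ρ θ : ℝ}
  {s : ENNReal} {r : ℝ} {u : ι → AbsSer ι} (S : PairData p q ν g P C b ρ θ s r u)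

variable (P r u) in
/-- The normalizing map. -/
def psi (y : ι → ℂ) (i : ι) : ℂ := ev y (pert r u i)

variable (p q ν P r u) in
/-- The series of the multiplier. -/
def ser : AbsSer ι := mult p q ν r (fc P (pert r u) p)

include S

theorem norm_u : ‖u‖ ≤ r := S.sol.norm_le.trans (by linarith [S.r_pos])

theorem norm_h (i : ι) : ‖fc P (pert r u) i‖ ≤ 4 * (32 * C * b ^ 2) * r ^ 2 := by
  refine (norm_fc_le S.cb (by linarith [S.r_pos]) S.r_le (norm_pert_le S.r_pos.le S.norm_u) i).trans
    (le_of_eq ?_)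
  ring

theorem norm_ser_sub : ‖ser p q ν P r u - ν • 1‖ ≤ 4 * (32 * C * b ^ 2) * r := by
  refine (norm_mult_sub_le S.r_pos (S.norm_h p)).trans (le_of_eq ?_)
  have := S.r_pos
  field_simp

theorem norm_ser : ‖ser p q ν P r u‖ ≤ ρ := by
  have h' := norm_le_norm_add_norm_sub' (ser p q ν P r u) (ν • 1)
  rw [norm_smul, norm_one, mul_one] at h'
  linarith [S.norm_ser_sub, S.small]

theorem norm_ev_ser_sub {y : ι → ℂ} (hy : ‖y‖ ≤ 1) : ‖ev y (ser p q ν P r u) - ν‖ ≤ ‖ν‖ / 2 := by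
  have h1 := (norm_ev_le hy (ser p q ν P r u - ν • 1)).trans (S.norm_ser_sub.trans S.small')
  rwa [← evHom_apply y hy, map_sub, evHom_apply, evHom_apply, ev_smul, ev_one, mul_one] at h1

theorem ev_ser_ne_zero {y : ι → ℂ} (hy : ‖y‖ ≤ 1) : ev y (ser p q ν P r u) ≠ 0 := by
  intro h
  have := S.norm_ev_ser_sub hy
  rw [h, zero_sub, norm_neg] at this
  linarith [S.ad.pos]

theorem ev_ser {y : ι → ℂ} (hy : ‖y‖ ≤ 1) :
    r * (ev y (ser p q ν P r u) - ν) = ev y (divq p q (fc P (pert r u) p)) := by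
  have hr : (r : ℂ) ≠ 0 := by exact_mod_cast S.r_pos.ne'
  rw [ser, mult, ev_add hy, ev_smul, ev_smul, ev_one, mul_one, add_sub_cancel_left,
    mul_inv_cancel_left₀ hr]

theorem ev_ser_rotp {c : ℂ} (hc : c ≠ 0) {y : ι → ℂ} (hy : ‖y‖ ≤ 1) (hy' : ‖rotp p q c y‖ ≤ 1) :
    ev (rotp p q c y) (ser p q ν P r u) = ev y (ser p q ν P r u) := by
  rw [ser, mult, ev_add hy, ev_add hy', ev_smul, ev_smul, ev_smul, ev_smul, ev_one, ev_one,
    ev_rotp_divq S.ne hc]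

theorem ev_ser_sw {y : ι → ℂ} (hy : ‖y‖ ≤ 1) :
    ev (sw p q y) (ser p q ν P r u) = ev y (ser p q ν P r u) := by
  have h : ev (sw p q y) (divq p q (fc P (pert r u) p)) = ev y (divq p q (fc P (pert r u) p)) :=
    ev_swap_divq _ _
  rw [ser, mult, ev_add hy, ev_add ((norm_sw_le y).trans hy), ev_smul, ev_smul, ev_smul, ev_smul,
    ev_one, ev_one, h]

theorem ev_fc {y : ι → ℂ} (hy : ‖y‖ ≤ 1) (i : ι) : ev y (fc P (pert r u) i) = g (psi r u y) i :=
  map_fc S.cb (evHom y hy) (fun x => norm_ev_le hy x) S.ps (by linarith [S.r_pos]) S.r_le S.r_lt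
    (norm_pert_le S.r_pos.le S.norm_u) i

theorem norm_psi_le {y : ι → ℂ} (hy : ‖y‖ ≤ 1) : ‖psi r u y‖ ≤ 2 * r :=
  (pi_norm_le_iff_of_nonneg (by linarith [S.r_pos])).2 fun i => (norm_ev_le hy _).trans
    ((norm_le_pi_norm _ i).trans (norm_pert_le S.r_pos.le S.norm_u))

theorem psi_eq {y : ι → ℂ} (hy : ‖y‖ ≤ 1) (i : ι) : psi r u y i = r * y i + ev y (u i) := by
  rw [psi, pert, ev_add hy, ev_smul, ev_X]

theorem u_snd : u q = multOp p q (coefV ν (ser p q ν P r u)) (fc P (pert r u) p) := by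
  conv_lhs => rw [S.sol.eq]
  simp [step, ser]

theorem u_fst : u p = exch p q (u q) := by
  rw [S.u_snd]
  conv_lhs => rw [S.sol.eq]
  simp [step, S.ne, ser]

theorem u_ne {i : ι} (hp : i ≠ p) (hq : i ≠ q) :
    u i = multOp p q (coefX (ser p q ν P r u)) (fc P (pert r u) i) +
      exch p q (multOp p q (coefX (ser p q ν P r u)) (fc P (pert r u) i)) := by
  conv_lhs => rw [S.sol.eq]
  simp [step, hp, hq, ser]

theorem psi_sw {y : ι → ℂ} (hy : ‖y‖ ≤ 1) : psi r u (sw p q y) p = psi r u y q := by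
  rw [S.psi_eq hy, S.psi_eq ((norm_sw_le y).trans hy), sw_fst, S.u_fst]
  have : ev (sw p q y) (exch p q (u q)) = ev (sw p q (sw p q y)) (u q) := ev_exch _ _
  rw [this, sw_sw]

theorem psi_sw' {y : ι → ℂ} (hy : ‖y‖ ≤ 1) {i : ι} (hp : i ≠ p) (hq : i ≠ q) :
    psi r u (sw p q y) i = psi r u y i := by
  have hy' := (norm_sw_le (p := p) (q := q) y).trans hy
  rw [S.psi_eq hy, S.psi_eq hy', sw_ne hp hq, S.u_ne hp hq, ev_add hy, ev_add hy']
  have h : ∀ (y : ι → ℂ) (f : AbsSer ι), ev y (exch p q f) = ev (sw p q y) f := fun y f => ev_exch _ _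
  rw [h, h, sw_sw, add_comm (ev (sw p q y) _)]

theorem psi_tw {y : ι → ℂ} (hy : ‖y‖ ≤ 1) (hy' : ‖tw p q (ev y (ser p q ν P r u)) y‖ ≤ 1) :
    psi r u (tw p q (ev y (ser p q ν P r u)) y) p = ν * psi r u y q + g (psi r u y) p := by
  obtain ⟨C₀, L, -, -, hbd, -⟩ := S.ad.exists_bounds (ι := ι)
  set N := ser p q ν P r u with hNdef
  set n := ev y N with hn
  have hn0 : n ≠ 0 := S.ev_ser_ne_zero hy
  set m := rotp p q n⁻¹ y with hm
  have hm1 : ‖m‖ ≤ 1 := by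
    rw [hm, ← sw_tw S.ne]; exact (norm_sw_le _).trans hy'
  have h1 : psi r u (tw p q n y) p = psi r u m q := by
    rw [← sw_sw (p := p) (q := q) (tw p q n y), sw_tw S.ne, S.psi_sw hm1]
  have hmN : ev m N = ev y N := S.ev_ser_rotp (inv_ne_zero hn0) hy hm1
  rw [h1, S.psi_eq hm1, S.psi_eq hy, S.u_snd, hm, rotp_snd S.ne, inv_inv, ← hm, ← S.ev_fc hy]
  set h := fc P (pert r u) p with hh
  have s1 := hasSum_ev_multOp (p := p) (q := q) (fun k => (hbd N S.norm_ser k).1) h hm1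
  have s2 := (hasSum_ev_multOp (p := p) (q := q) (fun k => (hbd N S.norm_ser k).1) h hy).mul_left ν
  have s3 := s1.sub s2
  have s4 := (hasSum_ev_proj (p := p) (q := q) h hy).update (-1) 0
  have hterm : (fun k => ev m (coefV ν N k) * ev m (proj p q k h) -
      ν * (ev y (coefV ν N k) * ev y (proj p q k h))) =
      Function.update (fun k => ev y (proj p q k h)) (-1) 0 := by
    ext k
    rw [S.ad.ev_coefV_congr S.norm_ser hm1 hy hmN k, hm, ev_rotp_proj S.ne (inv_ne_zero hn0)]
    have h5 := S.ad.ev_coefV S.norm_ser hy hn0 k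
    have h6 : ev y (coefV ν N k) * (n⁻¹ ^ k * ev y (proj p q k h)) -
        ν * (ev y (coefV ν N k) * ev y (proj p q k h)) =
        ev y (coefV ν N k) * (n⁻¹ ^ k - ν) * ev y (proj p q k h) := by ring
    rw [h6, h5, Function.update_apply]
    split_ifs <;> simp
  rw [hterm] at s3
  have h7 := s3.unique s4
  have h8 := ev_divq S.ne h y
  rw [← S.ev_ser hy] at h8
  linear_combination h7 + h8

theorem hasSum_defect {y : ι → ℂ} (hy : ‖y‖ ≤ 1) (hy' : ‖tw p q (ev y (ser p q ν P r u)) y‖ ≤ 1)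
    {i : ι} (hp : i ≠ p) (hq : i ≠ q) :
    HasSum (fun k : ℤ => if k ≤ 0 then ev y (proj p q k (fc P (pert r u) i))
        else ev (tw p q (ev y (ser p q ν P r u)) y) (proj p q k (fc P (pert r u) i)))
      (psi r u y i + g (psi r u y) i - psi r u (tw p q (ev y (ser p q ν P r u)) y) i) := by
  obtain ⟨C₀, L, -, -, hbd, -⟩ := S.ad.exists_bounds (ι := ι)
  set N := ser p q ν P r u with hNdef
  set n := ev y N with hn
  have hn0 : n ≠ 0 := S.ev_ser_ne_zero hy
  set m := rotp p q n⁻¹ y with hm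
  set w := tw p q n y with hw
  have hm1 : ‖m‖ ≤ 1 := by
    rw [hm, ← sw_tw S.ne]; exact (norm_sw_le _).trans hy'
  have hs1 : ‖sw p q y‖ ≤ 1 := (norm_sw_le y).trans hy
  have hmN : ev m N = ev y N := S.ev_ser_rotp (inv_ne_zero hn0) hy hm1
  have hsN : ev (sw p q y) N = ev y N := S.ev_ser_sw hy
  have hwN : ev w N = ev y N := by
    rw [hw, tw, S.ev_ser_rotp hn0 hs1 hy', hsN]
  set h := fc P (pert r u) i with hh
  have t1 := hasSum_ev_multOp (p := p) (q := q) (fun k => (hbd N S.norm_ser k).2) h hy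
  have t2 := hasSum_ev_multOp (p := p) (q := q) (fun k => (hbd N S.norm_ser k).2) h hs1
  have t3 := hasSum_ev_multOp (p := p) (q := q) (fun k => (hbd N S.norm_ser k).2) h hm1
  have t4 := hasSum_ev_multOp (p := p) (q := q) (fun k => (hbd N S.norm_ser k).2) h hy'
  have t5 := hasSum_ev_proj (p := p) (q := q) h hy
  have t := (t5.add ((t1.add t2).sub (t3.add t4)))
  have hex : ∀ (y : ι → ℂ) (f : AbsSer ι), ev y (exch p q f) = ev (sw p q y) f := fun y f => ev_exch _ _
  have hval : psi r u y i + g (psi r u y) i - psi r u w i = ev y h +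
      (ev y (multOp p q (coefX N) h) + ev (sw p q y) (multOp p q (coefX N) h) -
        (ev m (multOp p q (coefX N) h) + ev w (multOp p q (coefX N) h))) := by
    have hwi : w i = y i := by rw [hw, tw, rotp_ne hp hq, sw_ne hp hq]
    have hswm : sw p q w = m := sw_tw S.ne n y
    rw [S.psi_eq hy, S.psi_eq hy', S.u_ne hp hq, ← S.ev_fc hy, ev_add hy, ev_add hy', hex, hex, hswm,
      hwi]
    ring
  rw [hval]
  refine (congrArg (HasSum · _) (funext fun k => ?_)).mpr t
  have hsw : ev (sw p q y) (proj p q k h) = n⁻¹ ^ k * ev w (proj p q k h) := by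
    rw [hw, tw, ev_rotp_proj S.ne hn0, ← mul_assoc, ← mul_zpow, inv_mul_cancel₀ hn0, one_zpow, one_mul]
  rw [S.ad.ev_coefX_congr S.norm_ser hm1 hy hmN k, S.ad.ev_coefX_congr S.norm_ser hs1 hy hsN k,
    S.ad.ev_coefX_congr S.norm_ser hy' hy hwN k, hm, ev_rotp_proj S.ne (inv_ne_zero hn0), hsw]
  have h5 := S.ad.ev_coefX S.norm_ser hy hn0 k
  have h6 : ev y (proj p q k h) + (ev y (coefX N k) * ev y (proj p q k h) +
      ev y (coefX N k) * (n⁻¹ ^ k * ev w (proj p q k h)) -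
      (ev y (coefX N k) * (n⁻¹ ^ k * ev y (proj p q k h)) + ev y (coefX N k) * ev w (proj p q k h))) =
      ev y (proj p q k h) - ev y (coefX N k) * (n⁻¹ ^ k - 1) * ev y (proj p q k h) +
        ev y (coefX N k) * (n⁻¹ ^ k - 1) * ev w (proj p q k h) := by ring
  rw [h6, h5]
  by_cases hk : 0 < k
  · rw [if_pos hk, if_neg (by omega)]; ring
  · rw [if_neg hk, if_pos (by omega)]; ring

end PairData

end AbsSer

end

section

/-! ### Fourier series -/

theorem expi_zero : expi 0 = 1 := by simp [expi]

theorem conj_expi (t : ℝ) : conj (expi t) = (expi t)⁻¹ := by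
  rw [Complex.inv_def, Complex.normSq_eq_norm_sq, norm_expi]; simp

theorem expi_zpow (t : ℝ) (k : ℤ) : expi t ^ k = expi (k * t) := by
  rw [expi, expi, ← Complex.exp_int_mul]; congr 1; push_cast; ring

theorem norm_expi_zpow (t : ℝ) (k : ℤ) : ‖expi t ^ k‖ = 1 := by
  rw [norm_zpow, norm_expi, one_zpow]

theorem continuous_expi_zpow (k : ℤ) : Continuous fun t => expi t ^ k := by
  simp_rw [expi_zpow]
  exact continuous_expi.comp (by fun_prop)

theorem integral_expi_zpow (k : ℤ) :
    ∫ t in (0 : ℝ)..2 * Real.pi, expi t ^ k = if k = 0 then 2 * Real.pi else 0 := by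
  split_ifs with h
  · simp [h]
  · have hk : (k : ℂ) * Complex.I ≠ 0 := mul_ne_zero (by exact_mod_cast h) Complex.I_ne_zero
    have h1 := integral_exp_mul_complex (a := 0) (b := 2 * Real.pi) hk
    have h2 : Complex.exp (k * Complex.I * ((2 * Real.pi : ℝ) : ℂ)) = 1 := by
      rw [Complex.exp_eq_one_iff]
      exact ⟨k, by push_cast; ring⟩
    rw [h2] at h1
    simp only [Complex.ofReal_zero, mul_zero, Complex.exp_zero, sub_self, zero_div] at h1
    rw [Complex.ofReal_zero]
    refine Eq.trans (intervalIntegral.integral_congr fun t _ => ?_) h1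
    simp only [expi_zpow]
    rw [expi]
    congr 1; push_cast; ring

/-- The zeroth Fourier coefficient of an absolutely convergent trigonometric series. -/
theorem integral_trig {X : Type*} [Countable X] (c : X → ℂ) (k : X → ℤ) (hc : Summable fun x => ‖c x‖) :
    HasSum (fun x => if k x = 0 then c x * (2 * Real.pi) else 0)
      (∫ t in (0 : ℝ)..2 * Real.pi, ∑' x, c x * expi t ^ k x) := by
  have h := intervalIntegral.hasSum_intervalIntegral_of_summable_norm (a := 0) (b := 2 * Real.pi)
    (f := fun x => (⟨fun t => c x * expi t ^ k x, (continuous_expi_zpow _).const_mul _⟩ : C(ℝ, ℂ))) ?_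
  · refine (congrArg (HasSum · _) (funext fun x => ?_)).mpr h
    simp only [ContinuousMap.coe_mk]
    rw [intervalIntegral.integral_const_mul, integral_expi_zpow]
    split_ifs <;> simp
  · refine Summable.of_nonneg_of_le (fun _ => norm_nonneg _) (fun x => ?_) hc
    refine (ContinuousMap.norm_le _ (norm_nonneg _)).2 fun t => ?_
    simp only [ContinuousMap.coe_mk, ContinuousMap.restrict_apply, norm_mul, norm_expi_zpow, mul_one,
      le_refl]

theorem continuous_trig {c : ℤ → ℂ} (hc : Summable fun k => ‖c k‖) :
    Continuous fun t => ∑' k, c k * expi t ^ k :=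
  continuous_tsum (fun k => (continuous_expi_zpow k).const_mul _) hc fun k t => by
    rw [norm_mul, norm_expi_zpow, mul_one]

theorem summable_trig {c : ℤ → ℂ} (hc : Summable fun k => ‖c k‖) (t : ℝ) :
    Summable fun k => ‖c k * expi t ^ k‖ := by
  simpa only [norm_mul, norm_expi_zpow, mul_one] using hc

theorem integral_norm_sq_le {β β' : ℤ → ℂ} (h : Summable fun k => ‖β k‖) (h' : Summable fun k => ‖β' k‖)
    (h1 : ∀ k, 0 < k → β k = 0) (h2 : ∀ k, k < 0 → β' k = 0) (h0 : β 0 = β' 0) :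
    ∫ t in (0 : ℝ)..2 * Real.pi, ‖∑' k, β k * expi t ^ k‖ ^ 2 ≤
      ∫ t in (0 : ℝ)..2 * Real.pi, ‖∑' k, β k * expi t ^ k + ∑' k, β' k * expi t ^ k‖ ^ 2 := by
  set a : ℝ → ℂ := fun t => ∑' k, β k * expi t ^ k with ha
  set b : ℝ → ℂ := fun t => ∑' k, β' k * expi t ^ k with hb
  have hac : Continuous a := continuous_trig h
  have hbc : Continuous b := continuous_trig h'
  have hprod : ∀ t, a t * conj (b t) = ∑' x : ℤ × ℤ, (β x.1 * conj (β' x.2)) * expi t ^ (x.1 - x.2) := by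
    intro t
    have hcb : conj (b t) = ∑' k, conj (β' k) * expi t ^ (-k) := by
      rw [hb, Complex.conj_tsum]
      refine tsum_congr fun k => ?_
      rw [map_mul, map_zpow₀, conj_expi, inv_zpow']
    rw [hcb, ha]
    have hs : Summable fun k => ‖conj (β' k) * expi t ^ (-k)‖ := by
      simpa only [norm_mul, norm_expi_zpow, mul_one, RCLike.norm_conj] using h'
    rw [tsum_mul_tsum_of_summable_norm (summable_trig h t) hs]
    refine tsum_congr fun x => ?_
    rw [sub_eq_add_neg, zpow_add₀ (expi_ne_zero t)]
    ring
  have hsum : Summable fun x : ℤ × ℤ => ‖β x.1 * conj (β' x.2)‖ := by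
    have := summable_mul_of_summable_norm (f := fun k => (‖β k‖ : ℝ)) (g := fun k => (‖β' k‖ : ℝ))
      (by simpa using h) (by simpa using h')
    simpa [norm_mul] using this
  have hint : ∫ t in (0 : ℝ)..2 * Real.pi, a t * conj (b t) = β 0 * conj (β' 0) * (2 * Real.pi) := by
    have h3 := integral_trig (fun x : ℤ × ℤ => β x.1 * conj (β' x.2)) (fun x => x.1 - x.2) hsum
    rw [intervalIntegral.integral_congr fun t _ => hprod t]
    refine h3.unique ?_
    have h4 := hasSum_single (f := fun x : ℤ × ℤ => if x.1 - x.2 = 0 then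
      β x.1 * conj (β' x.2) * (2 * Real.pi : ℂ) else 0) (0, 0) (fun x hx => ?_)
    · simpa using h4
    · split_ifs with h5
      · rcases lt_trichotomy x.1 0 with h6 | h6 | h6
        · rw [h2 x.2 (by omega)]; simp
        · exact absurd (Prod.ext h6 (by simp; omega)) hx
        · rw [h1 _ h6]; simp
      · rfl
  have hre : 0 ≤ ∫ t in (0 : ℝ)..2 * Real.pi, (a t * conj (b t)).re := by
    have h5 : ∫ t in (0 : ℝ)..2 * Real.pi, (a t * conj (b t)).re =
        (∫ t in (0 : ℝ)..2 * Real.pi, a t * conj (b t)).re := by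
      have h6 : IntervalIntegrable (fun t => a t * conj (b t)) MeasureTheory.volume 0 (2 * Real.pi) :=
        (hac.mul (Complex.continuous_conj.comp hbc)).intervalIntegrable _ _
      exact Complex.reCLM.intervalIntegral_comp_comm h6
    rw [h5, hint, h0, Complex.mul_conj]
    norm_cast
    have := Complex.normSq_nonneg (β' 0)
    have := Real.pi_pos
    positivity
  have hle : ∀ t, ‖a t‖ ^ 2 + 2 * (a t * conj (b t)).re ≤ ‖a t + b t‖ ^ 2 := by
    intro t
    rw [← Complex.normSq_eq_norm_sq, ← Complex.normSq_eq_norm_sq, Complex.normSq_add]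
    linarith [Complex.normSq_nonneg (b t)]
  have hc1 : Continuous fun t => ‖a t‖ ^ 2 := hac.norm.pow 2
  have hc2 : Continuous fun t => 2 * (a t * conj (b t)).re :=
    (Complex.continuous_re.comp (hac.mul (Complex.continuous_conj.comp hbc))).const_mul 2
  have hpi : (0 : ℝ) ≤ 2 * Real.pi := by positivity
  have hmono := intervalIntegral.integral_mono (μ := MeasureTheory.volume) hpi ((hc1.add hc2).intervalIntegrable _ _)
    (((hac.add hbc).norm.pow 2).intervalIntegrable _ _) hle
  simp only [Pi.add_apply, Pi.pow_apply] at hmono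
  rw [intervalIntegral.integral_add (hc1.intervalIntegrable _ _) (hc2.intervalIntegrable _ _),
    intervalIntegral.integral_const_mul] at hmono
  change ∫ t in (0 : ℝ)..2 * Real.pi, ‖a t‖ ^ 2 ≤ ∫ t in (0 : ℝ)..2 * Real.pi, ‖a t + b t‖ ^ 2
  linarith

namespace AbsSer

variable {ι : Type*} [Fintype ι] [DecidableEq ι] {p q : ι}

theorem norm_rotp_le {c : ℂ} (hc : ‖c‖ = 1) (y : ι → ℂ) : ‖rotp p q c y‖ ≤ ‖y‖ := by
  refine (pi_norm_le_iff_of_nonneg (norm_nonneg _)).2 fun i => ?_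
  have := norm_le_pi_norm y i
  unfold rotp
  split_ifs <;> simpa [norm_mul, hc] using this

theorem norm_tw_le {n : ℂ} {K : ℝ} (hK : 1 ≤ K) (h1 : ‖n‖ ≤ K) (h2 : ‖n⁻¹‖ ≤ K) (y : ι → ℂ) :
    ‖tw p q n y‖ ≤ K * ‖y‖ := by
  refine (pi_norm_le_iff_of_nonneg (by positivity)).2 fun i => ?_
  have := norm_le_pi_norm y (Equiv.swap p q i)
  have hn := norm_nonneg (y (Equiv.swap p q i))
  have key : ∀ a : ℂ, ‖a‖ ≤ K → ‖a * y (Equiv.swap p q i)‖ ≤ K * ‖y‖ := fun a ha => by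
    rw [norm_mul]; gcongr
  unfold tw rotp sw
  split_ifs
  · exact key _ h1
  · exact key _ h2
  · simpa using key 1 (by simpa using hK)

theorem continuous_ev_rotp {z : ι → ℂ} (hz : ‖z‖ < 1) (f : AbsSer ι) {e : ℝ → ℂ} (he : Continuous e)
    (h1 : ∀ t, ‖e t‖ = 1) : Continuous fun t => ev (rotp p q (e t) z) f := by
  have hc : Continuous fun t => rotp p q (e t) z := by
    refine continuous_pi fun i => ?_
    unfold rotp
    split_ifs
    · exact he.mul continuous_const
    · exact (he.inv₀ fun t ht => by simpa [ht] using h1 t).mul continuous_const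
    · exact continuous_const
  refine continuous_iff_continuousAt.2 fun t => ?_
  have h2 : rotp p q (e t) z ∈ Metric.ball (0 : ι → ℂ) 1 := by
    rw [mem_ball_zero_iff]; exact (norm_rotp_le (h1 t) z).trans_lt hz
  exact ContinuousAt.comp (f := fun t => rotp p q (e t) z) (analyticAt_ev f _ h2).continuousAt hc.continuousAt

/-- The `L²` estimate along an orbit. -/
theorem integral_orbit_le (hpq : p ≠ q) (h : AbsSer ι) {y w : ι → ℂ} (hy1 : ‖y‖ ≤ 1) (hw1 : ‖w‖ ≤ 1)
    (h0 : ev w (proj p q 0 h) = ev y (proj p q 0 h)) {a b : ℝ → ℂ}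
    (ha : ∀ t, HasSum (fun k : ℤ => if k ≤ 0 then ev (rotp p q (expi t) y) (proj p q k h)
        else ev (rotp p q (expi t)⁻¹ w) (proj p q k h)) (a t))
    (hb : ∀ t, HasSum (fun k : ℤ => if k ≤ 0 then ev (rotp p q (expi t)⁻¹ w) (proj p q k h)
        else ev (rotp p q (expi t) y) (proj p q k h)) (b t)) :
    Continuous (fun t => a t + b t) ∧
      ∫ t in (0 : ℝ)..2 * Real.pi, ‖a t‖ ^ 2 ≤ ∫ t in (0 : ℝ)..2 * Real.pi, ‖a t + b t‖ ^ 2 := by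
  set β : ℤ → ℂ := fun k => (if k ≤ 0 then ev y (proj p q k h) else 0) +
    (if -k ≤ 0 then 0 else ev w (proj p q (-k) h)) with hβ
  set β' : ℤ → ℂ := fun k => (if k ≤ 0 then 0 else ev y (proj p q k h)) +
    (if -k ≤ 0 then ev w (proj p q (-k) h) else 0) with hβ'
  have sh : Summable fun k => ‖proj p q k h‖ := (hasSum_norm_proj h).summable
  have bd : ∀ c : ℤ → ℂ, (∀ k, ‖c k‖ ≤ ‖proj p q k h‖) → Summable (fun k => ‖c k‖) ∧
      Summable fun k => ‖c (-k)‖ := fun c hc => by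
    have h1 := Summable.of_nonneg_of_le (fun _ => norm_nonneg _) hc sh
    exact ⟨h1, (Equiv.neg ℤ).summable_iff.2 h1⟩
  have n1 : ∀ k, ‖ev y (proj p q k h)‖ ≤ ‖proj p q k h‖ := fun k => norm_ev_le hy1 _
  have n2 : ∀ k, ‖ev w (proj p q k h)‖ ≤ ‖proj p q k h‖ := fun k => norm_ev_le hw1 _
  have s1 := bd (fun k => if k ≤ 0 then ev y (proj p q k h) else 0) fun k => by
    split_ifs; exacts [n1 k, by simp]
  have s2 := bd (fun k => if k ≤ 0 then 0 else ev w (proj p q k h)) fun k => by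
    split_ifs; exacts [by simp, n2 k]
  have s3 := bd (fun k => if k ≤ 0 then 0 else ev y (proj p q k h)) fun k => by
    split_ifs; exacts [by simp, n1 k]
  have s4 := bd (fun k => if k ≤ 0 then ev w (proj p q k h) else 0) fun k => by
    split_ifs; exacts [n2 k, by simp]
  have sβ : Summable fun k => ‖β k‖ :=
    Summable.of_nonneg_of_le (fun _ => norm_nonneg _) (fun k => norm_add_le _ _) (s1.1.add s2.2)
  have sβ' : Summable fun k => ‖β' k‖ :=
    Summable.of_nonneg_of_le (fun _ => norm_nonneg _) (fun k => norm_add_le _ _) (s3.1.add s4.2)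
  have hsplit : ∀ (t : ℝ) (a c : ℤ → ℂ) (v : ℂ),
      Summable (fun k => ‖a k‖) → Summable (fun k => ‖c (-k)‖) →
      HasSum (fun k => a k * expi t ^ k + c k * (expi t)⁻¹ ^ k) v →
      v = ∑' k, (a k + c (-k)) * expi t ^ k := by
    intro t a c v ha hc hv
    have s1 : Summable fun k => a k * expi t ^ k := (summable_trig ha t).of_norm
    have s2 : Summable fun k => c (-k) * expi t ^ k := (summable_trig hc t).of_norm
    have s3 : HasSum (fun k => c k * (expi t)⁻¹ ^ k) (∑' k, c (-k) * expi t ^ k) := by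
      rw [← (Equiv.neg ℤ).hasSum_iff]
      refine (congrArg (HasSum · _) (funext fun k => ?_)).mpr s2.hasSum
      simp [Function.comp]
    rw [hv.unique (s1.hasSum.add s3), ← s1.tsum_add s2]
    exact tsum_congr fun k => by ring
  have e1 : ∀ t, a t = ∑' k, β k * expi t ^ k := fun t => by
    refine hsplit t (fun k => if k ≤ 0 then ev y (proj p q k h) else 0)
      (fun k => if k ≤ 0 then 0 else ev w (proj p q k h)) _ s1.1 s2.2 ?_
    refine (congrArg (HasSum · _) (funext fun k => ?_)).mpr (ha t)
    split_ifs with hk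
    · rw [ev_rotp_proj hpq (expi_ne_zero t)]; ring
    · rw [ev_rotp_proj hpq (inv_ne_zero (expi_ne_zero t))]; ring
  have e2 : ∀ t, b t = ∑' k, β' k * expi t ^ k := fun t => by
    refine hsplit t (fun k => if k ≤ 0 then 0 else ev y (proj p q k h))
      (fun k => if k ≤ 0 then ev w (proj p q k h) else 0) _ s3.1 s4.2 ?_
    refine (congrArg (HasSum · _) (funext fun k => ?_)).mpr (hb t)
    split_ifs with hk
    · rw [ev_rotp_proj hpq (inv_ne_zero (expi_ne_zero t))]; ring
    · rw [ev_rotp_proj hpq (expi_ne_zero t)]; ring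
  have h4 := integral_norm_sq_le sβ sβ'
    (fun k hk => by simp only [hβ]; rw [if_neg (by omega), if_pos (by omega), add_zero])
    (fun k hk => by simp only [hβ']; rw [if_pos (by omega), if_neg (by omega), add_zero])
    (by simp [hβ, hβ', h0])
  constructor
  · simp only [e1, e2]
    exact (continuous_trig sβ).add (continuous_trig sβ')
  · simpa only [e1, e2] using h4

variable (p q) in
/-- The linear map `x_p ↦ ν x_q`, `x_q ↦ ν⁻¹ x_p`. -/
def invLin (ν : ℂ) (x : ι → ℂ) (i : ι) : ℂ :=
  if i = p then ν * x q else if i = q then ν⁻¹ * x p else x i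

namespace PairData

variable {ν : ℂ} {g : (ι → ℂ) → ι → ℂ} {P : FormalMultilinearSeries ℂ (ι → ℂ) (ι → ℂ)} {C b ρ θ : ℝ}
  {s : ENNReal} {r : ℝ} {u : ι → AbsSer ι} (S : PairData p q ν g P C b ρ θ s r u)

include S

theorem norm_g_sub_le {x x' : ι → ℂ} (hx : ‖x‖ ≤ 2 * r) (hx' : ‖x'‖ ≤ 2 * r) (i : ι) :
    ‖g x i - g x' i‖ ≤ 64 * C * b ^ 2 * r * ‖x - x'‖ := by
  have hr : 0 ≤ 2 * r := by linarith [S.r_pos]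
  have key : ∀ x : ι → ℂ, ‖x‖ ≤ 2 * r → fc P x i = g x i := fun x hx =>
    map_fc S.cb (AlgHom.id ℂ ℂ) (fun _ => le_rfl) S.ps hr S.r_le S.r_lt hx i
  rw [← key x hx, ← key x' hx']
  refine (norm_fc_sub_le S.cb hr S.r_le hx hx' i).trans (le_of_eq (by ring))

set_option maxHeartbeats 1000000 in
/-- The normalizing map solves the functional equation. -/
theorem psi_conj (hcard : (Fintype.card ι : ℝ) * (64 * C * b ^ 2 * r / ‖ν‖) ^ 2 < 1)
    (hinv : ∀ᶠ x in 𝓝 (0 : ι → ℂ),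
      invLin p q ν (invLin p q ν x + g x) + g (invLin p q ν x + g x) = x) :
    ∀ᶠ y in 𝓝 (0 : ι → ℂ), invLin p q ν (psi r u y) + g (psi r u y) =
      psi r u (tw p q (ev y (ser p q ν P r u)) y) := by
  set N := ser p q ν P r u with hNdef
  have hν := S.ad.pos
  have hν1 : ‖ν‖ < 1 := S.ad.lt.trans S.ad.lt_one
  have hpan : AnalyticAt ℂ (psi r u) 0 := analyticAt_pi_iff.2 fun i => analyticAt_ev _ 0 (by simp)
  have hp0 : psi r u 0 = 0 := by
    ext i
    rw [S.psi_eq (by simp), S.sol.zero]; simp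
  set A : (ι → ℂ) → ι → ℂ := fun x => invLin p q ν x + g x with hA
  have hgan : AnalyticAt ℂ g 0 := ⟨P, s, S.ps⟩
  have hg0 : g 0 = 0 := by
    have := S.ps.coeff_zero (fun _ => 0)
    rw [← this, S.cb.zero]; rfl
  have hlin : Continuous (invLin p q ν : (ι → ℂ) → ι → ℂ) := by
    refine continuous_pi fun i => ?_
    unfold invLin
    split_ifs <;> fun_prop
  have hA0 : A 0 = 0 := by
    ext i; simp [hA, hg0, invLin]
  have hAt : Tendsto A (𝓝 0) (𝓝 0) := by
    have : ContinuousAt A 0 := hlin.continuousAt.add hgan.continuousAt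
    have h := this.tendsto
    rwa [hA0] at h
  have hpt : Tendsto (psi r u) (𝓝 0) (𝓝 0) := AnalyticAt.tendsto_zero hpan hp0
  set K : ℝ := 2 + 2 / ‖ν‖ with hK
  have hKn : 2 / ‖ν‖ ≤ K ∧ 2 ≤ K := by
    have : 0 < 2 / ‖ν‖ := by positivity
    constructor <;> linarith
  have hnb : ∀ y : ι → ℂ, ‖y‖ ≤ 1 → ‖tw p q (ev y N) y‖ ≤ K * ‖y‖ := by
    intro y hy
    have h1 := S.norm_ev_ser_sub hy
    have h2 : ‖ev y N‖ ≤ K := by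
      have := norm_le_norm_add_norm_sub' (ev y N) ν
      linarith
    have h3 : ‖ν‖ / 2 ≤ ‖ev y N‖ := by
      have := norm_le_norm_add_norm_sub' ν (ev y N)
      rw [norm_sub_rev] at this
      linarith
    refine norm_tw_le (by linarith) h2 ?_ y
    rw [norm_inv]
    refine le_trans (inv_anti₀ (by positivity) h3) ?_
    rw [inv_div]; exact hKn.1
  have hev : ∀ᶠ y in 𝓝 (0 : ι → ℂ), A (A (psi r u y)) = psi r u y ∧ ‖A (psi r u y)‖ ≤ 2 * r ∧
      ‖y‖ * K < 1 := by
    have e1 := hpt.eventually hinv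
    have e2 := (hAt.comp hpt).eventually (Metric.closedBall_mem_nhds (0 : ι → ℂ)
      (show 0 < 2 * r by linarith [S.r_pos]))
    have e3 : ∀ᶠ y : ι → ℂ in 𝓝 0, ‖y‖ * K < 1 := by
      have : Tendsto (fun y : ι → ℂ => ‖y‖ * K) (𝓝 0) (𝓝 (‖(0 : ι → ℂ)‖ * K)) :=
        (continuous_norm.tendsto 0).mul_const K
      rw [norm_zero, zero_mul] at this
      exact this.eventually_lt_const one_pos
    filter_upwards [e1, e2, e3] with y h1 h2 h3
    exact ⟨h1, by simpa using h2, h3⟩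
  obtain ⟨R, hR, hball⟩ := Metric.eventually_nhds_iff_ball.1 hev
  refine Metric.eventually_nhds_iff_ball.2 ⟨R, hR, fun y hy => ?_⟩
  rw [mem_ball_zero_iff] at hy
  have hB : ∀ z : ι → ℂ, ‖z‖ ≤ ‖y‖ → A (A (psi r u z)) = psi r u z ∧ ‖A (psi r u z)‖ ≤ 2 * r ∧
      ‖z‖ < 1 ∧ ‖tw p q (ev z N) z‖ < 1 := by
    intro z hz
    obtain ⟨h1, h2, h3⟩ := hball z (by rw [mem_ball_zero_iff]; linarith)
    have h4 : ‖z‖ < 1 := by nlinarith [norm_nonneg z]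
    exact ⟨h1, h2, h4, (hnb z h4.le).trans_lt (by linarith)⟩
  set D : (ι → ℂ) → ι → ℂ := fun z => A (psi r u z) - psi r u (tw p q (ev z N) z) with hD
  set δ := 64 * C * b ^ 2 * r with hδ
  have hδ0 : 0 ≤ δ := by
    have := S.cb.b_pos; have := S.cb.C_nonneg; have := S.r_pos
    positivity
  have htwN : ∀ z : ι → ℂ, ‖z‖ ≤ ‖y‖ → ev (tw p q (ev z N) z) N = ev z N := by
    intro z hz
    obtain ⟨-, -, h3, h4⟩ := hB z hz
    rw [tw, S.ev_ser_rotp (S.ev_ser_ne_zero h3.le) ((norm_sw_le z).trans h3.le) h4.le, S.ev_ser_sw h3.le]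
  have hDp : ∀ z : ι → ℂ, ‖z‖ ≤ ‖y‖ → D z p = 0 := by
    intro z hz
    obtain ⟨-, -, h3, h4⟩ := hB z hz
    simp only [hD, hA, Pi.sub_apply, Pi.add_apply]
    rw [S.psi_tw h3.le h4.le]
    simp [invLin]
  have htt : ∀ z : ι → ℂ, ‖z‖ ≤ ‖y‖ →
      tw p q (ev (tw p q (ev z N) z) N) (tw p q (ev z N) z) = z := by
    intro z hz
    rw [htwN z hz, tw_tw S.ne (S.ev_ser_ne_zero (hB z hz).2.2.1.le)]
  have hDD : ∀ z : ι → ℂ, ‖z‖ ≤ ‖y‖ → ∀ i,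
      ‖D (tw p q (ev z N) z) i + invLin p q ν (D z) i‖ ≤ δ * ‖D z‖ := by
    intro z hz i
    obtain ⟨h1, h2, h3, h4⟩ := hB z hz
    set w := tw p q (ev z N) z with hw
    have h5 : D w i + invLin p q ν (D z) i = g (psi r u w) i - g (A (psi r u z)) i := by
      have h6 : D w = A (psi r u w) - A (A (psi r u z)) := by
        simp only [hD]
        rw [htt z hz, h1]
      rw [h6]
      simp only [hA, hD, ← hw, invLin, Pi.sub_apply, Pi.add_apply]
      split_ifs <;> ring
    rw [h5, norm_sub_rev]
    refine (S.norm_g_sub_le h2 (S.norm_psi_le h4.le) i).trans (le_of_eq ?_)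
    rfl
  have hDq : ∀ z : ι → ℂ, ‖z‖ ≤ ‖y‖ → ‖D z q‖ ≤ δ / ‖ν‖ * ‖D z‖ := by
    intro z hz
    have h1 := hDD z hz p
    have h2 : D (tw p q (ev z N) z) p = 0 := by
      obtain ⟨-, h2', h3, h4⟩ := hB z hz
      simp only [hD, hA, Pi.sub_apply, Pi.add_apply]
      rw [S.psi_tw h4.le (by rw [htt z hz]; exact h3.le)]
      simp [invLin]
    rw [h2, zero_add] at h1
    simp only [invLin, if_true] at h1
    rw [norm_mul] at h1
    rw [div_mul_eq_mul_div, le_div_iff₀ hν]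
    linarith
  set rr : ℝ → ι → ℂ := fun t => rotp p q (expi t) y with hrr
  have hrn : ∀ t, ‖rr t‖ ≤ ‖y‖ := fun t => norm_rotp_le (norm_expi t) y
  obtain ⟨-, -, hy1, hw1⟩ := hB y le_rfl
  set w := tw p q (ev y N) y with hw
  have hrN : ∀ t, ev (rr t) N = ev y N := fun t =>
    S.ev_ser_rotp (expi_ne_zero t) hy1.le ((hrn t).trans hy1.le)
  have hrw : ∀ t, tw p q (ev (rr t) N) (rr t) = rotp p q (expi t)⁻¹ w := fun t => by
    rw [hrN, hrr, tw_rotp S.ne]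
  have he : Continuous fun t => (expi t)⁻¹ := continuous_expi.inv₀ expi_ne_zero
  have he1 : ∀ t, ‖(expi t)⁻¹‖ = 1 := fun t => by rw [norm_inv, norm_expi, inv_one]
  have hDc : ∀ i, Continuous fun t => D (rr t) i := by
    intro i
    have c1 : ∀ f, Continuous fun t => ev (rr t) f := fun f =>
      continuous_ev_rotp hy1 f continuous_expi norm_expi
    have c2 : ∀ f, Continuous fun t => ev (rotp p q (expi t)⁻¹ w) f := fun f =>
      continuous_ev_rotp hw1 f he he1
    have c3 : (fun t => D (rr t) i) = fun t => invLin p q ν (psi r u (rr t)) i +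
        ev (rr t) (fc P (pert r u) i) - psi r u (rotp p q (expi t)⁻¹ w) i := by
      ext t
      simp only [hD, hA, Pi.sub_apply, Pi.add_apply]
      rw [hrw, S.ev_fc ((hrn t).trans hy1.le)]
    rw [c3]
    refine (Continuous.add ?_ (c1 _)).sub (c2 _)
    exact (continuous_pi_iff.1 (hlin.comp (continuous_pi fun j => c1 (pert r u j)))) i
  have hpi : (0 : ℝ) < 2 * Real.pi := by positivity
  have hDn : Continuous fun t => ‖D (rr t)‖ ^ 2 := (continuous_pi hDc).norm.pow 2
  set I := ∫ t in (0 : ℝ)..2 * Real.pi, ‖D (rr t)‖ ^ 2 with hI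
  have hδν : δ ≤ δ / ‖ν‖ := by
    rw [le_div_iff₀ hν]; nlinarith
  have hpt : ∀ i, ∫ t in (0 : ℝ)..2 * Real.pi, ‖D (rr t) i‖ ^ 2 ≤ (δ / ‖ν‖) ^ 2 * I := by
    intro i
    rw [hI, ← intervalIntegral.integral_const_mul]
    have bound : ∀ f : ℝ → ℂ, Continuous f → (∀ t, ‖f t‖ ≤ δ / ‖ν‖ * ‖D (rr t)‖) →
        ∫ t in (0 : ℝ)..2 * Real.pi, ‖f t‖ ^ 2 ≤
          ∫ t in (0 : ℝ)..2 * Real.pi, (δ / ‖ν‖) ^ 2 * ‖D (rr t)‖ ^ 2 := by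
      intro f hf hfb
      refine intervalIntegral.integral_mono hpi.le ((hf.norm.pow 2).intervalIntegrable _ _)
        ((hDn.const_mul _).intervalIntegrable _ _) fun t => ?_
      rw [← mul_pow]
      exact pow_le_pow_left₀ (norm_nonneg _) (hfb t) 2
    by_cases hip : i = p
    · refine bound _ (hDc i) fun t => ?_
      rw [hip, hDp _ (hrn t), norm_zero]
      positivity
    by_cases hiq : i = q
    · exact bound _ (hDc i) fun t => by rw [hiq]; exact hDq _ (hrn t)
    set h := fc P (pert r u) i with hh
    have hval : ∀ z : ι → ℂ, ‖z‖ ≤ 1 → ‖tw p q (ev z N) z‖ ≤ 1 →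
        HasSum (fun k : ℤ => if k ≤ 0 then ev z (proj p q k h)
          else ev (tw p q (ev z N) z) (proj p q k h)) (D z i) := by
      intro z h1 h2
      have := S.hasSum_defect h1 h2 hip hiq
      simpa only [hD, hA, Pi.sub_apply, Pi.add_apply, invLin, if_neg hip, if_neg hiq] using this
    have e1 : ∀ t, HasSum (fun k : ℤ => if k ≤ 0 then ev (rotp p q (expi t) y) (proj p q k h)
        else ev (rotp p q (expi t)⁻¹ w) (proj p q k h)) (D (rr t) i) := by
      intro t
      have h1 := hval (rr t) ((hrn t).trans hy1.le) (hB _ (hrn t)).2.2.2.le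
      rwa [hrw t] at h1
    have e2 : ∀ t, HasSum (fun k : ℤ => if k ≤ 0 then ev (rotp p q (expi t)⁻¹ w) (proj p q k h)
        else ev (rotp p q (expi t) y) (proj p q k h)) (D (tw p q (ev (rr t) N) (rr t)) i) := by
      intro t
      have h1 := hval (tw p q (ev (rr t) N) (rr t)) (hB _ (hrn t)).2.2.2.le
        (by rw [htt _ (hrn t)]; exact (hrn t).trans hy1.le)
      rw [htt _ (hrn t)] at h1
      rw [hrw t] at h1 ⊢
      exact h1
    have b0 : ev w (proj p q 0 h) = ev y (proj p q 0 h) := by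
      rw [hw, tw, ev_rotp_proj S.ne (S.ev_ser_ne_zero hy1.le), zpow_zero, one_mul]
      exact ev_swap_proj_zero h y
    obtain ⟨h5, h4⟩ := integral_orbit_le S.ne h hy1.le hw1.le b0 e1 e2
    have h3 : ∀ t, ‖D (rr t) i + D (tw p q (ev (rr t) N) (rr t)) i‖ ≤ δ / ‖ν‖ * ‖D (rr t)‖ := by
      intro t
      have := hDD (rr t) (hrn t) i
      simp only [invLin, if_neg hip, if_neg hiq] at this
      rw [add_comm]
      exact this.trans (by gcongr)
    exact h4.trans (bound _ h5 h3)
  have hsum : I ≤ Fintype.card ι * (δ / ‖ν‖) ^ 2 * I := by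
    have h1 : ∀ t, ‖D (rr t)‖ ^ 2 ≤ ∑ i, ‖D (rr t) i‖ ^ 2 := by
      intro t
      have : ‖D (rr t)‖ ≤ Real.sqrt (∑ i, ‖D (rr t) i‖ ^ 2) := by
        refine (pi_norm_le_iff_of_nonneg (Real.sqrt_nonneg _)).2 fun i => ?_
        refine Real.le_sqrt_of_sq_le ?_
        exact Finset.single_le_sum (f := fun i => ‖D (rr t) i‖ ^ 2) (fun _ _ => by positivity)
          (Finset.mem_univ i)
      calc _ ≤ Real.sqrt (∑ i, ‖D (rr t) i‖ ^ 2) ^ 2 := pow_le_pow_left₀ (norm_nonneg _) this 2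
        _ = _ := Real.sq_sqrt (Finset.sum_nonneg fun _ _ => by positivity)
    have hcont : ∀ i, Continuous fun t => ‖D (rr t) i‖ ^ 2 := fun i => (hDc i).norm.pow 2
    have h2 : I ≤ ∫ t in (0 : ℝ)..2 * Real.pi, ∑ i, ‖D (rr t) i‖ ^ 2 :=
      intervalIntegral.integral_mono hpi.le (hDn.intervalIntegrable _ _)
        ((continuous_finsetSum _ fun i _ => hcont i).intervalIntegrable _ _) h1
    rw [intervalIntegral.integral_finsetSum fun i _ => (hcont i).intervalIntegrable _ _] at h2
    refine h2.trans ((Finset.sum_le_sum fun i _ => hpt i).trans (le_of_eq ?_))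
    rw [Finset.sum_const, Finset.card_univ, nsmul_eq_mul]; ring
  have hI0 : I ≤ 0 := by
    by_contra hneg
    push Not at hneg
    nlinarith
  have hDy : D y = 0 := by
    by_contra hne
    have hpos : 0 < I := by
      refine intervalIntegral.integral_pos hpi hDn.continuousOn (fun t _ => by positivity)
        ⟨0, by simp [hpi.le], ?_⟩
      simp only [hrr, expi_zero, rotp_one]
      have := norm_pos_iff.2 hne
      positivity
    linarith
  exact sub_eq_zero.1 hDy

end PairData

end AbsSer

end

section

namespace AbsSer

variable {ι : Type*} [Fintype ι] [DecidableEq ι] {p q : ι}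

theorem PairData.fderiv_psi_injective {ν : ℂ} {g : (ι → ℂ) → ι → ℂ}
    {P : FormalMultilinearSeries ℂ (ι → ℂ) (ι → ℂ)} {C b ρ θ : ℝ} {s : ENNReal} {r : ℝ} {u : ι → AbsSer ι}
    (S : PairData p q ν g P C b ρ θ s r u) (v : ι → ℂ) (hv : fderiv ℂ (psi r u) 0 v = 0) : v = 0 := by
  set f : (ι → ℂ) → ι → ℂ := fun y i => ev y (u i) with hf
  have hfd : DifferentiableOn ℂ f (Metric.ball 0 1) :=
    differentiableOn_pi.2 fun i => (analyticAt_ev (u i)).differentiableOn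
  have hf0 : f 0 = 0 := by ext i; exact S.sol.zero i
  have hmaps : Set.MapsTo f (Metric.ball 0 1) (Metric.closedBall (f 0) (r / 2)) := by
    intro y hy
    rw [hf0, mem_closedBall_zero_iff]
    rw [mem_ball_zero_iff] at hy
    refine (pi_norm_le_iff_of_nonneg (by linarith [S.r_pos])).2 fun i => ?_
    exact (norm_ev_le hy.le _).trans ((norm_le_pi_norm u i).trans S.sol.norm_le)
  have hb := Complex.norm_fderiv_le_div_of_mapsTo_ball hfd hmaps one_pos
  rw [div_one] at hb
  have hpsi : psi r u =ᶠ[𝓝 0] fun y => (r : ℂ) • y + f y := by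
    filter_upwards [Metric.ball_mem_nhds (0 : ι → ℂ) one_pos] with y hy
    rw [mem_ball_zero_iff] at hy
    ext i
    rw [S.psi_eq hy.le]; rfl
  have hfa : DifferentiableAt ℂ f 0 := hfd.differentiableAt (Metric.ball_mem_nhds _ one_pos)
  rw [hpsi.fderiv_eq, fderiv_fun_add (by fun_prop) hfa, fderiv_fun_const_smul (by fun_prop)] at hv
  simp only [fderiv_fun_id, add_apply, smul_apply,
    ContinuousLinearMap.id_apply] at hv
  have h1 : ‖(r : ℂ) • v‖ = ‖fderiv ℂ f 0 v‖ := by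
    rw [eq_neg_of_add_eq_zero_left hv, norm_neg]
  rw [norm_smul, Complex.norm_real, Real.norm_of_nonneg S.r_pos.le] at h1
  have h2 : ‖fderiv ℂ f 0 v‖ ≤ r / 2 * ‖v‖ :=
    ((fderiv ℂ f 0).le_opNorm v).trans (by gcongr)
  have h3 : ‖v‖ ≤ 0 := by
    have := S.r_pos
    by_contra h
    push Not at h
    nlinarith
  exact norm_le_zero_iff.1 h3

/-- The normal form of a pair of involutions the first of which is a transposition. -/
theorem exists_pair_normal_form (hpq : p ≠ q) {ν : ℂ} (hν0 : ν ≠ 0) (hν1 : ‖ν‖ < 1)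
    {g : (ι → ℂ) → ι → ℂ} (hg : AnalyticAt ℂ g 0) (g0 : g 0 = 0) (dg : fderiv ℂ g 0 = 0)
    (hinv : ∀ᶠ x in 𝓝 (0 : ι → ℂ),
      invLin p q ν (invLin p q ν x + g x) + g (invLin p q ν x + g x) = x) :
    ∃ (Ψ : (ι → ℂ) → ι → ℂ) (N : (ι → ℂ) → ℂ), AnalyticAt ℂ Ψ 0 ∧ Ψ 0 = 0 ∧
      (∀ v, fderiv ℂ Ψ 0 v = 0 → v = 0) ∧ AnalyticAt ℂ N 0 ∧ N 0 ≠ 0 ∧ ‖N 0‖ < 1 ∧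
      (∀ c y, c ≠ 0 → ‖y‖ ≤ 1 → ‖rotp p q c y‖ ≤ 1 → N (rotp p q c y) = N y) ∧
      (∀ y, ‖y‖ ≤ 1 → N (sw p q y) = N y) ∧
      (∀ᶠ y in 𝓝 0, Ψ (sw p q y) = sw p q (Ψ y)) ∧
      ∀ᶠ y in 𝓝 0, invLin p q ν (Ψ y) + g (Ψ y) = Ψ (tw p q (N y) y) := by
  obtain ⟨P, C, b, s, hp, hs, hP⟩ := exists_coeffBound hg g0 dg
  obtain ⟨ρ, θ, H⟩ := exists_adapted hν0 hν1
  have hν := H.pos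
  have ev1 : ∀ c d : ℝ, 0 < d → ∀ᶠ r : ℝ in 𝓝[>] 0, c * r < d := by
    intro c d hd
    have : Tendsto (fun r : ℝ => c * r) (𝓝[>] 0) (𝓝 (c * 0)) :=
      (tendsto_id.mono_left nhdsWithin_le_nhds).const_mul c
    rw [mul_zero] at this
    exact this.eventually_lt_const hd
  have ev2 : ∀ᶠ r : ℝ in 𝓝[>] 0, ENNReal.ofReal (2 * r) < s := by
    have : Tendsto (fun r : ℝ => ENNReal.ofReal (2 * r)) (𝓝[>] 0) (𝓝 (ENNReal.ofReal (2 * 0))) :=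
      ENNReal.tendsto_ofReal ((tendsto_id.mono_left nhdsWithin_le_nhds).const_mul 2)
    rw [mul_zero, ENNReal.ofReal_zero] at this
    exact this.eventually_lt_const hs
  have ev3 : ∀ᶠ r : ℝ in 𝓝[>] 0, (Fintype.card ι : ℝ) * (64 * C * b ^ 2 * r / ‖ν‖) ^ 2 < 1 := by
    have : Tendsto (fun r : ℝ => (Fintype.card ι : ℝ) * (64 * C * b ^ 2 * r / ‖ν‖) ^ 2) (𝓝[>] 0)
        (𝓝 ((Fintype.card ι : ℝ) * (64 * C * b ^ 2 * 0 / ‖ν‖) ^ 2)) :=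
      (Continuous.tendsto (f := fun r : ℝ => (Fintype.card ι : ℝ) * (64 * C * b ^ 2 * r / ‖ν‖) ^ 2)
        (by fun_prop) 0).mono_left nhdsWithin_le_nhds
    simp only [mul_zero, zero_div, ne_eq, OfNat.ofNat_ne_zero, not_false_eq_true, zero_pow] at this
    exact this.eventually_lt_const one_pos
  obtain ⟨r, ⟨u, hu⟩, h1, h2, h3, h4, h5, hr⟩ := ((exists_isSol (p := p) (q := q) hp H g0 hs hP).and
    ((ev1 (8 * b) 1 one_pos).and ((ev1 (4 * (32 * C * b ^ 2)) (ρ - ‖ν‖) (by linarith [H.lt])).and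
    ((ev1 (4 * (32 * C * b ^ 2)) (‖ν‖ / 2) (by positivity)).and
    (ev2.and (ev3.and self_mem_nhdsWithin)))))).exists
  have S : PairData p q ν g P C b ρ θ s r u :=
    ⟨hpq, hp, H, hP, hr, by linarith, h4, hu, h2.le, h3.le⟩
  have hsmall : ∀ᶠ y in 𝓝 (0 : ι → ℂ), ‖y‖ ≤ 1 := by
    filter_upwards [Metric.closedBall_mem_nhds (0 : ι → ℂ) one_pos] with y hy
    simpa using hy
  have h0 : ‖(0 : ι → ℂ)‖ ≤ 1 := by simp
  refine ⟨PairData.psi r u, fun y => ev y (PairData.ser p q ν P r u),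
    analyticAt_pi_iff.2 fun i => analyticAt_ev _ 0 (by simp), ?_, S.fderiv_psi_injective,
    analyticAt_ev _ 0 (by simp), S.ev_ser_ne_zero h0, ?_, fun c y hc hy hy' => S.ev_ser_rotp hc hy hy',
    fun y hy => S.ev_ser_sw hy, ?_, S.psi_conj h5 hinv⟩
  · ext i
    rw [S.psi_eq h0, S.sol.zero]; simp
  · exact (norm_ev_le h0 _).trans_lt (S.norm_ser.trans_lt H.lt_one)
  · filter_upwards [hsmall] with y hy
    have hy' := (norm_sw_le (p := p) (q := q) y).trans hy
    refine ext_pair (p := p) (q := q) ?_ ?_ fun i hip hiq => ?_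
    · rw [sw_fst, S.psi_sw hy]
    · rw [sw_snd, ← S.psi_sw hy', sw_sw]
    · rw [sw_ne hip hiq, S.psi_sw' hy hip hiq]

end AbsSer

variable {κ : Type*} [Fintype κ] [DecidableEq κ]

theorem commute_rot_of_commute {j : κ} {L : Dbl κ →L[ℂ] Dbl κ} {ν : ℂ} (hν0 : ν ≠ 0) (hν1 : ‖ν‖ ≠ 1)
    (h : ∀ v, L (rot j ν v) = rot j ν (L v)) (c : ℂ) (v : Dbl κ) : L (rot j c v) = rot j c (L v) := by
  have h1 : ν - 1 ≠ 0 := fun h => hν1 (by rw [sub_eq_zero.1 h, norm_one])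
  have h2 : ν + 1 ≠ 0 := fun h => hν1 (by rw [eq_neg_of_add_eq_zero_left h, norm_neg, norm_one])
  have h' : ∀ v, L (rot j ν⁻¹ v) = rot j ν⁻¹ (L v) := fun v => by
    rw [← rot_inv_rot j hν0 (L (rot j ν⁻¹ v)), ← h, rot_rot_inv j hν0]
  obtain ⟨x, y, z, e1, e2, e3⟩ : ∃ x y z : ℂ, x + y * ν + z * ν⁻¹ = c ∧ x + y * ν⁻¹ + z * ν = c⁻¹ ∧
      x + y + z = 1 := by
    set d := c⁻¹
    refine ⟨1 - ((c - 1) * (ν - 1) - (d - 1) * (ν⁻¹ - 1)) / ((ν - 1) ^ 2 - (ν⁻¹ - 1) ^ 2) -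
      ((d - 1) * (ν - 1) - (c - 1) * (ν⁻¹ - 1)) / ((ν - 1) ^ 2 - (ν⁻¹ - 1) ^ 2),
      ((c - 1) * (ν - 1) - (d - 1) * (ν⁻¹ - 1)) / ((ν - 1) ^ 2 - (ν⁻¹ - 1) ^ 2),
      ((d - 1) * (ν - 1) - (c - 1) * (ν⁻¹ - 1)) / ((ν - 1) ^ 2 - (ν⁻¹ - 1) ^ 2), ?_, ?_, by ring⟩ <;>
    · have h3 : (ν - 1) ^ 2 - (ν⁻¹ - 1) ^ 2 ≠ 0 := by
        have : (ν - 1) ^ 2 - (ν⁻¹ - 1) ^ 2 = (ν - 1) ^ 3 * (ν + 1) / ν ^ 2 := by field_simp; ring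
        rw [this]
        positivity
      generalize hw : (ν - 1) ^ 2 - (ν⁻¹ - 1) ^ 2 = w at h3
      field_simp
      rw [← hw]
      field_simp
      ring
  have key : ∀ v : Dbl κ, rot j c v = x • v + y • rot j ν v + z • rot j ν⁻¹ v := by
    intro v
    refine Dbl.ext' j ?_ ?_ fun i hi => ⟨?_, ?_⟩
    · simp only [rot_fst_self, Prod.fst_add, Prod.smul_fst, Pi.add_apply, Pi.smul_apply, smul_eq_mul]
      rw [← e1]; ring
    · simp only [rot_snd_self, Prod.snd_add, Prod.smul_snd, Pi.add_apply, Pi.smul_apply, smul_eq_mul]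
      rw [← e2, inv_inv]; ring
    · simp only [rot_fst_ne hi, Prod.fst_add, Prod.smul_fst, Pi.add_apply, Pi.smul_apply, smul_eq_mul]
      rw [← add_mul, ← add_mul, e3, one_mul]
    · simp only [rot_snd_ne hi, Prod.snd_add, Prod.smul_snd, Pi.add_apply, Pi.smul_apply, smul_eq_mul]
      rw [← add_mul, ← add_mul, e3, one_mul]
  rw [key, key, map_add, map_add, map_smul, map_smul, map_smul, h, h']

theorem eq_of_intertwines_rot {j : κ} {L : Dbl κ →L[ℂ] Dbl κ} (hL : ∀ v, L v = 0 → v = 0) {m s : ℂ}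
    (hm : 1 < ‖m‖) (hs : 1 < ‖s‖) (h : ∀ v, L (rot j m v) = rot j s (L v)) : m = s := by
  set e : Dbl κ := (Pi.single j 1, 0) with he
  have h1 : rot j m e = m • e := by
    refine Dbl.ext' j ?_ ?_ fun i hi => ⟨?_, ?_⟩
    · simp [he]
    · simp [he]
    · rw [rot_fst_ne hi]; simp [he, hi]
    · rw [rot_snd_ne hi]; simp [he]
  have h2 := h e
  rw [h1, map_smul] at h2
  by_contra hne
  have h3 : L e = 0 := by
    refine Dbl.ext' j ?_ ?_ fun i hi => ⟨?_, ?_⟩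
    · have := congrArg (fun x : Dbl κ => x.1 j) h2
      simp only [Prod.smul_fst, Pi.smul_apply, smul_eq_mul, rot_fst_self] at this
      by_contra h4
      exact hne (mul_right_cancel₀ h4 this)
    · have := congrArg (fun x : Dbl κ => x.2 j) h2
      simp only [Prod.smul_snd, Pi.smul_apply, smul_eq_mul, rot_snd_self] at this
      by_contra h4
      have h5 := mul_right_cancel₀ h4 this
      rw [h5, norm_inv] at hm
      exact absurd hm (not_lt.2 (inv_le_one_of_one_le₀ hs.le))
    · have := congrArg (fun x : Dbl κ => x.1 i) h2
      simp only [Prod.smul_fst, Pi.smul_apply, smul_eq_mul, rot_fst_ne hi] at this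
      by_contra h4
      rw [mul_eq_right₀ h4] at this
      rw [this, norm_one] at hm
      exact lt_irrefl _ hm
    · have := congrArg (fun x : Dbl κ => x.2 i) h2
      simp only [Prod.smul_snd, Pi.smul_apply, smul_eq_mul, rot_snd_ne hi] at this
      by_contra h4
      rw [mul_eq_right₀ h4] at this
      rw [this, norm_one] at hm
      exact lt_irrefl _ hm
  have h6 := congrArg (fun x : Dbl κ => x.1 j) (hL e h3)
  simp [he] at h6

/-- `σ` is conjugated by `ψ`, with inverse `χ`, to the map `y ↦ rot j (M y) y`, with an invariant
multiplier `M`, `M 0 = μ`. -/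
structure IsPairNF (j : κ) (μ : ℂ) (σ ψ χ : Dbl κ → Dbl κ) (M : Dbl κ → ℂ) : Prop where
  germ : IsGermInv ψ χ
  an : AnalyticAt ℂ M 0
  val : M 0 = μ
  inv : ∃ ε > 0, ∀ c y, c ≠ 0 → ‖y‖ < ε → ‖rot j c y‖ < ε → M (rot j c y) = M y
  conj_eq : ∀ᶠ y in 𝓝 0, σ (ψ y) = ψ (rot j (M y) y)
  comm : ∀ c v, fderiv ℂ ψ 0 (rot j c v) = rot j c (fderiv ℂ ψ 0 v)

variable (κ) in
/-- The coordinates `(ξ, η)` as one vector. -/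
def toVec : Dbl κ ≃L[ℂ] (κ ⊕ κ → ℂ) := (ContinuousLinearEquiv.sumPiEquivProdPi ℂ κ κ fun _ => ℂ).symm

theorem toVec_inl (y : Dbl κ) (i : κ) : toVec κ y (Sum.inl i) = y.1 i := rfl
theorem toVec_inr (y : Dbl κ) (i : κ) : toVec κ y (Sum.inr i) = y.2 i := rfl

theorem toVec_eq {j : κ} {x : κ ⊕ κ → ℂ} {y : Dbl κ} (h1 : x (Sum.inl j) = y.1 j)
    (h2 : x (Sum.inr j) = y.2 j) (h : ∀ i, i ≠ j → x (Sum.inl i) = y.1 i ∧ x (Sum.inr i) = y.2 i) :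
    x = toVec κ y := by
  ext i
  rcases i with i | i <;> by_cases hi : i = j
  · subst hi; exact h1
  · exact (h i hi).1
  · subst hi; exact h2
  · exact (h i hi).2

theorem norm_toVec (y : Dbl κ) : ‖toVec κ y‖ = ‖y‖ := by
  refine le_antisymm ((pi_norm_le_iff_of_nonneg (norm_nonneg _)).2 fun i => ?_)
    (Dbl.norm_le (norm_nonneg _) fun i => ⟨?_, ?_⟩)
  · rcases i with i | i
    · exact norm_coord_fst_le y i
    · exact norm_coord_snd_le y i
  · exact norm_le_pi_norm (toVec κ y) (Sum.inl i)
  · exact norm_le_pi_norm (toVec κ y) (Sum.inr i)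

theorem inl_ne_inr (j : κ) : (Sum.inl j : κ ⊕ κ) ≠ Sum.inr j := by simp

open AbsSer in
theorem sw_toVec (j : κ) (y : Dbl κ) : sw (Sum.inl j) (Sum.inr j) (toVec κ y) = toVec κ (flip j 1 y) := by
  refine toVec_eq (j := j) ?_ ?_ fun i hi => ⟨?_, ?_⟩
  · rw [sw_fst, toVec_inr]; simp
  · rw [sw_snd, toVec_inl]; simp
  · rw [sw_ne (by simpa using hi) (by simp), toVec_inl, flip_fst_ne hi]
  · rw [sw_ne (by simp) (by simpa using hi), toVec_inr, flip_snd_ne hi]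

open AbsSer in
theorem rotp_toVec (j : κ) (c : ℂ) (y : Dbl κ) :
    rotp (Sum.inl j) (Sum.inr j) c (toVec κ y) = toVec κ (rot j c y) := by
  refine toVec_eq (j := j) ?_ ?_ fun i hi => ⟨?_, ?_⟩
  · rw [rotp_fst, toVec_inl]; simp
  · rw [rotp_snd (inl_ne_inr j), toVec_inr]; simp
  · rw [rotp_ne (by simpa using hi) (by simp), toVec_inl, rot_fst_ne hi]
  · rw [rotp_ne (by simp) (by simpa using hi), toVec_inr, rot_snd_ne hi]

open AbsSer in
theorem invLin_toVec (j : κ) (ν : ℂ) (y : Dbl κ) :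
    invLin (Sum.inl j) (Sum.inr j) ν (toVec κ y) = toVec κ (flip j ν y) := by
  refine toVec_eq (j := j) ?_ ?_ fun i hi => ⟨?_, ?_⟩
  · simp [invLin, toVec_inr]
  · simp [invLin, toVec_inl]
  · simp [invLin, hi, toVec_inl, flip_fst_ne hi]
  · simp [invLin, hi, toVec_inr, flip_snd_ne hi]

open AbsSer in
/-- The normal form of a pair of involutions the first of which is linear. -/
theorem exists_isPairNF_flip_one {j : κ} {ν : ℂ} (hν0 : ν ≠ 0) (hν1 : ‖ν‖ < 1) {A : Dbl κ → Dbl κ}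
    (hA : AnalyticAt ℂ A 0) (hA0 : A 0 = 0) (hAA : ∀ᶠ x in 𝓝 0, A (A x) = x)
    (hdA : ∀ v, fderiv ℂ A 0 v = flip j ν v) :
    ∃ ψ χ M, IsPairNF j ν⁻¹ (fun x => flip j 1 (A x)) ψ χ M ∧
      ∀ᶠ y in 𝓝 0, flip j 1 (ψ y) = ψ (flip j 1 y) := by
  set e := toVec κ with he
  set g : (κ ⊕ κ → ℂ) → κ ⊕ κ → ℂ := fun x => e (A (e.symm x)) - e (flip j ν (e.symm x)) with hgdef
  have hes : AnalyticAt ℂ (fun x => e.symm x) 0 := e.symm.toContinuousLinearMap.analyticAt 0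
  have hea : AnalyticAt ℂ (fun x => e x) 0 := e.toContinuousLinearMap.analyticAt 0
  have hAe : AnalyticAt ℂ (fun x => A (e.symm x)) 0 := AnalyticAt.comp_zero hA hes (map_zero _)
  have hAe0 : A (e.symm 0) = 0 := by rw [map_zero, hA0]
  have hfl : AnalyticAt ℂ (fun x => e (flip j ν (e.symm x))) 0 :=
    ((e.toContinuousLinearMap.comp (flip j ν)).comp e.symm.toContinuousLinearMap).analyticAt 0
  have hg : AnalyticAt ℂ g 0 := (AnalyticAt.comp_zero hea hAe hAe0).sub hfl
  have hAg : ∀ x, invLin (Sum.inl j) (Sum.inr j) ν x + g x = e (A (e.symm x)) := by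
    intro x
    have : invLin (Sum.inl j) (Sum.inr j) ν x = e (flip j ν (e.symm x)) := by
      rw [← invLin_toVec, ← he, e.apply_symm_apply]
    rw [this, hgdef]
    simp
  have dg : fderiv ℂ g 0 = 0 := by
    ext1 v
    have h1 : fderiv ℂ (fun x => e (A (e.symm x))) 0 v = e (flip j ν (e.symm v)) := by
      rw [fderiv_comp_zero hea hAe hAe0, fderiv_comp_zero hA hes (map_zero _), hdA]
      rw [show (fun x => e.symm x) = e.symm from rfl, show (fun x => e x) = e from rfl,
        e.symm.fderiv, e.fderiv]
      rfl
    have h2 : fderiv ℂ (fun x => e (flip j ν (e.symm x))) 0 v = e (flip j ν (e.symm v)) := by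
      have := ((e.toContinuousLinearMap.comp (flip j ν)).comp e.symm.toContinuousLinearMap).fderiv (x := 0)
      exact congrArg (fun L : (κ ⊕ κ → ℂ) →L[ℂ] κ ⊕ κ → ℂ => L v) this
    rw [hgdef, fderiv_fun_sub (AnalyticAt.comp_zero hea hAe hAe0).differentiableAt hfl.differentiableAt,
      sub_apply, h1, h2, sub_self]
    rfl
  obtain ⟨Ψ, N, Ψan, Ψ0, Ψinj, Nan, N0, N1, Nrot, Nsw, Ψsw, hconj⟩ :=
    exists_pair_normal_form (inl_ne_inr j) hν0 hν1 hg (by simp [hgdef, hA0]) dg (by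
      have ht : Tendsto (fun x => e.symm x) (𝓝 0) (𝓝 0) := AnalyticAt.tendsto_zero hes (map_zero _)
      filter_upwards [ht.eventually hAA] with x hx
      rw [hAg, hAg, e.symm_apply_apply, hx, e.apply_symm_apply])
  obtain ⟨Χ, hΧ⟩ := IsGermInv.exists_of_fderiv_injective Ψan Ψ0 Ψinj
  have hgerm : IsGermInv (fun y => e.symm (Ψ (e y))) (fun y => e.symm (Χ (e y))) := by
    have h1 := (IsGermInv.of_equiv e).symm.comp (hΧ.comp (IsGermInv.of_equiv e))
    exact h1
  have hMan : AnalyticAt ℂ (fun y => N (e y)) 0 := AnalyticAt.comp_zero Nan hea (map_zero _)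
  have het : Tendsto (fun y => e y) (𝓝 0) (𝓝 0) := AnalyticAt.tendsto_zero hea (map_zero _)
  have hMne : ∀ᶠ y in 𝓝 (0 : Dbl κ), N (e y) ≠ 0 :=
    hMan.continuousAt.eventually_ne (by simpa using N0)
  -- the conjugation
  have hconj' : ∀ᶠ y in 𝓝 0, flip j 1 (A (e.symm (Ψ (e y)))) =
      e.symm (Ψ (e (rot j (N (e y))⁻¹ y))) := by
    have ht : Tendsto (fun y : Dbl κ => tw (Sum.inl j) (Sum.inr j) (N (e y)) (e y)) (𝓝 0) (𝓝 0) := by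
      have h1 : ContinuousAt (fun y : Dbl κ => tw (Sum.inl j) (Sum.inr j) (N (e y)) (e y)) 0 := by
        refine continuousAt_pi.2 fun i => ?_
        have hNc : ContinuousAt (fun y : Dbl κ => N (e y)) 0 := hMan.continuousAt
        have hNi : ContinuousAt (fun y : Dbl κ => (N (e y))⁻¹) 0 := hNc.inv₀ (by simpa using N0)
        have hc : ∀ i, ContinuousAt (fun y : Dbl κ => sw (Sum.inl j) (Sum.inr j) (e y) i) 0 := fun i =>
          (continuous_apply (Equiv.swap (Sum.inl j) (Sum.inr j) i)).continuousAt.comp e.continuous.continuousAt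
        unfold tw rotp
        split_ifs
        · exact hNc.mul (hc _)
        · exact hNi.mul (hc _)
        · exact hc _
      have h2 := h1.tendsto
      have h3 : tw (Sum.inl j) (Sum.inr j) (N (e 0)) (e 0) = 0 := by
        ext i; simp [tw, rotp, sw]
      rwa [h3] at h2
    filter_upwards [het.eventually hconj, ht.eventually Ψsw] with y h1 h2
    rw [hAg] at h1
    have h3 : A (e.symm (Ψ (e y))) = e.symm (Ψ (tw (Sum.inl j) (Sum.inr j) (N (e y)) (e y))) := by
      rw [← h1, e.symm_apply_apply]
    apply e.injective
    rw [h3, he, ← sw_toVec, ← he, e.apply_symm_apply, ← h2, e.apply_symm_apply, sw_tw (inl_ne_inr j), he,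
      rotp_toVec]
  -- the linear part
  set L := fderiv ℂ (fun y => e.symm (Ψ (e y))) 0 with hL
  have hLinj : ∀ v, L v = 0 → v = 0 := fun v hv => by
    have := hgerm.fderiv_left v
    rw [← this, hv, map_zero]
  have hlin : ∀ v, L (rot j (N 0)⁻¹ v) = rot j ν⁻¹ (L v) := by
    intro v
    have hfan : AnalyticAt ℂ (flip j (1 : ℂ)) (0 : Dbl κ) := (flip j 1).analyticAt 0
    have hAψ : AnalyticAt ℂ (fun y => A (e.symm (Ψ (e y)))) 0 := AnalyticAt.comp_zero hA hgerm.an hgerm.map0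
    have hAψ0 : A (e.symm (Ψ (e 0))) = 0 := by rw [show e.symm (Ψ (e 0)) = 0 from hgerm.map0, hA0]
    have d1 : fderiv ℂ (fun y => flip j 1 (A (e.symm (Ψ (e y))))) 0 v = rot j ν⁻¹ (L v) := by
      rw [fderiv_comp_zero hfan hAψ hAψ0, fderiv_comp_zero hA hgerm.an hgerm.map0, hdA,
        ContinuousLinearMap.fderiv, flip_flip', one_div]
    have hrd : HasFDerivAt (fun y : Dbl κ => rot j (N (e y))⁻¹ y) (rot j (N 0)⁻¹) 0 := by
      have hNd : DifferentiableAt ℂ (fun y : Dbl κ => N (e y)) 0 := hMan.differentiableAt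
      have hNid : DifferentiableAt ℂ (fun y : Dbl κ => (N (e y))⁻¹) 0 := hNd.inv (by simpa using N0)
      have key : ∀ (f : Dbl κ → ℂ) (l : Dbl κ →L[ℂ] ℂ), DifferentiableAt ℂ f 0 →
          HasFDerivAt (fun y => f y * l y) (f 0 • l) 0 := by
        intro f l hf
        have h : HasFDerivAt (fun y => f y * l y) (f 0 • (l : Dbl κ →L[ℂ] ℂ) + l 0 • fderiv ℂ f 0) 0 :=
          hf.hasFDerivAt.mul l.hasFDerivAt
        refine h.congr_fderiv ?_
        rw [map_zero]
        exact (congrArg (f 0 • l + ·) (zero_smul ℂ (fderiv ℂ f 0))).trans (add_zero _)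
      have f1 : HasFDerivAt (fun y : Dbl κ => (rot j (N (e y))⁻¹ y).1)
          ((ContinuousLinearMap.fst ℂ _ _).comp (rot j (N 0)⁻¹)) 0 := by
        refine hasFDerivAt_pi'.2 fun i => ?_
        by_cases hi : i = j
        · subst hi
          have := key (fun y => (N (e y))⁻¹)
            ((ContinuousLinearMap.proj i).comp (ContinuousLinearMap.fst ℂ (κ → ℂ) (κ → ℂ))) hNid
          simp only [map_zero] at this
          refine (this.congr_of_eventuallyEq (Eventually.of_forall fun y => by simp)).congr_fderiv ?_
          ext v <;> simp
        · have := ((ContinuousLinearMap.proj (R := ℂ) (φ := fun _ : κ => ℂ) i).comp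
            (ContinuousLinearMap.fst ℂ (κ → ℂ) (κ → ℂ))).hasFDerivAt (x := 0)
          refine (this.congr_of_eventuallyEq (Eventually.of_forall fun y => rot_fst_ne hi _ _)).congr_fderiv ?_
          ext v <;> simp [rot_fst_ne hi]
      have f2 : HasFDerivAt (fun y : Dbl κ => (rot j (N (e y))⁻¹ y).2)
          ((ContinuousLinearMap.snd ℂ _ _).comp (rot j (N 0)⁻¹)) 0 := by
        refine hasFDerivAt_pi'.2 fun i => ?_
        by_cases hi : i = j
        · subst hi
          have := key (fun y => N (e y))
            ((ContinuousLinearMap.proj i).comp (ContinuousLinearMap.snd ℂ (κ → ℂ) (κ → ℂ))) hNd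
          simp only [map_zero] at this
          refine (this.congr_of_eventuallyEq (Eventually.of_forall fun y => by simp)).congr_fderiv ?_
          ext v <;> simp
        · have := ((ContinuousLinearMap.proj (R := ℂ) (φ := fun _ : κ => ℂ) i).comp
            (ContinuousLinearMap.snd ℂ (κ → ℂ) (κ → ℂ))).hasFDerivAt (x := 0)
          refine (this.congr_of_eventuallyEq (Eventually.of_forall fun y => rot_snd_ne hi _ _)).congr_fderiv ?_
          ext v <;> simp [rot_snd_ne hi]
      exact (f1.prodMk f2).congr_fderiv (by ext v <;> simp)
    have d2 : fderiv ℂ (fun y => e.symm (Ψ (e (rot j (N (e y))⁻¹ y)))) 0 v = L (rot j (N 0)⁻¹ v) := by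
      have hLd : HasFDerivAt (fun y => e.symm (Ψ (e y))) L (rot j (N (e 0))⁻¹ (0 : Dbl κ)) := by
        rw [map_zero]; exact hgerm.an.differentiableAt.hasFDerivAt
      have := HasFDerivAt.comp (f := fun y : Dbl κ => rot j (N (e y))⁻¹ y) (0 : Dbl κ) hLd hrd
      have h3 := this.fderiv
      exact congrArg (fun l : Dbl κ →L[ℂ] Dbl κ => l v) h3
    rw [← d1, ← d2]
    exact congrArg (fun l : Dbl κ →L[ℂ] Dbl κ => l v) (EventuallyEq.fderiv_eq hconj').symm
  have hn1 : 1 < ‖(N 0)⁻¹‖ := by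
    rw [norm_inv]; exact (one_lt_inv₀ (norm_pos_iff.2 N0)).2 N1
  have hn2 : 1 < ‖ν⁻¹‖ := by
    rw [norm_inv]; exact (one_lt_inv₀ (norm_pos_iff.2 hν0)).2 hν1
  have hNν := eq_of_intertwines_rot hLinj hn1 hn2 hlin
  refine ⟨_, _, fun y => (N (e y))⁻¹, ⟨hgerm, hMan.inv (by simpa using N0), by simpa using hNν, ?_, hconj', ?_⟩, ?_⟩
  · refine ⟨1, one_pos, fun c y hc hy hy' => ?_⟩
    rw [he, ← rotp_toVec, Nrot c _ hc (by rw [norm_toVec]; exact hy.le)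
      (by rw [rotp_toVec, norm_toVec]; exact hy'.le)]
  · rw [hNν] at hlin
    exact commute_rot_of_commute (inv_ne_zero hν0) hn2.ne' hlin
  · filter_upwards [het.eventually Ψsw] with y hy
    apply e.injective
    rw [he, ← sw_toVec, ← sw_toVec, ← he, e.apply_symm_apply, e.apply_symm_apply, hy]

end

section

variable {κ : Type*} [Fintype κ] [DecidableEq κ]

theorem rot_flip (j : κ) (c α : ℂ) (y : Dbl κ) : rot j c (flip j α y) = flip j (c * α) y := by
  refine Dbl.ext' j ?_ ?_ fun i hi => ?_
  · simp; ring
  · simp; ring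
  · simp [flip_fst_ne hi, flip_snd_ne hi, rot_fst_ne hi, rot_snd_ne hi]

/-- Along a bounded family of rotations one stays near the origin. -/
theorem eventually_forall_rot_le (j : κ) {P : Dbl κ → Prop} (h : ∀ᶠ y in 𝓝 0, P y) {C : ℝ} (hC : 1 ≤ C) :
    ∀ᶠ y in 𝓝 0, ∀ c : ℂ, ‖c‖ ≤ C → ‖c⁻¹‖ ≤ C → P (rot j c y) := by
  obtain ⟨r, hr, hP⟩ := Metric.eventually_nhds_iff_ball.1 h
  filter_upwards [Metric.ball_mem_nhds (0 : Dbl κ) (show 0 < r / C by positivity)] with y hy c hc hc'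
  refine hP _ ?_
  rw [mem_ball_zero_iff] at hy ⊢
  refine (norm_rot_le' j hC hc hc' y).trans_lt ?_
  rwa [lt_div_iff₀' (by positivity)] at hy

theorem exists_bound_near {X : Type*} [TopologicalSpace X] {x : X} {f : X → ℂ} (hf : ContinuousAt f x)
    (h0 : f x ≠ 0) : ∃ C : ℝ, 1 ≤ C ∧ ∀ᶠ y in 𝓝 x, f y ≠ 0 ∧ ‖f y‖ < C ∧ ‖(f y)⁻¹‖ < C := by
  refine ⟨1 + ‖f x‖ + ‖(f x)⁻¹‖, by have := norm_nonneg (f x); have := norm_nonneg (f x)⁻¹; linarith, ?_⟩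
  filter_upwards [hf.eventually_ne h0,
    hf.norm.eventually_lt_const (show ‖f x‖ < 1 + ‖f x‖ + ‖(f x)⁻¹‖ by
      have := norm_nonneg (f x)⁻¹; linarith),
    (hf.inv₀ h0).norm.eventually_lt_const (show ‖(f x)⁻¹‖ < 1 + ‖f x‖ + ‖(f x)⁻¹‖ by
      have := norm_nonneg (f x); linarith)] with y h1 h2 h3
  exact ⟨h1, h2, h3⟩

theorem eventually_rot (j : κ) {P : Dbl κ → Prop} (h : ∀ᶠ y in 𝓝 0, P y) {f : Dbl κ → ℂ}
    (hf : ContinuousAt f 0) (h0 : f 0 ≠ 0) : ∀ᶠ y in 𝓝 0, P (rot j (f y) y) := by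
  obtain ⟨C, hC, hb⟩ := exists_bound_near hf h0
  filter_upwards [eventually_forall_rot_le j h hC, hb] with y h1 h2
  exact h1 _ h2.2.1.le h2.2.2.le

theorem exists_isPairNF_of_lt {j : κ} {α β : ℂ} (hα : α ≠ 0) (hβ : β ≠ 0) (hlt : ‖β‖ < ‖α‖)
    {a A : Dbl κ → Dbl κ} (ha : AnalyticAt ℂ a 0) (ha0 : a 0 = 0) (haa : ∀ᶠ x in 𝓝 0, a (a x) = x)
    (hda : ∀ v, fderiv ℂ a 0 v = flip j α v)
    (hA : AnalyticAt ℂ A 0) (hA0 : A 0 = 0) (hAA : ∀ᶠ x in 𝓝 0, A (A x) = x)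
    (hdA : ∀ v, fderiv ℂ A 0 v = flip j β v) :
    ∃ ψ χ M, IsPairNF j (α / β) (fun x => a (A x)) ψ χ M ∧ ∀ᶠ y in 𝓝 0, a (ψ y) = ψ (flip j 1 y) := by
  obtain ⟨c, hc⟩ : ∃ c : ℂ, c ^ 2 = α⁻¹ := IsAlgClosed.exists_pow_nat_eq _ two_pos
  have hc0 : c ≠ 0 := by
    rintro rfl
    exact inv_ne_zero hα (by rw [← hc]; simp)
  set h : Dbl κ → Dbl κ := fun x => (1 / 2 : ℂ) • (rot j c x + flip j 1 (rot j c (a x))) with hh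
  have hS : AnalyticAt ℂ (rot j c) (0 : Dbl κ) := (rot j c).analyticAt 0
  set F : Dbl κ →L[ℂ] Dbl κ := (flip j 1).comp (rot j c) with hF
  have hFa : AnalyticAt ℂ (fun x => F (a x)) 0 := AnalyticAt.comp_zero (F.analyticAt 0) ha ha0
  have han : AnalyticAt ℂ h 0 := by
    have h' : AnalyticAt ℂ (fun x => rot j c x + F (a x)) 0 := hS.add hFa
    exact (analyticAt_const (v := (1 / 2 : ℂ))).smul h'
  have h0 : h 0 = 0 := by simp [hh, ha0]
  have hdh : ∀ v, fderiv ℂ h 0 v = rot j c v := by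
    intro v
    have h1 : fderiv ℂ (fun x => F (a x)) 0 v = rot j c v := by
      rw [fderiv_comp_zero (F.analyticAt 0) ha ha0, hda, F.fderiv]
      change flip j 1 (rot j c (flip j α v)) = _
      rw [rot_flip, flip_flip']
      congr 2
      field_simp
      rw [hc, inv_mul_cancel₀ hα]
    have h2 : h = fun x => (1 / 2 : ℂ) • (rot j c x + F (a x)) := rfl
    have h3 : DifferentiableAt ℂ (fun x => rot j c x + F (a x)) 0 :=
      hS.differentiableAt.add hFa.differentiableAt
    rw [h2, fderiv_fun_const_smul h3, fderiv_fun_add hS.differentiableAt hFa.differentiableAt, smul_apply, add_apply, h1,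
      (rot j c).fderiv, ← two_smul ℂ, smul_smul]
    norm_num
  obtain ⟨k, hk⟩ := IsGermInv.exists_of_fderiv_injective han h0 fun v hv => by
    rw [hdh] at hv
    rw [← rot_inv_rot j hc0 v, hv, map_zero]
  have hha : ∀ᶠ x in 𝓝 0, h (a x) = flip j 1 (h x) := by
    filter_upwards [haa] with x hx
    simp only [hh]
    rw [hx, map_smul, map_add, flip_flip j one_ne_zero, add_comm]
  have hdk : ∀ v, fderiv ℂ k 0 v = rot j c⁻¹ v := fun v => by
    have h1 := hk.fderiv_right v
    rw [hdh] at h1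
    rw [← h1, rot_inv_rot j hc0, h1]
  set A' : Dbl κ → Dbl κ := fun x => h (A (k x)) with hA'
  have hAk : AnalyticAt ℂ (fun x => A (k x)) 0 := AnalyticAt.comp_zero hA hk.an' hk.map0'
  have hAk0 : A (k 0) = 0 := by rw [hk.map0', hA0]
  have hA'an : AnalyticAt ℂ A' 0 := AnalyticAt.comp_zero han hAk hAk0
  have tA : Tendsto A (𝓝 0) (𝓝 0) := AnalyticAt.tendsto_zero hA hA0
  have ta : Tendsto a (𝓝 0) (𝓝 0) := AnalyticAt.tendsto_zero ha ha0
  have tA' : Tendsto A' (𝓝 0) (𝓝 0) := AnalyticAt.tendsto_zero hA'an (by simp only [hA']; rw [hAk0, h0])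
  obtain ⟨ψ, χ, M, H, hsw⟩ := exists_isPairNF_flip_one (j := j) (ν := β / α) (A := A') (div_ne_zero hβ hα)
    (by rw [norm_div, div_lt_one (norm_pos_iff.2 hα)]; exact hlt) hA'an
    (by simp only [hA']; rw [hAk0, h0]) (by
      filter_upwards [(tA.comp hk.tendsto').eventually hk.left, hk.tendsto'.eventually hAA, hk.right]
        with x h1 h2 h3
      simp only [hA', Function.comp] at h1 ⊢
      rw [h1, h2, h3]) (fun v => by
      rw [hA', fderiv_comp_zero han hAk hAk0, fderiv_comp_zero hA hk.an' hk.map0', hdA, hdh, hdk, flip_rot,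
        inv_inv, rot_rot, rot_flip, ← sq, hc, div_eq_inv_mul])
  -- `a ∘ k = k ∘ flip`
  have hak : ∀ᶠ x in 𝓝 0, a (k x) = k (flip j 1 x) := by
    filter_upwards [(ta.comp hk.tendsto').eventually hk.left, hk.tendsto'.eventually hha, hk.right]
      with x h1 h2 h3
    simp only [Function.comp] at h1
    rw [← h1, h2, h3]
  refine ⟨fun y => k (ψ y), fun x => χ (h x), M, ⟨hk.symm.comp H.germ, H.an, ?_, H.inv, ?_, ?_⟩, ?_⟩
  · rw [H.val, inv_div]
  · filter_upwards [H.germ.tendsto.eventually ((tA.comp hk.tendsto').eventually hk.left),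
      H.germ.tendsto.eventually (tA'.eventually hak), H.conj_eq] with y h1 h2 h3
    simp only [Function.comp] at h1
    rw [← h1]
    change a (k (A' (ψ y))) = _
    rw [h2, h3]
  · intro d v
    rw [fderiv_comp_zero hk.an' H.germ.an H.germ.map0, fderiv_comp_zero hk.an' H.germ.an H.germ.map0,
      hdk, hdk, H.comm, rot_comm]
  · filter_upwards [H.germ.tendsto.eventually hak, hsw] with y h1 h2
    rw [h1, h2]

/-- The one-parameter group of a normal form. -/
def flow (j : κ) (ψ χ : Dbl κ → Dbl κ) (c : ℂ) (x : Dbl κ) : Dbl κ := ψ (rot j c (χ x))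

theorem IsGermInv.eventually_flow {ψ χ : Dbl κ → Dbl κ} (h : IsGermInv ψ χ) (j : κ) {P : Dbl κ → Prop}
    (hP : ∀ᶠ x in 𝓝 0, P x) : ∀ᶠ x in 𝓝 0, ∀ c : ℂ, ‖c‖ = 1 → P (flow j ψ χ c x) :=
  h.tendsto'.eventually (eventually_forall_rot j (h.tendsto.eventually hP))

/-- The normal form of a pair of involutions. -/
theorem exists_isPairNF {j : κ} {α β : ℂ} (hα : α ≠ 0) (hβ : β ≠ 0) (hne : ‖β‖ ≠ ‖α‖)
    {a A : Dbl κ → Dbl κ} (ha : AnalyticAt ℂ a 0) (ha0 : a 0 = 0) (haa : ∀ᶠ x in 𝓝 0, a (a x) = x)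
    (hda : ∀ v, fderiv ℂ a 0 v = flip j α v)
    (hA : AnalyticAt ℂ A 0) (hA0 : A 0 = 0) (hAA : ∀ᶠ x in 𝓝 0, A (A x) = x)
    (hdA : ∀ v, fderiv ℂ A 0 v = flip j β v) :
    ∃ ψ χ M, IsPairNF j (α / β) (fun x => a (A x)) ψ χ M ∧
      ∀ᶠ x in 𝓝 0, ∀ c : ℂ, ‖c‖ = 1 → a (flow j ψ χ c x) = flow j ψ χ c⁻¹ (a x) := by
  rcases lt_or_gt_of_ne hne with hlt | hlt
  · obtain ⟨ψ, χ, M, H, hsw⟩ := exists_isPairNF_of_lt hα hβ hlt ha ha0 haa hda hA hA0 hAA hdA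
    refine ⟨ψ, χ, M, H, ?_⟩
    have tf : Tendsto (fun x => flip j 1 (χ x)) (𝓝 0) (𝓝 0) := by
      have := (flip j (1 : ℂ)).continuous.tendsto (0 : Dbl κ)
      rw [map_zero] at this
      exact this.comp H.germ.tendsto'
    filter_upwards [H.germ.tendsto'.eventually (eventually_forall_rot j hsw), H.germ.tendsto'.eventually hsw,
      tf.eventually H.germ.left, H.germ.right] with x h1 h2 h3 h4 c hc
    rw [h4] at h2
    rw [flow, h1 c hc, flip_rot, flow, h2, h3]
  · obtain ⟨ψ, χ, M, H, hsw⟩ := exists_isPairNF_of_lt hβ hα hlt hA hA0 hAA hdA ha ha0 haa hda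
    have hM0 : M 0 ≠ 0 := by rw [H.val]; exact div_ne_zero hβ hα
    have ta : Tendsto a (𝓝 0) (𝓝 0) := AnalyticAt.tendsto_zero ha ha0
    have hMi : ContinuousAt (fun y => (M y)⁻¹) 0 := H.an.continuousAt.inv₀ hM0
    obtain ⟨ε, hε, hinv⟩ := H.inv
    have hsm : ∀ᶠ y in 𝓝 (0 : Dbl κ), ‖y‖ < ε := by
      filter_upwards [Metric.ball_mem_nhds (0 : Dbl κ) hε] with y hy using mem_ball_zero_iff.1 hy
    have hconj : ∀ᶠ y in 𝓝 0, a (A (ψ y)) = ψ (rot j (M y)⁻¹ y) := by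
      filter_upwards [hsm, eventually_rot j hsm hMi (inv_ne_zero hM0),
        eventually_rot j H.conj_eq hMi (inv_ne_zero hM0),
        eventually_rot j (H.germ.tendsto.eventually haa) hMi (inv_ne_zero hM0),
        eventually_rot j (H.germ.tendsto.eventually (ta.eventually hAA)) hMi (inv_ne_zero hM0),
        H.an.continuousAt.eventually_ne hM0] with y h1 h2 h3 h4 h5 h6
      rw [hinv _ _ (inv_ne_zero h6) h1 h2, rot_rot_inv j h6] at h3
      rw [← h3, h5, h4]
    refine ⟨ψ, χ, fun y => (M y)⁻¹, ⟨H.germ, H.an.inv hM0, by rw [H.val, inv_div], ⟨ε, hε, ?_⟩, hconj,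
      H.comm⟩, ?_⟩
    · intro c y hc hy hy'
      rw [hinv c y hc hy hy']
    · have tf : Tendsto (fun x => flip j 1 (χ x)) (𝓝 0) (𝓝 0) := by
        have := (flip j (1 : ℂ)).continuous.tendsto (0 : Dbl κ)
        rw [map_zero] at this
        exact this.comp H.germ.tendsto'
      have hsw' : ∀ᶠ y in 𝓝 0, a (ψ y) = ψ (rot j (M (flip j 1 y))⁻¹ (flip j 1 y)) := by
        have tf' : Tendsto (fun x : Dbl κ => flip j 1 x) (𝓝 0) (𝓝 0) := by
          have := (flip j (1 : ℂ)).continuous.tendsto (0 : Dbl κ)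
          rwa [map_zero] at this
        filter_upwards [hsw, tf'.eventually hconj, H.germ.tendsto.eventually hAA] with y h1 h2 h3
        rw [← h2, ← h1, h3]
      filter_upwards [H.germ.tendsto'.eventually (eventually_forall_rot j hsw'),
        H.germ.tendsto'.eventually hsw', tf.eventually (eventually_forall_rot j hsm),
        tf.eventually hsm, tf.eventually (eventually_rot j H.germ.left hMi (inv_ne_zero hM0)),
        H.germ.right] with x h1 h2 h3 h4 h5 h6 c hc
      have hc' : ‖c⁻¹‖ = 1 := by rw [norm_inv, hc, inv_one]
      rw [h6] at h2
      rw [flow, h1 c hc, flip_rot, hinv _ _ (inv_ne_zero (ne_zero_of_norm_one hc)) h4 (h3 _ hc'),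
        flow, h2, h5, rot_rot, rot_rot, mul_comm]

end

section

/-! ### Functions on an annulus which are homogeneous under a dilation -/

/-- A continuous function on the unit circle with a single Fourier coefficient. -/
theorem eq_zpow_of_integral_eq_zero {f : ℂ → ℂ} (hf : ContinuousOn f (Metric.sphere 0 1)) {k₀ : ℤ}
    (h : ∀ k, k ≠ k₀ → ∫ t in (0 : ℝ)..2 * Real.pi, f (expi t) * expi t ^ (-k) = 0) {z : ℂ} (hz : ‖z‖ = 1) :
    f z = f 1 * z ^ k₀ := by
  have : Fact (0 < 2 * Real.pi) := ⟨Real.two_pi_pos⟩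
  have hc : Continuous fun t : AddCircle (2 * Real.pi) => f (AddCircle.toCircle t : ℂ) := by
    refine hf.comp_continuous (continuous_induced_dom.comp AddCircle.continuous_toCircle) fun t => ?_
    exact mem_sphere_zero_iff_norm.2 (Circle.norm_coe _)
  set g : C(AddCircle (2 * Real.pi), ℂ) := ⟨_, hc⟩ with hg
  have hfour : ∀ (n : ℤ) (t : ℝ), fourier n (t : AddCircle (2 * Real.pi)) = expi t ^ n := by
    intro n t
    rw [fourier_coe_apply, expi_zpow, expi]
    congr 1
    have := Real.pi_ne_zero
    push_cast
    field_simp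
  have hcirc : ∀ t : ℝ, (AddCircle.toCircle (t : AddCircle (2 * Real.pi)) : ℂ) = expi t := by
    intro t
    have := hfour 1 t
    rwa [fourier_one, zpow_one] at this
  have hco : ∀ k, k ≠ k₀ → fourierCoeff g k = 0 := by
    intro k hk
    rw [fourierCoeff_eq_intervalIntegral g k 0, zero_add]
    have : ∀ t : ℝ, fourier (-k) (t : AddCircle (2 * Real.pi)) • g t = f (expi t) * expi t ^ (-k) := by
      intro t
      rw [hfour, hg, ContinuousMap.coe_mk, hcirc, smul_eq_mul, mul_comm]
    simp only [this]
    rw [h k hk, smul_zero]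
  have hsum : Summable (fourierCoeff g) := by
    refine (hasSum_single k₀ fun k hk => hco k hk).summable
  have hval : ∀ t : ℝ, f (expi t) = fourierCoeff g k₀ * expi t ^ k₀ := by
    intro t
    have h1 := has_pointwise_sum_fourier_series_of_summable hsum (t : AddCircle (2 * Real.pi))
    have h2 := hasSum_single (f := fun i => fourierCoeff g i • fourier i (t : AddCircle (2 * Real.pi))) k₀
      fun k hk => by rw [hco k hk, zero_smul]
    have h3 := h1.unique h2
    rw [hfour, hg, ContinuousMap.coe_mk, hcirc, smul_eq_mul] at h3
    exact h3
  obtain ⟨s, rfl⟩ := exists_expi hz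
  have h0 := hval 0
  rw [expi_zero, one_zpow, mul_one] at h0
  rw [hval s, h0]

theorem integral_circle_eq {g : ℂ → ℂ} {C : ℝ} (hC : 1 ≤ C)
    (hg : ∀ z : ℂ, z ≠ 0 → ‖z‖ ≤ C → ‖z⁻¹‖ ≤ C → DifferentiableAt ℂ g z) {r : ℝ} (hr0 : 0 < r) (hr : r ≤ C)
    (hr' : r⁻¹ ≤ C) :
    ∫ t in (0 : ℝ)..2 * Real.pi, g (r * expi t) = ∫ t in (0 : ℝ)..2 * Real.pi, g (expi t) := by
  have hmem : ∀ (z : ℂ) (s t : ℝ), 0 < s → s⁻¹ ≤ C → t ≤ C → s ≤ ‖z‖ → ‖z‖ ≤ t → DifferentiableAt ℂ g z := by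
    intro z s t hs hs' ht h1 h2
    refine hg z (norm_pos_iff.1 (hs.trans_le h1)) (h2.trans ht) ?_
    rw [norm_inv]
    exact (inv_anti₀ hs h1).trans hs'
  have key : ∀ s t : ℝ, 0 < s → s ≤ t → s⁻¹ ≤ C → t ≤ C →
      (∮ z in C(0, t), (z - 0)⁻¹ • g z) = ∮ z in C(0, s), (z - 0)⁻¹ • g z := by
    intro s t hs hst hs' ht
    refine Complex.circleIntegral_sub_center_inv_smul_eq_of_differentiable_on_annulus_off_countable hs hst
      Set.countable_empty (fun z hz => ?_) fun z hz => ?_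
    · simp only [Set.mem_sdiff, Metric.mem_closedBall, dist_zero_right, Metric.mem_ball, not_lt] at hz
      exact (hmem z s t hs hs' ht hz.2 hz.1).continuousAt.continuousWithinAt
    · simp only [Set.mem_sdiff, Metric.mem_closedBall, dist_zero_right, Metric.mem_ball, not_le] at hz
      exact hmem z s t hs hs' ht hz.1.2.le hz.1.1.le
  have hcirc : ∀ s : ℝ, 0 < s → (∮ z in C(0, s), (z - 0)⁻¹ • g z) =
      Complex.I * ∫ t in (0 : ℝ)..2 * Real.pi, g (s * expi t) := by
    intro s hs
    rw [circleIntegral, ← intervalIntegral.integral_const_mul]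
    refine intervalIntegral.integral_congr fun t _ => ?_
    have h1 : circleMap 0 s t = s * expi t := by simp [circleMap, expi]
    have h2 : circleMap 0 s t ≠ 0 := circleMap_ne_center hs.ne'
    simp only [deriv_circleMap, sub_zero, smul_eq_mul]
    rw [← h1]
    field_simp
  have h1 : (∮ z in C(0, r), (z - 0)⁻¹ • g z) = ∮ z in C(0, 1), (z - 0)⁻¹ • g z := by
    rcases le_total r 1 with h | h
    · exact (key r 1 hr0 h hr' hC).symm
    · exact key 1 r one_pos h (by simpa using hC) hr
  rw [hcirc r hr0, hcirc 1 one_pos] at h1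
  simpa using mul_left_cancel₀ Complex.I_ne_zero h1

/-- A function on an annulus with `f (m z) = c f z` is a monomial, if the multiplier `c` is not a power of
`m` other than the given one. -/
theorem eq_zpow_of_dilation {f : ℂ → ℂ} {C : ℝ} (hC : 1 ≤ C)
    (hf : ∀ z : ℂ, z ≠ 0 → ‖z‖ ≤ C → ‖z⁻¹‖ ≤ C → DifferentiableAt ℂ f z) {m c : ℂ} (hm : m ≠ 0) (hmC : ‖m‖ ≤ C)
    (hmC' : ‖m⁻¹‖ ≤ C) (h : ∀ z : ℂ, ‖z‖ = 1 → f (m * z) = c * f z) {k₀ : ℤ}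
    (hk : ∀ k, k ≠ k₀ → c ≠ m ^ k) {z : ℂ} (hz : ‖z‖ = 1) : f z = f 1 * z ^ k₀ := by
  have hCpos : 0 < C := by linarith
  refine eq_zpow_of_integral_eq_zero (fun w hw => ?_) (fun k hk' => ?_) hz
  · rw [mem_sphere_zero_iff_norm] at hw
    exact (hf w (ne_zero_of_norm_one hw) (by rw [hw]; exact hC) (by rw [norm_inv, hw, inv_one]; exact hC)).continuousAt.continuousWithinAt
  · set g : ℂ → ℂ := fun z => f z * z ^ (-k) with hg
    obtain ⟨φ, hφ⟩ : ∃ φ : ℝ, m = ‖m‖ * expi φ := by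
      refine ⟨Complex.arg m, ?_⟩
      rw [expi, Complex.norm_mul_exp_arg_mul_I]
    have hmpos : 0 < ‖m‖ := norm_pos_iff.2 hm
    have h1 : ∫ t in (0 : ℝ)..2 * Real.pi, g (‖m‖ * expi t) = ∫ t in (0 : ℝ)..2 * Real.pi, g (expi t) :=
      integral_circle_eq hC (fun z h0 h1 h2 => (hf z h0 h1 h2).mul (differentiableAt_zpow.2 (Or.inl h0)))
        hmpos hmC (by rwa [norm_inv] at hmC')
    have hper : Function.Periodic (fun t => g (‖m‖ * expi t)) (2 * Real.pi) := fun t => by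
      simp only [expi_periodic t]
    have h2 : ∫ t in (0 : ℝ)..2 * Real.pi, g (‖m‖ * expi (t + φ)) =
        ∫ t in (0 : ℝ)..2 * Real.pi, g (‖m‖ * expi t) := by
      rw [intervalIntegral.integral_comp_add_right (fun t => g (‖m‖ * expi t)), zero_add,
        add_comm (2 * Real.pi), hper.intervalIntegral_add_eq φ 0, zero_add]
    have h3 : ∀ t : ℝ, g (‖m‖ * expi (t + φ)) = c * m ^ (-k) * g (expi t) := by
      intro t
      have : (‖m‖ : ℂ) * expi (t + φ) = m * expi t := by
        conv_rhs => rw [hφ]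
        rw [expi_add]; ring
      rw [this, hg]
      simp only
      rw [h _ (norm_expi t), mul_zpow]
      ring
    simp only [h3] at h2
    rw [intervalIntegral.integral_const_mul, h1] at h2
    by_contra hI
    have h4 := (mul_eq_right₀ hI).1 h2
    rw [zpow_neg, mul_inv_eq_one₀ (zpow_ne_zero _ hm)] at h4
    exact hk k hk' h4

variable {κ : Type*} [Fintype κ] [DecidableEq κ]

theorem differentiableAt_rot (j : κ) (y : Dbl κ) {z : ℂ} (hz : z ≠ 0) :
    DifferentiableAt ℂ (fun z => rot j z y) z := by
  refine DifferentiableAt.prodMk ?_ ?_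
  · refine differentiableAt_pi.2 fun i => ?_
    change DifferentiableAt ℂ (fun z => (rot j z y).1 i) z
    by_cases hi : i = j
    · subst hi; simp only [rot_fst_self]; fun_prop
    · simp only [rot_fst_ne hi]; fun_prop
  · refine differentiableAt_pi.2 fun i => ?_
    change DifferentiableAt ℂ (fun z => (rot j z y).2 i) z
    by_cases hi : i = j
    · subst hi; simp only [rot_snd_self]; exact (differentiableAt_inv hz).mul_const _
    · simp only [rot_snd_ne hi]; fun_prop

set_option maxHeartbeats 400000 in
/-- A germ which commutes with `y ↦ rot j (M y) y` commutes with all rotations. -/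
theorem commute_rot_of_commute_germ {j : κ} {F : Dbl κ → Dbl κ} (hF : AnalyticAt ℂ F 0) (hF0 : F 0 = 0)
    {M : Dbl κ → ℂ} (hM : AnalyticAt ℂ M 0) (hM0 : M 0 ≠ 0) (hM1 : ‖M 0‖ ≠ 1)
    (hinv : ∃ ε > 0, ∀ c y, c ≠ 0 → ‖y‖ < ε → ‖rot j c y‖ < ε → M (rot j c y) = M y)
    (hcomm : ∀ᶠ y in 𝓝 0, F (rot j (M y) y) = rot j (M (F y)) (F y)) :
    ∀ᶠ y in 𝓝 0, ∀ c : ℂ, ‖c‖ = 1 → F (rot j c y) = rot j c (F y) := by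
  obtain ⟨ε, hε, hinv⟩ := hinv
  obtain ⟨C, hC, hMb⟩ := exists_bound_near hM.continuousAt hM0
  have tF : Tendsto F (𝓝 0) (𝓝 0) := AnalyticAt.tendsto_zero hF hF0
  have hsm : ∀ᶠ y in 𝓝 (0 : Dbl κ), ‖y‖ < ε := by
    filter_upwards [Metric.ball_mem_nhds (0 : Dbl κ) hε] with y hy using mem_ball_zero_iff.1 hy
  have hMF : AnalyticAt ℂ (fun y => M (F y)) 0 := AnalyticAt.comp_zero hM hF hF0
  have hlog0 : Real.log ‖M 0‖ ≠ 0 :=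
    Real.log_ne_zero_of_pos_of_ne_one (norm_pos_iff.2 hM0) hM1
  have hlog : ∀ᶠ y in 𝓝 (0 : Dbl κ), |Real.log ‖M (F y)‖ - Real.log ‖M y‖| < |Real.log ‖M y‖| := by
    have c1 : ContinuousAt (fun y => Real.log ‖M y‖) 0 :=
      ContinuousAt.comp (f := fun y => ‖M y‖) (Real.continuousAt_log (norm_ne_zero_iff.2 hM0))
        hM.continuousAt.norm
    have c2 : ContinuousAt (fun y => Real.log ‖M (F y)‖) 0 :=
      ContinuousAt.comp (f := fun y => ‖M (F y)‖)
        (Real.continuousAt_log (by rw [hF0]; exact norm_ne_zero_iff.2 hM0)) hMF.continuousAt.norm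
    refine ((c2.sub c1).abs.tendsto.eventually_lt c1.abs.tendsto ?_)
    simp only [Pi.sub_apply]
    rw [hF0, sub_self, abs_zero]
    exact abs_pos.2 hlog0
  have hall : ∀ᶠ y in 𝓝 (0 : Dbl κ), AnalyticAt ℂ F y ∧ AnalyticAt ℂ (fun y => M (F y)) y ∧
      F (rot j (M y) y) = rot j (M (F y)) (F y) ∧ ‖y‖ < ε ∧ ‖F y‖ < ε ∧ M (F y) ≠ 0 ∧
      ‖rot j (M (F y)) (F y)‖ < ε := by
    filter_upwards [hF.eventually_analyticAt, hMF.eventually_analyticAt, hcomm, hsm, tF.eventually hsm,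
      tF.eventually hMb, tF.eventually (eventually_forall_rot_le j hsm hC)] with y h1 h2 h3 h4 h5 h6 h7
    exact ⟨h1, h2, h3, h4, h5, h6.1, h7 _ h6.2.1.le h6.2.2.le⟩
  filter_upwards [eventually_forall_rot_le j hall hC, hMb, hlog, hall] with y hy hb hl hy1 z hz
  set m := M y with hm
  have hb1 : ‖m‖ ≤ C := hb.2.1.le
  have hb2 : ‖m⁻¹‖ ≤ C := hb.2.2.le
  have hunit : ∀ z : ℂ, ‖z‖ = 1 → z ≠ 0 ∧ ‖z‖ ≤ C ∧ ‖z⁻¹‖ ≤ C := fun z hz =>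
    ⟨ne_zero_of_norm_one hz, by rw [hz]; exact hC, by rw [norm_inv, hz, inv_one]; exact hC⟩
  have hMrot : ∀ z : ℂ, ‖z‖ = 1 → M (rot j z y) = m := fun z hz => by
    obtain ⟨h0, h1, h2⟩ := hunit z hz
    exact hinv z y h0 hy1.2.2.2.1 (hy z h1 h2).2.2.2.1
  have hstep : ∀ z : ℂ, ‖z‖ = 1 → F (rot j (m * z) y) = rot j (M (F (rot j z y))) (F (rot j z y)) := by
    intro z hz
    obtain ⟨h0, h1, h2⟩ := hunit z hz
    have := (hy z h1 h2).2.2.1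
    rwa [hMrot z hz, rot_rot] at this
  have hlm : Real.log ‖m‖ ≠ 0 := fun h => by
    rw [h, abs_zero] at hl
    exact absurd hl (not_lt.2 (abs_nonneg _))
  have hk0 : ∀ k : ℤ, k ≠ 0 → (1 : ℂ) ≠ m ^ k := by
    intro k hk h
    have := congrArg (fun z : ℂ => Real.log ‖z‖) h
    simp only [norm_one, Real.log_one, norm_zpow, Real.log_zpow] at this
    exact mul_ne_zero (Int.cast_ne_zero.2 hk) hlm this.symm
  have hw : ∀ z : ℂ, ‖z‖ = 1 → M (F (rot j z y)) = M (F y) := by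
    intro z hz
    have := eq_zpow_of_dilation (f := fun z => M (F (rot j z y))) hC (fun z h0 h1 h2 => ?_) hb.1 hb1 hb2
      (c := 1) (fun z hz => ?_) hk0 hz
    · simpa using this
    · exact DifferentiableAt.comp (g := fun y => M (F y)) z ((hy z h1 h2).2.1.differentiableAt)
        (differentiableAt_rot j y h0)
    · obtain ⟨h0, h1, h2⟩ := hunit z hz
      rw [hstep z hz, one_mul]
      have h3 := hy z h1 h2
      exact hinv _ _ h3.2.2.2.2.2.1 h3.2.2.2.2.1 h3.2.2.2.2.2.2
  set c₀ := M (F y) with hc₀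
  have hc0 : c₀ ≠ 0 := hy1.2.2.2.2.2.1
  have hstep' : ∀ z : ℂ, ‖z‖ = 1 → F (rot j (m * z) y) = rot j c₀ (F (rot j z y)) := fun z hz => by
    rw [hstep z hz, hw z hz]
  have hFd : ∀ z : ℂ, z ≠ 0 → ‖z‖ ≤ C → ‖z⁻¹‖ ≤ C → DifferentiableAt ℂ (fun z => F (rot j z y)) z :=
    fun z h0 h1 h2 => ((hy z h1 h2).1.differentiableAt).comp z (differentiableAt_rot j y h0)
  have hk1 : ∀ k : ℤ, k ≠ 1 → c₀ ≠ m ^ k := by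
    intro k hk h
    rw [h, norm_zpow, Real.log_zpow, ← sub_one_mul, abs_mul] at hl
    have h1 : (1 : ℝ) ≤ |(k : ℝ) - 1| := by
      have : (1 : ℤ) ≤ |k - 1| := Int.one_le_abs (sub_ne_zero.2 hk)
      exact_mod_cast this
    have h2 := abs_pos.2 hlm
    nlinarith
  have hk2 : ∀ k : ℤ, k ≠ -1 → c₀⁻¹ ≠ m ^ k := by
    intro k hk h
    refine hk1 (-k) (by omega) ?_
    rw [zpow_neg, ← h, inv_inv]
  have d1 : ∀ i, ∀ z : ℂ, z ≠ 0 → ‖z‖ ≤ C → ‖z⁻¹‖ ≤ C →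
      DifferentiableAt ℂ (fun z => (F (rot j z y)).1 i) z := fun i z h0 h1 h2 =>
    differentiableAt_pi.1 (hFd z h0 h1 h2).fst i
  have d2 : ∀ i, ∀ z : ℂ, z ≠ 0 → ‖z‖ ≤ C → ‖z⁻¹‖ ≤ C →
      DifferentiableAt ℂ (fun z => (F (rot j z y)).2 i) z := fun i z h0 h1 h2 =>
    differentiableAt_pi.1 (hFd z h0 h1 h2).snd i
  refine Dbl.ext' j ?_ ?_ fun i hi => ⟨?_, ?_⟩
  · rw [rot_fst_self]
    have := eq_zpow_of_dilation hC (d1 j) hb.1 hb1 hb2 (c := c₀)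
      (fun z hz => by rw [hstep' z hz, rot_fst_self]) hk1 hz
    simp only [rot_one, zpow_one] at this
    rw [this, mul_comm]
  · rw [rot_snd_self]
    have := eq_zpow_of_dilation hC (d2 j) hb.1 hb1 hb2 (c := c₀⁻¹)
      (fun z hz => by rw [hstep' z hz, rot_snd_self]) hk2 hz
    simp only [rot_one, zpow_neg, zpow_one] at this
    rw [this, mul_comm]
  · rw [rot_fst_ne hi]
    have := eq_zpow_of_dilation hC (d1 i) hb.1 hb1 hb2 (c := 1)
      (fun z hz => by rw [hstep' z hz, rot_fst_ne hi, one_mul]) hk0 hz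
    simpa only [rot_one, zpow_zero, mul_one] using this
  · rw [rot_snd_ne hi]
    have := eq_zpow_of_dilation hC (d2 i) hb.1 hb1 hb2 (c := 1)
      (fun z hz => by rw [hstep' z hz, rot_snd_ne hi, one_mul]) hk0 hz
    simpa only [rot_one, zpow_zero, mul_one] using this

end

section

variable {κ : Type*} [Fintype κ] [DecidableEq κ]

/-- Families of analytic germs with a common domain. -/
theorem eventually_forall_eq_of_forall_eventually {E F X : Type*} [NormedAddCommGroup E] [NormedSpace ℂ E]
    [NormedAddCommGroup F] [NormedSpace ℂ F] [CompleteSpace F] {S : Set X} {P Q : X → E → F}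
    (hP : ∀ᶠ x in 𝓝 0, ∀ c ∈ S, AnalyticAt ℂ (P c) x) (hQ : ∀ᶠ x in 𝓝 0, ∀ c ∈ S, AnalyticAt ℂ (Q c) x)
    (h : ∀ c ∈ S, ∀ᶠ x in 𝓝 0, P c x = Q c x) : ∀ᶠ x in 𝓝 0, ∀ c ∈ S, P c x = Q c x := by
  obtain ⟨r, hr, hb⟩ := Metric.eventually_nhds_iff_ball.1 (hP.and hQ)
  filter_upwards [Metric.ball_mem_nhds (0 : E) hr] with x hx c hc
  exact eventually_forall_ball_of_eventually (fun y hy => (hb y hy).1 c hc) (fun y hy => (hb y hy).2 c hc) hr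
    (h c hc) x hx

theorem avg_eq_rot_avg (i j : κ) {B : Dbl κ → Dbl κ} {c : ℂ} (hc : c ≠ 0) {w w' : Dbl κ}
    (h : ∀ d : ℂ, ‖d‖ = 1 → B (rot j d w') = rot i c (B (rot j d w))) :
    avg j B w' = rot i c (avg j B w) := by
  let e : Dbl κ ≃L[ℂ] Dbl κ := ContinuousLinearEquiv.equivOfInverse (rot i c) (rot i c⁻¹)
    (rot_inv_rot i hc) (rot_rot_inv i hc)
  have h1 : ∀ t, rot j (expi t)⁻¹ (B (rot j (expi t) w')) = e (rot j (expi t)⁻¹ (B (rot j (expi t) w))) := by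
    intro t
    rw [h _ (norm_expi t)]
    exact (rot_comm i j c _ _).symm
  have h2 : (∫ t in (0 : ℝ)..2 * Real.pi, e (rot j (expi t)⁻¹ (B (rot j (expi t) w)))) =
      e (∫ t in (0 : ℝ)..2 * Real.pi, rot j (expi t)⁻¹ (B (rot j (expi t) w))) := by
    rw [intervalIntegral.integral_of_le Real.two_pi_pos.le, intervalIntegral.integral_of_le Real.two_pi_pos.le]
    exact e.integral_comp_comm _
  unfold avg
  simp only [h1]
  rw [h2]
  exact (e.map_smul_of_tower _ _).symm

section Flow

variable {j : κ} {ψ χ : Dbl κ → Dbl κ}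

theorem flow_zero (h : IsGermInv ψ χ) (c : ℂ) : flow j ψ χ c 0 = 0 := by
  rw [flow, h.map0', map_zero, h.map0]

theorem analyticAt_flow (h : IsGermInv ψ χ) (c : ℂ) : AnalyticAt ℂ (flow j ψ χ c) 0 := by
  have h1 : AnalyticAt ℂ (fun x => rot j c (χ x)) 0 :=
    AnalyticAt.comp_zero ((rot j c).analyticAt 0) h.an' h.map0'
  have h2 : rot j c (χ 0) = 0 := by rw [h.map0', map_zero]
  exact AnalyticAt.comp_zero (f := fun x => rot j c (χ x)) h.an h1 h2

theorem eventually_analyticAt_flow (h : IsGermInv ψ χ) :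
    ∀ᶠ x in 𝓝 0, ∀ c : ℂ, ‖c‖ = 1 → AnalyticAt ℂ (flow j ψ χ c) x := by
  filter_upwards [h.tendsto'.eventually (eventually_forall_rot j h.an.eventually_analyticAt),
    h.an'.eventually_analyticAt] with x h1 h2 c hc
  exact AnalyticAt.fun_comp (f := fun x => rot j c (χ x)) (h1 c hc)
    (((rot j c).analyticAt _).fun_comp h2)

theorem fderiv_symm_comm (h : IsGermInv ψ χ)
    (hd : ∀ c v, fderiv ℂ ψ 0 (rot j c v) = rot j c (fderiv ℂ ψ 0 v)) (c : ℂ) (v : Dbl κ) :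
    fderiv ℂ χ 0 (rot j c v) = rot j c (fderiv ℂ χ 0 v) := by
  conv_lhs => rw [← h.fderiv_right v, ← hd, h.fderiv_left]

end Flow

namespace IsPairNF

variable {j : κ} {μ : ℂ} {σ ψ χ : Dbl κ → Dbl κ} {M : Dbl κ → ℂ}

/-- A germ which commutes with `σ` commutes with its one-parameter group. -/
theorem commute_flow (H : IsPairNF j μ σ ψ χ M) (hμ0 : μ ≠ 0) (hμ1 : ‖μ‖ ≠ 1) {F : Dbl κ → Dbl κ}
    (hF : AnalyticAt ℂ F 0) (hF0 : F 0 = 0) (hc : ∀ᶠ x in 𝓝 0, F (σ x) = σ (F x)) :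
    ∀ᶠ x in 𝓝 0, ∀ c : ℂ, ‖c‖ = 1 → F (flow j ψ χ c x) = flow j ψ χ c (F x) := by
  have hFψ : AnalyticAt ℂ (fun y => F (ψ y)) 0 := AnalyticAt.comp_zero hF H.germ.an H.germ.map0
  have hFψ0 : F (ψ 0) = 0 := by rw [H.germ.map0, hF0]
  have hF' : AnalyticAt ℂ (fun y => χ (F (ψ y))) 0 := AnalyticAt.comp_zero H.germ.an' hFψ hFψ0
  have hF'0 : χ (F (ψ 0)) = 0 := by rw [hFψ0, H.germ.map0']
  have tF : Tendsto F (𝓝 0) (𝓝 0) := AnalyticAt.tendsto_zero hF hF0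
  have tF' : Tendsto (fun y => χ (F (ψ y))) (𝓝 0) (𝓝 0) := AnalyticAt.tendsto_zero hF' hF'0
  have hM0 : M 0 ≠ 0 := by rwa [H.val]
  have hcomm : ∀ᶠ y in 𝓝 0, χ (F (ψ (rot j (M y) y))) = rot j (M (χ (F (ψ y)))) (χ (F (ψ y))) := by
    filter_upwards [H.conj_eq, H.germ.tendsto.eventually hc,
      H.germ.tendsto.eventually (tF.eventually H.germ.right), tF'.eventually H.conj_eq,
      tF'.eventually (eventually_rot j H.germ.left H.an.continuousAt hM0)] with y h1 h2 h3 h4 h5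
    rw [← h1, h2, ← h5, ← h4, h3]
  have key := commute_rot_of_commute_germ hF' hF'0 H.an hM0 (by rwa [H.val]) H.inv hcomm
  filter_upwards [H.germ.tendsto'.eventually key, H.germ.eventually_flow j (tF.eventually H.germ.right),
    H.germ.right] with x h1 h2 h3 c hc
  rw [← h2 c hc]
  rw [flow, h1 c hc, h3]
  rfl

/-- The one-parameter groups of commuting germs with the same rotation agree. -/
theorem flow_eq_of_commute (H : IsPairNF j μ σ ψ χ M) (hμ0 : μ ≠ 0) (hμ1 : ‖μ‖ ≠ 1)
    (hσ : AnalyticAt ℂ σ 0) (hσ0 : σ 0 = 0) {μ' : ℂ} {σ' ψ' χ' : Dbl κ → Dbl κ} {M' : Dbl κ → ℂ}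
    (H' : IsPairNF j μ' σ' ψ' χ' M') (hμ'0 : μ' ≠ 0) (hμ'1 : ‖μ'‖ ≠ 1)
    (hc : ∀ᶠ x in 𝓝 0, σ (σ' x) = σ' (σ x)) :
    ∀ᶠ x in 𝓝 0, ∀ c : ℂ, ‖c‖ = 1 → flow j ψ' χ' c x = flow j ψ χ c x := by
  have h1 := H'.commute_flow hμ'0 hμ'1 hσ hσ0 hc
  have h2 : ∀ c : ℂ, ‖c‖ = 1 → ∀ᶠ x in 𝓝 0, ∀ d : ℂ, ‖d‖ = 1 →
      flow j ψ' χ' c (flow j ψ χ d x) = flow j ψ χ d (flow j ψ' χ' c x) := fun c hc =>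
    H.commute_flow hμ0 hμ1 (analyticAt_flow H'.germ c) (flow_zero H'.germ c) (by
      filter_upwards [h1] with x hx using (hx c hc).symm)
  set B : Dbl κ → Dbl κ := fun y => χ' (ψ y) with hB
  have hBg : IsGermInv B (fun y => χ (ψ' y)) := H'.germ.symm.comp H.germ
  have hdB : ∀ c v, fderiv ℂ B 0 (rot j c v) = rot j c (fderiv ℂ B 0 v) := fun c v => by
    rw [hB, fderiv_comp_zero H'.germ.an' H.germ.an H.germ.map0, H.comm,
      fderiv_symm_comm H'.germ H'.comm, fderiv_comp_zero H'.germ.an' H.germ.an H.germ.map0]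
  have hha : AnalyticAt ℂ (avg j B) 0 := analyticAt_avg j hBg.an
  obtain ⟨k, hk⟩ := IsGermInv.exists_of_fderiv_injective hha (avg_zero j hBg.map0) fun v hv => by
    rw [(hasFDerivAt_avg j hBg.an hBg.map0 fun c _ v => hdB c v).fderiv] at hv
    have := hBg.fderiv_left v
    rw [← this, hv, map_zero]
  have h3 : ∀ c : ℂ, ‖c‖ = 1 → ∀ᶠ x in 𝓝 0, flow j ψ' χ' c x = flow j ψ χ c x := by
    intro c hc
    have tf : Tendsto (fun y => flow j ψ' χ' c (ψ y)) (𝓝 0) (𝓝 0) :=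
      (AnalyticAt.tendsto_zero (analyticAt_flow H'.germ c) (flow_zero H'.germ c)).comp H.germ.tendsto
    have tr : Tendsto (fun y : Dbl κ => rot j c y) (𝓝 0) (𝓝 0) :=
      (rot_germInv j (ne_zero_of_norm_one hc)).tendsto
    have hkey : ∀ᶠ y in 𝓝 0, χ (flow j ψ' χ' c (ψ y)) = rot j c y := by
      filter_upwards [H.germ.tendsto.eventually (h2 c hc), (H.germ.tendsto'.comp tf).eventually
        (eventually_forall_rot j H.germ.left), H.germ.left,
        eventually_forall_rot j (tf.eventually H.germ.right),
        eventually_forall_rot j (H.germ.tendsto.eventually (H'.germ.tendsto'.eventually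
          (eventually_forall_rot j H'.germ.left))),
        (H.germ.tendsto'.comp tf).eventually hk.left, tr.eventually hk.left] with y e1 e2 e3 e4 e5 e6 e7
      have e8 : avg j B (χ (flow j ψ' χ' c (ψ y))) = rot j c (avg j B y) := by
        refine avg_eq_rot_avg j j (ne_zero_of_norm_one hc) fun d hd => ?_
        have h5 : ψ (rot j d (χ (flow j ψ' χ' c (ψ y)))) = flow j ψ' χ' c (ψ (rot j d y)) := by
          have := e1 d hd
          rw [flow, flow, flow, e3] at this
          exact this.symm
        rw [hB]
        simp only
        rw [h5]
        exact e5 d hd c hc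
      simp only [Function.comp] at e6
      rw [← e6, e8, ← avg_rot j B hc, e7]
    have tf' : Tendsto (fun x => flow j ψ' χ' c x) (𝓝 0) (𝓝 0) :=
      AnalyticAt.tendsto_zero (analyticAt_flow H'.germ c) (flow_zero H'.germ c)
    filter_upwards [H.germ.tendsto'.eventually hkey, H.germ.right, tf'.eventually H.germ.right]
      with x e1 e2 e3
    rw [e2] at e1
    exact e3.symm.trans (congrArg ψ e1)
  exact eventually_forall_eq_of_forall_eventually (S := {c : ℂ | ‖c‖ = 1})
    (eventually_analyticAt_flow H'.germ) (eventually_analyticAt_flow H.germ) h3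

/-- The one-parameter groups of commuting germs commute. -/
theorem flow_comm (H : IsPairNF j μ σ ψ χ M) (hμ0 : μ ≠ 0) (hμ1 : ‖μ‖ ≠ 1)
    (hσ : AnalyticAt ℂ σ 0) (hσ0 : σ 0 = 0) {i : κ} {μ' : ℂ} {σ' ψ' χ' : Dbl κ → Dbl κ} {M' : Dbl κ → ℂ}
    (H' : IsPairNF i μ' σ' ψ' χ' M') (hμ'0 : μ' ≠ 0) (hμ'1 : ‖μ'‖ ≠ 1)
    (hc : ∀ᶠ x in 𝓝 0, σ (σ' x) = σ' (σ x)) :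
    ∀ᶠ x in 𝓝 0, ∀ c d : ℂ, ‖c‖ = 1 → ‖d‖ = 1 →
      flow i ψ' χ' c (flow j ψ χ d x) = flow j ψ χ d (flow i ψ' χ' c x) := by
  have h1 := H'.commute_flow hμ'0 hμ'1 hσ hσ0 hc
  have h2 : ∀ c : ℂ, ‖c‖ = 1 → ∀ᶠ x in 𝓝 0, ∀ d : ℂ, ‖d‖ = 1 →
      flow i ψ' χ' c (flow j ψ χ d x) = flow j ψ χ d (flow i ψ' χ' c x) := fun c hc =>
    H.commute_flow hμ0 hμ1 (analyticAt_flow H'.germ c) (flow_zero H'.germ c) (by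
      filter_upwards [h1] with x hx using (hx c hc).symm)
  have h3 := eventually_forall_eq_of_forall_eventually (S := {c : ℂ × ℂ | ‖c.1‖ = 1 ∧ ‖c.2‖ = 1})
    (P := fun c x => flow i ψ' χ' c.1 (flow j ψ χ c.2 x))
    (Q := fun c x => flow j ψ χ c.2 (flow i ψ' χ' c.1 x)) (by
      filter_upwards [eventually_analyticAt_flow (j := j) H.germ,
        H.germ.eventually_flow j (eventually_analyticAt_flow (j := i) H'.germ)] with x e1 e2 c hc
      exact AnalyticAt.fun_comp (e2 _ hc.2 _ hc.1) (e1 _ hc.2)) (by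
      filter_upwards [eventually_analyticAt_flow (j := i) H'.germ,
        H'.germ.eventually_flow i (eventually_analyticAt_flow (j := j) H.germ)] with x e1 e2 c hc
      exact AnalyticAt.fun_comp (e2 _ hc.1 _ hc.2) (e1 _ hc.1)) fun c hc => by
      filter_upwards [h2 c.1 hc.1] with x hx using hx _ hc.2
  filter_upwards [h3] with x hx c d hc hd
  exact hx (c, d) ⟨hc, hd⟩

end IsPairNF

/-- Commuting circle actions are simultaneously linearizable. -/
theorem exists_simultaneous_linearization {ψ χ : κ → Dbl κ → Dbl κ} (h : ∀ k, IsGermInv (ψ k) (χ k))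
    (hd : ∀ k c v, fderiv ℂ (ψ k) 0 (rot k c v) = rot k c (fderiv ℂ (ψ k) 0 v))
    (hc : ∀ i k, i ≠ k → ∀ᶠ x in 𝓝 0, ∀ c d : ℂ, ‖c‖ = 1 → ‖d‖ = 1 →
      flow i (ψ i) (χ i) c (flow k (ψ k) (χ k) d x) = flow k (ψ k) (χ k) d (flow i (ψ i) (χ i) c x)) :
    ∃ f : Dbl κ → Dbl κ, AnalyticAt ℂ f 0 ∧ f 0 = 0 ∧ (∀ v, fderiv ℂ f 0 v = v) ∧
      ∀ k, ∀ᶠ x in 𝓝 0, ∀ c : ℂ, ‖c‖ = 1 → f (flow k (ψ k) (χ k) c x) = rot k c (f x) := by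
  suffices hs : ∀ s : Finset κ, ∃ f : Dbl κ → Dbl κ, AnalyticAt ℂ f 0 ∧ f 0 = 0 ∧
      (∀ v, fderiv ℂ f 0 v = v) ∧
      ∀ k ∈ s, ∀ᶠ x in 𝓝 0, ∀ c : ℂ, ‖c‖ = 1 → f (flow k (ψ k) (χ k) c x) = rot k c (f x) by
    obtain ⟨f, h1, h2, h3, h4⟩ := hs Finset.univ
    exact ⟨f, h1, h2, h3, fun k => h4 k (Finset.mem_univ k)⟩
  intro s
  induction s using Finset.induction_on with
  | empty => exact ⟨id, analyticAt_id, rfl, fun v => by simp, by simp⟩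
  | insert k s hk ih =>
    obtain ⟨f, fan, f0, fd, fs⟩ := ih
    set B : Dbl κ → Dbl κ := fun y => f (ψ k y) with hB
    have hBan : AnalyticAt ℂ B 0 := AnalyticAt.comp_zero fan (h k).an (h k).map0
    have hB0 : B 0 = 0 := by simp only [hB]; rw [(h k).map0, f0]
    have hBd : ∀ v, fderiv ℂ B 0 v = fderiv ℂ (ψ k) 0 v := fun v => by
      rw [hB, fderiv_comp_zero fan (h k).an (h k).map0, fd]
    have hav : AnalyticAt ℂ (avg k B) 0 := analyticAt_avg k hBan
    refine ⟨fun x => avg k B (χ k x), AnalyticAt.comp_zero hav (h k).an' (h k).map0', ?_, fun v => ?_, ?_⟩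
    · simp only
      rw [(h k).map0', avg_zero k hB0]
    · rw [fderiv_comp_zero hav (h k).an' (h k).map0',
        (hasFDerivAt_avg k hBan hB0 fun c _ v => by rw [hBd, hBd, hd]).fderiv, hBd, (h k).fderiv_right]
    · intro i hi
      rcases Finset.mem_insert.1 hi with rfl | his
      · filter_upwards [(h i).tendsto'.eventually (eventually_forall_rot i (h i).left)] with x h1 c hc1
        rw [flow, h1 c hc1, avg_rot i B hc1]
      · have hik : i ≠ k := fun e => hk (e ▸ his)
        filter_upwards [hc i k hik, (h k).eventually_flow k (fs i his)] with x h1 h2 c hc1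
        refine avg_eq_rot_avg i k (ne_zero_of_norm_one hc1) fun d hd1 => ?_
        have h3 := h2 d hd1 c hc1
        rw [h1 c d hc1 hd1] at h3
        exact h3

end

section

section Semilinear

variable {E E' F F' : Type*} [NormedAddCommGroup E] [NormedSpace ℂ E] [NormedAddCommGroup E']
  [NormedSpace ℂ E'] [NormedAddCommGroup F] [NormedSpace ℂ F] [NormedAddCommGroup F'] [NormedSpace ℂ F']

/-- The conjugate of a multilinear map by antilinear maps. -/
def semiconjMultilinear (R : F →SL[starRingEnd ℂ] F') (S : E' →SL[starRingEnd ℂ] E) {n : ℕ}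
    (m : E [×n]→L[ℂ] F) : E' [×n]→L[ℂ] F' where
  toFun v := R (m fun i => S (v i))
  map_update_add' := by
    intro _ v i x y
    have h : ∀ z, (fun l => S (Function.update v i z l)) = Function.update (fun l => S (v l)) i (S z) := fun z => by
      ext l
      rcases eq_or_ne l i with rfl | hl
      · simp
      · simp [hl]
    simp only [h, map_add, m.map_update_add]
  map_update_smul' := by
    intro _ v i c x
    have h : ∀ z, (fun l => S (Function.update v i z l)) = Function.update (fun l => S (v l)) i (S z) := fun z => by
      ext l
      rcases eq_or_ne l i with rfl | hl
      · simp
      · simp [hl]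
    simp only [h, map_smulₛₗ, m.map_update_smul]
    simp
  cont := R.continuous.comp (m.cont.comp (continuous_pi fun i => S.continuous.comp (continuous_apply i)))

theorem norm_semiconjMultilinear_le (R : F →SL[starRingEnd ℂ] F') (S : E' →SL[starRingEnd ℂ] E) {n : ℕ}
    (m : E [×n]→L[ℂ] F) : ‖semiconjMultilinear R S m‖ ≤ ‖R‖ * ‖m‖ * ‖S‖ ^ n := by
  refine ContinuousMultilinearMap.opNorm_le_bound (by positivity) fun v => ?_
  change ‖R (m fun i => S (v i))‖ ≤ _
  calc ‖R (m fun i => S (v i))‖ ≤ ‖R‖ * ‖m fun i => S (v i)‖ := R.le_opNorm _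
    _ ≤ ‖R‖ * (‖m‖ * ∏ i, ‖S (v i)‖) := by gcongr; exact m.le_opNorm _
    _ ≤ ‖R‖ * (‖m‖ * ∏ i, ‖S‖ * ‖v i‖) := by
        gcongr with i
        exact S.le_opNorm _
    _ = ‖R‖ * ‖m‖ * ‖S‖ ^ n * ∏ i, ‖v i‖ := by
        rw [Finset.prod_mul_distrib, Finset.prod_const, Finset.card_univ, Fintype.card_fin]; ring

theorem AnalyticAt.semiconj (R : F →SL[starRingEnd ℂ] F') (S : E' →SL[starRingEnd ℂ] E) {f : E → F}
    (hf : AnalyticAt ℂ f 0) : AnalyticAt ℂ (fun x => R (f (S x))) 0 := by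
  obtain ⟨p, r, hp⟩ := hf
  obtain ⟨r', hr'0, hr'⟩ := ENNReal.lt_iff_exists_nnreal_btwn.1 hp.r_pos
  have hr'0 : 0 < r' := by exact_mod_cast hr'0
  obtain ⟨C, -, hC⟩ := p.norm_mul_pow_le_of_lt_radius (hr'.trans_le hp.r_le)
  set s : NNReal := r' / (‖S‖₊ + 1) with hs
  have hs0 : 0 < s := by positivity
  have hsS : (‖S‖ : ℝ) * s ≤ r' := by
    have : ‖S‖₊ * s ≤ r' := by
      rw [hs, ← mul_div_assoc]
      refine NNReal.div_le_of_le_mul ?_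
      rw [mul_comm]
      gcongr
      exact le_self_add
    exact_mod_cast this
  refine ⟨fun n => semiconjMultilinear R S (p n), s, ?_, by exact_mod_cast hs0, ?_⟩
  · refine FormalMultilinearSeries.le_radius_of_bound _ (‖R‖ * C) fun n => ?_
    calc ‖semiconjMultilinear R S (p n)‖ * (s : ℝ) ^ n ≤ ‖R‖ * ‖p n‖ * ‖S‖ ^ n * s ^ n := by
          gcongr; exact norm_semiconjMultilinear_le R S _
      _ = ‖R‖ * (‖p n‖ * (‖S‖ * s) ^ n) := by rw [mul_pow]; ring
      _ ≤ ‖R‖ * (‖p n‖ * r' ^ n) := by gcongr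
      _ ≤ ‖R‖ * C := by gcongr; exact hC n
  · intro y hy
    have hy' : ‖y‖ < s := by simpa using hy
    have hSy : S y ∈ Metric.eball (0 : E) r := by
      have h1 : ‖S y‖ ≤ r' := by
        refine (S.le_opNorm y).trans (le_trans ?_ hsS)
        gcongr
      have : ‖S y‖₊ ≤ r' := h1
      rw [Metric.mem_eball, edist_zero_right, enorm_eq_nnnorm]
      exact lt_of_le_of_lt (by exact_mod_cast this) hr'
    have := (hp.hasSum hSy).mapL R
    simp only [zero_add] at this ⊢
    exact this

end Semilinear

end

section

section GermMonoid

variable {X : Type*} [TopologicalSpace X]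

/-- The maps which are continuous at the point `x₀` and fix it. -/
def fixingMonoid (x₀ : X) : Submonoid (Function.End X) where
  carrier := {f | Tendsto f (𝓝 x₀) (𝓝 x₀)}
  mul_mem' := fun hf hg => Tendsto.comp hf hg
  one_mem' := tendsto_id

/-- Equality of germs. -/
def germCon (x₀ : X) : Con (fixingMonoid x₀) where
  r f g := ∀ᶠ x in 𝓝 x₀, f.1 x = g.1 x
  iseqv := ⟨fun f => .of_forall fun x => rfl, fun h => h.mono fun x hx => hx.symm,
    fun h h' => by filter_upwards [h, h'] with x hx hx' using hx.trans hx'⟩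
  mul' := fun {f g f' g'} h h' => by
    have t : Tendsto f'.1 (𝓝 x₀) (𝓝 x₀) := f'.2
    filter_upwards [t.eventually h, h'] with x h1 h2
    change f.1 (f'.1 x) = g.1 (g'.1 x)
    rw [h1, h2]

/-- The germ of a map fixing a point. -/
def toGerm (x₀ : X) (f : X → X) (hf : Tendsto f (𝓝 x₀) (𝓝 x₀)) : (germCon x₀).Quotient :=
  ((⟨f, hf⟩ : fixingMonoid x₀) : (germCon x₀).Quotient)

theorem toGerm_eq {x₀ : X} {f g : X → X} {hf : Tendsto f (𝓝 x₀) (𝓝 x₀)} {hg : Tendsto g (𝓝 x₀) (𝓝 x₀)} :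
    toGerm x₀ f hf = toGerm x₀ g hg ↔ ∀ᶠ x in 𝓝 x₀, f x = g x :=
  (germCon x₀).eq

theorem conjugate_commutes_of_involutions {G : Type*} [Monoid G] {x y X Y : G} (hx : x * x = 1) (hy : y * y = 1)
    (hX : X * X = 1) (hY : Y * Y = 1) (hxy : x * y = y * x) (hXY : X * Y = Y * X)
    (h : (x * X) * (y * Y) = (y * Y) * (x * X)) :
    (y * Y) * (x * (y * Y) * x) = (x * (y * Y) * x) * (y * Y) := by
  have e1 : x * (y * Y) * x = X * (y * Y) * X := by
    calc x * (y * Y) * x = x * ((y * Y) * (x * X)) * X := by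
          simp only [mul_assoc, hX, mul_one]
      _ = x * ((x * X) * (y * Y)) * X := by rw [h]
      _ = (x * x) * (X * (y * Y) * X) := by simp only [mul_assoc]
      _ = X * (y * Y) * X := by rw [hx, one_mul]
  have e2 : X * (Y * y) * X = x * (Y * y) * x := by
    have i1 : (X * (Y * y) * X) * (X * (y * Y) * X) = 1 := by
      calc (X * (Y * y) * X) * (X * (y * Y) * X) = X * (Y * (y * ((X * X) * (y * (Y * X))))) := by
            simp only [mul_assoc]
        _ = X * (Y * ((y * y) * (Y * X))) := by rw [hX, one_mul]; simp only [mul_assoc]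
        _ = X * ((Y * Y) * X) := by rw [hy, one_mul]; simp only [mul_assoc]
        _ = 1 := by rw [hY, one_mul, hX]
    have i2 : (x * (y * Y) * x) * (x * (Y * y) * x) = 1 := by
      calc (x * (y * Y) * x) * (x * (Y * y) * x) = x * (y * (Y * ((x * x) * (Y * (y * x))))) := by
            simp only [mul_assoc]
        _ = x * (y * ((Y * Y) * (y * x))) := by rw [hx, one_mul]; simp only [mul_assoc]
        _ = x * ((y * y) * x) := by rw [hY, one_mul]; simp only [mul_assoc]
        _ = 1 := by rw [hy, one_mul, hx]
    rw [← e1] at i1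
    exact left_inv_eq_right_inv i1 i2
  have e3 : Y * (x * (y * Y) * x) = X * (Y * y) * X * Y := by
    rw [e1]
    calc Y * (X * (y * Y) * X) = (Y * X) * (y * (Y * X)) := by simp only [mul_assoc]
      _ = (X * Y) * (y * (X * Y)) := by rw [← hXY]
      _ = _ := by simp only [mul_assoc]
  have e4 : y * (x * (Y * y) * x) = x * (y * Y) * x * y := by
    calc y * (x * (Y * y) * x) = (y * x) * (Y * (y * x)) := by simp only [mul_assoc]
      _ = (x * y) * (Y * (x * y)) := by rw [← hxy]
      _ = _ := by simp only [mul_assoc]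
  calc (y * Y) * (x * (y * Y) * x) = y * (Y * (x * (y * Y) * x)) := by simp only [mul_assoc]
    _ = (y * (x * (Y * y) * x)) * Y := by rw [e3, e2]; simp only [mul_assoc]
    _ = (x * (y * Y) * x) * (y * Y) := by rw [e4]; simp only [mul_assoc]

end GermMonoid

variable {κ : Type*} [Fintype κ] [DecidableEq κ]

/-- Two families of commuting involutions whose products commute. -/
structure IsPairFamily (α β : κ → ℂ) (a A : κ → Dbl κ → Dbl κ) : Prop where
  ne : ∀ j, α j ≠ 0
  ne' : ∀ j, β j ≠ 0
  norm_ne : ∀ j, ‖β j‖ ≠ ‖α j‖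
  an : ∀ j, AnalyticAt ℂ (a j) 0
  an' : ∀ j, AnalyticAt ℂ (A j) 0
  map0 : ∀ j, a j 0 = 0
  map0' : ∀ j, A j 0 = 0
  invol : ∀ j, ∀ᶠ x in 𝓝 0, a j (a j x) = x
  invol' : ∀ j, ∀ᶠ x in 𝓝 0, A j (A j x) = x
  deriv : ∀ j v, fderiv ℂ (a j) 0 v = flip j (α j) v
  deriv' : ∀ j v, fderiv ℂ (A j) 0 v = flip j (β j) v
  comm : ∀ i j, ∀ᶠ x in 𝓝 0, a i (a j x) = a j (a i x)
  comm' : ∀ i j, ∀ᶠ x in 𝓝 0, A i (A j x) = A j (A i x)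
  prod_comm : ∀ i j, ∀ᶠ x in 𝓝 0, a i (A i (a j (A j x))) = a j (A j (a i (A i x)))

namespace IsPairNF

variable {j : κ} {μ : ℂ} {σ ψ χ : Dbl κ → Dbl κ} {M : Dbl κ → ℂ}

/-- Conjugation of a normal form by a germ. -/
theorem conj_germ (H : IsPairNF j μ σ ψ χ M) {f g : Dbl κ → Dbl κ}
    (hfg : IsGermInv f g) (hd : ∀ c v, fderiv ℂ f 0 (rot j c v) = rot j c (fderiv ℂ f 0 v)) :
    IsPairNF j μ (fun x => f (σ (g x))) (fun x => f (ψ x)) (fun x => χ (g x)) M where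
  germ := hfg.comp H.germ
  an := H.an
  val := H.val
  inv := H.inv
  conj_eq := by
    filter_upwards [H.conj_eq, H.germ.tendsto.eventually hfg.left] with y h1 h2
    rw [h2, h1]
  comm := fun c v => by
    rw [fderiv_comp_zero hfg.an H.germ.an H.germ.map0, H.comm, hd,
      fderiv_comp_zero hfg.an H.germ.an H.germ.map0]

end IsPairNF

namespace IsPairFamily

variable {α β : κ → ℂ} {a A : κ → Dbl κ → Dbl κ}

theorem tendsto (H : IsPairFamily α β a A) (j : κ) : Tendsto (a j) (𝓝 0) (𝓝 0) :=
  AnalyticAt.tendsto_zero (H.an j) (H.map0 j)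

theorem tendsto' (H : IsPairFamily α β a A) (j : κ) : Tendsto (A j) (𝓝 0) (𝓝 0) :=
  AnalyticAt.tendsto_zero (H.an' j) (H.map0' j)

theorem prod_an (H : IsPairFamily α β a A) (j : κ) : AnalyticAt ℂ (fun x => a j (A j x)) 0 :=
  AnalyticAt.comp_zero (H.an j) (H.an' j) (H.map0' j)

theorem prod_zero (H : IsPairFamily α β a A) (j : κ) : a j (A j 0) = 0 := by rw [H.map0', H.map0]

theorem ratio_ne_zero (H : IsPairFamily α β a A) (j : κ) : α j / β j ≠ 0 := div_ne_zero (H.ne j) (H.ne' j)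

theorem norm_ratio_ne_one (H : IsPairFamily α β a A) (j : κ) : ‖α j / β j‖ ≠ 1 := by
  rw [norm_div, Ne, div_eq_one_iff_eq (norm_ne_zero_iff.2 (H.ne' j))]
  exact fun h => H.norm_ne j h.symm

theorem conjugate_commutes (H : IsPairFamily α β a A) (i j : κ) :
    ∀ᶠ x in 𝓝 0, a j (A j (a i (a j (A j (a i x))))) = a i (a j (A j (a i (a j (A j x))))) := by
  have key := conjugate_commutes_of_involutions (x := toGerm 0 (a i) (H.tendsto i))
    (y := toGerm 0 (a j) (H.tendsto j)) (X := toGerm 0 (A i) (H.tendsto' i))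
    (Y := toGerm 0 (A j) (H.tendsto' j)) (toGerm_eq.2 (H.invol i)) (toGerm_eq.2 (H.invol j))
    (toGerm_eq.2 (H.invol' i)) (toGerm_eq.2 (H.invol' j)) (toGerm_eq.2 (H.comm i j))
    (toGerm_eq.2 (H.comm' i j)) (toGerm_eq.2 (H.prod_comm i j))
  exact toGerm_eq.1 key

/-- The normal forms of the products, and their relations with the involutions. -/
theorem exists_flows (H : IsPairFamily α β a A) : ∃ ψ χ : κ → Dbl κ → Dbl κ, ∃ M : κ → Dbl κ → ℂ,
    (∀ j, IsPairNF j (α j / β j) (fun x => a j (A j x)) (ψ j) (χ j) (M j)) ∧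
    (∀ j, ∀ᶠ x in 𝓝 0, ∀ c : ℂ, ‖c‖ = 1 →
      a j (flow j (ψ j) (χ j) c x) = flow j (ψ j) (χ j) c⁻¹ (a j x)) ∧
    (∀ j, ∀ᶠ x in 𝓝 0, ∀ c : ℂ, ‖c‖ = 1 →
      A j (flow j (ψ j) (χ j) c x) = flow j (ψ j) (χ j) c⁻¹ (A j x)) ∧
    (∀ i j, i ≠ j → ∀ᶠ x in 𝓝 0, ∀ c : ℂ, ‖c‖ = 1 →
      a i (flow j (ψ j) (χ j) c x) = flow j (ψ j) (χ j) c (a i x)) ∧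
    (∀ i j, i ≠ j → ∀ᶠ x in 𝓝 0, ∀ c : ℂ, ‖c‖ = 1 →
      A i (flow j (ψ j) (χ j) c x) = flow j (ψ j) (χ j) c (A i x)) ∧
    ∀ i j, ∀ᶠ x in 𝓝 0, ∀ c d : ℂ, ‖c‖ = 1 → ‖d‖ = 1 →
      flow i (ψ i) (χ i) c (flow j (ψ j) (χ j) d x) = flow j (ψ j) (χ j) d (flow i (ψ i) (χ i) c x) := by
  have h := fun j => exists_isPairNF (H.ne j) (H.ne' j) (H.norm_ne j) (H.an j) (H.map0 j) (H.invol j)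
    (H.deriv j) (H.an' j) (H.map0' j) (H.invol' j) (H.deriv' j)
  choose ψ χ M hNF haf using h
  have hsf : ∀ i j, ∀ᶠ x in 𝓝 0, ∀ c : ℂ, ‖c‖ = 1 →
      a i (A i (flow j (ψ j) (χ j) c x)) = flow j (ψ j) (χ j) c (a i (A i x)) := fun i j =>
    (hNF j).commute_flow (H.ratio_ne_zero j) (H.norm_ratio_ne_one j) (H.prod_an i) (H.prod_zero i)
      (H.prod_comm i j)
  have hai : ∀ i j, i ≠ j → ∀ᶠ x in 𝓝 0, ∀ c : ℂ, ‖c‖ = 1 →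
      a i (flow j (ψ j) (χ j) c x) = flow j (ψ j) (χ j) c (a i x) := by
    intro i j hij
    have hX := (hNF j).conj_germ
      (IsGermInv.of_involutive (H.an i) (H.map0 i) (H.invol i)) fun c v => by
        rw [H.deriv, H.deriv, flip_rot_of_ne hij]
    have := (hNF j).flow_eq_of_commute (H.ratio_ne_zero j) (H.norm_ratio_ne_one j) (H.prod_an j)
      (H.prod_zero j) hX (H.ratio_ne_zero j) (H.norm_ratio_ne_one j) (H.conjugate_commutes i j)
    filter_upwards [(H.tendsto i).eventually this, H.invol i] with x h1 h2 c hc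
    rw [← h1 c hc]
    simp only [flow, h2]
  refine ⟨ψ, χ, M, hNF, haf, ?_, hai, ?_, fun i j => ?_⟩
  · intro j
    filter_upwards [hsf j j, (H.tendsto' j).eventually (H.invol j), ((H.tendsto j).comp (H.tendsto' j)).eventually (haf j),
      (hNF j).germ.eventually_flow j ((H.tendsto' j).eventually (H.invol j))] with x h1 h2 h3 h4 c hc
    simp only [Function.comp] at h3
    rw [← h4 c hc, h1 c hc, h3 c hc, h2]
  · intro i j hij
    filter_upwards [hsf i j, (H.tendsto' i).eventually (H.invol i), ((H.tendsto i).comp (H.tendsto' i)).eventually (hai i j hij),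
      (hNF j).germ.eventually_flow j ((H.tendsto' i).eventually (H.invol i))] with x h1 h2 h3 h4 c hc
    simp only [Function.comp] at h3
    rw [← h4 c hc, h1 c hc, h3 c hc, h2]
  · exact (hNF j).flow_comm (H.ratio_ne_zero j) (H.norm_ratio_ne_one j) (H.prod_an j) (H.prod_zero j)
      (hNF i) (H.ratio_ne_zero i) (H.norm_ratio_ne_one i) (H.prod_comm j i)

end IsPairFamily

end

section

variable {κ : Type*} [Fintype κ] [DecidableEq κ]

/-- An antilinear isometric involution which permutes the rotations, up to inversion. -/
structure IsRotReal (R : Dbl κ →SL[starRingEnd ℂ] Dbl κ) (st : κ → κ) (s : κ → ℤ) : Prop where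
  invol : ∀ x, R (R x) = x
  norm_map : ∀ x, ‖R x‖ = ‖x‖
  st_st : ∀ j, st (st j) = j
  s_st : ∀ j, s (st j) = s j
  s_sq : ∀ j, s j * s j = 1
  map_rot : ∀ j c x, R (rot j c x) = rot (st j) ((conj c) ^ s j) (R x)

theorem conj_zpow_ne_zero {c : ℂ} (hc : c ≠ 0) (n : ℤ) : (conj c) ^ n ≠ 0 :=
  zpow_ne_zero _ ((map_ne_zero _).2 hc)

theorem norm_conj_zpow {c : ℂ} (hc : ‖c‖ = 1) (n : ℤ) : ‖(conj c) ^ n‖ = 1 := by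
  rw [norm_zpow, RCLike.norm_conj, hc, one_zpow]

namespace IsRotReal

variable {R : Dbl κ →SL[starRingEnd ℂ] Dbl κ} {st : κ → κ} {s : κ → ℤ}

theorem conj_zpow_conj_zpow (H : IsRotReal R st s) (j : κ) (c : ℂ) :
    (conj ((conj c) ^ s j)) ^ s j = c := by
  rw [map_zpow₀, Complex.conj_conj, ← zpow_mul, H.s_sq, zpow_one]

theorem map_rot' (H : IsRotReal R st s) (j : κ) (c : ℂ) (x : Dbl κ) :
    R (rot (st j) c x) = rot j ((conj c) ^ s j) (R x) := by
  rw [H.map_rot, H.st_st, H.s_st]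

theorem tendsto (R : Dbl κ →SL[starRingEnd ℂ] Dbl κ) : Tendsto R (𝓝 0) (𝓝 0) := by
  have := R.continuous.tendsto 0
  rwa [map_zero] at this

end IsRotReal

section

variable {E F : Type*} [NormedAddCommGroup E] [NormedSpace ℂ E] [NormedAddCommGroup F] [NormedSpace ℂ F]

theorem fderiv_semiconj {E' F' : Type*} [NormedAddCommGroup E'] [NormedSpace ℂ E']
    [NormedAddCommGroup F'] [NormedSpace ℂ F'] (R : F →SL[starRingEnd ℂ] F') (S : E' →SL[starRingEnd ℂ] E) {f : E → F}
    (hf : AnalyticAt ℂ f 0) (v : E') : fderiv ℂ (fun x => R (f (S x))) 0 v = R (fderiv ℂ f 0 (S v)) := by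
  have h : HasFDerivAt f (fderiv ℂ f 0) (S 0) := by
    rw [map_zero]; exact hf.differentiableAt.hasFDerivAt
  have := (h.comp_semilinear R S).fderiv
  change fderiv ℂ (R ∘ f ∘ S) 0 v = _
  rw [this]
  rfl

theorem IsGermInv.semiconj {f : E → E} {g : E → E} (h : IsGermInv f g) (R : E →SL[starRingEnd ℂ] E)
    (hR : ∀ x, R (R x) = x) : IsGermInv (fun x => R (f (R x))) (fun x => R (g (R x))) where
  an := AnalyticAt.semiconj R R h.an
  map0 := by rw [map_zero, h.map0, map_zero]
  an' := AnalyticAt.semiconj R R h.an'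
  map0' := by rw [map_zero, h.map0', map_zero]
  left := by
    have t : Tendsto R (𝓝 0) (𝓝 0) := by simpa using R.continuous.tendsto 0
    filter_upwards [t.eventually h.left] with x hx
    rw [hR, hx, hR]
  right := by
    have t : Tendsto R (𝓝 0) (𝓝 0) := by simpa using R.continuous.tendsto 0
    filter_upwards [t.eventually h.right] with x hx
    rw [hR, hx, hR]

end

namespace IsPairNF

variable {j : κ} {μ : ℂ} {σ ψ χ : Dbl κ → Dbl κ} {M : Dbl κ → ℂ} {R : Dbl κ →SL[starRingEnd ℂ] Dbl κ}
  {st : κ → κ} {s : κ → ℤ}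

theorem semiconj (H : IsPairNF j μ σ ψ χ M) (hμ : μ ≠ 0) (hR : IsRotReal R st s) :
    IsPairNF (st j) ((conj μ) ^ s j) (fun x => R (σ (R x))) (fun x => R (ψ (R x))) (fun x => R (χ (R x)))
      fun x => (conj (M (R x))) ^ s j where
  germ := H.germ.semiconj R hR.invol
  an := by
    have h : AnalyticAt ℂ (fun x => conj (M (R x))) 0 :=
      AnalyticAt.semiconj (starL ℂ : ℂ ≃L⋆[ℂ] ℂ).toContinuousLinearMap R H.an
    refine h.zpow ?_
    rw [map_zero, H.val]
    exact (map_ne_zero _).2 hμ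
  val := by rw [map_zero, H.val]
  inv := by
    obtain ⟨ε, hε, h⟩ := H.inv
    refine ⟨ε, hε, fun c y hc h1 h2 => ?_⟩
    rw [hR.map_rot', h _ _ (conj_zpow_ne_zero hc _)]
    · rwa [hR.norm_map]
    · rwa [← hR.map_rot', hR.norm_map]
  conj_eq := by
    have t := IsRotReal.tendsto R
    filter_upwards [t.eventually H.conj_eq] with y h1
    rw [hR.invol, h1, hR.map_rot', hR.conj_zpow_conj_zpow]
  comm := fun c v => by
    rw [fderiv_semiconj R R H.germ.an, fderiv_semiconj R R H.germ.an, hR.map_rot', H.comm, hR.map_rot,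
      hR.conj_zpow_conj_zpow]

end IsPairNF

namespace IsPairFamily

variable {α β : κ → ℂ} {a A : κ → Dbl κ → Dbl κ} {R : Dbl κ →SL[starRingEnd ℂ] Dbl κ} {st : κ → κ} {s : κ → ℤ}

theorem semiconj_flow (H : IsPairFamily α β a A) (hR : IsRotReal R st s)
    (hA : ∀ j, ∀ᶠ x in 𝓝 0, A j x = R (a (st j) (R x))) {ψ χ : κ → Dbl κ → Dbl κ} {M : κ → Dbl κ → ℂ}
    (hNF : ∀ j, IsPairNF j (α j / β j) (fun x => a j (A j x)) (ψ j) (χ j) (M j)) (j : κ) :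
    ∀ᶠ x in 𝓝 0, ∀ c : ℂ, ‖c‖ = 1 →
      R (flow j (ψ j) (χ j) c x) = flow (st j) (ψ (st j)) (χ (st j)) ((conj c) ^ s j) (R x) := by
  have hX := (hNF j).semiconj (H.ratio_ne_zero j) hR
  have t := IsRotReal.tendsto R
  have hinv : ∀ᶠ x in 𝓝 0, R (a j (A j (R x))) = A (st j) (a (st j) x) := by
    filter_upwards [t.eventually (hA j), ((H.tendsto (st j))).eventually (hA (st j))] with x h1 h2
    rw [h1, h2, hR.invol, hR.st_st]
  have hc : ∀ᶠ x in 𝓝 0, a (st j) (A (st j) (R (a j (A j (R x))))) =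
      R (a j (A j (R (a (st j) (A (st j) x))))) := by
    filter_upwards [hinv, ((H.tendsto (st j)).comp (H.tendsto' (st j))).eventually hinv,
      (H.tendsto (st j)).eventually (H.invol' (st j)), H.invol (st j),
      (H.tendsto' (st j)).eventually (H.invol (st j)), H.invol' (st j)] with x h1 h2 h3 h4 h5 h6
    simp only [Function.comp] at h2
    rw [h1, h2, h3, h4, h5, h6]
  have hμ' : ‖(conj (α j / β j)) ^ s j‖ ≠ 1 := by
    intro h
    apply H.norm_ratio_ne_one j
    rw [← hR.conj_zpow_conj_zpow j (α j / β j)]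
    exact norm_conj_zpow h _
  have := (hNF (st j)).flow_eq_of_commute (H.ratio_ne_zero _) (H.norm_ratio_ne_one _) (H.prod_an _)
    (H.prod_zero _) hX (conj_zpow_ne_zero (H.ratio_ne_zero j) _) hμ' hc
  filter_upwards [t.eventually this] with x hx c hc
  rw [← hx _ (norm_conj_zpow hc _), flow, flow, hR.invol, hR.map_rot', hR.conj_zpow_conj_zpow, hR.invol]

/-- Coordinates in which the involutions are equivariant under the torus of rotations. -/
theorem exists_torus_equivariant (H : IsPairFamily α β a A) (hR : IsRotReal R st s)
    (hA : ∀ j, ∀ᶠ x in 𝓝 0, A j x = R (a (st j) (R x))) : ∃ f g : Dbl κ → Dbl κ, IsGermInv f g ∧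
      (∀ v, fderiv ℂ f 0 v = v) ∧ (∀ x, R (f x) = f (R x)) ∧
      (∀ j, ∀ᶠ x in 𝓝 0, ∀ c : ℂ, ‖c‖ = 1 → f (a j (g (rot j c x))) = rot j c⁻¹ (f (a j (g x)))) ∧
      (∀ j, ∀ᶠ x in 𝓝 0, ∀ c : ℂ, ‖c‖ = 1 → f (A j (g (rot j c x))) = rot j c⁻¹ (f (A j (g x)))) ∧
      (∀ i j, i ≠ j → ∀ᶠ x in 𝓝 0, ∀ c : ℂ, ‖c‖ = 1 → f (a i (g (rot j c x))) = rot j c (f (a i (g x)))) ∧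
      ∀ i j, i ≠ j → ∀ᶠ x in 𝓝 0, ∀ c : ℂ, ‖c‖ = 1 → f (A i (g (rot j c x))) = rot j c (f (A i (g x))) := by
  obtain ⟨ψ, χ, M, hNF, haf, hAf, hai, hAi, hcomm⟩ := H.exists_flows
  obtain ⟨h, han, h0, hd, hfl⟩ := exists_simultaneous_linearization (fun k => (hNF k).germ)
    (fun k => (hNF k).comm) fun i k _ => hcomm i k
  have t := IsRotReal.tendsto R
  have hRan : AnalyticAt ℂ (fun x => R (h (R x))) 0 := AnalyticAt.semiconj R R han
  set f : Dbl κ → Dbl κ := fun x => (1 / 2 : ℂ) • (h x + R (h (R x))) with hf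
  have fan : AnalyticAt ℂ f 0 := (han.add hRan).const_smul (c := (1 / 2 : ℂ))
  have f0 : f 0 = 0 := by simp [hf, h0]
  have fd : ∀ v, fderiv ℂ f 0 v = v := fun v => by
    have h1 : HasFDerivAt f ((1 / 2 : ℂ) • (fderiv ℂ h 0 + fderiv ℂ (fun x => R (h (R x))) 0)) 0 :=
      (han.differentiableAt.hasFDerivAt.add hRan.differentiableAt.hasFDerivAt).const_smul (1 / 2 : ℂ)
    rw [h1.fderiv]
    simp only [smul_apply, add_apply]
    rw [fderiv_semiconj R R han, hd, hd, hR.invol, ← two_smul ℂ v, smul_smul]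
    norm_num
  have fR : ∀ x, R (f x) = f (R x) := fun x => by
    simp only [hf]
    rw [map_smulₛₗ, map_add, hR.invol, hR.invol, add_comm, map_div₀, map_one, Complex.conj_ofNat]
  have ff : ∀ k, ∀ᶠ x in 𝓝 0, ∀ c : ℂ, ‖c‖ = 1 → f (flow k (ψ k) (χ k) c x) = rot k c (f x) := by
    intro k
    filter_upwards [hfl k, t.eventually (hfl (st k)), H.semiconj_flow hR hA hNF k] with x h1 h2 h3 c hc
    simp only [hf]
    rw [h1 c hc, h3 c hc, h2 _ (norm_conj_zpow hc _), hR.map_rot', hR.conj_zpow_conj_zpow, map_smul, map_add]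
  obtain ⟨g, hg⟩ := IsGermInv.exists_of_fderiv_injective fan f0 fun v hv => by rwa [fd] at hv
  have gf : ∀ k, ∀ᶠ x in 𝓝 0, ∀ c : ℂ, ‖c‖ = 1 → g (rot k c x) = flow k (ψ k) (χ k) c (g x) := by
    intro k
    filter_upwards [hg.tendsto'.eventually (ff k), hg.right,
      hg.tendsto'.eventually ((hNF k).germ.eventually_flow k hg.left)] with x h1 h2 h3 c hc
    have := h1 c hc
    rw [h2] at this
    rw [← this, h3 c hc]
  have main : ∀ (F : Dbl κ → Dbl κ) (k : κ) (e : ℂ → ℂ), (∀ c, ‖c‖ = 1 → ‖e c‖ = 1) →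
      Tendsto F (𝓝 0) (𝓝 0) →
      (∀ᶠ x in 𝓝 0, ∀ c : ℂ, ‖c‖ = 1 → F (flow k (ψ k) (χ k) c x) = flow k (ψ k) (χ k) (e c) (F x)) →
      ∀ᶠ x in 𝓝 0, ∀ c : ℂ, ‖c‖ = 1 → f (F (g (rot k c x))) = rot k (e c) (f (F (g x))) := by
    intro F k e he tF hF
    filter_upwards [gf k, hg.tendsto'.eventually hF, (tF.comp hg.tendsto').eventually (ff k)]
      with x h1 h2 h3 c hc
    rw [h1 c hc, h2 c hc]
    exact h3 _ (he c hc)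
  refine ⟨f, g, hg, fd, fR, fun j => ?_, fun j => ?_, fun i j hij => ?_, fun i j hij => ?_⟩
  · exact main (a j) j (fun c => c⁻¹) (fun c hc => by simp [hc]) (H.tendsto j) (haf j)
  · exact main (A j) j (fun c => c⁻¹) (fun c hc => by simp [hc]) (H.tendsto' j) (hAf j)
  · exact main (a i) j (fun c => c) (fun c hc => hc) (H.tendsto i) (hai i j hij)
  · exact main (A i) j (fun c => c) (fun c hc => hc) (H.tendsto' i) (hAi i j hij)

end IsPairFamily

end

section

variable {κ : Type*} [Fintype κ] [DecidableEq κ]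

/-- Equivariance under the circle extends to dilations which stay in the ball. -/
theorem equivariant_of_circle {j : κ} {f : Dbl κ → ℂ} {R : ℝ} (hf : ∀ y, ‖y‖ < R → AnalyticAt ℂ f y)
    {m : ℤ} (hw : ∀ y, ‖y‖ < R → ∀ c : ℂ, ‖c‖ = 1 → f (rot j c y) = c ^ m * f y) {y : Dbl κ} (hy : ‖y‖ < R)
    {c : ℂ} (hc : c ≠ 0) (hcy : ‖rot j c y‖ < R) : f (rot j c y) = c ^ m * f y := by
  have hR : 0 < R := (norm_nonneg y).trans_lt hy
  have hexp : ∀ t : ℂ, ‖Complex.exp (-t)‖ = Real.exp (-t.re) := fun t => by rw [Complex.norm_exp]; simp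
  set S : Set ℝ := {x | ‖y.1 j‖ * Real.exp x < R ∧ ‖y.2 j‖ * Real.exp (-x) < R} with hS
  set U : Set ℂ := Complex.reLm ⁻¹' S with hU
  have hconv : Convex ℝ U := by
    refine Convex.linear_preimage ?_ _
    refine Set.OrdConnected.convex ⟨fun x hx z hz w hw => ⟨?_, ?_⟩⟩
    · refine lt_of_le_of_lt ?_ hz.1
      gcongr
      exact hw.2
    · refine lt_of_le_of_lt ?_ hx.2
      gcongr
      exact hw.1
  have hmem : ∀ t, t ∈ U → ‖rot j (Complex.exp t) y‖ < R := by
    intro t ht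
    have h1 : ‖y.1 j‖ * Real.exp t.re < R ∧ ‖y.2 j‖ * Real.exp (-t.re) < R := ht
    rw [Prod.norm_def, max_lt_iff, pi_norm_lt_iff hR, pi_norm_lt_iff hR]
    refine ⟨fun i => ?_, fun i => ?_⟩
    · rcases eq_or_ne i j with rfl | hi
      · rw [rot_fst_self, norm_mul, Complex.norm_exp, mul_comm]; exact h1.1
      · rw [rot_fst_ne hi]; exact (norm_coord_fst_le y i).trans_lt hy
    · rcases eq_or_ne i j with rfl | hi
      · rw [rot_snd_self, norm_mul, ← Complex.exp_neg, hexp, mul_comm]; exact h1.2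
      · rw [rot_snd_ne hi]; exact (norm_coord_snd_le y i).trans_lt hy
  have hmem' : ∀ t, ‖rot j (Complex.exp t) y‖ < R → t ∈ U := by
    intro t ht
    have h1 := (norm_coord_fst_le (rot j (Complex.exp t) y) j).trans_lt ht
    have h2 := (norm_coord_snd_le (rot j (Complex.exp t) y) j).trans_lt ht
    rw [rot_fst_self, norm_mul, Complex.norm_exp, mul_comm] at h1
    rw [rot_snd_self, norm_mul, ← Complex.exp_neg, hexp, mul_comm] at h2
    exact ⟨h1, h2⟩
  have hopen : IsOpen U := by
    have h1 : U = {t : ℂ | ‖y.1 j‖ * Real.exp t.re < R} ∩ {t : ℂ | ‖y.2 j‖ * Real.exp (-t.re) < R} := rfl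
    rw [h1]
    exact (isOpen_lt (by fun_prop) continuous_const).inter (isOpen_lt (by fun_prop) continuous_const)
  have han : AnalyticOnNhd ℂ (fun t => f (rot j (Complex.exp t) y) - Complex.exp (m * t) * f y) U := by
    refine DifferentiableOn.analyticOnNhd (fun t ht => ?_) hopen
    refine DifferentiableAt.differentiableWithinAt ?_
    have h1 : DifferentiableAt ℂ (fun t => rot j (Complex.exp t) y) t :=
      (differentiableAt_rot j y (Complex.exp_ne_zero t)).comp t Complex.differentiableAt_exp
    have h2 : DifferentiableAt ℂ (fun t => f (rot j (Complex.exp t) y)) t :=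
      DifferentiableAt.comp t (hf _ (hmem t ht)).differentiableAt h1
    exact h2.sub (by fun_prop)
  have h0U : (0 : ℂ) ∈ U := hmem' 0 (by rw [Complex.exp_zero, rot_one]; exact hy)
  have hz := han.eqOn_zero_of_preconnected_of_frequently_eq_zero hconv.isPreconnected h0U (by
    have ht : Tendsto (fun x : ℝ => (x : ℂ) * Complex.I) (𝓝[≠] 0) (𝓝[≠] 0) := by
      refine tendsto_nhdsWithin_iff.2 ⟨?_, ?_⟩
      · have : Continuous fun x : ℝ => (x : ℂ) * Complex.I := by fun_prop
        simpa using (this.tendsto 0).mono_left nhdsWithin_le_nhds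
      · filter_upwards [self_mem_nhdsWithin] with x hx
        simpa using hx
    refine ht.frequently (Frequently.of_forall fun x => ?_)
    rw [hw y hy _ (Complex.norm_exp_ofReal_mul_I x), ← Complex.exp_int_mul]
    simp)
  obtain ⟨t, rfl⟩ : ∃ t, Complex.exp t = c := ⟨Complex.log c, Complex.exp_log hc⟩
  have := hz (hmem' t hcy)
  simp only [Pi.zero_apply, sub_eq_zero] at this
  rw [this, Complex.exp_int_mul]

/-- Move the coordinates in `s` to `ξ_j = r`. -/
def moveTo (r : ℂ) (s : Finset κ) (y : Dbl κ) : Dbl κ :=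
  (fun j => if j ∈ s then r else y.1 j, fun j => if j ∈ s then y.1 j * y.2 j / r else y.2 j)

theorem moveTo_insert {r : ℂ} (hr : r ≠ 0) {s : Finset κ} {j : κ} (hj : j ∉ s) {y : Dbl κ} (hy : y.1 j ≠ 0) :
    moveTo r (insert j s) y = rot j (r / y.1 j) (moveTo r s y) := by
  refine Dbl.ext' j ?_ ?_ fun i hi => ?_
  · simp [moveTo, hj]; field_simp
  · simp [moveTo, hj]; field_simp
  · simp [moveTo, rot_fst_ne hi, rot_snd_ne hi, hi]

theorem norm_moveTo_le {r : ℝ} (hr : 0 < r) (s : Finset κ) {y : Dbl κ} (hy : ‖y‖ ≤ r) :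
    ‖moveTo (r : ℂ) s y‖ ≤ r := by
  refine Dbl.norm_le hr.le fun j => ?_
  have h1 := (norm_coord_fst_le y j).trans hy
  have h2 := (norm_coord_snd_le y j).trans hy
  simp only [moveTo]
  split_ifs
  · refine ⟨by simp [abs_of_pos hr], ?_⟩
    rw [norm_div, norm_mul, Complex.norm_real, Real.norm_eq_abs, abs_of_pos hr, div_le_iff₀ hr]
    exact mul_le_mul h1 h2 (norm_nonneg _) hr.le
  · exact ⟨h1, h2⟩

/-- An analytic function with the torus weight of `ξ_k` is `ξ_k` times a function of the products. -/
theorem exists_eq_fst_mul (k : κ) {f : Dbl κ → ℂ} (hf : AnalyticAt ℂ f 0)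
    (hw : ∀ j, ∀ᶠ y in 𝓝 0, ∀ c : ℂ, ‖c‖ = 1 → f (rot j c y) = (if j = k then c else 1) * f y) :
    ∃ β : (κ → ℂ) → ℂ, AnalyticAt ℂ β 0 ∧ ∀ᶠ y : Dbl κ in 𝓝 0, f y = y.1 k * β (y.1 * y.2) := by
  obtain ⟨R, hR, hball⟩ := Metric.eventually_nhds_iff_ball.1 (hf.eventually_analyticAt.and (eventually_all.2 hw))
  have hfR : ∀ y, ‖y‖ < R → AnalyticAt ℂ f y := fun y hy => (hball y (by simpa using hy)).1
  have hwR : ∀ j y, ‖y‖ < R → ∀ c : ℂ, ‖c‖ = 1 → f (rot j c y) = c ^ (if j = k then (1 : ℤ) else 0) * f y :=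
    fun j y hy c hc => by
      rw [(hball y (by simpa using hy)).2 j c hc]
      split_ifs <;> simp
  obtain ⟨r, hr, hrR⟩ := exists_between hR
  have hr0 : (r : ℂ) ≠ 0 := by exact_mod_cast hr.ne'
  set L : (κ → ℂ) → Dbl κ := fun ζ => (fun _ => (r : ℂ), (r : ℂ)⁻¹ • ζ) with hL
  set β : (κ → ℂ) → ℂ := fun ζ => (r : ℂ)⁻¹ * f (L ζ) with hβ
  have hLan : ∀ ζ, AnalyticAt ℂ L ζ := fun ζ => analyticAt_const.prod (analyticAt_id.const_smul (c := (r : ℂ)⁻¹))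
  have hβan : ∀ ζ, ‖L ζ‖ < R → AnalyticAt ℂ β ζ := fun ζ h =>
    analyticAt_const.mul (AnalyticAt.fun_comp (f := L) (hfR _ h) (hLan ζ))
  have hLy : ∀ y : Dbl κ, L (y.1 * y.2) = moveTo (r : ℂ) Finset.univ y := fun y => by
    refine Prod.ext ?_ ?_ <;> funext i
    · simp [hL, moveTo]
    · simp [hL, moveTo]; field_simp
  have hnz : ∀ y : Dbl κ, ‖y‖ < r → (∀ j, y.1 j ≠ 0) → f y = y.1 k * β (y.1 * y.2) := by
    intro y hy h0
    have key : ∀ s : Finset κ, f (moveTo (r : ℂ) s y) = (if k ∈ s then r / y.1 k else 1) * f y := by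
      intro s
      induction s using Finset.induction_on with
      | empty => simp [moveTo]
      | insert j s hj ih =>
        have h1 := norm_moveTo_le hr s hy.le
        have h2 := norm_moveTo_le hr (insert j s) hy.le
        rw [moveTo_insert hr0 hj (h0 j)] at h2 ⊢
        rw [equivariant_of_circle hfR (hwR j) (h1.trans_lt hrR) (div_ne_zero hr0 (h0 j)) (h2.trans_lt hrR), ih]
        rcases eq_or_ne j k with rfl | hjk
        · simp [hj]
        · simp [hjk, hjk.symm]
    have := key Finset.univ
    simp only [Finset.mem_univ, if_true] at this
    simp only [hβ]
    rw [hLy, this]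
    have := h0 k
    field_simp
  refine ⟨β, hβan 0 ?_, ?_⟩
  · have := hLy 0
    simp only [Prod.fst_zero, Prod.snd_zero, mul_zero] at this
    rw [this]
    exact (norm_moveTo_le hr _ (by simpa using hr.le)).trans_lt hrR
  · filter_upwards [Metric.ball_mem_nhds (0 : Dbl κ) hr] with y hy
    rw [mem_ball_zero_iff] at hy
    set p : ℂ → Dbl κ := fun t => (fun j => y.1 j + t, y.2) with hp
    have hp0 : p 0 = y := by simp [hp]
    have hpc : Continuous p := by fun_prop
    have hpt : Tendsto p (𝓝[≠] 0) (𝓝 y) := by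
      have := hpc.tendsto 0
      rw [hp0] at this
      exact this.mono_left nhdsWithin_le_nhds
    have h1 : Tendsto (fun t => f (p t)) (𝓝[≠] 0) (𝓝 (f y)) :=
      (hfR y (hy.trans hrR)).continuousAt.tendsto.comp hpt
    have h2 : ContinuousAt (fun y : Dbl κ => y.1 k * β (y.1 * y.2)) y := by
      have hb : ContinuousAt β (y.1 * y.2) := (hβan _ (by
        rw [hLy]; exact (norm_moveTo_le hr _ hy.le).trans_lt hrR)).continuousAt
      have hm : ContinuousAt (fun y : Dbl κ => y.1 * y.2) y := by fun_prop
      have hc : ContinuousAt (fun y : Dbl κ => β (y.1 * y.2)) y := ContinuousAt.comp (f := fun y : Dbl κ => y.1 * y.2) hb hm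
      exact ContinuousAt.mul (by fun_prop) hc
    refine tendsto_nhds_unique h1 (Tendsto.congr' ?_ (h2.tendsto.comp hpt))
    have h3 : ∀ᶠ t in 𝓝[≠] (0 : ℂ), ∀ j, y.1 j + t ≠ 0 := by
      refine eventually_all.2 fun j => ?_
      by_cases hj : y.1 j = 0
      · filter_upwards [self_mem_nhdsWithin] with t ht
        simpa [hj] using ht
      · have : ContinuousAt (fun t : ℂ => y.1 j + t) 0 := by fun_prop
        exact (this.eventually_ne (by simpa using hj)).filter_mono nhdsWithin_le_nhds
    have h4 : ∀ᶠ t in 𝓝[≠] (0 : ℂ), ‖p t‖ < r :=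
      hpt.norm.eventually_lt_const hy
    filter_upwards [h3, h4] with t h3 h4
    exact (hnz (p t) h4 h3).symm

/-- An analytic function with the torus weight of `η_k` is `η_k` times a function of the products. -/
theorem exists_eq_snd_mul (k : κ) {f : Dbl κ → ℂ} (hf : AnalyticAt ℂ f 0)
    (hw : ∀ j, ∀ᶠ y in 𝓝 0, ∀ c : ℂ, ‖c‖ = 1 → f (rot j c y) = (if j = k then c⁻¹ else 1) * f y) :
    ∃ β : (κ → ℂ) → ℂ, AnalyticAt ℂ β 0 ∧ ∀ᶠ y : Dbl κ in 𝓝 0, f y = y.2 k * β (y.1 * y.2) := by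
  have t : Tendsto (fun y : Dbl κ => (y.2, y.1)) (𝓝 0) (𝓝 0) := by
    have : Continuous fun y : Dbl κ => (y.2, y.1) := by fun_prop
    exact this.tendsto 0
  have hs : ∀ (j : κ) (c : ℂ) (y : Dbl κ), ((rot j c y).2, (rot j c y).1) = rot j c⁻¹ (y.2, y.1) := fun j c y => by
    simp [rot_apply]
  obtain ⟨β, h1, h2⟩ := exists_eq_fst_mul (f := fun y => f (y.2, y.1)) k
    (AnalyticAt.comp_zero (f := fun y : Dbl κ => (y.2, y.1)) hf (analyticAt_snd.prod analyticAt_fst) rfl) fun j => by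
      filter_upwards [t.eventually (hw j)] with y hy c hc
      rw [hs, hy _ (by simp [hc]), inv_inv]
  refine ⟨β, h1, ?_⟩
  filter_upwards [t.eventually h2] with y hy
  rw [hy, mul_comm y.1]

end

section

theorem tendsto_inv_smul_of_analyticAt {E F : Type*} [NormedAddCommGroup E] [NormedSpace ℂ E]
    [NormedAddCommGroup F] [NormedSpace ℂ F] {f : E → F} (hf : AnalyticAt ℂ f 0) (h0 : f 0 = 0) (v : E) :
    Tendsto (fun t : ℂ => t⁻¹ • f (t • v)) (𝓝[≠] 0) (𝓝 (fderiv ℂ f 0 v)) := by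
  have h1 : HasDerivAt (fun t : ℂ => t • v) v 0 := by simpa using (hasDerivAt_id (0 : ℂ)).smul_const v
  have h2 : HasFDerivAt f (fderiv ℂ f 0) ((0 : ℂ) • v) := by
    rw [zero_smul]; exact hf.differentiableAt.hasFDerivAt
  have h3 : HasDerivAt (fun t : ℂ => f (t • v)) (fderiv ℂ f 0 v) 0 := h2.comp_hasDerivAt 0 h1
  have := hasDerivAt_iff_tendsto_slope_zero.1 h3
  simpa [h0] using this

theorem dense_forall_ne_zero (κ : Type*) : Dense {w : κ → ℂ | ∀ k, w k ≠ 0} := by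
  have := dense_pi (Set.univ : Set κ) (s := fun _ => ({0}ᶜ : Set ℂ)) fun i _ => dense_compl_singleton 0
  simpa [Set.pi, Set.mem_compl_iff] using this

variable {κ : Type*} [Fintype κ] [DecidableEq κ]

/-- Curves of fixed points of an involution, with a given tangent vector. -/
theorem exists_fixed_curve {E : Type*} [NormedAddCommGroup E] [NormedSpace ℂ E] [FiniteDimensional ℂ E]
    {T : E → E} (hT : AnalyticAt ℂ T 0) (hT0 : T 0 = 0) (hTT : ∀ᶠ y in 𝓝 0, T (T y) = y) {v : E}
    (hv : fderiv ℂ T 0 v = v) : ∃ c : ℂ → E, Tendsto (fun t : ℂ => t⁻¹ • c t) (𝓝[≠] 0) (𝓝 v) ∧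
      Tendsto c (𝓝[≠] 0) (𝓝 0) ∧ ∀ᶠ t in 𝓝[≠] 0, T (c t) = c t := by
  set L := fderiv ℂ T 0 with hL
  have hLL : ∀ w, L (L w) = w := (IsGermInv.of_involutive hT hT0 hTT).fderiv_left
  set H : E → E := fun y => (1 / 2 : ℂ) • (y + L (T y)) with hH
  have hLT : AnalyticAt ℂ (fun y => L (T y)) 0 := AnalyticAt.comp_zero (L.analyticAt 0) hT hT0
  have hHan : AnalyticAt ℂ H 0 := (analyticAt_id.add hLT).const_smul (c := (1 / 2 : ℂ))
  have hH0 : H 0 = 0 := by simp [hH, hT0]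
  have hHd : ∀ w, fderiv ℂ H 0 w = w := fun w => by
    have h1 : HasFDerivAt H ((1 / 2 : ℂ) • (ContinuousLinearMap.id ℂ E + fderiv ℂ (fun y => L (T y)) 0)) 0 :=
      ((hasFDerivAt_id 0).add hLT.differentiableAt.hasFDerivAt).const_smul (1 / 2 : ℂ)
    rw [h1.fderiv]
    simp only [smul_apply, add_apply]
    rw [fderiv_comp_zero (L.analyticAt 0) hT hT0, L.fderiv, hLL, ContinuousLinearMap.id_apply, ← two_smul ℂ w, smul_smul]
    norm_num
  have hHT : ∀ᶠ y in 𝓝 0, H (T y) = L (H y) := by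
    filter_upwards [hTT] with y hy
    simp only [hH]
    rw [hy, map_smul, map_add, hLL, add_comm]
  obtain ⟨G, hG⟩ := IsGermInv.exists_of_fderiv_injective hHan hH0 fun w hw => by rwa [hHd] at hw
  have hGd : ∀ w, fderiv ℂ G 0 w = w := fun w => by rw [← hHd (fderiv ℂ G 0 w), hG.fderiv_right]
  have ht : Tendsto (fun t : ℂ => t • v) (𝓝[≠] 0) (𝓝 0) := by
    have : Continuous fun t : ℂ => t • v := by fun_prop
    simpa using (this.tendsto 0).mono_left nhdsWithin_le_nhds
  have htan := tendsto_inv_smul_of_analyticAt hG.an' hG.map0' v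
  rw [hGd] at htan
  refine ⟨fun t => G (t • v), htan, hG.tendsto'.comp ht, ?_⟩
  filter_upwards [ht.eventually hG.right, (hG.tendsto'.comp ht).eventually hHT,
    ((AnalyticAt.tendsto_zero hT hT0).comp (hG.tendsto'.comp ht)).eventually hG.left,
    (hG.tendsto'.comp ht).eventually hG.left] with t h1 h2 h3 h4
  simp only [Function.comp] at h2 h3 h4
  rw [h1, map_smul, hv] at h2
  rw [← h3, h2]

/-- A torus equivariant involution is a reflection whose coefficient depends on the products. -/
theorem exists_eq_flip {i : κ} {α : ℂ} (hα : α ≠ 0) {T : Dbl κ → Dbl κ} (hT : AnalyticAt ℂ T 0) (hT0 : T 0 = 0)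
    (hTT : ∀ᶠ y in 𝓝 0, T (T y) = y) (hd : ∀ v, fderiv ℂ T 0 v = flip i α v)
    (hi : ∀ᶠ y in 𝓝 0, ∀ c : ℂ, ‖c‖ = 1 → T (rot i c y) = rot i c⁻¹ (T y))
    (hne : ∀ j, i ≠ j → ∀ᶠ y in 𝓝 0, ∀ c : ℂ, ‖c‖ = 1 → T (rot j c y) = rot j c (T y)) :
    ∃ A : (κ → ℂ) → ℂ, AnalyticAt ℂ A 0 ∧ A 0 = α ∧ ∀ᶠ y : Dbl κ in 𝓝 0, T y = flip i (A (y.1 * y.2)) y := by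
  have h1an : ∀ k, AnalyticAt ℂ (fun y => (T y).1 k) 0 := fun k =>
    ((ContinuousLinearMap.proj (R := ℂ) (φ := fun _ : κ => ℂ) k).comp
      (ContinuousLinearMap.fst ℂ (κ → ℂ) (κ → ℂ))).analyticAt _ |>.comp hT
  have h2an : ∀ k, AnalyticAt ℂ (fun y => (T y).2 k) 0 := fun k =>
    ((ContinuousLinearMap.proj (R := ℂ) (φ := fun _ : κ => ℂ) k).comp
      (ContinuousLinearMap.snd ℂ (κ → ℂ) (κ → ℂ))).analyticAt _ |>.comp hT
  obtain ⟨A, hAan, hA⟩ := exists_eq_snd_mul i (h1an i) fun j => by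
    rcases eq_or_ne j i with rfl | hj
    · filter_upwards [hi] with y hy c hc
      rw [hy c hc, rot_fst_self, if_pos rfl]
    · filter_upwards [hne j hj.symm] with y hy c hc
      rw [hy c hc, rot_fst_ne hj.symm, if_neg hj, one_mul]
  obtain ⟨B, hBan, hB⟩ := exists_eq_fst_mul i (h2an i) fun j => by
    rcases eq_or_ne j i with rfl | hj
    · filter_upwards [hi] with y hy c hc
      rw [hy c hc, rot_snd_self, if_pos rfl, inv_inv]
    · filter_upwards [hne j hj.symm] with y hy c hc
      rw [hy c hc, rot_snd_ne hj.symm, if_neg hj, one_mul]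
  have hfix : ∀ g : (κ → ℂ) → ℂ, AnalyticAt ℂ g 0 →
      (∀ᶠ y : Dbl κ in 𝓝 0, T y = y → (∀ k, y.1 k ≠ 0) → (∀ k, y.2 k ≠ 0) → g (y.1 * y.2) = 0) →
      ∀ᶠ ζ in 𝓝 0, g ζ = 0 := by
    intro g hg hgy
    refine eventually_eq_zero_of_curves hg _ (dense_forall_ne_zero κ) fun w hw => ?_
    obtain ⟨b, hb⟩ : ∃ b : ℂ, b ^ 2 = w i / α := IsAlgClosed.exists_pow_nat_eq _ two_pos
    have hb0 : b ≠ 0 := by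
      rintro rfl
      exact div_ne_zero (hw i) hα (by rw [← hb]; simp)
    set v : Dbl κ := (Function.update w i (α * b), Function.update (fun _ => 1) i b) with hv
    have hv1 : ∀ k, v.1 k ≠ 0 := fun k => by
      rcases eq_or_ne k i with rfl | hk
      · simp [hv, hα, hb0]
      · simp [hv, hk, hw k]
    have hv2 : ∀ k, v.2 k ≠ 0 := fun k => by
      rcases eq_or_ne k i with rfl | hk
      · simp [hv, hb0]
      · simp [hv, hk]
    have hv12 : v.1 * v.2 = w := by
      funext k
      rcases eq_or_ne k i with rfl | hk
      · simp only [hv, Pi.mul_apply, Function.update_self]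
        rw [mul_assoc, ← sq, hb, mul_div_cancel₀ _ hα]
      · simp [hv, hk]
    have hvf : fderiv ℂ T 0 v = v := by
      rw [hd]
      refine Dbl.ext' i ?_ ?_ fun k hk => ?_
      · simp [hv]
      · simp [hv, hα]
      · simp [flip_fst_ne hk, flip_snd_ne hk]
    obtain ⟨c, hc1, hc2, hc3⟩ := exists_fixed_curve hT hT0 hTT hvf
    refine ⟨2, fun t => (c t).1 * (c t).2, one_le_two, ?_, ?_⟩
    · have h1 := (continuous_fst.tendsto v).comp hc1
      have h2 := (continuous_snd.tendsto v).comp hc1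
      have h3 := h1.mul h2
      rw [hv12] at h3
      refine h3.congr fun t => ?_
      funext k
      simp [sq]
      ring
    · have hnz : ∀ᶠ t in 𝓝[≠] (0 : ℂ), (∀ k, (c t).1 k ≠ 0) ∧ ∀ k, (c t).2 k ≠ 0 := by
        rw [eventually_and, eventually_all, eventually_all]
        have h1 := (continuous_fst.tendsto v).comp hc1
        have h2 := (continuous_snd.tendsto v).comp hc1
        refine ⟨fun k => ?_, fun k => ?_⟩
        · filter_upwards [(tendsto_pi_nhds.1 h1 k).eventually_ne (hv1 k)] with t ht h
          exact ht (by simp [h])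
        · filter_upwards [(tendsto_pi_nhds.1 h2 k).eventually_ne (hv2 k)] with t ht h
          exact ht (by simp [h])
      filter_upwards [hc2.eventually hgy, hc3, hnz] with t h1 h2 h3
      exact h1 h2 h3.1 h3.2
  have hAB : ∀ᶠ ζ in 𝓝 0, A ζ * B ζ - 1 = 0 := by
    refine hfix _ ((hAan.mul hBan).sub analyticAt_const) ?_
    filter_upwards [hA, hB] with y h1 h2 hf e1 e2
    rw [hf] at h1 h2
    have := e2 i
    rw [h1] at h2
    have h3 : y.2 i * (A (y.1 * y.2) * B (y.1 * y.2)) = y.2 i * 1 := by rw [mul_one, ← mul_assoc]; exact h2.symm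
    rw [mul_left_cancel₀ this h3, sub_self]
  have hF1 : ∀ k, k ≠ i → ∀ᶠ y in 𝓝 0, (T y).1 k = y.1 k := by
    intro k hk
    obtain ⟨D, hDan, hD⟩ := exists_eq_fst_mul k (h1an k) fun j => by
      rcases eq_or_ne j i with rfl | hj
      · filter_upwards [hi] with y hy c hc
        rw [hy c hc, rot_fst_ne hk, if_neg hk.symm, one_mul]
      · filter_upwards [hne j hj.symm] with y hy c hc
        rw [hy c hc]
        rcases eq_or_ne j k with rfl | hjk
        · rw [rot_fst_self, if_pos rfl]
        · rw [rot_fst_ne hjk.symm, if_neg hjk, one_mul]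
    have hD1 : ∀ᶠ ζ in 𝓝 0, D ζ - 1 = 0 := by
      refine hfix _ (hDan.sub analyticAt_const) ?_
      filter_upwards [hD] with y h1 hf e1 e2
      rw [hf] at h1
      rw [sub_eq_zero]
      exact mul_left_cancel₀ (e1 k) (by rw [mul_one]; exact h1.symm)
    have tz : Tendsto (fun y : Dbl κ => y.1 * y.2) (𝓝 0) (𝓝 0) := by
      have : Continuous fun y : Dbl κ => y.1 * y.2 := by fun_prop
      simpa using this.tendsto 0
    filter_upwards [hD, tz.eventually hD1] with y h1 h2
    rw [h1, sub_eq_zero.1 h2, mul_one]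
  have hF2 : ∀ k, k ≠ i → ∀ᶠ y in 𝓝 0, (T y).2 k = y.2 k := by
    intro k hk
    obtain ⟨D, hDan, hD⟩ := exists_eq_snd_mul k (h2an k) fun j => by
      rcases eq_or_ne j i with rfl | hj
      · filter_upwards [hi] with y hy c hc
        rw [hy c hc, rot_snd_ne hk, if_neg hk.symm, one_mul]
      · filter_upwards [hne j hj.symm] with y hy c hc
        rw [hy c hc]
        rcases eq_or_ne j k with rfl | hjk
        · rw [rot_snd_self, if_pos rfl]
        · rw [rot_snd_ne hjk.symm, if_neg hjk, one_mul]
    have hD1 : ∀ᶠ ζ in 𝓝 0, D ζ - 1 = 0 := by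
      refine hfix _ (hDan.sub analyticAt_const) ?_
      filter_upwards [hD] with y h1 hf e1 e2
      rw [hf] at h1
      rw [sub_eq_zero]
      exact mul_left_cancel₀ (e2 k) (by rw [mul_one]; exact h1.symm)
    have tz : Tendsto (fun y : Dbl κ => y.1 * y.2) (𝓝 0) (𝓝 0) := by
      have : Continuous fun y : Dbl κ => y.1 * y.2 := by fun_prop
      simpa using this.tendsto 0
    filter_upwards [hD, tz.eventually hD1] with y h1 h2
    rw [h1, sub_eq_zero.1 h2, mul_one]
  have tz : Tendsto (fun y : Dbl κ => y.1 * y.2) (𝓝 0) (𝓝 0) := by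
    have : Continuous fun y : Dbl κ => y.1 * y.2 := by fun_prop
    simpa using this.tendsto 0
  refine ⟨A, hAan, ?_, ?_⟩
  · set v : Dbl κ := (0, Pi.single i 1) with hv
    have h1 := tendsto_inv_smul_of_analyticAt hT hT0 v
    have h2 := tendsto_pi_nhds.1 ((continuous_fst.tendsto _).comp h1) i
    rw [hd] at h2
    have h3 : (flip i α v).1 i = α := by simp [hv]
    rw [h3] at h2
    refine tendsto_nhds_unique (Tendsto.congr' ?_ tendsto_const_nhds) h2
    have ht : Tendsto (fun t : ℂ => t • v) (𝓝[≠] 0) (𝓝 0) := by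
      have : Continuous fun t : ℂ => t • v := by fun_prop
      simpa using (this.tendsto 0).mono_left nhdsWithin_le_nhds
    filter_upwards [ht.eventually hA, self_mem_nhdsWithin] with t h4 h5
    have h5 : t ≠ 0 := h5
    simp only [Function.comp, Prod.smul_fst, Pi.smul_apply, smul_eq_mul]
    rw [h4]
    simp [hv, h5]
  · filter_upwards [hA, hB, tz.eventually hAB, eventually_all.2 fun k => (eventually_imp_distrib_left.2 (hF1 k)),
      eventually_all.2 fun k => (eventually_imp_distrib_left.2 (hF2 k))] with y h1 h2 h3 h4 h5
    refine Dbl.ext' i ?_ ?_ fun k hk => ?_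
    · rw [h1, flip_fst_self, mul_comm]
    · rw [h2, flip_snd_self, mul_comm, eq_inv_of_mul_eq_one_right (sub_eq_zero.1 h3)]
    · rw [flip_fst_ne hk, flip_snd_ne hk, h4 k hk, h5 k hk]
      exact ⟨rfl, rfl⟩

end

section

variable {a b : ℕ}

theorem swapIdx_swapIdx (j : Idx a b) : swapIdx (swapIdx j) = j := by
  rcases j with e | s | s <;> rfl

/-- The exponent `-1` for the elliptic indices and `1` for the others. -/
def sgn : Idx a b → ℤ
  | Sum.inl _ => -1
  | Sum.inr _ => 1

theorem sgn_swapIdx (j : Idx a b) : sgn (swapIdx j) = sgn j := by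
  rcases j with e | s | s <;> rfl

theorem sgn_mul_sgn (j : Idx a b) : sgn j * sgn j = 1 := by
  rcases j with e | s | s <;> rfl

theorem rho_rho (x : V a b × V a b) : rho (rho x) = x := by
  ext j <;> rcases j with e | s | s <;> simp [rho, swapIdx]

theorem norm_rho_le (x : V a b × V a b) : ‖rho x‖ ≤ ‖x‖ := by
  refine Dbl.norm_le (norm_nonneg x) fun j => ?_
  rcases j with e | s | s <;> simp only [rho, RCLike.norm_conj, norm_coord_fst_le, norm_coord_snd_le, and_self]

theorem norm_rho (x : V a b × V a b) : ‖rho x‖ = ‖x‖ :=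
  le_antisymm (norm_rho_le x) (by simpa only [rho_rho] using norm_rho_le (rho x))

/-- The antilinear map `ρ`. -/
def rhoL (a b : ℕ) : Dbl (Idx a b) →SL[starRingEnd ℂ] Dbl (Idx a b) :=
  LinearMap.mkContinuous
    { toFun := rho
      map_add' := fun x y => by ext j <;> rcases j with e | s | s <;> simp [rho]
      map_smul' := fun c x => by ext j <;> rcases j with e | s | s <;> simp [rho] } 1
    fun x => by rw [one_mul]; exact norm_rho_le x

theorem rhoL_apply (x : V a b × V a b) : rhoL a b x = rho x := rfl

/-- Multiplication of `ξ` by `u` and of `η` by `u⁻¹`. -/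
def scale (u : V a b) (x : V a b × V a b) : V a b × V a b := (u * x.1, u⁻¹ * x.2)

theorem rho_scale (u : V a b) (x : V a b × V a b) :
    rho (scale u x) = scale (fun j => conj (u (swapIdx j)) ^ sgn j) (rho x) := by
  ext j <;> rcases j with e | s | s <;> simp [rho, scale, sgn, swapIdx]

theorem rho_rot (j : Idx a b) (c : ℂ) (x : V a b × V a b) :
    rho (rot j c x) = rot (swapIdx j) (conj c ^ sgn j) (rho x) := by
  ext i <;> rcases i with e | s | s <;> rcases j with e' | s' | s' <;>
    simp [rho, rot_apply, sgn, swapIdx, Function.update_apply] <;> split_ifs <;> simp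

theorem rho_flip (j : Idx a b) (c : ℂ) (x : V a b × V a b) :
    rho (flip j c x) = flip (swapIdx j) (conj c ^ sgn j) (rho x) := by
  ext i <;> rcases i with e | s | s <;> rcases j with e' | s' | s' <;>
    simp [rho, flip_apply, sgn, swapIdx, Function.update_apply] <;> split_ifs <;> simp

theorem rho_mul (x : V a b × V a b) : (rho x).1 * (rho x).2 = rhoZ (x.1 * x.2) := by
  funext j
  rcases j with e | s | s <;> simp [rho, rhoZ, swapIdx, mul_comm]

theorem rhoZ_rhoZ (ζ : V a b) : rhoZ (rhoZ ζ) = ζ := by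
  funext j
  simp [rhoZ, swapIdx_swapIdx]

theorem isRotReal_rhoL : IsRotReal (rhoL a b) swapIdx sgn where
  invol := rho_rho
  norm_map := norm_rho
  st_st := swapIdx_swapIdx
  s_st := sgn_swapIdx
  s_sq := sgn_mul_sgn
  map_rot := rho_rot

theorem tendsto_rho : Tendsto (rho : V a b × V a b → _) (𝓝 0) (𝓝 0) := IsRotReal.tendsto (rhoL a b)

theorem tendsto_rhoZ : Tendsto (rhoZ : V a b → _) (𝓝 0) (𝓝 0) := by
  have : Continuous (rhoZ : V a b → _) :=
    continuous_pi fun j => Complex.continuous_conj.comp (continuous_apply (swapIdx j))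
  have h := this.tendsto 0
  have h0 : rhoZ (0 : V a b) = 0 := by funext j; simp [rhoZ]
  rwa [h0] at h

theorem tendsto_mul_zero {κ : Type*} [Fintype κ] : Tendsto (fun x : (κ → ℂ) × (κ → ℂ) => x.1 * x.2) (𝓝 0) (𝓝 0) := by
  have : Continuous fun y : (κ → ℂ) × (κ → ℂ) => y.1 * y.2 := by fun_prop
  simpa using this.tendsto 0

theorem eventually_of_products {κ : Type*} [Fintype κ] {P : (κ → ℂ) → Prop}
    (h : ∀ᶠ y : (κ → ℂ) × (κ → ℂ) in 𝓝 0, (∀ k, y.1 k ≠ 0) → P (y.1 * y.2)) : ∀ᶠ ζ in 𝓝 0, P ζ := by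
  have t : Continuous fun q : ℂ × (κ → ℂ) => ((fun _ : κ => q.1), q.2) := by fun_prop
  have h1 : ∀ᶠ q : ℂ × (κ → ℂ) in 𝓝 0, (∀ _ : κ, q.1 ≠ 0) → P ((fun _ : κ => q.1) * q.2) :=
    (t.tendsto 0).eventually h
  rw [show (0 : ℂ × (κ → ℂ)) = (0, 0) from rfl, nhds_prod_eq] at h1
  obtain ⟨p, hp, q, hq, hpq⟩ := eventually_prod_iff.1 h1
  obtain ⟨r, hr1, hr2⟩ := ((hp.filter_mono nhdsWithin_le_nhds).and
    (self_mem_nhdsWithin : ({0}ᶜ : Set ℂ) ∈ 𝓝[≠] 0)).exists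
  have hr0 : r ≠ 0 := hr2
  have t2 : Tendsto (fun ζ : κ → ℂ => r⁻¹ • ζ) (𝓝 0) (𝓝 0) := by
    have : Continuous fun ζ : κ → ℂ => r⁻¹ • ζ := by fun_prop
    simpa using this.tendsto 0
  filter_upwards [t2.eventually hq] with ζ hζ
  have := hpq hr1 hζ fun _ => hr0
  have e : (fun _ : κ => r) * (r⁻¹ • ζ) = ζ := by funext k; simp [hr0]
  rwa [e] at this

theorem flip_scale {u : V a b} (hu : ∀ j, u j ≠ 0) (j : Idx a b) (c : ℂ) (x : V a b × V a b) :
    flip j c (scale u x) = scale u (flip j (c / u j ^ 2) x) := by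
  have := hu j
  refine Dbl.ext' j ?_ ?_ fun k hk => ?_
  · simp [scale]; field_simp
  · simp [scale]; field_simp
  · simp [scale, flip_fst_ne hk, flip_snd_ne hk]

end

section

variable {a b : ℕ}

theorem analyticAt_mul_products {κ : Type*} [Fintype κ] {β : (κ → ℂ) → ℂ} (h : AnalyticAt ℂ β 0) :
    AnalyticAt ℂ (fun x : (κ → ℂ) × (κ → ℂ) => β (x.1 * x.2)) 0 :=
  AnalyticAt.comp_zero (f := fun x : (κ → ℂ) × (κ → ℂ) => x.1 * x.2) h (analyticAt_fst.mul analyticAt_snd)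
    (mul_zero _)

theorem scale_products {u : V a b} (hu : ∀ j, u j ≠ 0) (x : V a b × V a b) :
    (scale u x).1 * (scale u x).2 = x.1 * x.2 := by
  funext j
  have := hu j
  simp [scale]
  field_simp

theorem analyticAt_coord_fst {κ : Type*} [Fintype κ] (j : κ) (x : (κ → ℂ) × (κ → ℂ)) :
    AnalyticAt ℂ (fun x : (κ → ℂ) × (κ → ℂ) => x.1 j) x :=
  ((ContinuousLinearMap.proj (R := ℂ) (φ := fun _ : κ => ℂ) j).comp
    (ContinuousLinearMap.fst ℂ (κ → ℂ) (κ → ℂ))).analyticAt x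

theorem analyticAt_coord_snd {κ : Type*} [Fintype κ] (j : κ) (x : (κ → ℂ) × (κ → ℂ)) :
    AnalyticAt ℂ (fun x : (κ → ℂ) × (κ → ℂ) => x.2 j) x :=
  ((ContinuousLinearMap.proj (R := ℂ) (φ := fun _ : κ => ℂ) j).comp
    (ContinuousLinearMap.snd ℂ (κ → ℂ) (κ → ℂ))).analyticAt x

theorem scale_germInv {u : Idx a b → V a b → ℂ} (hu : ∀ j, AnalyticAt ℂ (u j) 0) (h0 : ∀ j ζ, u j ζ ≠ 0) :
    IsGermInv (fun x : V a b × V a b => scale (fun j => u j (x.1 * x.2)) x)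
      (fun x => scale (fun j => (u j (x.1 * x.2))⁻¹) x) := by
  have han : ∀ {u : Idx a b → V a b → ℂ}, (∀ j, AnalyticAt ℂ (u j) 0) → (∀ j ζ, u j ζ ≠ 0) →
      AnalyticAt ℂ (fun x : V a b × V a b => scale (fun j => u j (x.1 * x.2)) x) 0 := by
    intro u hu h0
    refine AnalyticAt.prod ?_ ?_
    · rw [analyticAt_pi_iff]
      intro j
      exact (analyticAt_mul_products (hu j)).mul (analyticAt_coord_fst j 0)
    · rw [analyticAt_pi_iff]
      intro j
      exact ((analyticAt_mul_products (hu j)).inv (h0 j _)).mul (analyticAt_coord_snd j 0)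
  have hz : ∀ w : V a b, scale w 0 = 0 := fun w => by simp [scale]
  refine ⟨han hu h0, hz _, han (u := fun j ζ => (u j ζ)⁻¹) (fun j => (hu j).inv (h0 j 0))
    fun j ζ => inv_ne_zero (h0 j ζ), hz _, .of_forall fun x => ?_, .of_forall fun x => ?_⟩
  · rw [scale_products fun j => h0 j _]
    ext j <;> simp [scale, h0]
  · rw [scale_products fun j => inv_ne_zero (h0 j _)]
    ext j <;> simp [scale, h0]

theorem fderiv_scale {u : Idx a b → V a b → ℂ} (hu : ∀ j, AnalyticAt ℂ (u j) 0) (h1 : ∀ j, u j 0 = 1)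
    (v : V a b × V a b) : fderiv ℂ (fun x : V a b × V a b => scale (fun j => u j (x.1 * x.2)) x) 0 v = v := by
  have key : ∀ {w : V a b → ℂ}, AnalyticAt ℂ w 0 → w 0 = 1 → ∀ l : V a b × V a b →L[ℂ] ℂ,
      HasFDerivAt (fun x : V a b × V a b => w (x.1 * x.2) * l x) l 0 := by
    intro w hw hw1 l
    have := (analyticAt_mul_products hw).differentiableAt.hasFDerivAt.fun_mul (l.hasFDerivAt (x := 0))
    refine this.congr_fderiv (ContinuousLinearMap.ext fun v => ?_)
    rw [add_apply, smul_apply, smul_apply]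
    simp [hw1]
  have hf : ∀ j, HasFDerivAt (fun x : V a b × V a b => u j (x.1 * x.2) * x.1 j)
      ((ContinuousLinearMap.proj (R := ℂ) (φ := fun _ : Idx a b => ℂ) j).comp
        (ContinuousLinearMap.fst ℂ (V a b) (V a b))) 0 := fun j =>
    key (hu j) (h1 j) ((ContinuousLinearMap.proj (R := ℂ) (φ := fun _ : Idx a b => ℂ) j).comp
      (ContinuousLinearMap.fst ℂ (V a b) (V a b)))
  have hs : ∀ j, HasFDerivAt (fun x : V a b × V a b => (u j (x.1 * x.2))⁻¹ * x.2 j)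
      ((ContinuousLinearMap.proj (R := ℂ) (φ := fun _ : Idx a b => ℂ) j).comp
        (ContinuousLinearMap.snd ℂ (V a b) (V a b))) 0 := fun j =>
    key (w := fun ζ => (u j ζ)⁻¹) ((hu j).inv (by simp [h1])) (by simp [h1])
      ((ContinuousLinearMap.proj (R := ℂ) (φ := fun _ : Idx a b => ℂ) j).comp
        (ContinuousLinearMap.snd ℂ (V a b) (V a b)))
  have := (hasFDerivAt_pi.2 hf).prodMk (hasFDerivAt_pi.2 hs)
  have h2 : HasFDerivAt (fun x : V a b × V a b => scale (fun j => u j (x.1 * x.2)) x) _ 0 := this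
  rw [h2.fderiv]
  rfl

/-- A pair family with real structure is simultaneously conjugate to its normal form. -/
theorem exists_normalization {α : Idx a b → ℂ} {τ A : Idx a b → V a b × V a b → V a b × V a b}
    (H : IsPairFamily α (fun j => (α j)⁻¹) τ A)
    (hA : ∀ j, ∀ᶠ x in 𝓝 0, A j x = rho (τ (swapIdx j) (rho x))) :
    ∃ Λ : Idx a b → V a b → ℂ, (∀ j, AnalyticAt ℂ (Λ j) 0 ∧ Λ j 0 = α j) ∧ RealityCondition Λ ∧
      ∃ ψ χ : V a b × V a b → V a b × V a b, IsGermInv ψ χ ∧ (∀ v, fderiv ℂ ψ 0 v = v) ∧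
        (∀ᶠ x in 𝓝 0, rho (ψ x) = ψ (rho x)) ∧ ∀ j, (∀ᶠ x in 𝓝 0, τ j (ψ x) = ψ (nfTau (Λ j) j x)) ∧
          ∀ᶠ x in 𝓝 0, A j (ψ x) = ψ (nfTau (fun ζ => (Λ j ζ)⁻¹) j x) := by
  obtain ⟨f, g, hfg, hfd, hfR, h1, h2, h3, h4⟩ := H.exists_torus_equivariant isRotReal_rhoL hA
  simp only [rhoL_apply] at hfR
  have hgd : ∀ v, fderiv ℂ g 0 v = v := fun v => by rw [← hfd (fderiv ℂ g 0 v), hfg.fderiv_right]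
  have conjT : ∀ (T : V a b × V a b → V a b × V a b), AnalyticAt ℂ T 0 → T 0 = 0 →
      (∀ᶠ x in 𝓝 0, T (T x) = x) → AnalyticAt ℂ (fun x => f (T (g x))) 0 ∧ f (T (g 0)) = 0 ∧
      (∀ᶠ x in 𝓝 0, f (T (g (f (T (g x))))) = x) ∧
      ∀ v, fderiv ℂ (fun x => f (T (g x))) 0 v = fderiv ℂ T 0 v := by
    intro T hT hT0 hTT
    have hTg : AnalyticAt ℂ (fun x => T (g x)) 0 := AnalyticAt.comp_zero hT hfg.an' hfg.map0'
    have hTg0 : T (g 0) = 0 := by rw [hfg.map0', hT0]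
    refine ⟨AnalyticAt.comp_zero hfg.an hTg hTg0, by rw [hTg0, hfg.map0], ?_, fun v => ?_⟩
    · filter_upwards [hfg.tendsto'.eventually hTT,
        ((AnalyticAt.tendsto_zero hT hT0).comp hfg.tendsto').eventually hfg.left, hfg.right] with x e1 e2 e3
      simp only [Function.comp] at e2
      rw [e2, e1, e3]
    · rw [fderiv_comp_zero hfg.an hTg hTg0, hfd, fderiv_comp_zero hT hfg.an' hfg.map0', hgd]
  have hτc := fun j => conjT (τ j) (H.an j) (H.map0 j) (H.invol j)
  have hAc := fun j => conjT (A j) (H.an' j) (H.map0' j) (H.invol' j)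
  have k1 := fun j => exists_eq_flip (H.ne j) (hτc j).1 (hτc j).2.1 (hτc j).2.2.1
    (fun v => by rw [(hτc j).2.2.2, H.deriv]) (h1 j) fun i hi => h3 j i hi
  have k2 := fun j => exists_eq_flip (H.ne' j) (hAc j).1 (hAc j).2.1 (hAc j).2.2.1
    (fun v => by rw [(hAc j).2.2.2, H.deriv']) (h2 j) fun i hi => h4 j i hi
  choose p pan p0 hp using k1
  choose q qan q0 hq using k2
  have hgR : ∀ᶠ x in 𝓝 0, g (rho x) = rho (g x) := by
    filter_upwards [hfg.right, (tendsto_rho.comp hfg.tendsto').eventually hfg.left] with x e1 e2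
    simp only [Function.comp] at e2
    rw [← e2, ← hfR, e1]
  have hpq : ∀ j, ∀ᶠ ζ in 𝓝 0, q j ζ = conj (p (swapIdx j) (rhoZ ζ)) ^ sgn j := by
    intro j
    apply eventually_of_products
    filter_upwards [hq j, hfg.tendsto'.eventually (hA j), tendsto_rho.eventually (hp (swapIdx j)), hgR] with y e1 e2 e3 e4 e5
    have e6 : flip j (q j (y.1 * y.2)) y = flip j (conj (p (swapIdx j) (rhoZ (y.1 * y.2))) ^ sgn j) y := by
      rw [← e1, e2, ← e4, ← hfR, e3, rho_flip, rho_rho, swapIdx_swapIdx, sgn_swapIdx, rho_mul]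
    have e7 := congrFun (congrArg Prod.snd e6) j
    rw [flip_snd_self, flip_snd_self] at e7
    exact inv_injective (mul_right_cancel₀ (e5 j) e7)
  have hpq' : ∀ j, ∀ᶠ ζ in 𝓝 0, p j ζ = conj (q (swapIdx j) (rhoZ ζ)) ^ sgn j := by
    intro j
    filter_upwards [tendsto_rhoZ.eventually (hpq (swapIdx j))] with ζ e
    rw [e, swapIdx_swapIdx, sgn_swapIdx, rhoZ_rhoZ, map_zpow₀, Complex.conj_conj, ← zpow_mul, sgn_mul_sgn, zpow_one]
  have hpq0 : ∀ j, p j 0 * q j 0 = 1 := fun j => by rw [p0, q0, mul_inv_cancel₀ (H.ne j)]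
  set u : Idx a b → V a b → ℂ := fun j ζ => Complex.exp ((1 / 4 : ℂ) * Complex.log (p j ζ * q j ζ)) with hu
  have uan : ∀ j, AnalyticAt ℂ (u j) 0 := fun j =>
    (analyticAt_const.mul ((pan j).mul (qan j) |>.clog (by simp [hpq0]))).cexp
  have u0 : ∀ j ζ, u j ζ ≠ 0 := fun j ζ => Complex.exp_ne_zero _
  have unear : ∀ j, ∀ᶠ ζ in 𝓝 0, p j ζ * q j ζ ∈ Complex.slitPlane := fun j =>
    ((pan j).mul (qan j)).continuousAt.eventually_mem (by
      simp only [Pi.mul_apply, hpq0]; exact Complex.isOpen_slitPlane.mem_nhds (by simp))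
  have u4 : ∀ j, ∀ᶠ ζ in 𝓝 0, u j ζ ^ 4 = p j ζ * q j ζ := fun j => by
    filter_upwards [unear j] with ζ e
    rw [← Complex.exp_nat_mul, ← mul_assoc]
    norm_num
    rw [Complex.exp_log (Complex.slitPlane_ne_zero e)]
  have ureal : ∀ j, ∀ᶠ ζ in 𝓝 0, u j (rhoZ ζ) = conj (u (swapIdx j) ζ) ^ sgn j := by
    intro j
    filter_upwards [unear (swapIdx j), hpq (swapIdx j), hpq' (swapIdx j), tendsto_rhoZ.eventually (hpq j),
      tendsto_rhoZ.eventually (hpq' j)] with ζ e1 e2 e3 e4 e5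
    have e6 : p j (rhoZ ζ) * q j (rhoZ ζ) = conj (p (swapIdx j) ζ * q (swapIdx j) ζ) ^ sgn j := by
      rw [e4, e5, rhoZ_rhoZ, map_mul, mul_zpow, mul_comm]
    have e7 : (p (swapIdx j) ζ * q (swapIdx j) ζ).arg ≠ Real.pi := Complex.slitPlane_arg_ne_pi e1
    simp only [hu]
    rw [e6]
    set Q := p (swapIdx j) ζ * q (swapIdx j) ζ
    have e8 : conj ((1 / 4 : ℂ) * Complex.log Q) = (1 / 4 : ℂ) * Complex.log (conj Q) := by
      rw [map_mul, Complex.log_conj _ e7, map_div₀, map_one, Complex.conj_ofNat]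
    rw [← Complex.exp_conj, e8]
    rcases j with e | s
    · simp only [sgn, zpow_neg_one]
      rw [← Complex.exp_neg, Complex.log_inv _ (by
        rw [Complex.arg_conj, if_neg e7]
        have := Complex.neg_pi_lt_arg Q
        intro h
        linarith), mul_neg]
    · simp [sgn]
  have pne : ∀ j, ∀ᶠ ζ in 𝓝 0, p j ζ ≠ 0 := fun j => (pan j).continuousAt.eventually_ne (by rw [p0]; exact H.ne j)
  set Λ : Idx a b → V a b → ℂ := fun j ζ => p j ζ / u j ζ ^ 2 with hΛ
  have Λne : ∀ j, ∀ᶠ ζ in 𝓝 0, Λ j ζ ≠ 0 := fun j => (pne j).mono fun ζ h => div_ne_zero h (pow_ne_zero _ (u0 j ζ))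
  have Λinv : ∀ j, ∀ᶠ ζ in 𝓝 0, (Λ j ζ)⁻¹ = q j ζ / u j ζ ^ 2 := fun j => by
    filter_upwards [u4 j, pne j] with ζ e1 e2
    have := u0 j ζ
    simp only [hΛ, inv_div]
    rw [div_eq_div_iff e2 (pow_ne_zero _ this), mul_comm (q j ζ), ← e1]
    ring
  have Λreal : ∀ j, ∀ᶠ ζ in 𝓝 0, (Λ j ζ)⁻¹ = conj (Λ (swapIdx j) (rhoZ ζ)) ^ sgn j := fun j => by
    filter_upwards [Λinv j, hpq j, ureal (swapIdx j)] with ζ e1 e2 e3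
    rw [e1, e2]
    simp only [hΛ]
    rw [map_div₀, div_zpow, map_pow, e3, swapIdx_swapIdx, sgn_swapIdx, map_zpow₀, Complex.conj_conj,
      ← zpow_natCast, ← zpow_natCast, ← zpow_mul, ← zpow_mul]
    rw [show sgn j * (((2 : ℕ) : ℤ) * sgn j) = (2 : ℕ) by
      rw [mul_left_comm, sgn_mul_sgn, mul_one]]
  have u00 : ∀ j, u j 0 = 1 := fun j => by simp [hu, hpq0]
  have hS := scale_germInv uan u0
  have hflip : ∀ (j : Idx a b) {c : ℂ} (x : V a b × V a b), c ≠ 0 → (flip j c x).1 * (flip j c x).2 = x.1 * x.2 := by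
    intro j c x hc
    funext k
    rcases eq_or_ne k j with rfl | hk
    · simp; field_simp
    · simp [flip_fst_ne hk, flip_snd_ne hk]
  have main : ∀ (T : V a b × V a b → V a b × V a b) (r L : V a b → ℂ) (j : Idx a b),
      AnalyticAt ℂ T 0 → T 0 = 0 → (∀ᶠ y in 𝓝 0, f (T (g y)) = flip j (r (y.1 * y.2)) y) →
      (∀ᶠ ζ in 𝓝 0, L ζ = r ζ / u j ζ ^ 2 ∧ L ζ ≠ 0) →
      ∀ᶠ x in 𝓝 0, T (g (scale (fun j => u j (x.1 * x.2)) x)) =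
        g (scale (fun k => u k ((nfTau L j x).1 * (nfTau L j x).2)) (nfTau L j x)) := by
    intro T r L j hT hT0 hr hL
    filter_upwards [hS.tendsto.eventually hr, tendsto_mul_zero.eventually hL,
      ((AnalyticAt.tendsto_zero hT hT0).comp (hfg.tendsto'.comp hS.tendsto)).eventually hfg.left] with x e1 e2 e3
    simp only [Function.comp] at e3
    change _ = g (scale (fun k => u k ((flip j (L (x.1 * x.2)) x).1 * (flip j (L (x.1 * x.2)) x).2))
      (flip j (L (x.1 * x.2)) x))
    rw [← e3, e1, scale_products fun j => u0 j _, flip_scale fun j => u0 j _, hflip j x e2.2, e2.1]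
  refine ⟨Λ, fun j => ⟨(pan j).div ((uan j).pow 2) (pow_ne_zero _ (u0 j 0)), by simp [hΛ, u00, p0]⟩,
    ⟨fun e => ?_, fun s => ?_⟩, fun x => g (scale (fun j => u j (x.1 * x.2)) x), _, hfg.symm.comp hS, fun v => ?_, ?_, fun j => ⟨?_, ?_⟩⟩
  · filter_upwards [Λreal (Sum.inl e)] with ζ h
    simpa [sgn, swapIdx] using h
  · filter_upwards [Λreal (Sum.inr (Sum.inl s))] with ζ h
    simp only [sgn, swapIdx, zpow_one] at h
    rw [map_inv₀, ← h, inv_inv]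
  · rw [fderiv_comp_zero hfg.an' hS.an hS.map0, hgd, fderiv_scale uan u00]
  · filter_upwards [hS.tendsto.eventually hgR, tendsto_mul_zero.eventually (eventually_all.2 ureal)] with x e1 e2
    rw [← e1, rho_scale, rho_mul]
    simp only [e2]
  · exact main (τ j) (p j) (Λ j) j (H.an j) (H.map0 j) (hp j) ((Λne j).mono fun ζ h => ⟨rfl, h⟩)
  · refine main (A j) (q j) _ j (H.an' j) (H.map0' j) (hq j) ?_
    filter_upwards [Λinv j, Λne j] with ζ e1 e2 using ⟨e1, inv_ne_zero e2⟩

end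

section

section Cubic

variable {X Y : Type*} [NormedAddCommGroup X] [NormedSpace ℂ X] [NormedAddCommGroup Y] [NormedSpace ℂ Y]
  [CompleteSpace Y]

/-- A remainder of third order is Lipschitz on small balls, with a constant of second order. -/
theorem exists_lipschitz_of_isBigO_cube {R : X → Y} (hR : AnalyticAt ℂ R 0)
    (h3 : R =O[𝓝 0] fun x => ‖x‖ ^ 3) : ∃ C r : ℝ, 0 < r ∧ 0 ≤ C ∧ ∀ ρ, 0 < ρ → ρ < r → ∀ x y, ‖x‖ ≤ ρ → ‖y‖ ≤ ρ →
      ‖R x - R y‖ ≤ C * ρ ^ 2 * ‖x - y‖ := by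
  obtain ⟨C, hC⟩ := h3.bound
  have hC' : ∀ᶠ x in 𝓝 (0 : X), ‖R x‖ ≤ |C| * ‖x‖ ^ 3 := hC.mono fun x hx => hx.trans (by
    rw [norm_pow, norm_norm]
    gcongr
    exact le_abs_self C)
  obtain ⟨r, hr, hball⟩ := Metric.eventually_nhds_iff_ball.1 (hC'.and hR.eventually_analyticAt)
  refine ⟨8 * |C|, r / 2, by positivity, by positivity, fun ρ hρ hρr x y hx hy => ?_⟩
  have hB : ∀ x : X, ‖x‖ ≤ 2 * ρ → ‖R x‖ ≤ |C| * ‖x‖ ^ 3 ∧ AnalyticAt ℂ R x := fun x hx =>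
    hball x (by rw [mem_ball_zero_iff]; linarith)
  have hd : ∀ x ∈ Metric.closedBall (0 : X) ρ, ‖fderiv ℂ R x‖ ≤ 8 * |C| * ρ ^ 2 := by
    intro x hx
    rw [mem_closedBall_zero_iff] at hx
    refine ContinuousLinearMap.opNorm_le_bound _ (by positivity) fun v => ?_
    rcases eq_or_ne v 0 with rfl | hv
    · simp
    have hv : 0 < ‖v‖ := norm_pos_iff.2 hv
    have hline : ∀ s : ℂ, HasDerivAt (fun s : ℂ => x + s • v) v s := fun s => by
      simpa using ((hasDerivAt_id s).smul_const v).const_add x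
    have hn : ∀ s : ℂ, ‖s‖ ≤ ρ / ‖v‖ → ‖x + s • v‖ ≤ 2 * ρ := by
      intro s hs
      have h1 : ‖s • v‖ ≤ ρ := by
        rw [norm_smul]
        rwa [le_div_iff₀ hv] at hs
      have := norm_add_le x (s • v)
      linarith
    have hder : HasDerivAt (fun s : ℂ => R (x + s • v)) (fderiv ℂ R x v) 0 := by
      have h1 : HasFDerivAt R (fderiv ℂ R x) (x + (0 : ℂ) • v) := by
        rw [zero_smul, add_zero]; exact (hB x (by linarith)).2.differentiableAt.hasFDerivAt
      exact h1.comp_hasDerivAt 0 (hline 0)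
    have hdc : DiffContOnCl ℂ (fun s : ℂ => R (x + s • v)) (Metric.ball 0 (ρ / ‖v‖)) := by
      refine DifferentiableOn.diffContOnCl fun s hs => ?_
      have hs' : ‖s‖ ≤ ρ / ‖v‖ := by
        have := Metric.closure_ball_subset_closedBall hs
        simpa using this
      exact ((hB _ (hn s hs')).2.differentiableAt.comp s (hline s).differentiableAt).differentiableWithinAt
    have := Complex.norm_deriv_le_of_forall_mem_sphere_norm_le (C := |C| * (2 * ρ) ^ 3) (by positivity) hdc fun s hs => by
      have hs' : ‖s‖ ≤ ρ / ‖v‖ := by simp at hs; exact hs.le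
      refine (hB _ (hn s hs')).1.trans ?_
      gcongr
      exact hn s hs'
    rw [hder.deriv] at this
    refine this.trans (le_of_eq ?_)
    field_simp
    ring
  refine Convex.norm_image_sub_le_of_norm_fderiv_le (𝕜 := ℂ) (s := Metric.closedBall (0 : X) ρ) (fun x hx => ?_) hd
    (convex_closedBall 0 ρ) (by simpa using hy) (by simpa using hx)
  exact (hB x (by rw [mem_closedBall_zero_iff] at hx; linarith)).2.differentiableAt

end Cubic

variable {a b : ℕ} {γe : Fin a → ℝ} {γs : Fin b → ℂ}

/-- The linear forms of the product quadric. -/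
def quadL (γe : Fin a → ℝ) (γs : Fin b → ℂ) (j : Idx a b) : V a b × V a b →L[ℂ] ℂ :=
  (ContinuousLinearMap.proj (R := ℂ) (φ := fun _ : Idx a b => ℂ) j).comp (ContinuousLinearMap.fst ℂ (V a b) (V a b)) +
    (2 * gam γe γs j) • (ContinuousLinearMap.proj (R := ℂ) (φ := fun _ : Idx a b => ℂ) (swapIdx j)).comp
      (ContinuousLinearMap.snd ℂ (V a b) (V a b))

theorem quadL_apply (j : Idx a b) (x : V a b × V a b) : quadL γe γs j x = quadForm γe γs j x := rfl

theorem gam_ne_zero (hγe : ∀ e, 0 < γe e ∧ γe e < 1 / 2) (hγs : ∀ s, 1 / 2 < (γs s).re ∧ 0 < (γs s).im)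
    (j : Idx a b) : gam γe γs j ≠ 0 := by
  rcases j with e | s | s
  · simpa [gam] using (hγe e).1.ne'
  · intro h
    have := (hγs s).2
    simp only [gam] at h
    rw [h] at this
    simp at this
  · intro h
    have h2 := congrArg Complex.im h
    have := (hγs s).2
    simp [gam] at h2
    linarith

theorem eq_of_fst_quadL (hγ : ∀ j, gam γe γs j ≠ 0) {x y : V a b × V a b} (h1 : x.1 = y.1)
    (h2 : ∀ j, quadL γe γs j x = quadL γe γs j y) : x = y := by
  refine Prod.ext h1 (funext fun j => ?_)
  have h := h2 (swapIdx j)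
  simp only [quadL_apply, quadForm, swapIdx_swapIdx, h1, add_right_inj] at h
  exact mul_left_cancel₀ (mul_ne_zero two_ne_zero (hγ _)) h

theorem tendsto_inv_smul_of_tendsto {E F : Type*} [NormedAddCommGroup E] [NormedSpace ℂ E]
    [NormedAddCommGroup F] [NormedSpace ℂ F] {c : ℂ → E} {v : E}
    (hc : Tendsto (fun t : ℂ => t⁻¹ • c t) (𝓝[≠] 0) (𝓝 v)) (L : E →L[ℂ] F) :
    Tendsto (fun t : ℂ => t⁻¹ • L (c t)) (𝓝[≠] 0) (𝓝 (L v)) := by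
  refine ((L.continuous.tendsto v).comp hc).congr fun t => ?_
  simp

theorem eventually_norm_le_of_tendsto {E : Type*} [NormedAddCommGroup E] [NormedSpace ℂ E] {c : ℂ → E} {v : E}
    (hc : Tendsto (fun t : ℂ => t⁻¹ • c t) (𝓝[≠] 0) (𝓝 v)) :
    ∀ᶠ t : ℂ in 𝓝[≠] 0, ‖c t‖ ≤ (‖v‖ + 1) * ‖t‖ := by
  filter_upwards [hc.norm.eventually_lt_const (lt_add_one ‖v‖), self_mem_nhdsWithin] with t h1 h2
  have h2 : 0 < ‖t‖ := norm_pos_iff.2 h2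
  rw [norm_smul, norm_inv, inv_mul_lt_iff₀ h2] at h1
  linarith

theorem tendsto_of_tendsto_inv_smul {E : Type*} [NormedAddCommGroup E] [NormedSpace ℂ E] {c : ℂ → E} {v : E}
    (hc : Tendsto (fun t : ℂ => t⁻¹ • c t) (𝓝[≠] 0) (𝓝 v)) : Tendsto c (𝓝[≠] 0) (𝓝 0) := by
  have h1 : Tendsto (fun t : ℂ => t) (𝓝[≠] 0) (𝓝 0) := tendsto_id.mono_left nhdsWithin_le_nhds
  have := h1.smul hc
  rw [zero_smul] at this
  refine this.congr' ?_
  filter_upwards [self_mem_nhdsWithin] with t ht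
  have ht : t ≠ 0 := ht
  simp [smul_smul, ht]

theorem tendsto_inv_sq_smul (E : V a b × V a b → V a b) (hE : IsPerturbation γe γs E) {c : ℂ → V a b × V a b}
    {v : V a b × V a b} (hc : Tendsto (fun t : ℂ => t⁻¹ • c t) (𝓝[≠] 0) (𝓝 v)) (i : Idx a b) :
    Tendsto (fun t : ℂ => (t ^ 2)⁻¹ * E (c t) i) (𝓝[≠] 0) (𝓝 (quadL γe γs i v ^ 2)) := by
  obtain ⟨C, hC⟩ := hE.2.bound
  have h1 : Tendsto (fun t : ℂ => (t⁻¹ • quadL γe γs i (c t)) ^ 2) (𝓝[≠] 0) (𝓝 (quadL γe γs i v ^ 2)) :=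
    (tendsto_inv_smul_of_tendsto hc (quadL γe γs i)).pow 2
  have h2 : Tendsto (fun t : ℂ => (t ^ 2)⁻¹ * (E (c t) i - quadL γe γs i (c t) ^ 2)) (𝓝[≠] 0) (𝓝 0) := by
    refine squeeze_zero_norm' (a := fun t : ℂ => |C| * (‖v‖ + 1) ^ 3 * ‖t‖) ?_ ?_
    · filter_upwards [(tendsto_of_tendsto_inv_smul hc).eventually hC, eventually_norm_le_of_tendsto hc,
        self_mem_nhdsWithin] with t e1 e2 e3
      have e3 : 0 < ‖t‖ := norm_pos_iff.2 e3
      have e4 : ‖E (c t) i - quadL γe γs i (c t) ^ 2‖ ≤ |C| * ((‖v‖ + 1) * ‖t‖) ^ 3 := by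
        refine (norm_le_pi_norm (E (c t) - fun j => quadForm γe γs j (c t) ^ 2) i).trans (e1.trans ?_)
        rw [norm_pow, norm_norm]
        gcongr
        exact le_abs_self C
      rw [norm_mul, norm_inv, norm_pow, inv_mul_le_iff₀ (by positivity)]
      refine e4.trans (le_of_eq (by ring))
    · have : Continuous fun t : ℂ => |C| * (‖v‖ + 1) ^ 3 * ‖t‖ := by fun_prop
      simpa using (this.tendsto 0).mono_left nhdsWithin_le_nhds
  have := h1.add h2
  rw [add_zero] at this
  refine this.congr fun t => ?_
  simp only [smul_eq_mul]
  ring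

namespace IsDeck

variable {E : V a b × V a b → V a b} {F G : V a b × V a b → V a b × V a b}

theorem exists_germInv (hF : IsDeck E F) : ∃ G, IsGermInv F G := by
  obtain ⟨⟨h1, h2, G, h3, h4, h5, h6⟩, -⟩ := hF
  exact ⟨G, h1, h2, h3, h4, h5, h6⟩

theorem tendsto (hF : IsDeck E F) : Tendsto F (𝓝 0) (𝓝 0) := AnalyticAt.tendsto_zero hF.1.1 hF.1.2.1

theorem comp (hF : IsDeck E F) (hG : IsDeck E G) : IsDeck E (fun x => F (G x)) := by
  obtain ⟨F', hF'⟩ := hF.exists_germInv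
  obtain ⟨G', hG'⟩ := hG.exists_germInv
  have h := hF'.comp hG'
  refine ⟨⟨h.an, h.map0, _, h.an', h.map0', h.left, h.right⟩, ?_⟩
  filter_upwards [hG.tendsto.eventually hF.2, hG.2] with x h1 h2
  rw [h1, h2]

theorem id (E : V a b × V a b → V a b) : IsDeck E (fun x => x) :=
  ⟨⟨analyticAt_id, rfl, fun x => x, analyticAt_id, rfl, .of_forall fun _ => rfl, .of_forall fun _ => rfl⟩,
    .of_forall fun _ => rfl⟩

theorem fderiv_fst (hF : IsDeck E F) (v : V a b × V a b) : (fderiv ℂ F 0 v).1 = v.1 := by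
  have h1 := tendsto_inv_smul_of_tendsto (tendsto_inv_smul_of_analyticAt hF.1.1 hF.1.2.1 v)
    (ContinuousLinearMap.fst ℂ (V a b) (V a b))
  refine tendsto_nhds_unique h1 (Tendsto.congr' ?_ tendsto_const_nhds)
  have ht : Tendsto (fun t : ℂ => t • v) (𝓝[≠] 0) (𝓝 0) := by
    have : Continuous fun t : ℂ => t • v := by fun_prop
    simpa using (this.tendsto 0).mono_left nhdsWithin_le_nhds
  filter_upwards [ht.eventually hF.2, self_mem_nhdsWithin] with t e1 e2
  have e2 : t ≠ 0 := e2
  have e3 : (F (t • v)).1 = (t • v).1 := (Prod.ext_iff.1 e1).1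
  simp [e3, smul_smul, e2]

theorem quadL_sq (hE : IsPerturbation γe γs E) (hF : IsDeck E F) (i : Idx a b) (v : V a b × V a b) :
    quadL γe γs i (fderiv ℂ F 0 v) ^ 2 = quadL γe γs i v ^ 2 := by
  have h1 := tendsto_inv_sq_smul E hE (tendsto_inv_smul_of_analyticAt hF.1.1 hF.1.2.1 v) i
  have h0 : Tendsto (fun t : ℂ => t⁻¹ • (t • v)) (𝓝[≠] 0) (𝓝 v) := by
    refine Tendsto.congr' ?_ tendsto_const_nhds
    filter_upwards [self_mem_nhdsWithin] with t e2
    have e2 : t ≠ 0 := e2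
    simp [smul_smul, e2]
  have h2 := tendsto_inv_sq_smul E hE h0 i
  refine tendsto_nhds_unique h1 (h2.congr' ?_)
  filter_upwards [(tendsto_of_tendsto_inv_smul h0).eventually hF.2] with t e1
  have e3 : E (F (t • v)) = E (t • v) := (Prod.ext_iff.1 e1).2
  rw [e3]

theorem quadL_eq_or (hE : IsPerturbation γe γs E) (hF : IsDeck E F) (i : Idx a b) :
    (∀ v, quadL γe γs i (fderiv ℂ F 0 v) = quadL γe γs i v) ∨
      ∀ v, quadL γe γs i (fderiv ℂ F 0 v) = -quadL γe γs i v := by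
  have h := fun v => sq_eq_sq_iff_eq_or_eq_neg.1 (hF.quadL_sq hE i v)
  by_contra! hcon
  obtain ⟨⟨v, hv⟩, w, hw⟩ := hcon
  have hv' := (h v).resolve_left hv
  have hw' := (h w).resolve_right hw
  rcases h (v + w) with e | e
  · rw [map_add, map_add, map_add, hw'] at e
    exact hv (add_right_cancel e)
  · rw [map_add, map_add, map_add, hv', neg_add] at e
    exact hw (add_left_cancel e)

/-- Deck transformations with the same linear part agree. -/
theorem eq_of_fderiv_eq (hγ : ∀ j, gam γe γs j ≠ 0) (hE : IsPerturbation γe γs E) (hF : IsDeck E F) (hG : IsDeck E G)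
    (h : ∀ v, fderiv ℂ F 0 v = fderiv ℂ G 0 v) : ∀ᶠ x in 𝓝 0, F x = G x := by
  have hRan : AnalyticAt ℂ (fun x => E x - fun j => quadForm γe γs j x ^ 2) 0 := by
    refine hE.1.sub ?_
    rw [analyticAt_pi_iff]
    exact fun j => ((quadL γe γs j).analyticAt 0).pow 2
  obtain ⟨C, r, hr, hC0, hC⟩ := exists_lipschitz_of_isBigO_cube hRan hE.2
  obtain ⟨N, hN0, hN⟩ : ∃ N : ℝ, 0 < N ∧ ∀ j, ‖(2 * gam γe γs j)⁻¹‖ ≤ N := by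
    refine ⟨1 + ∑ j, ‖(2 * gam γe γs j)⁻¹‖, by positivity, fun j => ?_⟩
    have := Finset.single_le_sum (f := fun j => ‖(2 * gam γe γs j)⁻¹‖) (fun i _ => norm_nonneg _) (Finset.mem_univ j)
    linarith
  set S : V a b × V a b →L[ℂ] V a b := ContinuousLinearMap.pi fun i => (quadL γe γs i).comp (fderiv ℂ F 0) with hS
  obtain ⟨F', hF'⟩ := hF.exists_germInv
  have hSs : Function.Surjective S := by
    intro w
    refine ⟨fderiv ℂ F' 0 (w, 0), ?_⟩
    funext i
    change quadL γe γs i (fderiv ℂ F 0 (fderiv ℂ F' 0 (w, 0))) = w i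
    rw [hF'.fderiv_right, quadL_apply, quadForm]
    simp
  have hD : Dense (S ⁻¹' {w | ∀ k, w k ≠ 0}) := (dense_forall_ne_zero (Idx a b)).preimage (S.isOpenMap hSs)
  have key := eventually_eq_zero_of_curves (hF.1.1.sub hG.1.1) _ hD fun w hw => by
    have hcF := tendsto_inv_smul_of_analyticAt hF.1.1 hF.1.2.1 w
    have hcG := tendsto_inv_smul_of_analyticAt hG.1.1 hG.1.2.1 w
    rw [← h] at hcG
    set v := fderiv ℂ F 0 w with hv
    have h0 : Tendsto (fun t : ℂ => t⁻¹ • (t • w)) (𝓝[≠] 0) (𝓝 w) := by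
      refine Tendsto.congr' ?_ tendsto_const_nhds
      filter_upwards [self_mem_nhdsWithin] with t e2
      have e2 : t ≠ 0 := e2
      simp [smul_smul, e2]
    refine ⟨1, fun t => t • w, le_rfl, by simpa using h0, ?_⟩
    obtain ⟨m, hm0, hm⟩ : ∃ m : ℝ, 0 < m ∧ ∀ i, m ≤ ‖quadL γe γs i v‖ := by
      rcases isEmpty_or_nonempty (Idx a b) with he | he
      · exact ⟨1, one_pos, fun i => he.elim i⟩
      · obtain ⟨i, hi⟩ := Finite.exists_min fun i => ‖quadL γe γs i v‖
        exact ⟨_, norm_pos_iff.2 (hw i), hi⟩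
    set K := ‖v‖ + 1 with hK
    have hK0 : 0 < K := by positivity
    have hsum : ∀ i, ∀ᶠ t : ℂ in 𝓝[≠] 0, m * ‖t‖ ≤ ‖quadL γe γs i (F (t • w)) + quadL γe γs i (G (t • w))‖ := by
      intro i
      have h1 := (tendsto_inv_smul_of_tendsto hcF (quadL γe γs i)).add (tendsto_inv_smul_of_tendsto hcG (quadL γe γs i))
      have h2 : m < ‖quadL γe γs i v + quadL γe γs i v‖ := by
        rw [← two_mul, norm_mul, Complex.norm_ofNat]
        have := hm i
        linarith
      filter_upwards [h1.norm.eventually_const_lt h2, self_mem_nhdsWithin] with t e1 e2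
      have e2 : 0 < ‖t‖ := norm_pos_iff.2 e2
      rw [← smul_add, norm_smul, norm_inv, lt_inv_mul_iff₀ e2] at e1
      linarith
    have ht0 : Tendsto (fun t : ℂ => ‖t‖) (𝓝[≠] 0) (𝓝 0) := by
      simpa using (continuous_norm.tendsto (0 : ℂ)).mono_left nhdsWithin_le_nhds
    have hsm1 : ∀ᶠ t : ℂ in 𝓝[≠] 0, K * ‖t‖ < r := by
      have := ht0.const_mul K
      rw [mul_zero] at this
      exact this.eventually_lt_const hr
    have hsm2 : ∀ᶠ t : ℂ in 𝓝[≠] 0, N * (C * K ^ 2 * ‖t‖ / m) < 1 := by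
      have := ((ht0.const_mul (C * K ^ 2)).div_const m).const_mul N
      rw [mul_zero, zero_div, mul_zero] at this
      exact this.eventually_lt_const one_pos
    have tw := tendsto_of_tendsto_inv_smul h0
    filter_upwards [eventually_norm_le_of_tendsto hcF, eventually_norm_le_of_tendsto hcG, eventually_all.2 hsum, hsm1, hsm2,
      tw.eventually hF.2, tw.eventually hG.2, self_mem_nhdsWithin] with t e1 e2 e3 e4 e5 e6 e7 e8
    have e8 : 0 < ‖t‖ := norm_pos_iff.2 e8
    set x := F (t • w) with hx
    set y := G (t • w) with hy
    change x - y = 0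
    have hE' : E x = E y := (Prod.ext_iff.1 e6).2.trans (Prod.ext_iff.1 e7).2.symm
    have h1 : (x - y).1 = 0 := by
      have : x.1 = y.1 := (Prod.ext_iff.1 e6).1.trans (Prod.ext_iff.1 e7).1.symm
      simp [this]
    have hlip := hC (K * ‖t‖) (by positivity) e4 x y e1 e2
    have hq : ∀ i, ‖quadL γe γs i (x - y)‖ ≤ C * K ^ 2 * ‖t‖ / m * ‖x - y‖ := by
      intro i
      have h2 := (norm_le_pi_norm _ i).trans hlip
      simp only [Pi.sub_apply, hE'] at h2
      have h3 : E y i - quadForm γe γs i x ^ 2 - (E y i - quadForm γe γs i y ^ 2) =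
          -(quadL γe γs i (x - y) * (quadL γe γs i x + quadL γe γs i y)) := by
        rw [map_sub, quadL_apply, quadL_apply]; ring
      rw [h3, norm_neg, norm_mul] at h2
      have h4 := (mul_le_mul_of_nonneg_left (e3 i) (norm_nonneg (quadL γe γs i (x - y)))).trans h2
      rw [div_mul_eq_mul_div, le_div_iff₀ hm0]
      refine le_of_mul_le_mul_right ?_ e8
      calc _ = ‖quadL γe γs i (x - y)‖ * (m * ‖t‖) := by ring
        _ ≤ _ := h4
        _ = _ := by ring
    have hle : ‖x - y‖ ≤ N * (C * K ^ 2 * ‖t‖ / m) * ‖x - y‖ := by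
      refine Dbl.norm_le (by positivity) fun j => ⟨by rw [h1]; simp; positivity, ?_⟩
      have h5 : (x - y).2 j = (2 * gam γe γs (swapIdx j))⁻¹ * quadL γe γs (swapIdx j) (x - y) := by
        have := hγ (swapIdx j)
        rw [quadL_apply, quadForm, h1, swapIdx_swapIdx]
        simp only [Pi.zero_apply, zero_add]
        field_simp
      rw [h5, norm_mul, mul_assoc]
      exact mul_le_mul (hN _) (hq _) (norm_nonneg _) hN0.le
    by_contra hne
    have := norm_pos_iff.2 hne
    nlinarith
  filter_upwards [key] with x hx
  exact sub_eq_zero.1 hx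

end IsDeck

end

section

/-- A germ fixing a smooth hypersurface pointwise has a linear part fixing its tangent space. -/
theorem fderiv_eq_self_of_fixed {X : Type*} [NormedAddCommGroup X] [NormedSpace ℂ X] [FiniteDimensional ℂ X]
    {F : X → X} (hF : AnalyticAt ℂ F 0) (hF0 : F 0 = 0) {h : X → ℂ} (hh : AnalyticAt ℂ h 0) (h0 : h 0 = 0)
    (hd : fderiv ℂ h 0 ≠ 0) (hfix : ∀ᶠ x in 𝓝 0, h x = 0 → F x = x) {v : X} (hv : fderiv ℂ h 0 v = 0) :
    fderiv ℂ F 0 v = v := by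
  set l := fderiv ℂ h 0 with hl
  obtain ⟨e, he⟩ : ∃ e, l e = 1 := by
    obtain ⟨w, hw⟩ : ∃ w, l w ≠ 0 := by
      by_contra! hcon
      exact hd (ContinuousLinearMap.ext hcon)
    exact ⟨(l w)⁻¹ • w, by simp [hw]⟩
  set P : X → X := fun x => x + (h x - l x) • e with hP
  have hPs : AnalyticAt ℂ (fun x => (h x - l x) • e) 0 := (hh.sub (l.analyticAt 0)).smul analyticAt_const
  have hPan : AnalyticAt ℂ P 0 := analyticAt_id.add hPs
  have hP0 : P 0 = 0 := by simp [hP, h0]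
  have hPd : ∀ w, fderiv ℂ P 0 w = w := fun w => by
    have h1 : HasFDerivAt (fun x => (h x - l x) • e) ((l - l).smulRight e) 0 :=
      (hh.differentiableAt.hasFDerivAt.sub l.hasFDerivAt).smul_const e
    have h2 : HasFDerivAt P (ContinuousLinearMap.id ℂ X + (l - l).smulRight e) 0 := (hasFDerivAt_id 0).add h1
    rw [h2.fderiv]
    simp
  have hlP : ∀ x, l (P x) = h x := fun x => by simp [hP, he]
  obtain ⟨Q, hQ⟩ := IsGermInv.exists_of_fderiv_injective hPan hP0 fun w hw => by rwa [hPd] at hw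
  have hQd : ∀ w, fderiv ℂ Q 0 w = w := fun w => by rw [← hPd (fderiv ℂ Q 0 w), hQ.fderiv_right]
  have ht : Tendsto (fun t : ℂ => t • v) (𝓝[≠] 0) (𝓝 0) := by
    have : Continuous fun t : ℂ => t • v := by fun_prop
    simpa using (this.tendsto 0).mono_left nhdsWithin_le_nhds
  have h1 := tendsto_inv_smul_of_analyticAt (AnalyticAt.comp_zero hF hQ.an' hQ.map0') (by rw [hQ.map0', hF0]) v
  have h2 := tendsto_inv_smul_of_analyticAt hQ.an' hQ.map0' v
  rw [fderiv_comp_zero hF hQ.an' hQ.map0', hQd] at h1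
  rw [hQd] at h2
  refine tendsto_nhds_unique h1 (h2.congr' ?_)
  filter_upwards [(hQ.tendsto'.comp ht).eventually hfix, ht.eventually hQ.right] with t e1 e2
  simp only [Function.comp] at e1
  rw [e1]
  rw [← hlP, e2, map_smul, hv, smul_zero]

variable {a b : ℕ} {γe : Fin a → ℝ} {γs : Fin b → ℂ} {E : V a b × V a b → V a b}

theorem IsGenerator.quadL_self {j : Idx a b} {F : V a b × V a b → V a b × V a b} (hF : IsGenerator γe γs E j F)
    (v : V a b × V a b) : quadL γe γs j (fderiv ℂ F 0 v) = -quadL γe γs j v := hF.2.2 v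

theorem IsGenerator.quadL_ne (hE : IsPerturbation γe γs E) {i j : Idx a b}
    {F : V a b × V a b → V a b × V a b} (hF : IsGenerator γe γs E j F) (hij : i ≠ j)
    (v : V a b × V a b) : quadL γe γs i (fderiv ℂ F 0 v) = quadL γe γs i v := by
  rcases hF.1.quadL_eq_or hE i with h | h
  · exact h v
  exfalso
  obtain ⟨hd, ⟨h0, han, h00, hne, hfix⟩, -⟩ := id hF
  set l := fderiv ℂ h0 0 with hl
  have hker : ∀ v, l v = 0 → quadL γe γs i v = 0 ∧ quadL γe γs j v = 0 := by
    intro v hv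
    have hv' := fderiv_eq_self_of_fixed hd.1.1 hd.1.2.1 han h00 hne hfix hv
    have h1 := h v
    have h2 := hF.quadL_self v
    rw [hv'] at h1 h2
    exact ⟨CharZero.eq_neg_self_iff.1 h1, CharZero.eq_neg_self_iff.1 h2⟩
  set u : V a b × V a b := (Pi.single i 1, 0) with hu
  set w : V a b × V a b := (Pi.single j 1, 0) with hw
  have hui : quadL γe γs i u = 1 := by simp [quadL_apply, quadForm, hu]
  have huj : quadL γe γs j u = 0 := by simp [quadL_apply, quadForm, hu, hij.symm]
  have hwj : quadL γe γs j w = 1 := by simp [quadL_apply, quadForm, hw]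
  have hwi : quadL γe γs i w = 0 := by simp [quadL_apply, quadForm, hw, hij]
  have h1 := (hker (l w • u - l u • w) (by simp [mul_comm])).1
  have h2 := (hker (l w • u - l u • w) (by simp [mul_comm])).2
  rw [map_sub, map_smul, map_smul, hui, hwi] at h1
  rw [map_sub, map_smul, map_smul, huj, hwj] at h2
  have h3 : l u = 0 := by simpa using h2
  have := (hker u h3).1
  rw [hui] at this
  exact one_ne_zero this

/-! ### The linear normal form -/

theorem lam_facts (hγe : ∀ e, 0 < γe e ∧ γe e < 1 / 2) (hγs : ∀ s, 1 / 2 < (γs s).re ∧ 0 < (γs s).im) :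
    (∀ e : Fin a, ∃ l : ℝ, 1 < l ∧ lam γe γs (Sum.inl e) = l ∧ γe e * (1 + l ^ 2) = l) ∧
    ∀ s : Fin b, 1 < ‖lam γe γs (Sum.inr (Sum.inl s))‖ ∧
      γs s * (1 + lam γe γs (Sum.inr (Sum.inl s)) ^ 2) = lam γe γs (Sum.inr (Sum.inl s)) ^ 2 := by
  constructor
  · intro e
    obtain ⟨h1, h2⟩ := hγe e
    set s := Real.sqrt (1 - 4 * γe e ^ 2) with hs
    have hs2 : s ^ 2 = 1 - 4 * γe e ^ 2 := Real.sq_sqrt (by nlinarith)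
    have hs0 : 0 ≤ s := Real.sqrt_nonneg _
    refine ⟨(1 + s) / (2 * γe e), ?_, rfl, ?_⟩
    · rw [one_lt_div (by linarith)]
      linarith
    · clear_value s
      field_simp
      nlinarith
  · intro s
    obtain ⟨h1, h2⟩ := hγs s
    have hne : 1 - γs s ≠ 0 := by
      intro h
      have := congrArg Complex.im h
      simp at this
      linarith
    have hsq : lam γe γs (Sum.inr (Sum.inl s)) ^ 2 = γs s / (1 - γs s) := by
      simp only [lam]
      rw [← Complex.cpow_nat_mul]
      norm_num
    refine ⟨?_, ?_⟩
    · have h3 : 1 < ‖lam γe γs (Sum.inr (Sum.inl s))‖ ^ 2 := by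
        rw [← norm_pow, hsq, norm_div, one_lt_div (norm_pos_iff.2 hne), ← sq_lt_sq₀ (norm_nonneg _) (norm_nonneg _),
          ← Complex.normSq_eq_norm_sq, ← Complex.normSq_eq_norm_sq, Complex.normSq_apply, Complex.normSq_apply]
        simp
        nlinarith
      by_contra hcon
      push Not at hcon
      have := pow_le_one₀ (n := 2) (norm_nonneg _) hcon
      linarith
    · rw [hsq]
      field_simp
      ring

theorem conj_lam_swapIdx (hγe : ∀ e, 0 < γe e ∧ γe e < 1 / 2) (hγs : ∀ s, 1 / 2 < (γs s).re ∧ 0 < (γs s).im)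
    (j : Idx a b) : conj (lam γe γs (swapIdx j)) ^ sgn j = (lam γe γs j)⁻¹ := by
  obtain ⟨h1, h2⟩ := lam_facts hγe hγs
  rcases j with e | s | s
  · obtain ⟨l, -, hl, -⟩ := h1 e
    simp only [swapIdx, sgn, hl, Complex.conj_ofReal, zpow_neg_one]
  · simp [swapIdx, sgn, lam]
  · simp [swapIdx, sgn, lam]

theorem norm_lam_ne_one (hγe : ∀ e, 0 < γe e ∧ γe e < 1 / 2) (hγs : ∀ s, 1 / 2 < (γs s).re ∧ 0 < (γs s).im)
    (j : Idx a b) : lam γe γs j ≠ 0 ∧ ‖lam γe γs j‖ ≠ 1 := by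
  obtain ⟨h1, h2⟩ := lam_facts hγe hγs
  suffices h : 0 < ‖lam γe γs j‖ ∧ ‖lam γe γs j‖ ≠ 1 from ⟨norm_pos_iff.1 h.1, h.2⟩
  rcases j with e | s | s
  · obtain ⟨l, h3, hl, -⟩ := h1 e
    rw [hl, Complex.norm_real, Real.norm_eq_abs, abs_of_pos (by linarith)]
    exact ⟨by linarith, h3.ne'⟩
  · have := (h2 s).1
    exact ⟨by linarith, this.ne'⟩
  · have h3 := (h2 s).1
    have h4 : ‖lam γe γs (Sum.inr (Sum.inr s))‖ = ‖lam γe γs (Sum.inr (Sum.inl s))‖⁻¹ := by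
      simp [lam]
    rw [h4]
    exact ⟨by positivity, inv_ne_one.2 h3.ne'⟩

/-- The coefficients of the linear change of coordinates. -/
def unit : Idx a b → ℂ
  | Sum.inl _ => Complex.I
  | Sum.inr (Sum.inl _) => 1
  | Sum.inr (Sum.inr _) => -1

theorem unit_ne_zero (j : Idx a b) : unit j ≠ 0 := by
  rcases j with e | s | s <;> simp [unit]

/-- The coordinates `z'` as functions of `(ξ, η)`. -/
def linZ (l : Idx a b → ℂ) (x : V a b × V a b) : V a b := fun j => unit j * (x.1 j + l j * x.2 j)

/-- The linear change of coordinates `(ξ, η) ↦ (z', w')`. -/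
def lin (l : Idx a b → ℂ) : V a b × V a b →L[ℂ] V a b × V a b :=
  LinearMap.toContinuousLinearMap
    { toFun := fun x => (linZ l x, conjV (linZ l (rho x)))
      map_add' := fun x y => by
        ext j <;> rcases j with e | s | s <;> simp [linZ, conjV, rho] <;> ring
      map_smul' := fun c x => by
        ext j <;> rcases j with e | s | s <;> simp [linZ, conjV, rho] <;> ring }

theorem lin_apply (l : Idx a b → ℂ) (x : V a b × V a b) : lin l x = (linZ l x, conjV (linZ l (rho x))) := rfl

theorem conjV_conjV (z : V a b) : conjV (conjV z) = z := by funext j; simp [conjV]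

theorem rho0_lin (l : Idx a b → ℂ) (x : V a b × V a b) : rho0 (lin l x) = lin l (rho x) := by
  rw [lin_apply, lin_apply, rho_rho, rho0, conjV_conjV]

/-- The factor of the linear forms in the coordinates `(ξ, η)`. -/
def linFactor (l : ℂ) : ℂ := (1 - l ^ 2) / (1 + l ^ 2)

theorem quadL_lin (hγe : ∀ e, 0 < γe e ∧ γe e < 1 / 2) (hγs : ∀ s, 1 / 2 < (γs s).re ∧ 0 < (γs s).im)
    (j : Idx a b) : ∃ k : ℂ, k ≠ 0 ∧ ∀ x, quadL γe γs j (lin (lam γe γs) x) = k * (x.1 j - lam γe γs j * x.2 j) := by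
  obtain ⟨h1, h2⟩ := lam_facts hγe hγs
  have hu := unit_ne_zero j
  obtain ⟨hl0, hl1⟩ := norm_lam_ne_one hγe hγs j
  have hm : 1 - lam γe γs j ^ 2 ≠ 0 := by
    intro h
    apply hl1
    have h3 : ‖lam γe γs j‖ ^ 2 = 1 := by rw [← norm_pow, ← sub_eq_zero.1 h, norm_one]
    exact (pow_eq_one_iff_of_nonneg (norm_nonneg _) two_ne_zero).1 h3
  suffices hp : 1 + lam γe γs j ^ 2 ≠ 0 ∧ ∀ x, quadL γe γs j (lin (lam γe γs) x) =
      unit j * linFactor (lam γe γs j) * (x.1 j - lam γe γs j * x.2 j) from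
    ⟨_, mul_ne_zero hu (div_ne_zero hm hp.1), hp.2⟩
  rcases j with e | s | s
  · obtain ⟨l, h3, hl, h4⟩ := h1 e
    have h5 : (γe e : ℂ) = l / (1 + l ^ 2) := by
      rw [eq_div_iff]
      · exact_mod_cast h4
      · norm_cast; positivity
    have h6 : (1 + (l : ℂ) ^ 2) ≠ 0 := by norm_cast; positivity
    refine ⟨by rwa [hl], fun x => ?_⟩
    simp [quadL_apply, quadForm, lin_apply, linZ, conjV, rho, unit, gam, swapIdx, linFactor, hl, h5]
    field_simp
    ring
  · obtain ⟨h3, h4⟩ := h2 s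
    have h6 : 1 + lam γe γs (Sum.inr (Sum.inl s)) ^ 2 ≠ 0 := by
      intro h
      rw [h, mul_zero] at h4
      exact hl0 (pow_eq_zero_iff two_ne_zero |>.1 h4.symm)
    have h5 : γs s = lam γe γs (Sum.inr (Sum.inl s)) ^ 2 / (1 + lam γe γs (Sum.inr (Sum.inl s)) ^ 2) := by
      rw [eq_div_iff h6, h4]
    have h7 : conj (lam γe γs (Sum.inr (Sum.inr s))) = (lam γe γs (Sum.inr (Sum.inl s)))⁻¹ := by simp [lam]
    refine ⟨h6, fun x => ?_⟩
    simp only [quadL_apply, quadForm, lin_apply, linZ, conjV, rho, unit, gam, swapIdx, linFactor, map_mul, map_add, h7,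
      map_neg, map_one, Complex.conj_conj]
    generalize lam γe γs (Sum.inr (Sum.inl s)) = l at *
    rw [h5]
    field_simp
    ring
  · obtain ⟨h3, h4⟩ := h2 s
    have h7 : conj (lam γe γs (Sum.inr (Sum.inl s))) = (lam γe γs (Sum.inr (Sum.inr s)))⁻¹ := by simp [lam]
    have h8 := congrArg conj h4
    simp only [map_mul, map_add, map_pow, map_one, h7] at h8
    have h6 : 1 + lam γe γs (Sum.inr (Sum.inr s)) ^ 2 ≠ 0 := by
      intro h
      have h9 : lam γe γs (Sum.inr (Sum.inr s)) ^ 2 = -1 := by linear_combination h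
      rw [inv_pow, h9] at h8
      norm_num at h8
    have h5 : 1 - conj (γs s) = lam γe γs (Sum.inr (Sum.inr s)) ^ 2 / (1 + lam γe γs (Sum.inr (Sum.inr s)) ^ 2) := by
      rw [eq_div_iff h6]
      field_simp at h8
      linear_combination -h8
    refine ⟨h6, fun x => ?_⟩
    simp only [quadL_apply, quadForm, lin_apply, linZ, conjV, rho, unit, gam, swapIdx, linFactor, map_mul, map_add, h7,
      map_one, Complex.conj_conj]
    generalize lam γe γs (Sum.inr (Sum.inr s)) = l at *
    rw [h5]
    field_simp
    ring

end

section

variable {a b : ℕ} {γe : Fin a → ℝ} {γs : Fin b → ℂ} {E : V a b × V a b → V a b}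

theorem exists_lin_germInv (hγe : ∀ e, 0 < γe e ∧ γe e < 1 / 2) (hγs : ∀ s, 1 / 2 < (γs s).re ∧ 0 < (γs s).im) :
    ∃ χ, IsGermInv (fun x : V a b × V a b => lin (lam γe γs) x) χ := by
  refine IsGermInv.exists_of_fderiv_injective ((lin (lam γe γs)).analyticAt 0) (map_zero _) fun v hv => ?_
  have hv : lin (lam γe γs) v = 0 := by
    have h : fderiv ℂ (fun x => lin (lam γe γs) x) 0 = lin (lam γe γs) := (lin (lam γe γs)).fderiv
    rwa [h] at hv
  have h1 : ∀ j, v.1 j + lam γe γs j * v.2 j = 0 := fun j => by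
    have := congrFun (Prod.ext_iff.1 hv).1 j
    simpa [lin_apply, linZ, unit_ne_zero] using this
  have h2 : ∀ j, v.1 j - lam γe γs j * v.2 j = 0 := fun j => by
    obtain ⟨k, hk, h⟩ := quadL_lin hγe hγs j
    have := h v
    rw [hv, map_zero] at this
    exact (mul_eq_zero.1 this.symm).resolve_left hk
  ext j
  · have : (2 : ℂ) * v.1 j = 0 := by linear_combination h1 j + h2 j
    simpa using this
  · have : (2 : ℂ) * (lam γe γs j * v.2 j) = 0 := by linear_combination h1 j - h2 j
    simpa [(norm_lam_ne_one hγe hγs j).1] using this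

section Generators

variable {τ : Idx a b → V a b × V a b → V a b × V a b}

theorem generator_involutive (hγ : ∀ j, gam γe γs j ≠ 0) (hE : IsPerturbation γe γs E)
    (hτ : ∀ j, IsGenerator γe γs E j (τ j)) (j : Idx a b) : ∀ᶠ x in 𝓝 0, τ j (τ j x) = x := by
  refine ((hτ j).1.comp (hτ j).1).eq_of_fderiv_eq hγ hE (IsDeck.id E) fun v => ?_
  rw [fderiv_comp_zero (hτ j).1.1.1 (hτ j).1.1.1 (hτ j).1.1.2.1]
  have h : fderiv ℂ (fun x : V a b × V a b => x) 0 v = v := by simp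
  rw [h]
  refine eq_of_fst_quadL hγ ?_ fun i => ?_
  · rw [(hτ j).1.fderiv_fst, (hτ j).1.fderiv_fst]
  · rcases eq_or_ne i j with rfl | hij
    · rw [(hτ i).quadL_self, (hτ i).quadL_self, neg_neg]
    · rw [(hτ j).quadL_ne hE hij, (hτ j).quadL_ne hE hij]

theorem generator_comm (hγ : ∀ j, gam γe γs j ≠ 0) (hE : IsPerturbation γe γs E)
    (hτ : ∀ j, IsGenerator γe γs E j (τ j)) (i j : Idx a b) : ∀ᶠ x in 𝓝 0, τ i (τ j x) = τ j (τ i x) := by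
  refine ((hτ i).1.comp (hτ j).1).eq_of_fderiv_eq hγ hE ((hτ j).1.comp (hτ i).1) fun v => ?_
  rw [fderiv_comp_zero (hτ i).1.1.1 (hτ j).1.1.1 (hτ j).1.1.2.1,
    fderiv_comp_zero (hτ j).1.1.1 (hτ i).1.1.1 (hτ i).1.1.2.1]
  refine eq_of_fst_quadL hγ ?_ fun k => ?_
  · rw [(hτ i).1.fderiv_fst, (hτ j).1.fderiv_fst, (hτ j).1.fderiv_fst, (hτ i).1.fderiv_fst]
  · have h : ∀ l : Idx a b, ∃ c : ℂ, ∀ v, quadL γe γs k (fderiv ℂ (τ l) 0 v) = c * quadL γe γs k v := fun l => by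
      rcases eq_or_ne k l with rfl | hkl
      · exact ⟨-1, fun v => by rw [(hτ k).quadL_self, neg_one_mul]⟩
      · exact ⟨1, fun v => by rw [(hτ l).quadL_ne hE hkl, one_mul]⟩
    obtain ⟨c, hc⟩ := h i
    obtain ⟨d, hd⟩ := h j
    rw [hc, hd, hd, hc]
    ring

end Generators

/-- In the linear normal coordinates the involutions form a pair family. -/
theorem exists_pairFamily (hγe : ∀ e, 0 < γe e ∧ γe e < 1 / 2) (hγs : ∀ s, 1 / 2 < (γs s).re ∧ 0 < (γs s).im)
    (hE : IsPerturbation γe γs E) {τ : Idx a b → V a b × V a b → V a b × V a b}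
    (hτ : ∀ j, IsGenerator γe γs E j (τ j))
    (hσ : ∀ i j, ∀ᶠ x in 𝓝 0, sigmaJ τ i (sigmaJ τ j x) = sigmaJ τ j (sigmaJ τ i x)) :
    ∃ τ' A' : Idx a b → V a b × V a b → V a b × V a b,
      IsPairFamily (lam γe γs) (fun j => (lam γe γs j)⁻¹) τ' A' ∧
      (∀ j x, A' j x = rho (τ' (swapIdx j) (rho x))) ∧
      (∀ j, ∀ᶠ x in 𝓝 0, τ j (lin (lam γe γs) x) = lin (lam γe γs) (τ' j x)) ∧
      ∀ j, ∀ᶠ x in 𝓝 0, tau2 τ (swapIdx j) (lin (lam γe γs) x) = lin (lam γe γs) (A' j x) := by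
  have hγ := gam_ne_zero hγe hγs
  set l := lam γe γs with hl
  have hlam := norm_lam_ne_one hγe hγs
  obtain ⟨χ, hχ⟩ := exists_lin_germInv hγe hγs
  have hld : ∀ v, fderiv ℂ (fun x => lin l x) 0 v = lin l v := fun v => by
    have h : fderiv ℂ (fun x => lin l x) 0 = lin l := (lin l).fderiv
    rw [h]
  have tl : Tendsto (fun x => lin l x) (𝓝 0) (𝓝 0) := hχ.tendsto
  have tτ := fun j => (hτ j).1.tendsto
  have an1 : ∀ j, AnalyticAt ℂ (fun x => τ j (lin l x)) 0 := fun j =>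
    AnalyticAt.comp_zero (hτ j).1.1.1 hχ.an hχ.map0
  have z1 : ∀ j, τ j (lin l 0) = 0 := fun j => by rw [map_zero, (hτ j).1.1.2.1]
  set τ' : Idx a b → V a b × V a b → V a b × V a b := fun j x => χ (τ j (lin l x)) with hτ'
  have an2 : ∀ j, AnalyticAt ℂ (τ' j) 0 := fun j => AnalyticAt.comp_zero hχ.an' (an1 j) (z1 j)
  have z2 : ∀ j, τ' j 0 = 0 := fun j => by simp only [hτ']; rw [z1, hχ.map0']
  have tτ' := fun j => AnalyticAt.tendsto_zero (an2 j) (z2 j)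
  set A' : Idx a b → V a b × V a b → V a b × V a b := fun j x => rho (τ' (swapIdx j) (rho x)) with hA'
  have an3 : ∀ j, AnalyticAt ℂ (A' j) 0 := fun j => AnalyticAt.semiconj (rhoL a b) (rhoL a b) (an2 (swapIdx j))
  have hρ0 : rho (0 : V a b × V a b) = 0 := map_zero (rhoL a b)
  have z3 : ∀ j, A' j 0 = 0 := fun j => by simp only [hA']; rw [hρ0, z2, hρ0]
  have tA' := fun j => AnalyticAt.tendsto_zero (an3 j) (z3 j)
  have hτl : ∀ j, ∀ᶠ x in 𝓝 0, τ j (lin l x) = lin l (τ' j x) := fun j => by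
    filter_upwards [((tτ j).comp tl).eventually hχ.right] with x h1
    exact h1.symm
  have hAl : ∀ j, ∀ᶠ x in 𝓝 0, tau2 τ (swapIdx j) (lin l x) = lin l (A' j x) := fun j => by
    filter_upwards [tendsto_rho.eventually (hτl (swapIdx j))] with x h1
    simp only [tau2, Function.comp]
    rw [rho0_lin, h1, rho0_lin]
  have hinv : ∀ j, ∀ᶠ x in 𝓝 0, τ' j (τ' j x) = x := fun j => by
    filter_upwards [hτl j, tl.eventually (generator_involutive hγ hE hτ j), hχ.left] with x h1 h2 h3
    change χ (τ j (lin l (τ' j x))) = x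
    rw [← h1, h2, h3]
  have hcomm : ∀ i j, ∀ᶠ x in 𝓝 0, τ' i (τ' j x) = τ' j (τ' i x) := fun i j => by
    filter_upwards [hτl i, hτl j, tl.eventually (generator_comm hγ hE hτ i j)] with x h1 h2 h3
    change χ (τ i (lin l (τ' j x))) = χ (τ j (lin l (τ' i x)))
    rw [← h1, ← h2, h3]
  have hder : ∀ j v, fderiv ℂ (τ' j) 0 v = flip j (l j) v := by
    intro j v
    have h1 : lin l (fderiv ℂ (τ' j) 0 v) = fderiv ℂ (τ j) 0 (lin l v) := by
      rw [hτ', fderiv_comp_zero hχ.an' (an1 j) (z1 j), ← hld, hχ.fderiv_right,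
        fderiv_comp_zero (hτ j).1.1.1 hχ.an hχ.map0, hld]
    have h2 : lin l (fderiv ℂ (τ' j) 0 v) = lin l (flip j (l j) v) := by
      rw [h1]
      refine eq_of_fst_quadL hγ ?_ fun i => ?_
      · rw [(hτ j).1.fderiv_fst]
        funext i
        simp only [lin_apply, linZ]
        have hlj : l j ≠ 0 := (hlam j).1
        rcases eq_or_ne i j with rfl | hij
        · simp; field_simp; left; ring
        · simp [flip_fst_ne hij, flip_snd_ne hij]
      · obtain ⟨k, hk, h⟩ := quadL_lin hγe hγs i
        rw [← hl] at h
        have hlj : l j ≠ 0 := (hlam j).1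
        rcases eq_or_ne i j with rfl | hij
        · rw [(hτ i).quadL_self, h, h]
          simp; field_simp; ring
        · rw [(hτ j).quadL_ne hE hij, h, h]
          simp [flip_fst_ne hij, flip_snd_ne hij]
    rw [← hχ.fderiv_left (fderiv ℂ (τ' j) 0 v), hld, h2, ← hld, hχ.fderiv_left]
  have hder' : ∀ j v, fderiv ℂ (A' j) 0 v = flip j (l j)⁻¹ v := by
    intro j v
    have := fderiv_semiconj (rhoL a b) (rhoL a b) (an2 (swapIdx j)) v
    simp only [rhoL_apply] at this
    rw [hA', this, hder, rho_flip, rho_rho, swapIdx_swapIdx, sgn_swapIdx, conj_lam_swapIdx hγe hγs]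
  refine ⟨τ', A', ⟨fun j => (hlam j).1, fun j => inv_ne_zero (hlam j).1, fun j => ?_, an2, an3, z2, z3, hinv, fun j => ?_,
    hder, hder', hcomm, fun i j => ?_, fun i j => ?_⟩, fun j x => rfl, hτl, hAl⟩
  · intro h
    rw [norm_inv] at h
    apply (hlam j).2
    have h0 : 0 < ‖l j‖ := norm_pos_iff.2 (hlam j).1
    have h3 : ‖l j‖ ^ 2 = 1 := by
      rw [sq]
      nth_rw 1 [← h]
      exact inv_mul_cancel₀ h0.ne'
    exact (pow_eq_one_iff_of_nonneg h0.le two_ne_zero).1 h3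
  · filter_upwards [tendsto_rho.eventually (hinv (swapIdx j))] with x h1
    simp only [hA']
    rw [rho_rho, h1, rho_rho]
  · filter_upwards [tendsto_rho.eventually (hcomm (swapIdx i) (swapIdx j))] with x h1
    simp only [hA']
    rw [rho_rho, h1, rho_rho]
  · have hs : ∀ j, ∀ᶠ x in 𝓝 0, sigmaJ τ j (lin l x) = lin l (τ' j (A' j x)) := fun j => by
      filter_upwards [hAl j, (tA' j).eventually (hτl j)] with x h1 h2
      simp only [sigmaJ, Function.comp]
      rw [h1, h2]
    have ts := fun j => (tτ' j).comp (tA' j)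
    filter_upwards [tl.eventually (hσ i j), hs i, hs j, (ts i).eventually (hs j), (ts j).eventually (hs i),
      ((ts i).comp (ts j)).eventually hχ.left, ((ts j).comp (ts i)).eventually hχ.left] with x h1 h2 h3 h4 h5 h6 h7
    simp only [Function.comp] at h4 h5 h6 h7
    rw [h2, h3, h4, h5] at h1
    rw [← h6, h1, h7]

end

section

variable {a b : ℕ} {γe : Fin a → ℝ} {γs : Fin b → ℂ} {E : V a b × V a b → V a b}

theorem nfTau_products {L : V a b → ℂ} (j : Idx a b) {x : V a b × V a b} (h : L (x.1 * x.2) ≠ 0) :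
    (nfTau L j x).1 * (nfTau L j x).2 = x.1 * x.2 := by
  funext k
  rcases eq_or_ne k j with rfl | hk
  · simp [nfTau]; field_simp
  · simp [nfTau, hk]

theorem analyticAt_nfTau {L : V a b → ℂ} (hL : AnalyticAt ℂ L 0) (h0 : L 0 ≠ 0) (j : Idx a b) :
    AnalyticAt ℂ (nfTau L j) 0 := by
  have h1 := analyticAt_mul_products hL
  have h2 : L ((0 : V a b × V a b).1 * (0 : V a b × V a b).2) ≠ 0 := by simpa using h0
  refine AnalyticAt.prod ?_ ?_
  · rw [analyticAt_pi_iff]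
    intro i
    rcases eq_or_ne i j with rfl | hi
    · simp only [Function.update_self]
      exact h1.mul (analyticAt_coord_snd i 0)
    · simp only [Function.update_of_ne hi]
      exact analyticAt_coord_fst i 0
  · rw [analyticAt_pi_iff]
    intro i
    rcases eq_or_ne i j with rfl | hi
    · simp only [Function.update_self]
      exact (h1.inv h2).mul (analyticAt_coord_fst i 0)
    · simp only [Function.update_of_ne hi]
      exact analyticAt_coord_snd i 0

theorem nfTau_zero (L : V a b → ℂ) (j : Idx a b) : nfTau L j 0 = 0 := by
  simp [nfTau]

theorem exists_normalizing (hγe : ∀ e, 0 < γe e ∧ γe e < 1 / 2) (hγs : ∀ s, 1 / 2 < (γs s).re ∧ 0 < (γs s).im)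
    (hE : IsPerturbation γe γs E) {τ : Idx a b → V a b × V a b → V a b × V a b}
    (hτ : ∀ j, IsGenerator γe γs E j (τ j))
    (hσ : ∀ i j, ∀ᶠ x in 𝓝 0, sigmaJ τ i (sigmaJ τ j x) = sigmaJ τ j (sigmaJ τ i x)) :
    ∃ Λ : Idx a b → V a b → ℂ, (∀ j, AnalyticAt ℂ (Λ j) 0 ∧ Λ j 0 = lam γe γs j) ∧ RealityCondition Λ ∧
      ∃ ψ χ : V a b × V a b → V a b × V a b, IsGermInv ψ χ ∧
        (∀ v, fderiv ℂ ψ 0 v = lin (lam γe γs) v) ∧ Normalizes τ Λ ψ := by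
  obtain ⟨τ', A', H, hA, h1, h2⟩ := exists_pairFamily hγe hγs hE hτ hσ
  obtain ⟨Λ, hΛ, hreal, ψ, χ, hψ, hψd, hψR, hψj⟩ := exists_normalization H fun j => .of_forall (hA j)
  obtain ⟨χ0, hχ0⟩ := exists_lin_germInv hγe hγs
  have hG := hχ0.comp hψ
  have hlam := norm_lam_ne_one hγe hγs
  have n1 : ∀ j, ∀ᶠ x in 𝓝 0, τ j (lin (lam γe γs) (ψ x)) = lin (lam γe γs) (ψ (nfTau (Λ j) j x)) := fun j => by
    filter_upwards [hψ.tendsto.eventually (h1 j), (hψj j).1] with x e1 e2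
    rw [e1, e2]
  have n2 : ∀ j, ∀ᶠ x in 𝓝 0, tau2 τ (swapIdx j) (lin (lam γe γs) (ψ x)) =
      lin (lam γe γs) (ψ (nfTau (fun ζ => (Λ j ζ)⁻¹) j x)) := fun j => by
    filter_upwards [hψ.tendsto.eventually (h2 j), (hψj j).2] with x e1 e2
    rw [e1, e2]
  refine ⟨Λ, hΛ, hreal, fun x => lin (lam γe γs) (ψ x), _, hG, fun v => ?_,
    ⟨hG.an, hG.map0, _, hG.an', hG.map0', hG.left, hG.right⟩, ?_, fun j => ⟨n1 j, n2 j, ?_⟩⟩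
  · rw [fderiv_comp_zero hχ0.an hψ.an hψ.map0, hψd]
    have h : fderiv ℂ (fun x => lin (lam γe γs) x) 0 = lin (lam γe γs) := (lin (lam γe γs)).fderiv
    rw [h]
  · filter_upwards [hψR] with x e
    rw [rho0_lin, e]
  · have hΛ0 : Λ j 0 ≠ 0 := by rw [(hΛ j).2]; exact (hlam j).1
    have hinv : AnalyticAt ℂ (fun ζ => (Λ j ζ)⁻¹) 0 := (hΛ j).1.inv hΛ0
    have t := AnalyticAt.tendsto_zero (analyticAt_nfTau hinv (inv_ne_zero hΛ0) j) (nfTau_zero _ j)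
    filter_upwards [n2 j, t.eventually (n1 j),
      tendsto_mul_zero.eventually ((hΛ j).1.continuousAt.eventually_ne hΛ0)] with x e1 e2 e3
    simp only [sigmaJ, Function.comp]
    rw [e1, e2]
    have e4 := nfTau_products (L := fun ζ => (Λ j ζ)⁻¹) j (inv_ne_zero e3)
    congr 2
    refine Dbl.ext' j ?_ ?_ fun i hi => ?_
    · rw [nfTau, e4]
      simp [nfTau, nfSigma]
      ring
    · rw [nfTau, e4]
      simp [nfTau, nfSigma]
      field_simp
    · simp [nfTau, nfSigma, hi]

end

section

variable {κ : Type*} [Fintype κ] [DecidableEq κ]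

/-- Replace the coordinate `η_j`. -/
def updSnd (j : κ) (y : Dbl κ) (s : ℂ) : Dbl κ := (y.1, Function.update y.2 j s)

theorem updSnd_eq (j : κ) (y : Dbl κ) (s : ℂ) : updSnd j y s = updSnd j y 0 + s • (0, Pi.single j 1) := by
  refine Dbl.ext' j ?_ ?_ fun i hi => ?_
  · simp [updSnd]
  · simp [updSnd]
  · simp [updSnd, hi]

theorem continuous_updSnd (j : κ) : Continuous fun p : Dbl κ × ℂ => updSnd j p.1 p.2 := by
  refine Continuous.prodMk (by fun_prop) (continuous_pi fun i => ?_)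
  rcases eq_or_ne i j with rfl | hi
  · simpa using continuous_snd
  · simp only [Function.update_of_ne hi]
    fun_prop

theorem norm_updSnd_le (j : κ) (y : Dbl κ) {s : ℂ} {r : ℝ} (hy : ‖y‖ ≤ r) (hs : ‖s‖ ≤ r) : ‖updSnd j y s‖ ≤ r := by
  refine Dbl.norm_le ((norm_nonneg y).trans hy) fun i => ⟨(norm_coord_fst_le y i).trans hy, ?_⟩
  rcases eq_or_ne i j with rfl | hi
  · simpa [updSnd] using hs
  · simpa [updSnd, hi] using (norm_coord_snd_le y i).trans hy

section CircleMean

abbrev Arc : Type := Set.Icc (0 : ℝ) (2 * Real.pi)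

/-- The contour integral of a continuous function on the parameter interval. -/
def contourMap (r : ℝ) : C(Arc, ℂ) →L[ℂ] ℂ :=
  LinearMap.mkContinuous
    { toFun := fun u => ∫ t in (0 : ℝ)..2 * Real.pi, deriv (circleMap 0 r) t *
        u (Set.projIcc 0 (2 * Real.pi) Real.two_pi_pos.le t)
      map_add' := fun x y => by
        have hc : ∀ u : C(Arc, ℂ), IntervalIntegrable (fun t => deriv (circleMap 0 r) t *
            u (Set.projIcc 0 (2 * Real.pi) Real.two_pi_pos.le t)) MeasureTheory.volume 0 (2 * Real.pi) := fun u => by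
          refine Continuous.intervalIntegrable ?_ _ _
          have := u.continuous.comp (continuous_projIcc (h := Real.two_pi_pos.le))
          simp only [deriv_circleMap]
          exact ((continuous_circleMap 0 r).mul continuous_const).mul this
        rw [← intervalIntegral.integral_add (hc x) (hc y)]
        simp only [ContinuousMap.add_apply, mul_add]
      map_smul' := fun c y => by
        simp only [ContinuousMap.smul_apply, smul_eq_mul, RingHom.id_apply]
        rw [← intervalIntegral.integral_const_mul]
        congr 1
        ext t
        ring } (|r| * |2 * Real.pi - 0|) (fun u => by
      simp only [LinearMap.coe_mk, AddHom.coe_mk]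
      rw [mul_right_comm]
      refine intervalIntegral.norm_integral_le_of_norm_le_const fun t _ => ?_
      rw [norm_mul, deriv_circleMap, norm_mul, norm_circleMap_zero, Complex.norm_I, mul_one]
      gcongr
      exact u.norm_coe_le_norm _)

theorem contourMap_apply (r : ℝ) (u : C(Arc, ℂ)) {g : ℂ → ℂ} (h : ∀ t : Arc, u t = g (circleMap 0 r t)) :
    contourMap r u = ∮ s in C(0, r), g s := by
  rw [circleIntegral]
  change (∫ t in (0 : ℝ)..2 * Real.pi, deriv (circleMap 0 r) t *
        u (Set.projIcc 0 (2 * Real.pi) Real.two_pi_pos.le t)) = _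
  refine intervalIntegral.integral_congr fun t ht => ?_
  rw [Set.uIcc_of_le Real.two_pi_pos.le] at ht
  simp only [Set.projIcc_of_mem _ ht, h, smul_eq_mul]

end CircleMean

/-- The family of circles `η_j = r e^{i t}`. -/
def circleFamily (j : κ) : Dbl κ →L[ℂ] C(Arc, Dbl κ) :=
  LinearMap.mkContinuous
    { toFun := fun y => ContinuousMap.const _ (updSnd j y 0)
      map_add' := fun x y => by
        ext1 t
        refine Dbl.ext' j ?_ ?_ fun i hi => ?_ <;> simp [updSnd, *]
      map_smul' := fun c y => by
        ext1 t
        refine Dbl.ext' j ?_ ?_ fun i hi => ?_ <;> simp [updSnd, *] } 1 (fun y => by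
      rw [one_mul]
      refine (ContinuousMap.norm_le _ (norm_nonneg _)).2 fun t => ?_
      exact norm_updSnd_le j y le_rfl (by simp))

def circleBase (j : κ) (r : ℝ) : C(Arc, Dbl κ) :=
  ⟨fun t => updSnd j 0 (circleMap 0 r t), (continuous_updSnd j).comp (continuous_const.prodMk
    ((continuous_circleMap 0 r).comp continuous_subtype_val))⟩

theorem circleFamily_add_base (j : κ) (r : ℝ) (y : Dbl κ) (t : Arc) :
    (circleFamily j y + circleBase j r) t = updSnd j y (circleMap 0 r t) := by
  change updSnd j y 0 + updSnd j 0 (circleMap 0 r t) = _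
  refine Dbl.ext' j ?_ ?_ fun i hi => ?_ <;> simp [updSnd, *]

/-- An analytic function which is even in a variable is an analytic function of its square. -/
theorem exists_eq_comp_sq_coord (j : κ) {f : Dbl κ → ℂ} (hf : AnalyticAt ℂ f 0)
    (he : ∀ᶠ y in 𝓝 0, f (updSnd j y (-y.2 j)) = f y) :
    ∃ h : Dbl κ → ℂ, AnalyticAt ℂ h 0 ∧ ∀ᶠ y in 𝓝 0, f y = h (updSnd j y (y.2 j ^ 2)) := by
  have hfan := hf.eventually_analyticAt
  obtain ⟨p, R, hp⟩ := hf
  obtain ⟨R', hR', hball⟩ := Metric.eventually_nhds_iff_ball.1 (hfan.and he)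
  obtain ⟨r, hr, hrR, hrR'⟩ : ∃ r : ℝ, 0 < r ∧ ENNReal.ofReal r < R ∧ r < R' := by
    obtain ⟨q, hq0, hq⟩ := ENNReal.lt_iff_exists_nnreal_btwn.1 hp.r_pos
    have hq0 : 0 < q := by exact_mod_cast hq0
    refine ⟨min q (R' / 2), by positivity, ?_, (min_le_right _ _).trans_lt (by linarith)⟩
    refine lt_of_le_of_lt ?_ hq
    rw [← ENNReal.ofReal_coe_nnreal]
    exact ENNReal.ofReal_le_ofReal (min_le_left _ _)
  have hfR : ∀ y, ‖y‖ ≤ r → AnalyticAt ℂ f y := fun y hy =>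
    (hball y (by rw [mem_ball_zero_iff]; linarith)).1
  set S : C(Arc, ℂ) := ⟨fun t => circleMap 0 r t, (continuous_circleMap 0 r).comp continuous_subtype_val⟩ with hS
  have hSne : ∀ t, S t ≠ 0 := fun t => circleMap_ne_center hr.ne'
  have hSn : ∀ t, ‖S t‖ = r := fun t => by
    change ‖circleMap 0 r t‖ = r
    rw [norm_circleMap_zero, abs_of_pos hr]
  set D : Dbl κ → C(Arc, ℂ) := fun y => S ^ 2 - y.2 j • 1 with hD
  have hDan : AnalyticAt ℂ D 0 := analyticAt_const.sub ((analyticAt_coord_snd j 0).smul analyticAt_const)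
  have hD0 : IsUnit (D 0) := by
    have : D 0 = S ^ 2 := by
      ext1 t
      change (S t) ^ 2 - (0 : ℂ) * 1 = (S t) ^ 2
      rw [zero_mul, sub_zero]
    rw [this]
    refine IsUnit.pow 2 ((ContinuousMap.isUnit_iff_forall_ne_zero S).2 hSne)
  have hDu : ∀ᶠ y in 𝓝 0, IsUnit (D y) := hDan.continuousAt.eventually_mem (Units.isOpen.mem_nhds hD0)
  have hWan : AnalyticAt ℂ (fun y => Ring.inverse (D y)) 0 := by
    obtain ⟨u, hu⟩ := hD0
    refine AnalyticAt.fun_comp (g := Ring.inverse) (f := D) ?_ hDan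
    rw [← hu]
    exact analyticAt_inverse u
  have hUan : AnalyticAt ℂ (fun y => nemytskii f (circleFamily j y + circleBase j r)) 0 := by
    refine AnalyticAt.fun_comp (g := nemytskii f) (f := fun y => circleFamily j y + circleBase j r) ?_
      (((circleFamily j).analyticAt 0).add analyticAt_const)
    refine (hasFPowerSeriesOnBall_nemytskii hp).analyticOnNhd _ ?_
    rw [map_zero, zero_add, Metric.mem_eball, edist_zero_right]
    refine lt_of_le_of_lt ?_ hrR
    rw [← ofReal_norm]
    refine ENNReal.ofReal_le_ofReal ((ContinuousMap.norm_le _ hr.le).2 fun t => ?_)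
    exact norm_updSnd_le j 0 (by simpa using hr.le) (hSn t).le
  set h : Dbl κ → ℂ := fun y => (2 * Real.pi * Complex.I : ℂ)⁻¹ *
    contourMap r (nemytskii f (circleFamily j y + circleBase j r) * (S * Ring.inverse (D y))) with hh
  refine ⟨h, ?_, ?_⟩
  · exact analyticAt_const.mul (((contourMap r).analyticAt _).comp (hUan.mul (analyticAt_const.mul hWan)))
  have hval : ∀ᶠ y in 𝓝 0, h y = (2 * Real.pi * Complex.I : ℂ)⁻¹ *
      ∮ s in C(0, r), f (updSnd j y s) * (s * (s ^ 2 - y.2 j)⁻¹) := by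
    filter_upwards [hDu, Metric.ball_mem_nhds (0 : Dbl κ) hr] with y h1 h2
    rw [mem_ball_zero_iff] at h2
    simp only [hh]
    congr 1
    refine contourMap_apply r _ fun t => ?_
    have hcont : Continuous fun t : Arc => f ((circleFamily j y + circleBase j r) t) := by
      refine continuous_iff_continuousAt.2 fun t => ?_
      refine ContinuousAt.comp (f := fun t => (circleFamily j y + circleBase j r) t) ?_
        (circleFamily j y + circleBase j r).continuous.continuousAt
      refine (hfR _ ?_).continuousAt
      rw [circleFamily_add_base]
      exact norm_updSnd_le j y h2.le (hSn t).le
    rw [ContinuousMap.mul_apply, ContinuousMap.mul_apply, nemytskii, dif_pos hcont]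
    change f ((circleFamily j y + circleBase j r) t) * _ = _
    rw [circleFamily_add_base]
    congr 2
    have h3 := congrArg (fun u : C(Arc, ℂ) => u t) (Ring.mul_inverse_cancel _ h1)
    simp only [ContinuousMap.mul_apply, ContinuousMap.one_apply] at h3
    rw [eq_inv_of_mul_eq_one_right h3]
    simp [hD, hS]
  have tsq : Tendsto (fun y : Dbl κ => updSnd j y (y.2 j ^ 2)) (𝓝 0) (𝓝 0) := by
    have : Continuous fun y : Dbl κ => updSnd j y (y.2 j ^ 2) :=
      (continuous_updSnd j).comp (continuous_id.prodMk (by fun_prop))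
    have h0 : updSnd j (0 : Dbl κ) ((0 : Dbl κ).2 j ^ 2) = 0 := by
      refine Dbl.ext' j ?_ ?_ fun i hi => ?_ <;> simp [updSnd, *]
    have h1 := this.tendsto 0
    rwa [h0] at h1
  filter_upwards [tsq.eventually hval, Metric.ball_mem_nhds (0 : Dbl κ) hr] with y h1 h2
  rw [mem_ball_zero_iff] at h2
  set w := y.2 j with hw
  have hwr : ‖w‖ < r := (norm_coord_snd_le y j).trans_lt h2
  set g : ℂ → ℂ := fun s => f (updSnd j y s) with hg
  have hgd : DifferentiableOn ℂ g (Metric.closedBall 0 r) := by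
    intro s hs
    rw [mem_closedBall_zero_iff] at hs
    have hd : DifferentiableAt ℂ (fun s => updSnd j y s) s := by
      have : (fun s => updSnd j y s) = fun s => updSnd j y 0 + s • (0, Pi.single j 1) := funext (updSnd_eq j y)
      rw [this]
      fun_prop
    exact (DifferentiableAt.comp s (hfR _ (norm_updSnd_le j y h2.le hs)).differentiableAt hd).differentiableWithinAt
  have hgc : DiffContOnCl ℂ g (Metric.ball 0 r) :=
    (hgd.mono Metric.closure_ball_subset_closedBall).diffContOnCl
  have hC1 := hgc.circleIntegral_sub_inv_smul (w := w) (by simpa using hwr)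
  have hC2 := hgc.circleIntegral_sub_inv_smul (w := -w) (by simpa using hwr)
  have hne : ∀ s ∈ Metric.sphere (0 : ℂ) r, s - w ≠ 0 ∧ s - -w ≠ 0 := by
    intro s hs
    have hs : ‖s‖ = r := by simpa using hs
    refine ⟨fun h => ?_, fun h => ?_⟩
    · rw [sub_eq_zero] at h; rw [h] at hs; linarith
    · rw [sub_eq_zero] at h; rw [h, norm_neg] at hs; linarith
  have hgs : ContinuousOn g (Metric.sphere 0 r) := hgd.continuousOn.mono Metric.sphere_subset_closedBall
  have hI1 : CircleIntegrable (fun s => (s - w)⁻¹ • g s) 0 r := ContinuousOn.circleIntegrable hr.le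
    (ContinuousOn.smul (ContinuousOn.inv₀ (by fun_prop) fun s hs => (hne s hs).1) hgs)
  have hI2 : CircleIntegrable (fun s => (s - -w)⁻¹ • g s) 0 r := ContinuousOn.circleIntegrable hr.le
    (ContinuousOn.smul (ContinuousOn.inv₀ (by fun_prop) fun s hs => (hne s hs).2) hgs)
  have hsum : (∮ s in C(0, r), g s * (s * (s ^ 2 - w ^ 2)⁻¹)) =
      ∮ s in C(0, r), (1 / 2 : ℂ) * ((s - w)⁻¹ • g s + (s - -w)⁻¹ • g s) := by
    refine circleIntegral.integral_congr hr.le fun s hs => ?_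
    obtain ⟨n1, n2⟩ := hne s hs
    have n3 : s ^ 2 - w ^ 2 ≠ 0 := by
      have : s ^ 2 - w ^ 2 = (s - w) * (s - -w) := by ring
      rw [this]
      exact mul_ne_zero n1 n2
    have n2' : s + w ≠ 0 := by rwa [sub_neg_eq_add] at n2
    simp only [smul_eq_mul, sub_neg_eq_add]
    field_simp
    ring
  have hup : ∀ s q, updSnd j (updSnd j y q) s = updSnd j y s := fun s q => by simp [updSnd]
  have hyw : updSnd j y w = y := by simp [updSnd, hw]
  have heven : g (-w) = f y := (hball y (by rw [mem_ball_zero_iff]; linarith)).2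
  have hgw : g w = f y := by simp only [hg, hyw]
  have hq : (updSnd j y (w ^ 2)).2 j = w ^ 2 := by simp [updSnd]
  rw [h1]
  simp only [hup, hq]
  change _ = _ * ∮ s in C(0, r), g s * (s * (s ^ 2 - w ^ 2)⁻¹)
  rw [hsum, circleIntegral.integral_const_mul, circleIntegral.integral_add hI1 hI2, hC1, hC2, heven, hgw]
  have := Complex.two_pi_I_ne_zero
  simp only [smul_eq_mul]
  field_simp
  ring

end

section

section Even

variable {κ : Type*} [Fintype κ] [DecidableEq κ]

theorem eventually_of_sq (j : κ) {P : Dbl κ → Prop} (h : ∀ᶠ y in 𝓝 0, P (updSnd j y (y.2 j ^ 2))) :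
    ∀ᶠ y in 𝓝 0, P y := by
  have hsq : ∀ w : ℂ, (w ^ (1 / 2 : ℂ)) ^ 2 = w := fun w => by
    rw [← Complex.cpow_nat_mul]
    norm_num
  have t0 : Tendsto (fun w : ℂ => w ^ (1 / 2 : ℂ)) (𝓝 0) (𝓝 0) := by
    have h1 : Tendsto (fun w : ℂ => Real.sqrt ‖w‖) (𝓝 0) (𝓝 0) := by
      have : Continuous fun w : ℂ => Real.sqrt ‖w‖ := by fun_prop
      simpa using this.tendsto 0
    refine squeeze_zero_norm (fun w => ?_) h1
    refine Real.le_sqrt_of_sq_le ?_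
    rw [← norm_pow, hsq]
  have t1 : Tendsto (fun y : Dbl κ => updSnd j y (y.2 j ^ (1 / 2 : ℂ))) (𝓝 0) (𝓝 0) := by
    have h1 : Tendsto (fun y : Dbl κ => y.2 j) (𝓝 0) (𝓝 0) := by
      have : Continuous fun y : Dbl κ => y.2 j := by fun_prop
      simpa using this.tendsto 0
    have h2 := ((continuous_updSnd j).tendsto ((0 : Dbl κ), (0 : ℂ))).comp
      (tendsto_id.prodMk_nhds (t0.comp h1))
    have h0 : updSnd j (0 : Dbl κ) 0 = 0 := by
      refine Dbl.ext' j ?_ ?_ fun i hi => ?_ <;> simp [updSnd, *]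
    rw [h0] at h2
    exact h2
  filter_upwards [t1.eventually h] with y hy
  have : updSnd j (updSnd j y (y.2 j ^ (1 / 2 : ℂ))) ((updSnd j y (y.2 j ^ (1 / 2 : ℂ))).2 j ^ 2) = y := by
    simp only [updSnd, Function.update_self, Function.update_idem, hsq]
    simp
  rwa [this] at hy

/-- An analytic function which is even in each `η_j` is an analytic function of the squares. -/
theorem exists_eq_comp_sq {f : Dbl κ → ℂ} (hf : AnalyticAt ℂ f 0)
    (he : ∀ j, ∀ᶠ y in 𝓝 0, f (updSnd j y (-y.2 j)) = f y) :
    ∃ h : Dbl κ → ℂ, AnalyticAt ℂ h 0 ∧ ∀ᶠ y : Dbl κ in 𝓝 0, f y = h (y.1, y.2 ^ 2) := by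
  suffices hs : ∀ s : Finset κ, ∃ h : Dbl κ → ℂ, AnalyticAt ℂ h 0 ∧
      (∀ᶠ y : Dbl κ in 𝓝 0, f y = h (y.1, fun j => if j ∈ s then y.2 j ^ 2 else y.2 j)) ∧
      ∀ j, j ∉ s → ∀ᶠ y in 𝓝 0, h (updSnd j y (-y.2 j)) = h y by
    obtain ⟨h, h1, h2, -⟩ := hs Finset.univ
    refine ⟨h, h1, ?_⟩
    simp only [Finset.mem_univ, if_true] at h2; exact h2
  intro s
  induction s using Finset.induction_on with
  | empty => exact ⟨f, hf, by simp, fun j _ => he j⟩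
  | insert k s hk ih =>
    obtain ⟨h, han, heq, hev⟩ := ih
    obtain ⟨h', han', heq'⟩ := exists_eq_comp_sq_coord k han (hev k hk)
    refine ⟨h', han', ?_, fun j hj => ?_⟩
    · have t : Tendsto (fun y : Dbl κ => ((y.1, fun j => if j ∈ s then y.2 j ^ 2 else y.2 j) : Dbl κ)) (𝓝 0) (𝓝 0) := by
        have hc : Continuous fun y : Dbl κ => ((y.1, fun j => if j ∈ s then y.2 j ^ 2 else y.2 j) : Dbl κ) := by
          refine Continuous.prodMk (by fun_prop) (continuous_pi fun j => ?_)
          split_ifs <;> fun_prop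
        have h0 : (((0 : Dbl κ).1, fun j => if j ∈ s then (0 : Dbl κ).2 j ^ 2 else (0 : Dbl κ).2 j) : Dbl κ) = 0 := by
          ext j <;> simp
        have := hc.tendsto 0
        rwa [h0] at this
      filter_upwards [heq, t.eventually heq'] with y h1 h2
      rw [h1, h2]
      congr 1
      refine Dbl.ext' k rfl ?_ fun i hi => ⟨rfl, ?_⟩
      · simp [updSnd, hk]
      · simp [updSnd, hi]
    · rw [Finset.mem_insert, not_or] at hj
      refine eventually_of_sq k ?_
      have t : Tendsto (fun y : Dbl κ => updSnd j y (-y.2 j)) (𝓝 0) (𝓝 0) := by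
        have hc : Continuous fun y : Dbl κ => updSnd j y (-y.2 j) :=
          (continuous_updSnd j).comp (continuous_id.prodMk (by fun_prop))
        have h0 : updSnd j (0 : Dbl κ) (-(0 : Dbl κ).2 j) = 0 := by
          refine Dbl.ext' j ?_ ?_ fun i hi => ?_ <;> simp [updSnd, *]
        have := hc.tendsto 0
        rwa [h0] at this
      filter_upwards [hev j hj.2, heq', t.eventually heq'] with y h1 h2 h3
      rw [h1, h2] at h3
      rw [h3]
      congr 1
      have hjk := hj.1
      ext i
      · rfl
      · rcases eq_or_ne i j with rfl | hi
        · simp [updSnd, hjk]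
        · rcases eq_or_ne i k with rfl | hi'
          · simp [updSnd, hi]
          · simp [updSnd, hi, hi']

end Even

variable {a b : ℕ} {γe : Fin a → ℝ} {γs : Fin b → ℂ} {E : V a b × V a b → V a b}

/-- The coordinates which are preserved by the normalized involutions, up to sign. -/
def zfMap (Λ : Idx a b → V a b → ℂ) (x : V a b × V a b) : V a b × V a b :=
  (fun j => x.1 j + Λ j (x.1 * x.2) * x.2 j, fun j => x.1 j - Λ j (x.1 * x.2) * x.2 j)

theorem hasFDerivAt_mul_of_analyticAt {w : V a b → ℂ} (hw : AnalyticAt ℂ w 0) (l : V a b × V a b →L[ℂ] ℂ) :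
    HasFDerivAt (fun x : V a b × V a b => w (x.1 * x.2) * l x) (w 0 • l) 0 := by
  have := (analyticAt_mul_products hw).differentiableAt.hasFDerivAt.fun_mul (l.hasFDerivAt (x := 0))
  refine this.congr_fderiv (ContinuousLinearMap.ext fun v => ?_)
  rw [add_apply, smul_apply, smul_apply]
  simp

theorem zfMap_zero (Λ : Idx a b → V a b → ℂ) : zfMap Λ 0 = 0 := by
  ext j <;> simp [zfMap]

theorem exists_zfMap_germInv {Λ : Idx a b → V a b → ℂ} (hΛ : ∀ j, AnalyticAt ℂ (Λ j) 0) (h0 : ∀ j, Λ j 0 ≠ 0) :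
    (∃ χ, IsGermInv (zfMap Λ) χ) ∧ ∀ v, fderiv ℂ (zfMap Λ) 0 v =
      (fun j => v.1 j + Λ j 0 * v.2 j, fun j => v.1 j - Λ j 0 * v.2 j) := by
  set p1 : Idx a b → V a b × V a b →L[ℂ] ℂ := fun j => (ContinuousLinearMap.proj (R := ℂ) (φ := fun _ : Idx a b => ℂ) j).comp
    (ContinuousLinearMap.fst ℂ (V a b) (V a b)) with hp1
  set p2 : Idx a b → V a b × V a b →L[ℂ] ℂ := fun j => (ContinuousLinearMap.proj (R := ℂ) (φ := fun _ : Idx a b => ℂ) j).comp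
    (ContinuousLinearMap.snd ℂ (V a b) (V a b)) with hp2
  have han : AnalyticAt ℂ (zfMap Λ) 0 := by
    refine AnalyticAt.prod ?_ ?_
    · rw [analyticAt_pi_iff]
      exact fun j => (analyticAt_coord_fst j 0).add ((analyticAt_mul_products (hΛ j)).mul (analyticAt_coord_snd j 0))
    · rw [analyticAt_pi_iff]
      exact fun j => (analyticAt_coord_fst j 0).sub ((analyticAt_mul_products (hΛ j)).mul (analyticAt_coord_snd j 0))
  have hd : ∀ v, fderiv ℂ (zfMap Λ) 0 v =
      (fun j => v.1 j + Λ j 0 * v.2 j, fun j => v.1 j - Λ j 0 * v.2 j) := fun v => by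
    have h1 := fun j => (p1 j).hasFDerivAt (x := 0) |>.add (hasFDerivAt_mul_of_analyticAt (hΛ j) (p2 j))
    have h2 := fun j => (p1 j).hasFDerivAt (x := 0) |>.sub (hasFDerivAt_mul_of_analyticAt (hΛ j) (p2 j))
    have h3 : HasFDerivAt (zfMap Λ) _ 0 := (hasFDerivAt_pi.2 h1).prodMk (hasFDerivAt_pi.2 h2)
    rw [h3.fderiv]
    rfl
  refine ⟨IsGermInv.exists_of_fderiv_injective han (zfMap_zero Λ) fun v hv => ?_, hd⟩
  rw [hd] at hv
  have e1 : ∀ j, v.1 j + Λ j 0 * v.2 j = 0 := fun j => congrFun (Prod.ext_iff.1 hv).1 j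
  have e2 : ∀ j, v.1 j - Λ j 0 * v.2 j = 0 := fun j => congrFun (Prod.ext_iff.1 hv).2 j
  ext j
  · have : (2 : ℂ) * v.1 j = 0 := by linear_combination e1 j + e2 j
    simpa using this
  · have : (2 : ℂ) * (Λ j 0 * v.2 j) = 0 := by linear_combination e1 j - e2 j
    simpa [h0 j] using this

theorem zfMap_nfTau (Λ : Idx a b → V a b → ℂ) (j : Idx a b) {x : V a b × V a b} (h : Λ j (x.1 * x.2) ≠ 0) :
    zfMap Λ (nfTau (Λ j) j x) = updSnd j (zfMap Λ x) (-(zfMap Λ x).2 j) := by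
  have hp := nfTau_products (L := Λ j) j h
  refine Dbl.ext' j ?_ ?_ fun i hi => ?_
  · simp only [zfMap, hp, updSnd]
    simp [nfTau]
    field_simp
    ring
  · simp only [zfMap, hp, updSnd]
    simp [nfTau]
    field_simp
  · simp only [zfMap, hp, updSnd]
    simp [nfTau, hi]

end

section

variable {a b : ℕ} {γe : Fin a → ℝ} {γs : Fin b → ℂ} {E : V a b × V a b → V a b}

theorem IsPerturbation.map_zero (hE : IsPerturbation γe γs E) : E 0 = 0 := by
  obtain ⟨C, hC⟩ := hE.2.bound
  have h := hC.self_of_nhds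
  simp only [norm_zero, ne_eq, OfNat.ofNat_ne_zero, not_false_eq_true, zero_pow, mul_zero, norm_le_zero_iff] at h
  funext i
  have := congrFun h i
  simpa [quadForm] using this

theorem IsPerturbation.fderiv_eq_zero (hE : IsPerturbation γe γs E) (v : V a b × V a b) : fderiv ℂ E 0 v = 0 := by
  have h1 := tendsto_inv_smul_of_analyticAt hE.1 hE.map_zero v
  have hc : Tendsto (fun t : ℂ => t⁻¹ • (t • v)) (𝓝[≠] 0) (𝓝 v) := by
    refine tendsto_const_nhds.congr' ?_
    filter_upwards [self_mem_nhdsWithin] with t ht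
    rw [inv_smul_smul₀ ht]
  funext i
  have h2 := tendsto_inv_sq_smul E hE hc i
  have h3 : Tendsto (fun t : ℂ => t) (𝓝[≠] 0) (𝓝 0) := tendsto_id.mono_left nhdsWithin_le_nhds
  have h4 := h3.mul h2
  rw [zero_mul] at h4
  refine tendsto_nhds_unique ((tendsto_pi_nhds.1 h1) i) (h4.congr' ?_)
  filter_upwards [self_mem_nhdsWithin] with t ht
  have ht : t ≠ 0 := ht
  simp only [Pi.smul_apply, smul_eq_mul]
  field_simp

variable {Λ : Idx a b → V a b → ℂ} {ψ χ : V a b × V a b → V a b × V a b}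

/-- The quotient of the complexification by the deck transformations is smooth; its coordinates are
the first components and the squares of the second components of `zfMap Λ`. -/
theorem exists_quotient_germInv (hγe : ∀ e, 0 < γe e ∧ γe e < 1 / 2) (hγs : ∀ s, 1 / 2 < (γs s).re ∧ 0 < (γs s).im)
    (hE : IsPerturbation γe γs E) (hΛ : ∀ j, AnalyticAt ℂ (Λ j) 0 ∧ Λ j 0 = lam γe γs j)
    (hψ : IsGermInv ψ χ) (hψd : ∀ v, fderiv ℂ ψ 0 v = lin (lam γe γs) v)
    (hinv : ∀ j, ∀ᶠ x in 𝓝 0, proj1 E (ψ (nfTau (Λ j) j x)) = proj1 E (ψ x)) :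
    ∃ H H' : V a b × V a b → V a b × V a b, IsGermInv H H' ∧
      ∀ᶠ x in 𝓝 0, proj1 E (ψ x) = H ((zfMap Λ x).1, (zfMap Λ x).2 ^ 2) := by
  have hl0 : ∀ j, Λ j 0 ≠ 0 := fun j => (hΛ j).2 ▸ (norm_lam_ne_one hγe hγs j).1
  obtain ⟨⟨Θ, hΘ⟩, hΘd⟩ := exists_zfMap_germInv (fun j => (hΛ j).1) hl0
  have hc := hψ.comp hΘ.symm
  have hcd : ∀ v, fderiv ℂ (fun y => ψ (Θ y)) 0 v = lin (lam γe γs) (fderiv ℂ Θ 0 v) := fun v => by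
    have h1 : HasFDerivAt ψ (fderiv ℂ ψ 0) (Θ 0) := by
      rw [hΘ.map0']; exact hψ.an.differentiableAt.hasFDerivAt
    have h2 : HasFDerivAt (fun y => ψ (Θ y)) _ 0 := h1.comp 0 hΘ.an'.differentiableAt.hasFDerivAt
    rw [h2.fderiv]
    exact hψd _
  have hΘv : ∀ v j, (fderiv ℂ Θ 0 v).1 j + lam γe γs j * (fderiv ℂ Θ 0 v).2 j = v.1 j ∧
      (fderiv ℂ Θ 0 v).1 j - lam γe γs j * (fderiv ℂ Θ 0 v).2 j = v.2 j := fun v j => by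
    have := hΘ.fderiv_right v
    rw [hΘd] at this
    rw [← (hΛ j).2]
    exact ⟨congrFun (Prod.ext_iff.1 this).1 j, congrFun (Prod.ext_iff.1 this).2 j⟩
  set f : V a b × V a b → V a b × V a b := fun y => proj1 E (ψ (Θ y)) with hf
  have hEan : AnalyticAt ℂ (fun y => E (ψ (Θ y))) 0 := by
    have : AnalyticAt ℂ E (ψ (Θ 0)) := by rw [hc.map0]; exact hE.1
    exact AnalyticAt.fun_comp this hc.an
  have hfan : AnalyticAt ℂ f 0 := (analyticAt_fst.fun_comp hc.an).prod hEan
  have hf0 : f 0 = 0 := by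
    show proj1 E (ψ (Θ 0)) = 0
    rw [hc.map0]
    exact Prod.ext rfl hE.map_zero
  have hfd : ∀ v, fderiv ℂ f 0 v = ((lin (lam γe γs) (fderiv ℂ Θ 0 v)).1, 0) := fun v => by
    have h1 : HasFDerivAt E (fderiv ℂ E 0) (ψ (Θ 0)) := by
      rw [hc.map0]; exact hE.1.differentiableAt.hasFDerivAt
    have h2 := hc.an.differentiableAt.hasFDerivAt
    have h3 : HasFDerivAt f _ 0 := h2.fst.prodMk (h1.comp 0 h2)
    rw [h3.fderiv]
    refine Prod.ext ?_ ?_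
    · exact (Prod.ext_iff.1 (hcd v)).1
    · exact hE.fderiv_eq_zero _
  have heven : ∀ j, ∀ᶠ y in 𝓝 0, f (updSnd j y (-y.2 j)) = f y := fun j => by
    have t1 : Tendsto (nfTau (Λ j) j) (𝓝 0) (𝓝 0) :=
      AnalyticAt.tendsto_zero (analyticAt_nfTau (hΛ j).1 (hl0 j) j) (nfTau_zero _ j)
    have hne : ∀ᶠ x : V a b × V a b in 𝓝 0, Λ j (x.1 * x.2) ≠ 0 :=
      tendsto_mul_zero.eventually ((hΛ j).1.continuousAt.eventually_ne (hl0 j))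
    filter_upwards [hΘ.right, (t1.comp hΘ.tendsto').eventually hΘ.left, hΘ.tendsto'.eventually (hinv j),
      hΘ.tendsto'.eventually hne] with y h1 h2 h3 h4
    have h5 := zfMap_nfTau Λ j h4
    rw [h1] at h5
    simp only [Function.comp] at h2
    rw [h5] at h2
    simp only [hf]
    rw [h2, h3]
  have hcomp1 : ∀ i, ∃ h : V a b × V a b → ℂ, AnalyticAt ℂ h 0 ∧
      ∀ᶠ y : V a b × V a b in 𝓝 0, (f y).1 i = h (y.1, y.2 ^ 2) := fun i =>
    exists_eq_comp_sq ((analyticAt_coord_fst i (f 0)).fun_comp hfan) fun j => (heven j).mono fun y hy => by rw [hy]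
  have hcomp2 : ∀ i, ∃ h : V a b × V a b → ℂ, AnalyticAt ℂ h 0 ∧
      ∀ᶠ y : V a b × V a b in 𝓝 0, (f y).2 i = h (y.1, y.2 ^ 2) := fun i =>
    exists_eq_comp_sq ((analyticAt_coord_snd i (f 0)).fun_comp hfan) fun j => (heven j).mono fun y hy => by rw [hy]
  choose h1 h1an h1eq using hcomp1
  choose h2 h2an h2eq using hcomp2
  set H : V a b × V a b → V a b × V a b := fun y => (fun i => h1 i y, fun i => h2 i y) with hH
  have hHan : AnalyticAt ℂ H 0 := (analyticAt_pi_iff.2 h1an).prod (analyticAt_pi_iff.2 h2an)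
  have hHf : ∀ᶠ y : V a b × V a b in 𝓝 0, f y = H (y.1, y.2 ^ 2) := by
    filter_upwards [eventually_all.2 h1eq, eventually_all.2 h2eq] with y e1 e2
    exact Prod.ext (funext e1) (funext e2)
  have hH0 : H 0 = 0 := by
    have := hHf.self_of_nhds
    rw [hf0] at this
    refine Eq.trans (congrArg H ?_) this.symm
    refine Prod.ext rfl ?_
    funext i
    simp
  have tv : ∀ v : V a b × V a b, Tendsto (fun t : ℂ => t • v) (𝓝[≠] 0) (𝓝 0) := fun v => by
    have : Continuous fun t : ℂ => t • v := by fun_prop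
    have h := (this.tendsto 0).mono_left (nhdsWithin_le_nhds (s := {0}ᶜ))
    rwa [zero_smul] at h
  have hd1 : ∀ Z : V a b, fderiv ℂ H 0 (Z, 0) = fderiv ℂ f 0 (Z, 0) := fun Z => by
    refine tendsto_nhds_unique (tendsto_inv_smul_of_analyticAt hHan hH0 (Z, 0))
      ((tendsto_inv_smul_of_analyticAt hfan hf0 (Z, 0)).congr' ?_)
    filter_upwards [(tv (Z, 0)).eventually hHf] with t ht
    rw [ht]
    congr 2
    ext <;> simp
  have hd2 : ∀ j, ∃ k : ℂ, k ≠ 0 ∧ ∀ q : V a b, (fderiv ℂ H 0 (0, q)).2 j = k ^ 2 * q j := fun j => by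
    obtain ⟨k, hk, hkx⟩ := quadL_lin hγe hγs j
    refine ⟨k, hk, fun q => ?_⟩
    set F : V a b := fun i => q i ^ (1 / 2 : ℂ) with hF
    have hFq : ∀ i, F i ^ 2 = q i := fun i => by
      rw [hF, ← Complex.cpow_nat_mul]
      norm_num
    have hsq : Tendsto (fun t : ℂ => t ^ 2) (𝓝[≠] 0) (𝓝[≠] 0) := by
      refine tendsto_nhdsWithin_iff.2 ⟨?_, ?_⟩
      · have : Continuous fun t : ℂ => t ^ 2 := by fun_prop
        simpa using (this.tendsto 0).mono_left (nhdsWithin_le_nhds (s := {0}ᶜ))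
      · filter_upwards [self_mem_nhdsWithin] with t ht using pow_ne_zero 2 ht
    have e1 := (tendsto_inv_smul_of_analyticAt hHan hH0 (0, q)).comp hsq
    have e2 := (((continuous_apply j).comp continuous_snd).tendsto _).comp e1
    have e3 := tendsto_inv_sq_smul E hE (tendsto_inv_smul_of_analyticAt hc.an hc.map0 (0, F)) j
    rw [hcd, hkx, (hΘv (0, F) j).2, mul_pow, hFq] at e3
    refine tendsto_nhds_unique e2 (e3.congr' ?_)
    filter_upwards [(tv (0, F)).eventually hHf] with t ht
    have e4 : ((t • ((0, F) : V a b × V a b)).1, (t • ((0, F) : V a b × V a b)).2 ^ 2) =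
        t ^ 2 • ((0, q) : V a b × V a b) := by
      ext i
      · simp
      · simp [mul_pow, hFq]
    rw [e4] at ht
    simp only [Function.comp]
    rw [← ht]
    rfl
  obtain ⟨H', hH'⟩ := IsGermInv.exists_of_fderiv_injective hHan hH0 fun v hv => by
    have hsplit : fderiv ℂ H 0 v = fderiv ℂ H 0 (v.1, 0) + fderiv ℂ H 0 (0, v.2) := by
      rw [← map_add]
      congr 1
      ext <;> simp
    have hv2 : v.2 = 0 := by
      funext j
      obtain ⟨k, hk, hkq⟩ := hd2 j
      have e := congrFun (congrArg Prod.snd (hsplit.symm.trans hv)) j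
      rw [hd1, hfd] at e
      have e' : (0 : ℂ) + (fderiv ℂ H 0 (0, v.2)).2 j = 0 := e
      rw [hkq, zero_add] at e'
      simpa [hk] using e'
    have hv1 : v.1 = 0 := by
      funext j
      have e := congrFun (congrArg Prod.fst (hsplit.symm.trans hv)) j
      rw [hv2, hd1, hfd] at e
      have e0 : fderiv ℂ H 0 ((0, 0) : V a b × V a b) = 0 := (fderiv ℂ H 0).map_zero
      rw [e0] at e
      have e' : unit j * ((fderiv ℂ Θ 0 (v.1, 0)).1 j + lam γe γs j * (fderiv ℂ Θ 0 (v.1, 0)).2 j) + 0 = 0 := e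
      rw [(hΘv _ j).1, add_zero] at e'
      simpa [unit_ne_zero] using e'
    exact Prod.ext hv1 hv2
  refine ⟨H, H', hH', ?_⟩
  filter_upwards [hΘ.tendsto.eventually hHf, hΘ.left] with x e1 e2
  rw [← e1]
  simp only [hf]
  rw [e2]

/-- The quotient in the coordinates `(Z, Λ(ζ) ζ)`. -/
theorem exists_normalForm_germInv (hγe : ∀ e, 0 < γe e ∧ γe e < 1 / 2)
    (hγs : ∀ s, 1 / 2 < (γs s).re ∧ 0 < (γs s).im)
    (hE : IsPerturbation γe γs E) (hΛ : ∀ j, AnalyticAt ℂ (Λ j) 0 ∧ Λ j 0 = lam γe γs j)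
    (hψ : IsGermInv ψ χ) (hψd : ∀ v, fderiv ℂ ψ 0 v = lin (lam γe γs) v)
    (hinv : ∀ j, ∀ᶠ x in 𝓝 0, proj1 E (ψ (nfTau (Λ j) j x)) = proj1 E (ψ x)) :
    ∃ H H' : V a b × V a b → V a b × V a b, IsGermInv H H' ∧
      ∀ᶠ x in 𝓝 0, proj1 E (ψ x) = H ((zfMap Λ x).1, fun j => Λ j (x.1 * x.2) * (x.1 j * x.2 j)) := by
  obtain ⟨H, H', hH, hHx⟩ := exists_quotient_germInv hγe hγs hE hΛ hψ hψd hinv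
  have hS : IsGermInv (fun y : V a b × V a b => ((y.1, y.1 ^ 2 - (4 : ℂ) • y.2) : V a b × V a b))
      (fun y => (y.1, (4 : ℂ)⁻¹ • (y.1 ^ 2 - y.2))) := by
    refine ⟨?_, by ext <;> simp, ?_, by ext <;> simp, .of_forall fun y => ?_, .of_forall fun y => ?_⟩
    · exact analyticAt_fst.prod ((analyticAt_fst.pow 2).sub (analyticAt_snd.fun_const_smul))
    · exact analyticAt_fst.prod (((analyticAt_fst.pow 2).sub analyticAt_snd).fun_const_smul)
    · ext i <;> simp
    · ext i <;> simp
  refine ⟨_, _, hH.comp hS, ?_⟩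
  filter_upwards [hHx] with x hx
  rw [hx]
  congr 1
  ext i
  · rfl
  · simp only [zfMap, Pi.pow_apply, Pi.sub_apply, Pi.smul_apply, smul_eq_mul]
    ring

end

section

variable {a b : ℕ}

/-- The factor which relates `conj z_{j^*}` to the second elementary function of `(ξ_j, η_j)`. -/
def twist (Λ : Idx a b → V a b → ℂ) (j : Idx a b) (ζ : V a b) : ℂ :=
  match j with
  | Sum.inl _ => 1
  | Sum.inr i => Λ (Sum.inr i) ζ

/-- The right hand side of the equations for `ζ`, where `w_j` stands for `conj z_{j^*}`. -/
def zetaRhs (Λ : Idx a b → V a b → ℂ) (z w ζ : V a b) (j : Idx a b) : ℂ :=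
  ((1 + Λ j ζ ^ 2) * z j * (twist Λ j ζ * w j) - Λ j ζ * (z j ^ 2 + (twist Λ j ζ * w j) ^ 2)) / (1 - Λ j ζ ^ 2) ^ 2

theorem isZetaSolution_iff {Λ : Idx a b → V a b → ℂ} {ζ : V a b → V a b} : IsZetaSolution Λ ζ ↔
    AnalyticAt ℝ ζ 0 ∧ ζ 0 = 0 ∧ ∀ᶠ z in 𝓝 0, ζ z = zetaRhs Λ z (rhoZ z) (ζ z) := by
  refine and_congr_right fun _ => and_congr_right fun _ => eventually_congr (.of_forall fun z => ?_)
  rw [funext_iff]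
  refine Iff.trans ?_ Sum.forall.symm
  refine and_congr (forall_congr' fun e => ?_) (forall_congr' fun i => ?_)
  · refine Eq.congr_right ?_
    simp only [coefA, coefB, zetaRhs, twist, rhoZ, swapIdx]
    ring
  · refine Eq.congr_right ?_
    simp only [coefA, coefB, zetaRhs, twist, rhoZ]
    ring

theorem zetaRhs_eq_mul {Λ : Idx a b → V a b → ℂ} {z w ζ : V a b} {j : Idx a b} {ξ η : ℂ}
    (h : 1 - Λ j ζ ^ 2 ≠ 0) (hz : z j = ξ + Λ j ζ * η) (hw : twist Λ j ζ * w j = η + Λ j ζ * ξ) :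
    zetaRhs Λ z w ζ j = ξ * η := by
  rw [zetaRhs, hz, hw, div_eq_iff (pow_ne_zero 2 h)]
  ring

theorem fderiv_mul_eq_zero {X : Type*} [NormedAddCommGroup X] [NormedSpace ℂ X] {f g : X → ℂ}
    (hf : AnalyticAt ℂ f 0) (hg : AnalyticAt ℂ g 0) (hf0 : f 0 = 0) (hg0 : g 0 = 0) :
    HasFDerivAt (fun x => f x * g x) (0 : X →L[ℂ] ℂ) 0 := by
  have h := hf.differentiableAt.hasFDerivAt.fun_mul hg.differentiableAt.hasFDerivAt
  rw [hf0, hg0] at h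
  refine h.congr_fderiv (ContinuousLinearMap.ext fun v => ?_)
  rw [add_apply, smul_apply, smul_apply]
  simp

theorem analyticAt_coord {κ : Type*} [Fintype κ] (j : κ) (x : κ → ℂ) : AnalyticAt ℂ (fun x : κ → ℂ => x j) x :=
  (ContinuousLinearMap.proj (R := ℂ) (φ := fun _ : κ => ℂ) j).analyticAt x

/-- The equations for `ζ`, with independent `z` and `w`, have a unique small solution. -/
theorem exists_zetaRhs_solution {Λ : Idx a b → V a b → ℂ} (hΛ : ∀ j, AnalyticAt ℂ (Λ j) 0)
    (hD : ∀ j, 1 - Λ j 0 ^ 2 ≠ 0) :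
    ∃ S : V a b × V a b → V a b, AnalyticAt ℂ S 0 ∧ S 0 = 0 ∧
      (∀ᶠ u in 𝓝 0, S u = zetaRhs Λ u.1 u.2 (S u)) ∧
      ∀ᶠ p : (V a b × V a b) × V a b in 𝓝 0, p.2 = zetaRhs Λ p.1.1 p.1.2 p.2 → p.2 = S p.1 := by
  set N : (V a b × V a b) × V a b → (V a b × V a b) × V a b := fun p =>
    (p.1, p.2 - zetaRhs Λ p.1.1 p.1.2 p.2) with hN
  have aΛ : ∀ j, AnalyticAt ℂ (fun p : (V a b × V a b) × V a b => Λ j p.2) 0 := fun j =>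
    AnalyticAt.comp_zero (f := fun p : (V a b × V a b) × V a b => p.2) (hΛ j) analyticAt_snd rfl
  have aT : ∀ j, AnalyticAt ℂ (fun p : (V a b × V a b) × V a b => twist Λ j p.2) 0 := by
    rintro (e | i)
    · exact analyticAt_const
    · exact aΛ _
  have az : ∀ j, AnalyticAt ℂ (fun p : (V a b × V a b) × V a b => p.1.1 j) 0 := fun j =>
    (analyticAt_coord_fst j _).fun_comp analyticAt_fst
  have aw : ∀ j, AnalyticAt ℂ (fun p : (V a b × V a b) × V a b => p.1.2 j) 0 := fun j =>
    (analyticAt_coord_snd j _).fun_comp analyticAt_fst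
  have aD : ∀ j, AnalyticAt ℂ (fun p : (V a b × V a b) × V a b => (1 - Λ j p.2 ^ 2) ^ 2) 0 := fun j =>
    (analyticAt_const.sub ((aΛ j).pow 2)).pow 2
  have a1 : ∀ j, AnalyticAt ℂ (fun p : (V a b × V a b) × V a b =>
      ((1 + Λ j p.2 ^ 2) * (twist Λ j p.2 * p.1.2 j) - Λ j p.2 * p.1.1 j) / (1 - Λ j p.2 ^ 2) ^ 2) 0 := fun j =>
    (((analyticAt_const.add ((aΛ j).pow 2)).mul ((aT j).mul (aw j))).sub ((aΛ j).mul (az j))).div (aD j)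
      (pow_ne_zero 2 (hD j))
  have a2 : ∀ j, AnalyticAt ℂ (fun p : (V a b × V a b) × V a b =>
      -(Λ j p.2 * (twist Λ j p.2 ^ 2 * p.1.2 j)) / (1 - Λ j p.2 ^ 2) ^ 2) 0 := fun j =>
    ((aΛ j).mul (((aT j).pow 2).mul (aw j))).neg.div (aD j) (pow_ne_zero 2 (hD j))
  have hR : ∀ (p : (V a b × V a b) × V a b) j, zetaRhs Λ p.1.1 p.1.2 p.2 j =
      p.1.1 j * (((1 + Λ j p.2 ^ 2) * (twist Λ j p.2 * p.1.2 j) - Λ j p.2 * p.1.1 j) / (1 - Λ j p.2 ^ 2) ^ 2) +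
      p.1.2 j * (-(Λ j p.2 * (twist Λ j p.2 ^ 2 * p.1.2 j)) / (1 - Λ j p.2 ^ 2) ^ 2) := fun p j => by
    rw [zetaRhs]
    ring
  have hRan : AnalyticAt ℂ (fun p : (V a b × V a b) × V a b => zetaRhs Λ p.1.1 p.1.2 p.2) 0 := by
    rw [analyticAt_pi_iff]
    intro j
    simp only [hR]
    exact ((az j).mul (a1 j)).add ((aw j).mul (a2 j))
  have hR0 : zetaRhs Λ 0 0 0 = 0 := by
    funext j
    simp [zetaRhs]
  have hRd : HasFDerivAt (fun p : (V a b × V a b) × V a b => zetaRhs Λ p.1.1 p.1.2 p.2)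
      (ContinuousLinearMap.pi fun _ => (0 + 0 : (V a b × V a b) × V a b →L[ℂ] ℂ)) 0 := by
    refine hasFDerivAt_pi.2 fun j => ?_
    simp only [hR]
    exact (fderiv_mul_eq_zero (az j) (a1 j) rfl (by simp)).add (fderiv_mul_eq_zero (aw j) (a2 j) rfl (by simp))
  have hNan : AnalyticAt ℂ N 0 := analyticAt_fst.prod (analyticAt_snd.sub hRan)
  have hN0 : N 0 = 0 := by
    refine Prod.ext rfl ?_
    show (0 : V a b) - zetaRhs Λ 0 0 0 = 0
    rw [hR0, sub_zero]
  obtain ⟨N', hN'⟩ := IsGermInv.exists_of_fderiv_injective hNan hN0 fun v hv => by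
    have h : HasFDerivAt N _ 0 := hasFDerivAt_fst.prodMk (hasFDerivAt_snd.sub hRd)
    rw [h.fderiv] at hv
    have h1 : v.1 = 0 := (Prod.ext_iff.1 hv).1
    have h2 : v.2 - (fun _ => (0 : ℂ) + 0) = 0 := (Prod.ext_iff.1 hv).2
    refine Prod.ext h1 ?_
    funext j
    have := congrFun h2 j
    simpa using this
  have hi : AnalyticAt ℂ (fun u : V a b × V a b => (u, (0 : V a b))) 0 := analyticAt_id.prod analyticAt_const
  have ti : Tendsto (fun u : V a b × V a b => (u, (0 : V a b))) (𝓝 0) (𝓝 0) := AnalyticAt.tendsto_zero hi rfl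
  refine ⟨fun u => (N' (u, 0)).2, ?_, ?_, ?_, ?_⟩
  · exact analyticAt_snd.fun_comp (AnalyticAt.comp_zero (f := fun u : V a b × V a b => (u, (0 : V a b))) hN'.an' hi rfl)
  · show (N' 0).2 = 0
    rw [hN'.map0']
    rfl
  · filter_upwards [ti.eventually hN'.right] with u hu
    have h1 : (N' (u, 0)).1 = u := (Prod.ext_iff.1 hu).1
    have h2 : (N' (u, 0)).2 - zetaRhs Λ (N' (u, 0)).1.1 (N' (u, 0)).1.2 (N' (u, 0)).2 = 0 := (Prod.ext_iff.1 hu).2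
    rw [h1] at h2
    exact sub_eq_zero.1 h2
  · filter_upwards [hN'.left] with p hp h
    have : N p = (p.1, 0) := Prod.ext rfl (sub_eq_zero.2 h)
    rw [this] at hp
    rw [hp]

theorem RealityCondition.conj_eq {Λ : Idx a b → V a b → ℂ} (h : RealityCondition Λ) : ∀ᶠ ζ in 𝓝 0,
    (∀ e, conj (Λ (Sum.inl e) ζ) = Λ (Sum.inl e) (rhoZ ζ)) ∧
    ∀ i, conj (Λ (swapIdx (Sum.inr i)) ζ) = (Λ (Sum.inr i) (rhoZ ζ))⁻¹ := by
  filter_upwards [eventually_all.2 h.1, eventually_all.2 h.2,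
    tendsto_rhoZ.eventually (eventually_all.2 h.2)] with ζ h1 h2 h3
  refine ⟨fun e => by rw [h1 e, Complex.conj_conj], ?_⟩
  rintro (s | s)
  · have := h3 s
    rw [rhoZ_rhoZ] at this
    rw [this, map_inv₀, inv_inv]
    rfl
  · show conj (Λ (Sum.inr (Sum.inl s)) ζ) = _
    rw [h2 s, Complex.conj_conj]

theorem zetaRhs_rhoZ {Λ : Idx a b → V a b → ℂ} {z ζ : V a b}
    (h1 : ∀ e, conj (Λ (Sum.inl e) ζ) = Λ (Sum.inl e) (rhoZ ζ))
    (h2 : ∀ i, conj (Λ (swapIdx (Sum.inr i)) ζ) = (Λ (Sum.inr i) (rhoZ ζ))⁻¹)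
    (h0 : ∀ j, Λ j (rhoZ ζ) ≠ 0) (hD : ∀ j, 1 - Λ j (rhoZ ζ) ^ 2 ≠ 0) :
    zetaRhs Λ z (rhoZ z) (rhoZ ζ) = rhoZ (zetaRhs Λ z (rhoZ z) ζ) := by
  funext j
  rcases j with e | i
  · simp only [rhoZ, zetaRhs, swapIdx, twist, map_div₀, map_sub, map_mul, map_add, map_pow, map_one,
      Complex.conj_conj]
    rw [h1 e]
    ring
  · have hL := h0 (Sum.inr i)
    have hD := hD (Sum.inr i)
    have hD' : 1 - ((Λ (Sum.inr i) (rhoZ ζ))⁻¹) ^ 2 ≠ 0 := by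
      intro h
      apply hD
      field_simp at h
      linear_combination -h
    have ht : ∀ i, twist Λ (swapIdx (Sum.inr i)) ζ = Λ (swapIdx (Sum.inr i)) ζ := by
      rintro (s | s) <;> rfl
    have hw : rhoZ z (swapIdx (Sum.inr i)) = conj (z (Sum.inr i)) := by rw [rhoZ, swapIdx_swapIdx]
    have e1 : rhoZ (zetaRhs Λ z (rhoZ z) ζ) (Sum.inr i) = conj (zetaRhs Λ z (rhoZ z) ζ (swapIdx (Sum.inr i))) := rfl
    have e2 : rhoZ z (Sum.inr i) = conj (z (swapIdx (Sum.inr i))) := rfl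
    rw [e1, zetaRhs, zetaRhs, ht, hw, e2]
    simp only [twist, map_div₀, map_sub, map_mul, map_add, map_pow, map_one, Complex.conj_conj, h2 i]
    rw [div_eq_div_iff (pow_ne_zero 2 hD) (pow_ne_zero 2 hD')]
    field_simp
    ring

theorem analyticAt_rhoZ : AnalyticAt ℝ (rhoZ : V a b → V a b) 0 := by
  have : AnalyticAt ℝ (fun z : V a b => fun j => Complex.conjCLE (z (swapIdx j))) 0 := by
    rw [analyticAt_pi_iff]
    exact fun j => (Complex.conjCLE.toContinuousLinearMap.comp
      (ContinuousLinearMap.proj (R := ℝ) (φ := fun _ : Idx a b => ℂ) (swapIdx j))).analyticAt 0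
  exact this

theorem exists_isZetaSolution {Λ : Idx a b → V a b → ℂ} (hΛ : ∀ j, AnalyticAt ℂ (Λ j) 0) (h0 : ∀ j, Λ j 0 ≠ 0)
    (hD : ∀ j, 1 - Λ j 0 ^ 2 ≠ 0) (hreal : RealityCondition Λ) :
    ∃ ζ : V a b → V a b, IsZetaSolution Λ ζ ∧ (∀ ζ₁ : V a b → V a b, IsZetaSolution Λ ζ₁ → ζ₁ =ᶠ[𝓝 0] ζ) ∧
      (∀ᶠ z in 𝓝 0, rhoZ (ζ z) = ζ z) ∧
      ∀ᶠ q : V a b × V a b in 𝓝 0, q.2 = zetaRhs Λ q.1 (rhoZ q.1) q.2 → q.2 = ζ q.1 := by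
  obtain ⟨S, hS, hS0, hS1, hS2⟩ := exists_zetaRhs_solution hΛ hD
  have hi : AnalyticAt ℝ (fun z : V a b => (z, rhoZ z)) 0 := analyticAt_id.prod analyticAt_rhoZ
  have hi0 : ((0, rhoZ 0) : V a b × V a b) = 0 := by
    refine Prod.ext rfl ?_
    funext j
    simp [rhoZ]
  have ti : Tendsto (fun z : V a b => (z, rhoZ z)) (𝓝 0) (𝓝 0) := by
    have := hi.continuousAt.tendsto
    rwa [hi0] at this
  have hζan : AnalyticAt ℝ (fun z => S (z, rhoZ z)) 0 := by
    have : AnalyticAt ℝ S (0, rhoZ 0) := by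
      rw [hi0]
      exact hS.restrictScalars
    exact AnalyticAt.fun_comp this hi
  have hζ0 : S (0, rhoZ 0) = 0 := by rw [hi0, hS0]
  have tζ : Tendsto (fun z => S (z, rhoZ z)) (𝓝 0) (𝓝 0) := by
    have := hζan.continuousAt.tendsto
    rwa [hζ0] at this
  have huniq : ∀ᶠ q : V a b × V a b in 𝓝 0, q.2 = zetaRhs Λ q.1 (rhoZ q.1) q.2 → q.2 = S (q.1, rhoZ q.1) := by
    have t1 : Tendsto (fun q : V a b × V a b => q.1) (𝓝 0) (𝓝 0) := continuous_fst.tendsto 0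
    have t2 : Tendsto (fun q : V a b × V a b => q.2) (𝓝 0) (𝓝 0) := continuous_snd.tendsto 0
    have t : Tendsto (fun q : V a b × V a b => ((q.1, rhoZ q.1), q.2)) (𝓝 0) (𝓝 0) :=
      (ti.comp t1).prodMk_nhds t2
    exact t.eventually hS2
  refine ⟨fun z => S (z, rhoZ z), isZetaSolution_iff.2 ⟨hζan, hζ0, ti.eventually hS1⟩, fun ζ₁ h₁ => ?_, ?_, huniq⟩
  · obtain ⟨h2, h3, h4⟩ := isZetaSolution_iff.1 h₁
    have t1 : Tendsto ζ₁ (𝓝 0) (𝓝 0) := by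
      have := h2.continuousAt.tendsto
      rwa [h3] at this
    filter_upwards [h4, (tendsto_id.prodMk_nhds t1).eventually huniq] with z e1 e2
    exact e2 e1
  · have hne : ∀ᶠ ζ in 𝓝 0, (∀ j, Λ j (rhoZ ζ) ≠ 0) ∧ ∀ j, 1 - Λ j (rhoZ ζ) ^ 2 ≠ 0 := tendsto_rhoZ.eventually <| by
      refine Eventually.and (p := fun ζ => ∀ j, Λ j ζ ≠ 0) (q := fun ζ => ∀ j, 1 - Λ j ζ ^ 2 ≠ 0)
        (eventually_all.2 fun j => (hΛ j).continuousAt.eventually_ne (h0 j)) (eventually_all.2 fun j => ?_)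
      have : AnalyticAt ℂ (fun ζ => 1 - Λ j ζ ^ 2) 0 := analyticAt_const.sub ((hΛ j).pow 2)
      exact this.continuousAt.eventually_ne (hD j)
    filter_upwards [tζ.eventually hreal.conj_eq, tζ.eventually hne, ti.eventually hS1,
      (tendsto_id.prodMk_nhds (tendsto_rhoZ.comp tζ)).eventually huniq] with z h1 h2 h3 h4
    refine h4 ?_
    simp only [id, Function.comp]
    rw [zetaRhs_rhoZ h1.1 h1.2 h2.1 h2.2]
    exact congrArg rhoZ h3

end

section

variable {a b : ℕ} {γe : Fin a → ℝ} {γs : Fin b → ℂ} {E : V a b × V a b → V a b} {Λ : Idx a b → V a b → ℂ}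

theorem rhoZ_zfMap_fst {x : V a b × V a b} (hx : rho x = x)
    (h1 : ∀ e, conj (Λ (Sum.inl e) (x.1 * x.2)) = Λ (Sum.inl e) (x.1 * x.2))
    (h2 : ∀ i, conj (Λ (swapIdx (Sum.inr i)) (x.1 * x.2)) = (Λ (Sum.inr i) (x.1 * x.2))⁻¹)
    (h0 : ∀ j, Λ j (x.1 * x.2) ≠ 0) (j : Idx a b) :
    twist Λ j (x.1 * x.2) * rhoZ (zfMap Λ x).1 j = x.2 j + Λ j (x.1 * x.2) * x.1 j := by
  rcases j with e | i
  · have e1 : conj (x.2 (Sum.inl e)) = x.1 (Sum.inl e) := congrFun (Prod.ext_iff.1 hx).1 (Sum.inl e)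
    have e2 : conj (x.1 (Sum.inl e)) = x.2 (Sum.inl e) := congrFun (Prod.ext_iff.1 hx).2 (Sum.inl e)
    simp only [twist, rhoZ, swapIdx, zfMap, map_add, map_mul, h1, e1, e2, one_mul]
  · have e1 : conj (x.1 (swapIdx (Sum.inr i))) = x.1 (Sum.inr i) := congrFun (Prod.ext_iff.1 hx).1 (Sum.inr i)
    have e2 : conj (x.2 (swapIdx (Sum.inr i))) = x.2 (Sum.inr i) := congrFun (Prod.ext_iff.1 hx).2 (Sum.inr i)
    have := h0 (Sum.inr i)
    simp only [twist, rhoZ, zfMap, map_add, map_mul, h2, e1, e2]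
    field_simp
    ring

/-- The point `(ξ, η)` fixed by `ρ` with given `z` and `ζ = ξη`. -/
def realPoint (Λ : Idx a b → V a b → ℂ) (z ζ : V a b) : V a b × V a b :=
  (fun j => (Λ j ζ * (twist Λ j ζ * rhoZ z j) - z j) / (Λ j ζ ^ 2 - 1),
   fun j => (Λ j ζ * z j - twist Λ j ζ * rhoZ z j) / (Λ j ζ ^ 2 - 1))

theorem realPoint_mul {z ζ : V a b} (hD : ∀ j, 1 - Λ j ζ ^ 2 ≠ 0) (h : ζ = zetaRhs Λ z (rhoZ z) ζ) :
    (realPoint Λ z ζ).1 * (realPoint Λ z ζ).2 = ζ := by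
  funext j
  have hD' : Λ j ζ ^ 2 - 1 ≠ 0 := fun h => hD j (by linear_combination -h)
  have e : zetaRhs Λ z (rhoZ z) ζ j = _ := zetaRhs_eq_mul (ξ := (realPoint Λ z ζ).1 j) (η := (realPoint Λ z ζ).2 j)
    (hD j) (by simp only [realPoint]; field_simp; ring) (by simp only [realPoint]; field_simp; ring)
  rw [← h] at e
  exact e.symm

theorem zfMap_realPoint_fst {z ζ : V a b} (hD : ∀ j, 1 - Λ j ζ ^ 2 ≠ 0) (h : ζ = zetaRhs Λ z (rhoZ z) ζ) :
    (zfMap Λ (realPoint Λ z ζ)).1 = z := by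
  funext j
  have hD' : Λ j ζ ^ 2 - 1 ≠ 0 := fun h => hD j (by linear_combination -h)
  simp only [zfMap, realPoint_mul hD h]
  simp only [realPoint]
  field_simp
  ring

theorem rho_realPoint {z ζ : V a b}
    (h1 : ∀ e, conj (Λ (Sum.inl e) ζ) = Λ (Sum.inl e) ζ)
    (h2 : ∀ i, conj (Λ (swapIdx (Sum.inr i)) ζ) = (Λ (Sum.inr i) ζ)⁻¹)
    (h0 : ∀ j, Λ j ζ ≠ 0) (hD : ∀ j, 1 - Λ j ζ ^ 2 ≠ 0) : rho (realPoint Λ z ζ) = realPoint Λ z ζ := by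
  have ht : ∀ i, twist Λ (swapIdx (Sum.inr i)) ζ = Λ (swapIdx (Sum.inr i)) ζ := by
    rintro (s | s) <;> rfl
  have hw : ∀ i, rhoZ z (swapIdx (Sum.inr i)) = conj (z (Sum.inr i)) := fun i => by rw [rhoZ, swapIdx_swapIdx]
  have hw' : ∀ i, conj (z (swapIdx (Sum.inr i))) = rhoZ z (Sum.inr i) := fun i => rfl
  have hm : ∀ i, Λ (Sum.inr i) ζ ^ 2 - 1 ≠ 0 := fun i h => hD (Sum.inr i) (by linear_combination -h)
  have hm' : ∀ i, (Λ (Sum.inr i) ζ)⁻¹ ^ 2 - 1 ≠ 0 := fun i h => by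
    have := h0 (Sum.inr i)
    apply hD (Sum.inr i)
    field_simp at h
    linear_combination h
  refine Prod.ext (funext fun j => ?_) (funext fun j => ?_)
  · rcases j with e | i
    · simp only [rho, realPoint, twist, rhoZ, swapIdx, map_div₀, map_sub, map_mul, map_pow, map_one, h1,
        Complex.conj_conj, one_mul]
    · simp only [rho, realPoint, ht, hw, map_div₀, map_sub, map_mul, map_pow, map_one, h2, Complex.conj_conj, hw']
      have := h0 (Sum.inr i)
      rw [div_eq_div_iff (hm' i) (hm i)]
      simp only [twist]
      field_simp
      ring
  · rcases j with e | i
    · simp only [rho, realPoint, twist, rhoZ, swapIdx, map_div₀, map_sub, map_mul, map_pow, map_one, h1,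
        Complex.conj_conj, one_mul]
    · simp only [rho, realPoint, ht, hw, map_div₀, map_sub, map_mul, map_pow, map_one, h2, Complex.conj_conj, hw']
      have := h0 (Sum.inr i)
      rw [div_eq_div_iff (hm' i) (hm i)]
      simp only [twist]
      field_simp
      ring

theorem tendsto_realPoint (hΛ : ∀ j, AnalyticAt ℂ (Λ j) 0) (hD : ∀ j, 1 - Λ j 0 ^ 2 ≠ 0) {ζ : V a b → V a b}
    (hζ : Tendsto ζ (𝓝 0) (𝓝 0)) : Tendsto (fun z => realPoint Λ z (ζ z)) (𝓝 0) (𝓝 0) := by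
  have tL : ∀ j, Tendsto (fun z => Λ j (ζ z)) (𝓝 0) (𝓝 (Λ j 0)) := fun j =>
    (hΛ j).continuousAt.tendsto.comp hζ
  have tT : ∀ j, Tendsto (fun z => twist Λ j (ζ z)) (𝓝 0) (𝓝 (twist Λ j 0)) := by
    rintro (e | i)
    · exact tendsto_const_nhds
    · exact tL _
  have tz : ∀ j, Tendsto (fun z : V a b => z j) (𝓝 0) (𝓝 0) := fun j => (continuous_apply j).tendsto 0
  have tw : ∀ j, Tendsto (fun z : V a b => rhoZ z j) (𝓝 0) (𝓝 0) := fun j =>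
    ((continuous_apply j).tendsto 0).comp tendsto_rhoZ
  have hD' : ∀ j, Λ j 0 ^ 2 - 1 ≠ 0 := fun j h => hD j (by linear_combination -h)
  refine Tendsto.prodMk_nhds (tendsto_pi_nhds.2 fun j => ?_) (tendsto_pi_nhds.2 fun j => ?_)
  · have := (((tL j).mul ((tT j).mul (tw j))).sub (tz j)).div (((tL j).pow 2).sub_const 1) (hD' j)
    rw [mul_zero, mul_zero, sub_zero, zero_div] at this
    exact this
  · have := (((tL j).mul (tz j)).sub ((tT j).mul (tw j))).div (((tL j).pow 2).sub_const 1) (hD' j)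
    rw [mul_zero, mul_zero, sub_zero, zero_div] at this
    exact this

/-- The quotient map transforms the real submanifold into its normal form. -/
theorem mem_realM_iff_mem_normalFormM (hΛ : ∀ j, AnalyticAt ℂ (Λ j) 0) (h0 : ∀ j, Λ j 0 ≠ 0)
    (hD : ∀ j, 1 - Λ j 0 ^ 2 ≠ 0) (hreal : RealityCondition Λ) {ψ χ H H' : V a b × V a b → V a b × V a b}
    (hψ : IsGermInv ψ χ) (hρ : ∀ᶠ x in 𝓝 0, rho0 (ψ x) = ψ (rho x)) (hH : IsGermInv H H')
    (hHx : ∀ᶠ x in 𝓝 0, proj1 E (ψ x) = H ((zfMap Λ x).1, fun j => Λ j (x.1 * x.2) * (x.1 j * x.2 j)))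
    {ζ : V a b → V a b} (hζ : IsZetaSolution Λ ζ) (hζr : ∀ᶠ z in 𝓝 0, rhoZ (ζ z) = ζ z)
    (huniq : ∀ᶠ q : V a b × V a b in 𝓝 0, q.2 = zetaRhs Λ q.1 (rhoZ q.1) q.2 → q.2 = ζ q.1) :
    ∀ᶠ p in 𝓝 0, (p ∈ realM E ↔ H' p ∈ normalFormM Λ ζ) := by
  obtain ⟨hζan, hζ0, hζeq⟩ := isZetaSolution_iff.1 hζ
  have tζ : Tendsto ζ (𝓝 0) (𝓝 0) := by
    have := hζan.continuousAt.tendsto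
    rwa [hζ0] at this
  have hne : ∀ᶠ ζ in 𝓝 0, (∀ j, Λ j ζ ≠ 0) ∧ ∀ j, 1 - Λ j ζ ^ 2 ≠ 0 :=
    (eventually_all.2 fun j => (hΛ j).continuousAt.eventually_ne (h0 j)).and (eventually_all.2 fun j => by
      have : AnalyticAt ℂ (fun ζ => 1 - Λ j ζ ^ 2) 0 := analyticAt_const.sub ((hΛ j).pow 2)
      exact this.continuousAt.eventually_ne (hD j))
  obtain ⟨⟨Θ, hΘ⟩, -⟩ := exists_zfMap_germInv hΛ h0
  have hgood : ∀ᶠ ζ in 𝓝 0, ((∀ j, Λ j ζ ≠ 0) ∧ ∀ j, 1 - Λ j ζ ^ 2 ≠ 0) ∧ (rhoZ ζ = ζ →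
      (∀ e, conj (Λ (Sum.inl e) ζ) = Λ (Sum.inl e) ζ) ∧
      ∀ i, conj (Λ (swapIdx (Sum.inr i)) ζ) = (Λ (Sum.inr i) ζ)⁻¹) := by
    filter_upwards [hne, hreal.conj_eq] with ζ e1 e2
    refine ⟨e1, fun h => ?_⟩
    rwa [h] at e2
  have t1 : Tendsto (fun p : V a b × V a b => p.1) (𝓝 0) (𝓝 0) := continuous_fst.tendsto 0
  have fwd : ∀ᶠ p in 𝓝 0, p ∈ realM E → H' p ∈ normalFormM Λ ζ := by
    have tN : Tendsto (fun x : V a b × V a b => ((zfMap Λ x).1, fun j => Λ j (x.1 * x.2) * (x.1 j * x.2 j)))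
        (𝓝 0) (𝓝 0) := by
      refine Tendsto.prodMk_nhds (t1.comp hΘ.tendsto) (tendsto_pi_nhds.2 fun j => ?_)
      have h1 := (hΛ j).continuousAt.tendsto.comp (tendsto_mul_zero (κ := Idx a b))
      have h2 : Tendsto (fun x : V a b × V a b => x.1 j * x.2 j) (𝓝 0) (𝓝 0) :=
        ((continuous_apply j).tendsto 0).comp (tendsto_mul_zero (κ := Idx a b))
      simpa using h1.mul h2
    have tq : Tendsto (fun x : V a b × V a b => ((zfMap Λ x).1, x.1 * x.2)) (𝓝 0) (𝓝 0) :=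
      Tendsto.prodMk_nhds (t1.comp hΘ.tendsto) tendsto_mul_zero
    have key : ∀ᶠ x in 𝓝 0, rho x = x → H' (proj1 E (ψ x)) ∈ normalFormM Λ ζ := by
      filter_upwards [hHx, tN.eventually hH.left, tq.eventually huniq, tendsto_mul_zero.eventually hgood]
        with x e1 e2 e3 e4 hx
      have hr : rhoZ (x.1 * x.2) = x.1 * x.2 := by rw [← rho_mul, hx]
      obtain ⟨⟨h3, h4⟩, h5⟩ := e4
      have e5 : x.1 * x.2 = ζ (zfMap Λ x).1 := e3 <| funext fun j =>
        (zetaRhs_eq_mul (h4 j) rfl (rhoZ_zfMap_fst hx (h5 hr).1 (h5 hr).2 h3 j)).symm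
      rw [e1, e2]
      intro j
      simp only
      rw [← e5]
      rfl
    have tconj : Tendsto (fun p : V a b × V a b => (p.1, conjV p.1)) (𝓝 0) (𝓝 0) := by
      have hcont : Continuous fun p : V a b × V a b => (p.1, conjV p.1) :=
        continuous_fst.prodMk (continuous_pi fun j =>
          Complex.continuous_conj.comp ((continuous_apply j).comp continuous_fst))
      have h := hcont.tendsto 0
      have h0 : (((0 : V a b × V a b).1, conjV (0 : V a b × V a b).1) : V a b × V a b) = 0 := by
        refine Prod.ext rfl (funext fun j => ?_)
        simp [conjV]
      rwa [h0] at h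
    have tx := hψ.tendsto'.comp tconj
    filter_upwards [tx.eventually key, tconj.eventually hψ.right, tx.eventually hρ, tx.eventually hψ.left,
      (tendsto_rho.comp tx).eventually hψ.left] with p e1 e2 e3 e4 e5 hp
    simp only [Function.comp] at e1 e2 e3 e4 e5
    have e6 : rho0 (p.1, conjV p.1) = (p.1, conjV p.1) := by simp only [rho0, conjV_conjV]
    rw [e2, e6] at e3
    rw [← e3] at e5
    have e7 := e1 e5.symm
    rw [e2] at e7
    have e8 : proj1 E (p.1, conjV p.1) = p := Prod.ext rfl (Eq.symm hp)
    rwa [e8] at e7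
  have bwd : ∀ᶠ p in 𝓝 0, H' p ∈ normalFormM Λ ζ → p ∈ realM E := by
    have tz : Tendsto (fun p => (H' p).1) (𝓝 0) (𝓝 0) := t1.comp hH.tendsto'
    have tx := (tendsto_realPoint hΛ hD tζ).comp tz
    filter_upwards [hH.right, tz.eventually hζeq, tz.eventually hζr, (tζ.comp tz).eventually hgood,
      tx.eventually hHx, tx.eventually hρ] with p e1 e2 e3 e4 e5 e6 hp
    simp only [Function.comp] at e4 e5 e6
    obtain ⟨⟨h3, h4⟩, h5⟩ := e4
    have hx := rho_realPoint (z := (H' p).1) (h5 e3).1 (h5 e3).2 h3 h4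
    have hm := realPoint_mul h4 e2
    rw [hx] at e6
    have e7 : proj1 E (ψ (realPoint Λ (H' p).1 (ζ (H' p).1))) = p := by
      rw [e5, zfMap_realPoint_fst h4 e2, hm]
      refine (congrArg H (?_ : _ = H' p)).trans e1
      refine Prod.ext rfl (funext fun j => ?_)
      rw [hp j]
      exact congrArg (Λ j (ζ (H' p).1) * ·) (congrFun hm j)
    have e8 : (ψ (realPoint Λ (H' p).1 (ζ (H' p).1))).1 = p.1 := (Prod.ext_iff.1 e7).1
    have e9 : E (ψ (realPoint Λ (H' p).1 (ζ (H' p).1))) = p.2 := (Prod.ext_iff.1 e7).2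
    have e10 : conjV (ψ (realPoint Λ (H' p).1 (ζ (H' p).1))).1 = (ψ (realPoint Λ (H' p).1 (ζ (H' p).1))).2 :=
      (Prod.ext_iff.1 e6).2
    show p.2 = E (p.1, conjV p.1)
    rw [← e9]
    refine congrArg E (Prod.ext e8 ?_)
    rw [← e10, e8]
  filter_upwards [fwd, bwd] with p h1 h2 using ⟨h1, h2⟩

/-- The normal form is flattened by `ζ ↦ Λ(ζ) ζ`. -/
theorem exists_flattening (hΛ : ∀ j, AnalyticAt ℂ (Λ j) 0) (h0 : ∀ j, Λ j 0 ≠ 0)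
    {ζ : V a b → V a b} (hζ : IsZetaSolution Λ ζ) (hζr : ∀ᶠ z in 𝓝 0, rhoZ (ζ z) = ζ z) :
    ∃ K K' : V a b × V a b → V a b × V a b, IsGermInv K K' ∧
      ∀ᶠ q in 𝓝 0, q ∈ normalFormM Λ ζ → K' q ∈ flatSpace a b := by
  obtain ⟨hζan, hζ0, -⟩ := isZetaSolution_iff.1 hζ
  have tζ : Tendsto ζ (𝓝 0) (𝓝 0) := by
    have := hζan.continuousAt.tendsto
    rwa [hζ0] at this
  set κ : V a b → V a b := fun ζ j => Λ j ζ * ζ j with hκ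
  have hκan : AnalyticAt ℂ κ 0 := by
    rw [analyticAt_pi_iff]
    exact fun j => (hΛ j).mul (analyticAt_coord j 0)
  have hκ0 : κ 0 = 0 := by
    funext j
    simp [hκ]
  obtain ⟨κ', hk⟩ := IsGermInv.exists_of_fderiv_injective hκan hκ0 fun v hv => by
    have h : HasFDerivAt κ _ 0 := hasFDerivAt_pi.2 fun j => (hΛ j).differentiableAt.hasFDerivAt.fun_mul
      ((ContinuousLinearMap.proj (R := ℂ) (φ := fun _ : Idx a b => ℂ) j).hasFDerivAt (x := 0))
    rw [h.fderiv] at hv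
    funext j
    have := congrFun hv j
    simpa [h0 j] using this
  have t1 : Tendsto (fun p : V a b × V a b => p.1) (𝓝 0) (𝓝 0) := continuous_fst.tendsto 0
  have t2 : Tendsto (fun p : V a b × V a b => p.2) (𝓝 0) (𝓝 0) := continuous_snd.tendsto 0
  refine ⟨fun q => (q.1, κ q.2), fun q => (q.1, κ' q.2), ⟨?_, ?_, ?_, ?_, ?_, ?_⟩, ?_⟩
  · exact analyticAt_fst.prod (AnalyticAt.comp_zero (f := fun q : V a b × V a b => q.2) hκan analyticAt_snd rfl)
  · exact Prod.ext rfl hκ0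
  · exact analyticAt_fst.prod (AnalyticAt.comp_zero (f := fun q : V a b × V a b => q.2) hk.an' analyticAt_snd rfl)
  · exact Prod.ext rfl hk.map0'
  · filter_upwards [t2.eventually hk.left] with q hq using Prod.ext rfl hq
  · filter_upwards [t2.eventually hk.right] with q hq using Prod.ext rfl hq
  · filter_upwards [(tζ.comp t1).eventually hk.left, t1.eventually hζr] with q e1 e2 hq
    have e3 : q.2 = κ (ζ q.1) := funext hq
    have e4 : κ' q.2 = ζ q.1 := by rw [e3]; exact e1
    refine ⟨fun e => ?_, fun s => ?_⟩
    · show κ' q.2 _ = conj (κ' q.2 _)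
      rw [e4]
      exact (congrFun e2 (Sum.inl e)).symm
    · show κ' q.2 _ = conj (κ' q.2 _)
      rw [e4]
      exact (congrFun e2 (Sum.inr (Sum.inl s))).symm

theorem IsGermInv.isBiholGerm {f g : V a b × V a b → V a b × V a b} (h : IsGermInv f g) : IsBiholGerm f :=
  ⟨h.an, h.map0, g, h.an', h.map0', h.left, h.right⟩

end

end

end AbelianCR

theorem theorem1p6 (a b : ℕ) (γe : Fin a → ℝ) (γs : Fin b → ℂ)
    (hγe : ∀ e, 0 < γe e ∧ γe e < 1 / 2)
    (hγs : ∀ s, 1 / 2 < (γs s).re ∧ 0 < (γs s).im)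
    (E : V a b × V a b → V a b) (hE : IsPerturbation γe γs E)
    (τ : Idx a b → V a b × V a b → V a b × V a b)
    (hτ : ∀ j, IsGenerator γe γs E j (τ j))
    (habel : IsAbelianCR E τ)
    (heig : HasDistinctEigenvalues τ) :
    (∃ Λ : Idx a b → V a b → ℂ,
      (∀ j, AnalyticAt ℂ (Λ j) 0 ∧ Λ j 0 = lam γe γs j) ∧
      RealityCondition Λ ∧
      (∃ ψ : V a b × V a b → V a b × V a b, Normalizes τ Λ ψ) ∧
      ∃ ζ : V a b → V a b, IsZetaSolution Λ ζ ∧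
        (∀ ζ₁ : V a b → V a b, IsZetaSolution Λ ζ₁ → ζ₁ =ᶠ[𝓝 0] ζ) ∧
        HolEquivalent (realM E) (normalFormM Λ ζ)) ∧
    ∃ Φ : V a b × V a b → V a b × V a b, IsBiholGerm Φ ∧
      ∀ᶠ x in 𝓝 0, x ∈ realM E → Φ x ∈ flatSpace a b := by
  obtain ⟨Λ, hΛ, hreal, ψ, χ, hψ, hψd, hnorm⟩ := exists_normalizing hγe hγs hE hτ habel.2
  have hΛa := fun j => (hΛ j).1
  have h0 : ∀ j, Λ j 0 ≠ 0 := fun j => (hΛ j).2 ▸ (norm_lam_ne_one hγe hγs j).1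
  have hD : ∀ j, 1 - Λ j 0 ^ 2 ≠ 0 := fun j h => by
    refine (norm_lam_ne_one hγe hγs j).2 ?_
    rw [← (hΛ j).2, ← pow_eq_one_iff_of_nonneg (norm_nonneg _) two_ne_zero, ← norm_pow, ← sub_eq_zero.1 h, norm_one]
  have hinv : ∀ j, ∀ᶠ x in 𝓝 0, proj1 E (ψ (nfTau (Λ j) j x)) = proj1 E (ψ x) := fun j => by
    filter_upwards [(hnorm.2.2 j).1, hψ.tendsto.eventually (hτ j).1.2] with x e1 e2
    rw [← e1, e2]
  obtain ⟨H, H', hH, hHx⟩ := exists_normalForm_germInv hγe hγs hE hΛ hψ hψd hinv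
  obtain ⟨ζ, hζ, hζu, hζr, huniq⟩ := exists_isZetaSolution hΛa h0 hD hreal
  have hM := mem_realM_iff_mem_normalFormM hΛa h0 hD hreal hψ hnorm.2.1 hH hHx hζ hζr huniq
  refine ⟨⟨Λ, hΛ, hreal, ⟨ψ, hnorm⟩, ζ, hζ, hζu, H', hH.symm.isBiholGerm, hM⟩, ?_⟩
  obtain ⟨K, K', hK, hflat⟩ := exists_flattening hΛa h0 hζ hζr
  refine ⟨_, (hK.symm.comp hH.symm).isBiholGerm, ?_⟩
  filter_upwards [hM, hH.tendsto'.eventually hflat] with p h1 h2 hp using h2 (h1.1 hp)
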